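/- **Theorem.** Let $L=\{l_1,\dots,l_n\}$ be a set of $n$ distinct lines in the plane and let $\ell$ be another line ($\ell\notin L$), all given by the real coefficients of equations $ax+by=c$ with $(a,b)\neq(0,0)$; lines parallel to $\ell$ and several lines meeting at a point of $\ell$ are allowed. The faces of the arrangement $\mathcal A(L)$ are the connected components of $\mathbb R^2\setminus\bigcup L$, and the zone $Z(\ell)$ is the set of those faces whose closure intersects $\ell$. Computing $Z(\ell)$ means listing every face of $Z(\ell)$ exactly once, each described by the counterclockwise cyclic sequence of its boundary edges, each edge given by its supporting line and its two end vertices (coordinates, or "at infinity"). The model of computation is the real RAM: exact arithmetic and comparisons on real numbers, random-access arrays, and addition, truncated subtraction and comparison of non-negative integers, at unit cost per operation. 1. There is an algorithm that computes $Z(\ell)$ from $L$ and $\ell$ in $O(n\log n)$ time. 2. There is an algorithm that computes $Z(\ell)$ in $O(n)$ time if it is given, besides $L$ and $\ell$, the sorted list along $\ell$ of the lines of $L$ that intersect $\ell$. Here, for $\ell:\ ax+by=c$, the direction of $\ell$ is $(b,-a)$ and the points with $ax+by>c$ are above $\ell$ (left to right, and the usual meaning of above, when $\ell$ is $y=0$);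 lines that meet $\ell$ at the same point are listed in the left-to-right order of their half-lines above $\ell$, left to right being the direction of $\ell$. The constants in the $O$-bounds are absolute. -/

import Mathlib

open Filter Asymptotics

/-! ## Lines, arrangements and zones -/

namespace ZoneRAM

/-- The plane; only its topology and its coordinates are used. -/
abbrev Plane : Type := ℝ × ℝ

/-- The equation `a x + b y = c` of a line in the plane. -/
structure LineEq where
  a : ℝ
  b : ℝ
  c : ℝ
  nondeg : a ≠ 0 ∨ b ≠ 0

/-- The line itself, as a set of points. -/
def LineEq.pts (l : LineEq) : Set Plane := {p | l.a * p.1 + l.b * p.2 = l.c}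

def dot (u v : Plane) : ℝ := u.1 * v.1 + u.2 * v.2

def cross (u v : Plane) : ℝ := u.1 * v.2 - u.2 * v.1

/-- `C` is a face (cell) of the arrangement of the lines `L`: a connected component of the
complement of the union of the lines. -/
def IsFace {n : ℕ} (L : Fin n → LineEq) (C : Set Plane) : Prop :=
  ∃ p ∈ (⋃ i, (L i).pts)ᶜ, C = connectedComponentIn (⋃ i, (L i).pts)ᶜ p

/-- The zone of `l`: the set of faces whose closure intersects `l`. -/
def zone {n : ℕ} (L : Fin n → LineEq) (l : LineEq) : Set (Set Plane) :=
  {C | IsFace L C ∧ (closure C ∩ l.pts).Nonempty}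

/-! ## Boundary descriptions of faces -/

/-- An oriented edge of a face: the index of its supporting line, its initial vertex and its
final vertex, where `none` stands for an end at infinity. -/
structure BoundaryEdge where
  line : ℕ
  tail : Option Plane
  head : Option Plane

/-- `e` is an edge of the face `C`: the part of the boundary of `C` on the line with index `e.line`
is more than a single point, and it is exactly the segment, ray or line from `e.tail` to `e.head`,
oriented by a direction `u` of that line that has `C` on its left. -/
def IsEdgeOf {n : ℕ} (L : Fin n → LineEq) (C : Set Plane) (e : BoundaryEdge) : Prop :=
  ∃ i : Fin n, e.line = (i : ℕ) ∧ (frontier C ∩ (L i).pts).Nontrivial ∧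
    (∀ v ∈ e.tail, v ∈ (L i).pts) ∧ (∀ v ∈ e.head, v ∈ (L i).pts) ∧
    ∃ u : Plane, (L i).a * u.1 + (L i).b * u.2 = 0 ∧
      (∀ q ∈ (L i).pts, ∀ p ∈ C, 0 < cross u (p - q)) ∧
      frontier C ∩ (L i).pts =
        {q ∈ (L i).pts | (∀ v ∈ e.tail, 0 ≤ dot u (q - v)) ∧ (∀ v ∈ e.head, 0 ≤ dot u (v - q))}

/-- `D` lists all edges of the face `C`, each once, in counterclockwise cyclic order: the final
vertex of every edge is the initial vertex of the cyclically next one (for unbounded faces the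
cyclic order passes through infinity). -/
def DescribesFace {n : ℕ} (L : Fin n → LineEq) (D : List BoundaryEdge) (C : Set Plane) : Prop :=
  (∀ e ∈ D, IsEdgeOf L C e) ∧
  (D.map BoundaryEdge.line).Nodup ∧
  (∀ i : Fin n, (frontier C ∩ (L i).pts).Nontrivial → (i : ℕ) ∈ D.map BoundaryEdge.line) ∧
  D.map BoundaryEdge.head = (D.map BoundaryEdge.tail).rotate 1

/-- `out` lists the boundary descriptions of all faces of the zone of `l`, one for each face. -/
def DescribesZone {n : ℕ} (L : Fin n → LineEq) (l : LineEq)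
    (out : List (List BoundaryEdge)) : Prop :=
  ∃ cells : List (Set Plane), cells.Nodup ∧ (∀ C, C ∈ cells ↔ C ∈ zone L l) ∧
    List.Forall₂ (DescribesFace L) out cells

/-! ## The sorted list of intersections -/

/-- `l` is directed by `(b, -a)`, and the points with `a x + b y > c` are those above it (for the
equation `y = 0` of the `x`-axis this is left to right, and above in the usual sense).
`Before l k k'` says that the line `k` meets `l` before `k'` does, or that `k` and `k'` meet `l` at
the same point and the half-line of `k` above `l` is left of the half-line of `k'` above `l`,
i.e. it is so at some (equivalently, at every) height above `l`. -/
def Before (l k k' : LineEq) : Prop :=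
  ∃ p ∈ l.pts ∩ k.pts, ∃ p' ∈ l.pts ∩ k'.pts,
    dot (l.b, -l.a) p < dot (l.b, -l.a) p' ∨
      (p = p' ∧ ∃ q ∈ k.pts, ∃ q' ∈ k'.pts, l.c < dot (l.a, l.b) q ∧
        dot (l.a, l.b) q = dot (l.a, l.b) q' ∧ dot (l.b, -l.a) q < dot (l.b, -l.a) q')

/-- `s` is the list of (indices of) all lines of `L` that intersect `l`, sorted along `l`. -/
def IsSortedAlong {n : ℕ} (L : Fin n → LineEq) (l : LineEq) (s : List (Fin n)) : Prop :=
  (∀ i, i ∈ s ↔ (l.pts ∩ (L i).pts).Nonempty) ∧ s.Pairwise (fun i j => Before l (L i) (L j))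

/-! ## A real RAM

Integer and real variables, and integer and real arrays with random access. Integers are used
for indices and counting only (addition and truncated subtraction); reals admit exact arithmetic
and comparisons. There is no rounding and no conversion between the two kinds. Every
operation has unit cost. -/

/-- A memory state: `nvar x`, `rvar x` are the variables, `narr k j`, `rarr k j` the cells with
index `j` of the array `k`. -/
structure State where
  nvar : ℕ → ℕ
  rvar : ℕ → ℝ
  narr : ℕ → ℕ → ℕ
  rarr : ℕ → ℕ → ℝ

/-- Integer expressions. -/
inductive NExpr where
  | const (k : ℕ)
  | var (x : ℕ)
  | get (arr : ℕ) (idx : NExpr)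
  | add (e f : NExpr)
  | sub (e f : NExpr)

/-- Real expressions. -/
inductive RExpr where
  | const (q : ℚ)
  | var (x : ℕ)
  | get (arr : ℕ) (idx : NExpr)
  | add (e f : RExpr)
  | sub (e f : RExpr)
  | mul (e f : RExpr)
  | div (e f : RExpr)

/-- Tests. -/
inductive BExpr where
  | nlt (e f : NExpr)
  | neq (e f : NExpr)
  | rlt (e f : RExpr)
  | req (e f : RExpr)
  | not (b : BExpr)
  | and (b c : BExpr)
  | or (b c : BExpr)

def NExpr.eval (σ : State) : NExpr → ℕ
  | .const k => k
  | .var x => σ.nvar x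
  | .get k e => σ.narr k (e.eval σ)
  | .add e f => e.eval σ + f.eval σ
  | .sub e f => e.eval σ - f.eval σ

/-- Division by zero returns zero. -/
noncomputable def RExpr.eval (σ : State) : RExpr → ℝ
  | .const q => (q : ℝ)
  | .var x => σ.rvar x
  | .get k e => σ.rarr k (e.eval σ)
  | .add e f => e.eval σ + f.eval σ
  | .sub e f => e.eval σ - f.eval σ
  | .mul e f => e.eval σ * f.eval σ
  | .div e f => e.eval σ / f.eval σ

/-- `neq` and `req` test equality of integers and of reals. -/
def BExpr.holds (σ : State) : BExpr → Prop
  | .nlt e f => e.eval σ < f.eval σ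
  | .neq e f => e.eval σ = f.eval σ
  | .rlt e f => e.eval σ < f.eval σ
  | .req e f => e.eval σ = f.eval σ
  | .not b => ¬ b.holds σ
  | .and b c => b.holds σ ∧ c.holds σ
  | .or b c => b.holds σ ∨ c.holds σ

/-- The number of elementary operations and memory accesses in an expression. -/
def NExpr.cost : NExpr → ℕ
  | .const _ => 1
  | .var _ => 1
  | .get _ e => e.cost + 1
  | .add e f => e.cost + f.cost + 1
  | .sub e f => e.cost + f.cost + 1

def RExpr.cost : RExpr → ℕ
  | .const _ => 1
  | .var _ => 1
  | .get _ e => e.cost + 1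
  | .add e f => e.cost + f.cost + 1
  | .sub e f => e.cost + f.cost + 1
  | .mul e f => e.cost + f.cost + 1
  | .div e f => e.cost + f.cost + 1

def BExpr.cost : BExpr → ℕ
  | .nlt e f => e.cost + f.cost + 1
  | .neq e f => e.cost + f.cost + 1
  | .rlt e f => e.cost + f.cost + 1
  | .req e f => e.cost + f.cost + 1
  | .not b => b.cost + 1
  | .and b c => b.cost + c.cost + 1
  | .or b c => b.cost + c.cost + 1

/-- Programs: assignments to variables and to array cells, and the usual control structures. -/
inductive Prog where
  | skip
  | nset (x : ℕ) (e : NExpr)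
  | rset (x : ℕ) (e : RExpr)
  | nput (arr : ℕ) (idx : NExpr) (e : NExpr)
  | rput (arr : ℕ) (idx : NExpr) (e : RExpr)
  | seq (P Q : Prog)
  | ite (b : BExpr) (P Q : Prog)
  | loop (b : BExpr) (P : Prog)

/-- `Exec P σ t τ`: started in the state `σ`, the program `P` terminates in the state `τ` after
exactly `t` elementary steps. `loop b P` is "while `b` do `P`". -/
inductive Exec : Prog → State → ℕ → State → Prop
  | skip (σ : State) : Exec .skip σ 1 σ
  | nset (σ : State) (x : ℕ) (e : NExpr) :
      Exec (.nset x e) σ (e.cost + 1) { σ with nvar := Function.update σ.nvar x (e.eval σ) }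
  | rset (σ : State) (x : ℕ) (e : RExpr) :
      Exec (.rset x e) σ (e.cost + 1) { σ with rvar := Function.update σ.rvar x (e.eval σ) }
  | nput (σ : State) (k : ℕ) (j e : NExpr) :
      Exec (.nput k j e) σ (j.cost + e.cost + 1)
        { σ with narr := Function.update σ.narr k
                          (Function.update (σ.narr k) (j.eval σ) (e.eval σ)) }
  | rput (σ : State) (k : ℕ) (j : NExpr) (e : RExpr) :
      Exec (.rput k j e) σ (j.cost + e.cost + 1)
        { σ with rarr := Function.update σ.rarr k
                          (Function.update (σ.rarr k) (j.eval σ) (e.eval σ)) }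
  | seq {P Q : Prog} {σ τ ρ : State} {s t : ℕ} :
      Exec P σ s τ → Exec Q τ t ρ → Exec (.seq P Q) σ (s + t) ρ
  | ite_true {b : BExpr} {P Q : Prog} {σ τ : State} {t : ℕ} :
      b.holds σ → Exec P σ t τ → Exec (.ite b P Q) σ (b.cost + t) τ
  | ite_false {b : BExpr} {P Q : Prog} {σ τ : State} {t : ℕ} :
      ¬ b.holds σ → Exec Q σ t τ → Exec (.ite b P Q) σ (b.cost + t) τ
  | loop_stop {b : BExpr} {P : Prog} {σ : State} :
      ¬ b.holds σ → Exec (.loop b P) σ b.cost σ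
  | loop_step {b : BExpr} {P : Prog} {σ τ ρ : State} {s t : ℕ} :
      b.holds σ → Exec P σ s τ → Exec (.loop b P) τ t ρ → Exec (.loop b P) σ (b.cost + s + t) ρ

/-! ## Input and output -/

/-- The input `L`, `l`: the number `n` of lines is the integer variable `0`, the coefficients of
`l` are the real variables `0, 1, 2`, those of line `i` are the entries `i` of the real arrays
`0, 1, 2`; everything else is zero. -/
noncomputable def inputState {n : ℕ} (L : Fin n → LineEq) (l : LineEq) : State where
  nvar x := if x = 0 then n else 0
  rvar x := if x = 0 then l.a else if x = 1 then l.b else if x = 2 then l.c else 0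
  narr _ _ := 0
  rarr k j :=
    if h : j < n then
      if k = 0 then (L ⟨j, h⟩).a else if k = 1 then (L ⟨j, h⟩).b
      else if k = 2 then (L ⟨j, h⟩).c else 0
    else 0

/-- The input `L`, `l` together with a list `s` of indices of lines: in addition, the length of
`s` is the integer variable `1` and the entries of `s` are in the integer array `0`. -/
noncomputable def sortedInputState {n : ℕ} (L : Fin n → LineEq) (l : LineEq)
    (s : List (Fin n)) : State :=
  { inputState L l with
    nvar := fun x => if x = 0 then n else if x = 1 then s.length else 0
    narr := fun k j =>
      if h : j < s.length then
        if k = 0 then ((s[j] : Fin n) : ℕ) else 0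
      else 0 }

/-- The edge record number `j` of the output: the integer array `1` holds the supporting line; the
integer array `2` tells whether the initial vertex is at infinity (entry `0`) or is the point
whose coordinates are in the real arrays `3, 4`; likewise the integer array `3` and the real arrays
`5, 6` for the final vertex. -/
def edgeAt (τ : State) (j : ℕ) : BoundaryEdge where
  line := τ.narr 1 j
  tail := if τ.narr 2 j = 0 then none else some (τ.rarr 3 j, τ.rarr 4 j)
  head := if τ.narr 3 j = 0 then none else some (τ.rarr 5 j, τ.rarr 6 j)

/-- The list of faces written in memory: the integer variable `2` is the number of faces, and the
edge records of face `k` are those from number `narr 4 k` up to, but excluding, `narr 4 (k + 1)`. -/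
def outputOf (τ : State) : List (List BoundaryEdge) :=
  (List.range (τ.nvar 2)).map fun k =>
    (List.range' (τ.narr 4 k) (τ.narr 4 (k + 1) - τ.narr 4 k)).map (edgeAt τ)

end ZoneRAM

/-! Take `l` as the horizontal axis. A line that crosses it has an equation `x = X + S y`; the other
lines are horizontal, and of these only the nearest one above and the nearest one below matter. A
parallel of `l` slightly above it meets the `m` crossing lines in distinct points, in the
lexicographic order of `(X, S)`, and its `m + 1` intervals lie in exactly those faces of the zone
that have a point above `l`. The remaining faces lie below `l` and touch it where several lines
meet. They are found in the same way from the reversed line, whose sorted list arises by reversing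
the order of the groups of concurrent lines while keeping the order inside each group
(`zoneCells_spec`, `exists_flipped`).

Consider the face in interval `j`, bounded on the left by lines `1, …, j` and on the right by the
others. At height `y > 0` put `w = 1 / y`: the left boundary, divided by `y`, is the upper envelope
of the linear functions `X i * w + S i` with `i ≤ j`. The envelopes of all prefixes share one tree
(`HullTree`), in which `j` points to the function that precedes it on the envelope of `1, …, j`;
Graham's scan builds it in linear time, the depth of the current node being the potential
(`hull_spec`). Reflections give the right chain and the lower half of the face. The edges are found
by walking away from the base line on both chains at once, always past the nearer vertex, until the
chains meet, or the horizontal bound is reached, or nothing more can happen up to infinity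
(`WalkInv.step`, `WalkInv.finish`).

All walks together take linear time. If face `j` steps past line `k` on its left chain, then at the
vertex in question `k` is strictly left of all lines on the right of the face, among them line `j +
1`. For a face further to the right, line `j + 1` is on the left, and `k` can contribute that vertex
only if it is not left of `j + 1` there. So a line is stepped past in at most one face per chain and
half (`Stepped.lt_absurd`, `sum_steps_le`). This argument yields the linear size of the zone as well
as the linear time.

The combinatorial outcome of the walks is translated into a complete cyclic list of edges
(`topPart`, `faceTags_spec`), and from there into the required description in the plane
(`describesFace`). The programs are verified by a small logic of total correctness with running
times (`Prog.eff`, `Frame`, `Runs`). Without the sorted list, a merge sort of the crossing lines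
precedes the linear algorithm. -/

namespace ZoneRAM

/-! ## Program logic -/

/-- The final state of a loop-free program. -/
noncomputable def Prog.eff : Prog → State → State
  | .skip, σ => σ
  | .nset x e, σ => ⟨Function.update σ.nvar x (e.eval σ), σ.rvar, σ.narr, σ.rarr⟩
  | .rset x e, σ => ⟨σ.nvar, Function.update σ.rvar x (e.eval σ), σ.narr, σ.rarr⟩
  | .nput k j e, σ => ⟨σ.nvar, σ.rvar,
      Function.update σ.narr k (Function.update (σ.narr k) (j.eval σ) (e.eval σ)), σ.rarr⟩
  | .rput k j e, σ => ⟨σ.nvar, σ.rvar, σ.narr,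
      Function.update σ.rarr k (Function.update (σ.rarr k) (j.eval σ) (e.eval σ))⟩
  | .seq P Q, σ => Q.eff (P.eff σ)
  | .ite b P Q, σ => @_root_.ite _ (b.holds σ) (Classical.dec _) (P.eff σ) (Q.eff σ)
  | .loop _ _, σ => σ

def Prog.loopFree : Prog → Bool
  | .seq P Q => P.loopFree && Q.loopFree
  | .ite _ P Q => P.loopFree && Q.loopFree
  | .loop _ _ => false
  | _ => true

/-- An upper bound for the running time of a loop-free program. -/
def Prog.worst : Prog → ℕ
  | .skip => 1
  | .nset _ e => e.cost + 1
  | .rset _ e => e.cost + 1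
  | .nput _ j e => j.cost + e.cost + 1
  | .rput _ j e => j.cost + e.cost + 1
  | .seq P Q => P.worst + Q.worst
  | .ite b P Q => b.cost + max P.worst Q.worst
  | .loop _ _ => 0

/-- Straight-line code needs no derivation of `Exec`: its effect is a function that `simp` can
unfold, and its time is bounded by a number. Only loops need an argument of their own. -/
theorem Prog.exec_eff (P : Prog) (h : P.loopFree = true) (σ : State) :
    ∃ t ≤ P.worst, Exec P σ t (P.eff σ) := by
  induction P generalizing σ with
  | skip => exact ⟨_, le_rfl, .skip σ⟩
  | nset x e => exact ⟨_, le_rfl, .nset σ x e⟩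
  | rset x e => exact ⟨_, le_rfl, .rset σ x e⟩
  | nput k j e => exact ⟨_, le_rfl, .nput σ k j e⟩
  | rput k j e => exact ⟨_, le_rfl, .rput σ k j e⟩
  | seq P Q ihP ihQ =>
    simp only [loopFree, Bool.and_eq_true] at h
    obtain ⟨s, hs, h1⟩ := ihP h.1 σ
    obtain ⟨t, ht, h2⟩ := ihQ h.2 (P.eff σ)
    exact ⟨s + t, add_le_add hs ht, .seq h1 h2⟩
  | ite b P Q ihP ihQ =>
    simp only [loopFree, Bool.and_eq_true] at h
    by_cases hb : b.holds σ
    · obtain ⟨s, hs, h1⟩ := ihP h.1 σ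
      refine ⟨b.cost + s, ?_, ?_⟩
      · simp only [worst]; omega
      · simpa only [eff, if_pos hb] using Exec.ite_true hb h1
    · obtain ⟨s, hs, h1⟩ := ihQ h.2 σ
      refine ⟨b.cost + s, ?_, ?_⟩
      · simp only [worst]; omega
      · simpa only [eff, if_neg hb] using Exec.ite_false hb h1
  | loop b P _ => simp [loopFree] at h

/-! ### Write sets and frame conditions -/

/-- The variables and arrays that a program may write to. -/
def Prog.nvars : Prog → List ℕ
  | .nset x _ => [x]
  | .seq P Q => P.nvars ++ Q.nvars
  | .ite _ P Q => P.nvars ++ Q.nvars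
  | .loop _ P => P.nvars
  | _ => []

def Prog.rvars : Prog → List ℕ
  | .rset x _ => [x]
  | .seq P Q => P.rvars ++ Q.rvars
  | .ite _ P Q => P.rvars ++ Q.rvars
  | .loop _ P => P.rvars
  | _ => []

def Prog.narrs : Prog → List ℕ
  | .nput k _ _ => [k]
  | .seq P Q => P.narrs ++ Q.narrs
  | .ite _ P Q => P.narrs ++ Q.narrs
  | .loop _ P => P.narrs
  | _ => []

def Prog.rarrs : Prog → List ℕ
  | .rput k _ _ => [k]
  | .seq P Q => P.rarrs ++ Q.rarrs
  | .ite _ P Q => P.rarrs ++ Q.rarrs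
  | .loop _ P => P.rarrs
  | _ => []

/-- `τ` agrees with `σ` on everything that `P` does not write to. -/
structure Frame (P : Prog) (σ τ : State) : Prop where
  nvar : ∀ x, x ∉ P.nvars → τ.nvar x = σ.nvar x
  rvar : ∀ x, x ∉ P.rvars → τ.rvar x = σ.rvar x
  narr : ∀ k, k ∉ P.narrs → τ.narr k = σ.narr k
  rarr : ∀ k, k ∉ P.rarrs → τ.rarr k = σ.rarr k

theorem Frame.rfl' {P : Prog} {σ : State} : Frame P σ σ :=
  ⟨fun _ _ => rfl, fun _ _ => rfl, fun _ _ => rfl, fun _ _ => rfl⟩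

theorem Frame.trans' {P : Prog} {σ τ ρ : State} (h : Frame P σ τ) (h' : Frame P τ ρ) :
    Frame P σ ρ :=
  ⟨fun x hx => (h'.nvar x hx).trans (h.nvar x hx), fun x hx => (h'.rvar x hx).trans (h.rvar x hx),
   fun x hx => (h'.narr x hx).trans (h.narr x hx), fun x hx => (h'.rarr x hx).trans (h.rarr x hx)⟩

/-- The write sets of a concrete program are explicit lists, so `decide` settles what a subprogram
leaves alone. Specifications therefore mention only what changes, and invariants are carried along
by this lemma. -/
theorem Exec.frame {P : Prog} {σ τ : State} {t : ℕ} (h : Exec P σ t τ) : Frame P σ τ := by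
  induction h with
  | skip => exact Frame.rfl'
  | nset σ x e =>
    refine ⟨fun y hy => ?_, fun _ _ => rfl, fun _ _ => rfl, fun _ _ => rfl⟩
    simp only [Prog.nvars, List.mem_singleton] at hy
    exact Function.update_of_ne hy _ _
  | rset σ x e =>
    refine ⟨fun _ _ => rfl, fun y hy => ?_, fun _ _ => rfl, fun _ _ => rfl⟩
    simp only [Prog.rvars, List.mem_singleton] at hy
    exact Function.update_of_ne hy _ _
  | nput σ k j e =>
    refine ⟨fun _ _ => rfl, fun _ _ => rfl, fun y hy => ?_, fun _ _ => rfl⟩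
    simp only [Prog.narrs, List.mem_singleton] at hy
    exact Function.update_of_ne hy _ _
  | rput σ k j e =>
    refine ⟨fun _ _ => rfl, fun _ _ => rfl, fun _ _ => rfl, fun y hy => ?_⟩
    simp only [Prog.rarrs, List.mem_singleton] at hy
    exact Function.update_of_ne hy _ _
  | seq _ _ h1 h2 =>
    refine ⟨fun x hx => ?_, fun x hx => ?_, fun x hx => ?_, fun x hx => ?_⟩ <;>
      simp only [Prog.nvars, Prog.rvars, Prog.narrs, Prog.rarrs, List.mem_append, not_or] at hx
    · exact (h2.nvar x hx.2).trans (h1.nvar x hx.1)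
    · exact (h2.rvar x hx.2).trans (h1.rvar x hx.1)
    · exact (h2.narr x hx.2).trans (h1.narr x hx.1)
    · exact (h2.rarr x hx.2).trans (h1.rarr x hx.1)
  | ite_true _ _ h1 =>
    refine ⟨fun x hx => ?_, fun x hx => ?_, fun x hx => ?_, fun x hx => ?_⟩ <;>
      simp only [Prog.nvars, Prog.rvars, Prog.narrs, Prog.rarrs, List.mem_append, not_or] at hx
    · exact h1.nvar x hx.1
    · exact h1.rvar x hx.1
    · exact h1.narr x hx.1
    · exact h1.rarr x hx.1
  | ite_false _ _ h1 =>
    refine ⟨fun x hx => ?_, fun x hx => ?_, fun x hx => ?_, fun x hx => ?_⟩ <;>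
      simp only [Prog.nvars, Prog.rvars, Prog.narrs, Prog.rarrs, List.mem_append, not_or] at hx
    · exact h1.nvar x hx.2
    · exact h1.rvar x hx.2
    · exact h1.narr x hx.2
    · exact h1.rarr x hx.2
  | loop_stop _ => exact Frame.rfl'
  | loop_step _ _ _ h1 h2 =>
    exact ⟨fun x hx => (h2.nvar x hx).trans (h1.nvar x hx),
      fun x hx => (h2.rvar x hx).trans (h1.rvar x hx),
      fun x hx => (h2.narr x hx).trans (h1.narr x hx),
      fun x hx => (h2.rarr x hx).trans (h1.rarr x hx)⟩

/-- Guarantees that the potential in `Runs.while` drops strictly in every iteration, which makes the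
loop terminate. -/
theorem BExpr.cost_pos (b : BExpr) : 0 < b.cost := by
  cases b <;> simp [BExpr.cost]


/-! ## Hull trees -/

/-- The value at `w` of the linear function with slope `X i` and constant term `S i`. -/
def lin (X S : ℕ → ℝ) (i : ℕ) (w : ℝ) : ℝ := X i * w + S i

/-- The place where the linear functions `i` and `k` agree. -/
noncomputable def meet (X S : ℕ → ℝ) (i k : ℕ) : ℝ := (S i - S k) / (X k - X i)

theorem lin_meet {X S : ℕ → ℝ} {i k : ℕ} (h : X i < X k) :
    lin X S i (meet X S i k) = lin X S k (meet X S i k) := by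
  have : X k - X i ≠ 0 := by linarith
  simp only [lin, meet]; field_simp; ring

theorem lin_le_iff {X S : ℕ → ℝ} {i k : ℕ} {w : ℝ} (h : X i < X k) :
    lin X S i w ≤ lin X S k w ↔ meet X S i k ≤ w := by
  have : 0 < X k - X i := by linarith
  rw [meet, div_le_iff₀ this]; simp only [lin]; constructor <;> intro h <;> nlinarith

theorem lin_lt_iff {X S : ℕ → ℝ} {i k : ℕ} {w : ℝ} (h : X i < X k) :
    lin X S i w < lin X S k w ↔ meet X S i k < w := by
  have : 0 < X k - X i := by linarith
  rw [meet, div_lt_iff₀ this]; simp only [lin]; constructor <;> intro h <;> nlinarith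

theorem lin_le_of_le {X S : ℕ → ℝ} {i k : ℕ} {w w' : ℝ} (h : X i ≤ X k)
    (h1 : lin X S i w ≤ lin X S k w) (h2 : w ≤ w') : lin X S i w' ≤ lin X S k w' := by
  simp only [lin] at *; nlinarith

theorem lin_lt_of_lt {X S : ℕ → ℝ} {i k : ℕ} {w w' : ℝ} (h : X i < X k)
    (h1 : lin X S i w ≤ lin X S k w) (h2 : w < w') : lin X S i w' < lin X S k w' := by
  simp only [lin] at *; nlinarith

theorem lin_le_of_ge {X S : ℕ → ℝ} {i k : ℕ} {w w' : ℝ} (h : X k ≤ X i)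
    (h1 : lin X S i w ≤ lin X S k w) (h2 : w' ≤ w) : lin X S i w' ≤ lin X S k w' := by
  simp only [lin] at *; nlinarith

theorem lin_lt_of_gt {X S : ℕ → ℝ} {i k : ℕ} {w w' : ℝ} (h : X k < X i)
    (h1 : lin X S i w ≤ lin X S k w) (h2 : w' < w) : lin X S i w' < lin X S k w' := by
  simp only [lin] at *; nlinarith

/-- `p` is reached from `j` along the pointers `nx`, where `1` is a root. -/
inductive Anc (nx : ℕ → ℕ) : ℕ → ℕ → Prop
  | refl (j : ℕ) : Anc nx j j
  | step {j p : ℕ} : 2 ≤ j → Anc nx (nx j) p → Anc nx j p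

theorem Anc.next {nx : ℕ → ℕ} {j p : ℕ} (h : Anc nx j p) (hp : 2 ≤ p) : Anc nx j (nx p) := by
  induction h with
  | refl j => exact .step hp (.refl _)
  | step h1 _ ih => exact .step h1 (ih hp)

theorem Anc.trans {nx : ℕ → ℕ} {j p q : ℕ} (h : Anc nx j p) (h' : Anc nx p q) : Anc nx j q := by
  induction h with
  | refl j => exact h'
  | step h1 _ ih => exact .step h1 (ih h')

/-- The place where the linear functions `nx p` and `p` agree. -/
noncomputable def brk (X S : ℕ → ℝ) (nx : ℕ → ℕ) (p : ℕ) : ℝ := meet X S (nx p) p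

/-- For every `j ≤ m`, the path from `j` along `nx` is the sequence of the linear functions that
contribute to the upper envelope of the functions `1, …, j`, from right to left. -/
structure HullTree (X S : ℕ → ℝ) (nx : ℕ → ℕ) (m : ℕ) : Prop where
  mono : ∀ i k, 1 ≤ i → i < k → k ≤ m → X i < X k
  nx_lt : ∀ k, 2 ≤ k → k ≤ m → 1 ≤ nx k ∧ nx k < k
  sup : ∀ j p i, j ≤ m → Anc nx j p → 2 ≤ p → 1 ≤ i → i ≤ j →
    lin X S i (brk X S nx p) ≤ lin X S p (brk X S nx p)
  str : ∀ p, 2 ≤ p → p ≤ m → 2 ≤ nx p → brk X S nx (nx p) < brk X S nx p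

theorem HullTree.restrict {X S : ℕ → ℝ} {nx : ℕ → ℕ} {m k : ℕ} (h : HullTree X S nx m)
    (hk : k ≤ m) : HullTree X S nx k :=
  ⟨fun i l h1 h2 h3 => h.mono i l h1 h2 (h3.trans hk), fun l h1 h2 => h.nx_lt l h1 (h2.trans hk),
   fun j p i h1 => h.sup j p i (h1.trans hk), fun p h1 h2 => h.str p h1 (h2.trans hk)⟩

theorem HullTree.anc_le {X S : ℕ → ℝ} {nx : ℕ → ℕ} {m j p : ℕ} (h : HullTree X S nx m)
    (hj : j ≤ m) (hp : Anc nx j p) : p ≤ j := by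
  induction hp with
  | refl => exact le_rfl
  | step h1 _ ih =>
    have := h.nx_lt _ h1 hj
    have := ih (by omega)
    omega

theorem HullTree.anc_pos {X S : ℕ → ℝ} {nx : ℕ → ℕ} {m j p : ℕ} (h : HullTree X S nx m)
    (hj : j ≤ m) (hp : Anc nx j p) (h1 : 1 ≤ j) : 1 ≤ p := by
  induction hp with
  | refl => exact h1
  | step h2 _ ih =>
    have := h.nx_lt _ h2 hj
    exact ih (by omega) (by omega)

theorem HullTree.lin_brk {X S : ℕ → ℝ} {nx : ℕ → ℕ} {m p : ℕ} (h : HullTree X S nx m)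
    (hp : 2 ≤ p) (hm : p ≤ m) :
    lin X S (nx p) (brk X S nx p) = lin X S p (brk X S nx p) := by
  have := h.nx_lt p hp hm
  exact lin_meet (h.mono _ _ this.1 this.2 hm)

theorem HullTree.brk_le {X S : ℕ → ℝ} {nx : ℕ → ℕ} {m j p : ℕ} (h : HullTree X S nx m)
    (hj : j ≤ m) (hp : Anc nx j p) (h2 : 2 ≤ p) : brk X S nx p ≤ brk X S nx j := by
  induction hp with
  | refl => exact le_rfl
  | step h1 h3 ih =>
    have := h.nx_lt _ h1 hj
    have := h.anc_le (by omega) h3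
    exact (ih (by omega) h2).trans (h.str _ h1 hj (by omega)).le

/-- A member of the path that is maximal at `B` is maximal from there to its break point. -/
theorem HullTree.max_between {X S : ℕ → ℝ} {nx : ℕ → ℕ} {j p i : ℕ} {B w : ℝ}
    (h : HullTree X S nx j) (hp : Anc nx j p) (hB : lin X S i B ≤ lin X S p B)
    (hw : w ≤ B) (hc : 2 ≤ p → brk X S nx p ≤ w) (h1 : 1 ≤ i) (hi : i ≤ j) :
    lin X S i w ≤ lin X S p w := by
  have hpj := h.anc_le le_rfl hp
  have hp1 := h.anc_pos le_rfl hp (h1.trans hi)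
  -- Functions before `p` have smaller slope, so being below `p` at its break they stay below to the
  -- right; functions after `p` have larger slope, so being below `p` at `B` they stay below to the
  -- left.
  rcases lt_trichotomy i p with h2 | rfl | h2
  · have h3 : 2 ≤ p := by omega
    exact lin_le_of_le (h.mono _ _ h1 h2 hpj).le (h.sup j p i le_rfl hp h3 h1 hi) (hc h3)
  · exact le_rfl
  · exact lin_le_of_ge (h.mono _ _ hp1 h2 hi).le hB hw

/-- Pointers lead strictly downwards, so a path from `j ≤ m` never reads the entry `m + 1`. This is
why one array can hold the envelopes of all prefixes. -/
theorem HullTree.anc_update {nx : ℕ → ℕ} {m j p q : ℕ}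
    (h : ∀ k, 2 ≤ k → k ≤ m → 1 ≤ nx k ∧ nx k < k)
    (hj : j ≤ m) (hp : Anc (Function.update nx (m + 1) q) j p) : Anc nx j p := by
  induction hp with
  | refl => exact .refl _
  | @step j p h1 _ ih =>
    have e : Function.update nx (m + 1) q j = nx j := Function.update_of_ne (by omega) _ _
    rw [e] at ih
    have := h j h1 hj
    exact .step h1 (ih (by omega))

theorem HullTree.one (X S : ℕ → ℝ) (nx : ℕ → ℕ) : HullTree X S nx 1 := by
  refine ⟨fun _ _ _ _ _ => by omega, fun _ _ _ => by omega, ?_, fun _ _ _ => by omega⟩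
  intro j p i hj hp h2 h3 h4
  rcases hp with _ | ⟨h5, -⟩ <;> omega

/-- The state of the search for the pointer of `m + 1`: `p` is on the path from `m`, and
everything after `p` is below the new function where `p` meets it. -/
def Search (X S : ℕ → ℝ) (nx : ℕ → ℕ) (m p : ℕ) : Prop :=
  Anc nx m p ∧ 1 ≤ p ∧ ∀ i, p < i → i ≤ m →
    lin X S i (meet X S p (m + 1)) ≤ lin X S p (meet X S p (m + 1))

theorem Search.init {X S : ℕ → ℝ} {nx : ℕ → ℕ} {m : ℕ} (hm : 1 ≤ m) : Search X S nx m m :=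
  ⟨.refl _, hm, fun _ _ _ => by omega⟩

/-- By `hc` the new function has caught up with `p` by the break of `p`. There `nx p` has the same
value as `p`, so `nx p` meets the new function at or left of this break; the functions after `nx p`
are at most `nx p` at the break and, being steeper, also left of it. -/
theorem Search.next {X S : ℕ → ℝ} {nx : ℕ → ℕ} {m p : ℕ} (h : HullTree X S nx m)
    (hX : ∀ i, 1 ≤ i → i ≤ m → X i < X (m + 1)) (hs : Search X S nx m p) (hp : 2 ≤ p)
    (hc : meet X S p (m + 1) ≤ brk X S nx p) : Search X S nx m (nx p) := by
  obtain ⟨h1, -, -⟩ := hs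
  have hpm := h.anc_le le_rfl h1
  have hn := h.nx_lt p hp hpm
  refine ⟨h1.next hp, hn.1, fun i hi him => ?_⟩
  have h2 := h.sup m p i le_rfl h1 hp (by omega) him
  rw [← h.lin_brk hp hpm] at h2
  refine lin_le_of_ge (h.mono _ _ hn.1 hi him).le h2 ?_
  rw [← lin_le_iff (hX _ hn.1 (by omega)), h.lin_brk hp hpm, lin_le_iff (hX p (by omega) hpm)]
  exact hc

/-- When the search ends, the break of `p` lies left of the place where `p` meets the new function.
Hence `p` is maximal at that place, which thus is the break of the new function on the envelope, and
the breaks along the new path still decrease. -/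
theorem HullTree.extend {X S : ℕ → ℝ} {nx : ℕ → ℕ} {m p : ℕ} (h : HullTree X S nx m)
    (hX : ∀ i, 1 ≤ i → i ≤ m → X i < X (m + 1)) (hs : Search X S nx m p)
    (hc : 2 ≤ p → brk X S nx p < meet X S p (m + 1)) :
    HullTree X S (Function.update nx (m + 1) p) (m + 1) := by
  obtain ⟨h1, hp1, h2⟩ := hs
  have hpm := h.anc_le le_rfl h1
  have hnew : Function.update nx (m + 1) p (m + 1) = p := Function.update_self ..
  have hold : ∀ k, k ≤ m → Function.update nx (m + 1) p k = nx k := fun k hk =>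
    Function.update_of_ne (by omega) _ _
  have hbrk : ∀ k, k ≤ m → brk X S (Function.update nx (m + 1) p) k = brk X S nx k :=
    fun k hk => by rw [brk, hold k hk, brk]
  have hbn : brk X S (Function.update nx (m + 1) p) (m + 1) = meet X S p (m + 1) := by
    rw [brk, hnew]
  -- `p` is maximal at the meeting point
  have hmax : ∀ i, 1 ≤ i → i ≤ m →
      lin X S i (meet X S p (m + 1)) ≤ lin X S p (meet X S p (m + 1)) := by
    intro i hi him
    rcases lt_trichotomy i p with h3 | rfl | h3
    · have h4 : 2 ≤ p := by omega
      exact lin_le_of_le (h.mono _ _ hi h3 hpm).le (h.sup m p i le_rfl h1 h4 hi him) (hc h4).le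
    · exact le_rfl
    · exact h2 i h3 him
  refine ⟨?_, ?_, ?_, ?_⟩
  · intro i k hi hik hk
    rcases Nat.lt_or_ge m k with h3 | h3
    · obtain rfl : k = m + 1 := by omega
      exact hX i hi (by omega)
    · exact h.mono i k hi hik h3
  · intro k hk hkm
    rcases Nat.lt_or_ge m k with h3 | h3
    · obtain rfl : k = m + 1 := by omega
      rw [hnew]; omega
    · rw [hold k h3]; exact h.nx_lt k hk h3
  · intro j q i hj hq hq2 hi hij
    rcases Nat.lt_or_ge m j with h3 | h3
    · obtain rfl : j = m + 1 := by omega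
      rcases hq with _ | ⟨-, hq⟩
      · rw [hbn]
        rcases Nat.lt_or_ge m i with h4 | h4
        · obtain rfl : i = m + 1 := by omega
          exact le_rfl
        · rw [← lin_meet (hX p hp1 hpm)]; exact hmax i hi h4
      · rw [hnew] at hq
        have hq' := HullTree.anc_update h.nx_lt hpm hq
        have hqp := h.anc_le hpm hq'
        rw [hbrk q (by omega)]
        have hmq : Anc nx m q := h1.trans hq'
        rcases Nat.lt_or_ge m i with h4 | h4
        · obtain rfl : i = m + 1 := by omega
          -- The new function exceeds `p` only beyond their meeting point, and all older breaks on
          -- the path lie left of it.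
          refine le_trans ?_ (h.sup p q p hpm hq' hq2 hp1 le_rfl)
          rw [← not_lt, lin_lt_iff (hX p hp1 hpm), not_lt]
          exact (h.brk_le hpm hq' hq2).trans (hc (by omega)).le
        · exact h.sup m q i le_rfl hmq hq2 hi h4
    · have hq' := HullTree.anc_update h.nx_lt h3 hq
      have hqp := h.anc_le h3 hq'
      rw [hbrk q (by omega)]
      exact h.sup j q i h3 hq' hq2 hi hij
  · intro q hq hqm hq2
    rcases Nat.lt_or_ge m q with h3 | h3
    · obtain rfl : q = m + 1 := by omega
      rw [hnew] at hq2
      rw [hnew, hbn, hbrk p hpm]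
      exact hc hq2
    · rw [hold q h3] at hq2 ⊢
      have := h.nx_lt q hq h3
      rw [hbrk q h3, hbrk _ (by omega)]
      exact h.str q hq h3 hq2


/-! ## Walking up the two chains of a face -/

/-- The upper envelope of the functions `1, …, j`. -/
structure Hull where
  X : ℕ → ℝ
  S : ℕ → ℝ
  nx : ℕ → ℕ
  j : ℕ

namespace Hull

def g (A : Hull) (i : ℕ) (w : ℝ) : ℝ := lin A.X A.S i w
noncomputable def brk (A : Hull) (p : ℕ) : ℝ := ZoneRAM.brk A.X A.S A.nx p
def Valid (A : Hull) : Prop := HullTree A.X A.S A.nx A.j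

/-- The two envelopes have disjoint sets of slopes after a reflection. -/
def Sep (A A' : Hull) : Prop :=
  ∀ i k, 1 ≤ i → i ≤ A.j → 1 ≤ k → k ≤ A'.j → A.X i + A'.X k < 0

/-- At `w` the function `v` is maximal, and not above the reflected envelope `A'`. -/
structure Good (A A' : Hull) (wh : ℝ) (v : ℕ) (w : ℝ) : Prop where
  pos : 0 < w
  le : wh ≤ w
  left : ∀ i, 1 ≤ i → i ≤ A.j → A.g i w ≤ A.g v w
  right : ∀ i, 1 ≤ i → i ≤ A'.j → A.g v w + A'.g i w ≤ 0

/-- Under `w = 1 / y`: the line `v` contributes more than one point to the upper half of the face.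
-/
def TwoGood (A A' : Hull) (wh : ℝ) (v : ℕ) : Prop :=
  ∃ w₁ w₂, w₁ < w₂ ∧ Good A A' wh v w₁ ∧ Good A A' wh v w₂

/-- `T` lists the functions on the path from `A.j` to `p`, the last one first. -/
structure SideOK (A A' : Hull) (wh : ℝ) (T : List ℕ) (p : ℕ) : Prop where
  ends : (T = [] ∧ p = 0 ∧ A.j = 0) ∨ (T.head? = some p ∧ T.getLast? = some A.j ∧ 1 ≤ p)
  mem : ∀ v ∈ T, 1 ≤ v ∧ v ≤ A.j ∧ TwoGood A A' wh v
  chain : T.IsChain fun v' v => v' < v ∧ ∃ w, Good A A' wh v w ∧ Good A A' wh v' w ∧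
    A.g v w = A.g v' w
  skip : ∀ i, p < i → i ≤ A.j → i ∉ T → ¬ TwoGood A A' wh i
  anc : Anc A.nx A.j p

/-- `p` is the maximal function of `A` at `B`, and its break point is not beyond `B`. -/
structure TopAt (A : Hull) (p : ℕ) (B : ℝ) : Prop where
  max : ∀ i, 1 ≤ i → i ≤ A.j → A.g i B ≤ A.g p B
  brk_le : 2 ≤ p → A.brk p ≤ B

/-- `B` is the position of a sweep that comes from infinity, that is from the base line, and moves
towards smaller `w`, that is to larger heights. At `B` both current functions are maximal in their
chains and the face still has positive width. -/
structure WalkInv (A A' : Hull) (wh : ℝ) (T T' : List ℕ) (p p' : ℕ) : Prop where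
  side : SideOK A A' wh T p
  side' : SideOK A' A wh T' p'
  cur : ∃ B, 0 < B ∧ wh < B ∧ TopAt A p B ∧ TopAt A' p' B ∧
    (1 ≤ p → 1 ≤ p' → A.g p B + A'.g p' B < 0)

theorem WalkInv.symm {A A' : Hull} {wh : ℝ} {T T' : List ℕ} {p p' : ℕ}
    (h : WalkInv A A' wh T T' p p') : WalkInv A' A wh T' T p' p := by
  obtain ⟨h1, h2, B, h3, h4, h5, h6, h7⟩ := h
  exact ⟨h2, h1, B, h3, h4, h6, h5, fun a b => by rw [add_comm]; exact h7 b a⟩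

theorem Sep.symm {A A' : Hull} (h : Sep A A') : Sep A' A := fun i k h1 h2 h3 h4 => by
  rw [add_comm]; exact h k i h3 h4 h1 h2

/-- The filter is used twice: it supplies a first place since it is nontrivial, and a second one
since it avoids the first. -/
theorem TwoGood.congr {A A' : Hull} {wh : ℝ} {v : ℕ} {l : Filter ℝ}
    (h : ∀ᶠ w in l, Good A A' wh v w) [l.NeBot] (hl : ∀ b, Good A A' wh v b → ∀ᶠ w in l, w ≠ b) :
    TwoGood A A' wh v := by
  obtain ⟨a, ha⟩ := h.exists
  obtain ⟨b, hb, hab⟩ := (h.and (hl a ha)).exists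
  rcases lt_or_gt_of_ne hab with h1 | h1
  · exact ⟨b, a, h1, hb, ha⟩
  · exact ⟨a, b, h1, ha, hb⟩

theorem eventually_lin_lt {X S : ℕ → ℝ} {i : ℕ} {a b : ℝ} (h : X i < a) :
    ∀ᶠ w in atTop, lin X S i w < a * w + b := by
  have h0 : 0 < a - X i := by linarith
  filter_upwards [eventually_gt_atTop ((S i - b) / (a - X i))] with w hw
  rw [div_lt_iff₀ h0] at hw
  simp only [lin]; nlinarith

theorem eventually_range {l : Filter ℝ} {n : ℕ} {P : ℕ → ℝ → Prop}
    (h : ∀ i, 1 ≤ i → i ≤ n → ∀ᶠ w in l, P i w) : ∀ᶠ w in l, ∀ i, 1 ≤ i → i ≤ n → P i w := by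
  have := (Finset.Icc 1 n).eventually_all (l := l) (p := fun i w => P i w)
  simp only [Finset.mem_Icc, and_imp] at this
  exact this.2 h

/-- Slopes increase with the index, so the last function wins for large `w`. Geometrically, line
`A.j` bounds the face near the base line, and every walk starts with it. -/
theorem eventually_top {A : Hull} (h : A.Valid) : ∀ᶠ w in atTop, TopAt A A.j w := by
  have h1 : ∀ᶠ w in atTop, ∀ i, 1 ≤ i → i ≤ A.j → A.g i w ≤ A.g A.j w := by
    refine eventually_range fun i h1 h2 => ?_
    rcases h2.lt_or_eq with h3 | rfl
    · exact (eventually_lin_lt (h.mono i _ h1 h3 le_rfl)).mono fun w hw => hw.le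
    · exact Eventually.of_forall fun w => le_rfl
  filter_upwards [h1, eventually_ge_atTop (A.brk A.j)] with w h1 h2
  exact ⟨h1, fun _ => h2⟩

theorem eventually_sep {A A' : Hull} (hs : Sep A A') (h1 : 1 ≤ A.j) :
    ∀ᶠ w in atTop, ∀ i, 1 ≤ i → i ≤ A'.j → A.g A.j w + A'.g i w < 0 := by
  refine eventually_range fun i h2 h3 => ?_
  have := hs A.j i h1 le_rfl h2 h3
  filter_upwards [eventually_lin_lt (X := A.X) (S := A.S) (i := A.j) (a := -A'.X i)
    (b := -A'.S i) (by linarith)] with w hw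
  simp only [g, lin] at *; linarith

theorem eventually_good {A A' : Hull} {wh : ℝ} (h : A.Valid) (hs : Sep A A') (h1 : 1 ≤ A.j) :
    ∀ᶠ w in atTop, Good A A' wh A.j w := by
  filter_upwards [eventually_top h, eventually_sep hs h1, eventually_gt_atTop 0,
    eventually_ge_atTop wh] with w h1 h2 h3 h4
  exact ⟨h3, h4, h1.max, fun i h5 h6 => (h2 i h5 h6).le⟩

def startList (j : ℕ) : List ℕ := if j = 0 then [] else [j]

theorem SideOK.start {A A' : Hull} {wh : ℝ} (h : A.Valid) (hs : Sep A A') :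
    SideOK A A' wh (startList A.j) A.j := by
  rcases Nat.eq_zero_or_pos A.j with h0 | h0
  · rw [h0]
    refine ⟨.inl ⟨rfl, rfl, h0⟩, fun v hv => by simp [startList] at hv, .nil, fun i h1 h2 => by omega,
      by rw [h0]; exact .refl _⟩
  · have e : startList A.j = [A.j] := if_neg (by omega)
    rw [e]
    refine ⟨.inr ⟨rfl, rfl, h0⟩, fun v hv => ?_, List.isChain_singleton _, fun i h1 h2 => by omega,
      .refl _⟩
    obtain rfl := List.mem_singleton.1 hv
    exact ⟨h0, le_rfl, TwoGood.congr (eventually_good h hs h0) fun b _ => eventually_ne_atTop b⟩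

theorem WalkInv.start {A A' : Hull} {wh : ℝ} (h : A.Valid) (h' : A'.Valid) (hs : Sep A A') :
    WalkInv A A' wh (startList A.j) (startList A'.j) A.j A'.j := by
  refine ⟨.start h hs, .start h' hs.symm, ?_⟩
  have h1 : ∀ᶠ B in atTop, 1 ≤ A.j → 1 ≤ A'.j → A.g A.j B + A'.g A'.j B < 0 := by
    by_cases h1 : 1 ≤ A.j
    · filter_upwards [eventually_sep hs h1] with B hB _ h2
      exact hB _ h2 le_rfl
    · exact Eventually.of_forall fun B h2 => absurd h2 h1
  obtain ⟨B, h2, h3, h4, h5, h6⟩ := ((eventually_gt_atTop 0).and ((eventually_gt_atTop wh).and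
    ((eventually_top h).and ((eventually_top h').and h1)))).exists
  exact ⟨B, h2, h3, h4, h5, h6⟩

/-- The walk may step past `k` on the chain `A`. -/
def Stepped (A A' : Hull) (k : ℕ) : Prop :=
  Anc A.nx A.j k ∧ 2 ≤ k ∧ ∀ i, 1 ≤ i → i ≤ A'.j → A.g k (A.brk k) + A'.g i (A.brk k) < 0

/-- The place where the current functions of the two chains meet; `0` if there is none. -/
noncomputable def cross (A A' : Hull) (p p' : ℕ) : ℝ :=
  if p = 0 ∨ p' = 0 then 0 else (A.S p + A'.S p') / (-A.X p - A'.X p')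

theorem cross_symm (A A' : Hull) (p p' : ℕ) : cross A A' p p' = cross A' A p' p := by
  simp only [cross, or_comm (a := p = 0), add_comm (A.S p), sub_eq_add_neg, add_comm (-A.X p)]

theorem cross_lt_iff {A A' : Hull} {p p' : ℕ} {w : ℝ} (h : A.X p + A'.X p' < 0) (hp : 1 ≤ p)
    (hp' : 1 ≤ p') : cross A A' p p' < w ↔ A.g p w + A'.g p' w < 0 := by
  rw [cross, if_neg (by omega), div_lt_iff₀ (by linarith)]
  simp only [g, lin]; constructor <;> intro h <;> linarith

theorem cross_le_iff {A A' : Hull} {p p' : ℕ} {w : ℝ} (h : A.X p + A'.X p' < 0) (hp : 1 ≤ p)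
    (hp' : 1 ≤ p') : cross A A' p p' ≤ w ↔ A.g p w + A'.g p' w ≤ 0 := by
  rw [cross, if_neg (by omega), div_le_iff₀ (by linarith)]
  simp only [g, lin]; constructor <;> intro h <;> linarith

theorem g_cross {A A' : Hull} {p p' : ℕ} (h : A.X p + A'.X p' < 0) (hp : 1 ≤ p)
    (hp' : 1 ≤ p') : A.g p (cross A A' p p') + A'.g p' (cross A A' p p') = 0 := by
  rw [cross, if_neg (by omega)]
  have : -A.X p - A'.X p' ≠ 0 := by linarith
  simp only [g, lin]; field_simp; ring

theorem SideOK.pos {A A' : Hull} {wh : ℝ} {T : List ℕ} {p : ℕ} (h : SideOK A A' wh T p)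
    (hj : 1 ≤ A.j) : 1 ≤ p := by
  rcases h.ends with h1 | h1 <;> omega

theorem SideOK.bounds {A A' : Hull} {wh : ℝ} {T : List ℕ} {p : ℕ} (h : SideOK A A' wh T p)
    (hA : A.Valid) : p ≤ A.j := hA.anc_le le_rfl h.anc

/-- The hypotheses compare `p` with the current function of the other chain only. This is enough,
because that function dominates its chain all the way from `B` down to its own break. -/
theorem stepped_of_walk {A A' : Hull} {wh : ℝ} {T T' : List ℕ} {p p' : ℕ} (hA' : A'.Valid)
    (h : WalkInv A A' wh T T' p p') (hp : 2 ≤ p)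
    (hc : 2 ≤ p' → A'.brk p' ≤ A.brk p) (hx : 1 ≤ p' → A.g p (A.brk p) + A'.g p' (A.brk p) < 0) :
    Stepped A A' p := by
  obtain ⟨B, h1, h2, h3, h4, h5⟩ := h.cur
  refine ⟨h.side.anc, hp, fun i hi hij => ?_⟩
  have := HullTree.max_between hA' h.side'.anc (h4.max i hi hij) (h3.brk_le hp) hc hi hij
  have := hx (h.side'.pos (hi.trans hij))
  simp only [g] at *
  linarith

/-- A step on the first chain. -/
theorem WalkInv.step {A A' : Hull} {wh : ℝ} {T T' : List ℕ} {p p' : ℕ} (hA : A.Valid)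
    (hA' : A'.Valid) (h : WalkInv A A' wh T T' p p') (hp : 2 ≤ p)
    (hc : 2 ≤ p' → A'.brk p' ≤ A.brk p) (hx : 1 ≤ p' → A.g p (A.brk p) + A'.g p' (A.brk p) < 0)
    (h0 : 0 < A.brk p) (hw : wh < A.brk p) :
    WalkInv A A' wh (A.nx p :: T) T' (A.nx p) p' := by
  have hst := stepped_of_walk hA' h hp hc hx
  obtain ⟨B, h1, h2, h3, h4, h5⟩ := h.cur
  have hpj := h.side.bounds hA
  have hn := hA.nx_lt p hp hpj
  have hX := hA.mono _ _ hn.1 hn.2 hpj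
  have he : A.g (A.nx p) (A.brk p) = A.g p (A.brk p) := hA.lin_brk hp hpj
  have hsup : ∀ i, 1 ≤ i → i ≤ A.j → A.g i (A.brk p) ≤ A.g p (A.brk p) := fun i hi hij =>
    hA.sup A.j p i le_rfl h.side.anc hp hi hij
  have hgood : Good A A' wh p (A.brk p) :=
    ⟨h0, hw.le, hsup, fun i hi hij => (hst.2.2 i hi hij).le⟩
  have hgood' : Good A A' wh (A.nx p) (A.brk p) :=
    ⟨h0, hw.le, by rwa [he], fun i hi hij => by rw [he]; exact (hst.2.2 i hi hij).le⟩
  have hbr : 2 ≤ A.nx p → A.brk (A.nx p) < A.brk p := hA.str p hp hpj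
  have hanc := h.side.anc.next hp
  -- All strict inequalities at the break of `p` persist slightly to the left of it, where `nx p` is
  -- maximal because its own break lies strictly further left.
  have htwo : TwoGood A A' wh (A.nx p) := by
    refine TwoGood.congr (l := nhdsWithin (A.brk p) (Set.Iio (A.brk p))) ?_ ?_
    · have e1 : ∀ᶠ w in nhds (A.brk p), ∀ i, 1 ≤ i → i ≤ A'.j → A.g (A.nx p) w + A'.g i w < 0 := by
        refine eventually_range fun i hi hij => ?_
        have hcont : ContinuousAt (fun w => A.g (A.nx p) w + A'.g i w) (A.brk p) := by
          unfold g lin; fun_prop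
        exact hcont.eventually_lt_const (by simpa only [he] using hst.2.2 i hi hij)
      have e2 : ∀ᶠ w in nhds (A.brk p), 2 ≤ A.nx p → A.brk (A.nx p) < w := by
        by_cases h6 : 2 ≤ A.nx p
        · exact (lt_mem_nhds (hbr h6)).mono fun w hw _ => hw
        · exact Eventually.of_forall fun w h7 => absurd h7 h6
      filter_upwards [mem_nhdsWithin_of_mem_nhds e1, mem_nhdsWithin_of_mem_nhds e2,
        mem_nhdsWithin_of_mem_nhds (lt_mem_nhds h0), mem_nhdsWithin_of_mem_nhds (lt_mem_nhds hw),
        self_mem_nhdsWithin] with w e1 e2 e3 e4 e5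
      refine ⟨e3, e4.le, fun i hi hij => ?_, fun i hi hij => (e1 i hi hij).le⟩
      exact hA.max_between hanc (by simpa only [g, he] using hgood'.left i hi hij)
        (le_of_lt e5) (fun h6 => (e2 h6).le) hi hij
    · intro b hb
      by_cases hbb : b = A.brk p
      · filter_upwards [self_mem_nhdsWithin] with w hw
        rw [hbb]; exact ne_of_lt hw
      · exact mem_nhdsWithin_of_mem_nhds (isOpen_ne.mem_nhds (Ne.symm hbb))
  refine ⟨⟨?_, ?_, ?_, ?_, hanc⟩, h.side', A.brk p, h0, hw, ⟨hgood'.left, fun h6 => (hbr h6).le⟩,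
    ⟨fun i hi hij => ?_, hc⟩, fun _ h6 => by rw [he]; exact hx h6⟩
  · rcases h.side.ends with h6 | h6
    · omega
    · refine .inr ⟨rfl, ?_, hn.1⟩
      rw [List.getLast?_cons]
      simp [h6.2.1]
  · intro v hv
    rcases List.mem_cons.1 hv with rfl | hv
    · exact ⟨hn.1, by omega, htwo⟩
    · exact h.side.mem v hv
  · rcases h.side.ends with h6 | h6
    · omega
    · obtain ⟨T₁, rfl⟩ : ∃ T₁, T = p :: T₁ := by
        cases T with
        | nil => simp at h6
        | cons a T₁ => simp only [List.head?_cons, Option.some.injEq] at h6; exact ⟨T₁, by rw [h6.1]⟩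
      exact List.isChain_cons_cons.2 ⟨⟨hn.2, A.brk p, hgood, hgood', he.symm⟩, h.side.chain⟩
  -- A function strictly between `nx p` and `p` can be maximal at the break of `p` only: to the
  -- right `p` beats it, to the left `nx p` does.
  · rintro i hi hij hiT ⟨w₁, w₂, hw12, g1, g2⟩
    rw [List.mem_cons, not_or] at hiT
    rcases lt_trichotomy i p with h6 | rfl | h6
    · have hi1 : 1 ≤ i := by omega
      have a1 : w₂ ≤ A.brk p := by
        by_contra! h7
        exact absurd (g2.left p (by omega) hpj) (not_le.2
          (lin_lt_of_lt (hA.mono i p hi1 h6 hpj) (hsup i hi1 hij) h7))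
      have a2 : A.brk p ≤ w₁ := by
        by_contra! h7
        exact absurd (g1.left (A.nx p) hn.1 (by omega)) (not_le.2
          (lin_lt_of_gt (hA.mono _ i hn.1 hi hij) (by simpa only [g, he] using hgood'.left i hi1 hij) h7))
      linarith
    · rcases h.side.ends with h7 | h7
      · omega
      · exact hiT.2 (List.mem_of_mem_head? h7.1)
    · exact h.side.skip i h6 hij hiT.2 ⟨w₁, w₂, hw12, g1, g2⟩
  · exact HullTree.max_between hA' h.side'.anc (h4.max i hi hij) (h3.brk_le hp) hc hi hij

/-- The result of a complete walk. -/
structure WalkEnd (A A' : Hull) (wh : ℝ) (T T' : List ℕ) (p p' : ℕ) : Prop where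
  side : SideOK A A' wh T p
  side' : SideOK A' A wh T' p'
  skip : ∀ i, 1 ≤ i → i ≤ A.j → i ∉ T → ¬ TwoGood A A' wh i
  skip' : ∀ i, 1 ≤ i → i ≤ A'.j → i ∉ T' → ¬ TwoGood A' A wh i
  flat : 0 < wh → cross A A' p p' < wh → (1 ≤ p → Good A A' wh p wh) ∧
    (1 ≤ p' → Good A' A wh p' wh) ∧ (1 ≤ p → 1 ≤ p' → A.g p wh + A'.g p' wh < 0)
  apex : 0 < cross A A' p p' → wh ≤ cross A A' p p' →
    Good A A' wh p (cross A A' p p') ∧ Good A' A wh p' (cross A A' p p') ∧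
    A.g p (cross A A' p p') + A'.g p' (cross A A' p p') = 0
  inf : wh = 0 → cross A A' p p' ≤ 0 → (∀ i, 1 ≤ i → i ≤ A.j → A.S i ≤ A.S p) ∧
    (∀ i, 1 ≤ i → i ≤ A'.j → A'.S i ≤ A'.S p') ∧ (1 ≤ p → 1 ≤ p' → A.S p + A'.S p' ≤ 0)

theorem WalkInv.good {A A' : Hull} {wh : ℝ} {T T' : List ℕ} {p p' : ℕ} {B w : ℝ} (hA : A.Valid)
    (hA' : A'.Valid) (h : WalkInv A A' wh T T' p p') (h3 : TopAt A p B) (h4 : TopAt A' p' B)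
    (hwB : w ≤ B) (hc : 2 ≤ p → A.brk p ≤ w) (hc' : 2 ≤ p' → A'.brk p' ≤ w) (h0 : 0 < w)
    (hw : wh ≤ w) (hx : 1 ≤ p' → A.g p w + A'.g p' w ≤ 0) : Good A A' wh p w := by
  refine ⟨h0, hw, fun i hi hij => HullTree.max_between hA h.side.anc (h3.max i hi hij) hwB hc hi hij,
    fun i hi hij => ?_⟩
  have := HullTree.max_between hA' h.side'.anc (h4.max i hi hij) hwB hc' hi hij
  have := hx (h.side'.pos (hi.trans hij))
  simp only [g] at *
  linarith

/-- A function before `p` that is `Good` at two places has both of them at or beyond `cross` and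
`wh`, hence the larger one strictly beyond the break of `p`, where `p` strictly dominates. Functions
after `p` were dealt with during the walk. -/
theorem WalkInv.skip_end {A A' : Hull} {wh : ℝ} {T T' : List ℕ} {p p' : ℕ} (hA : A.Valid)
    (hA' : A'.Valid) (hs : Sep A A') (h : WalkInv A A' wh T T' p p')
    (hc : 2 ≤ p → A.brk p ≤ max (cross A A' p p') wh) :
    ∀ i, 1 ≤ i → i ≤ A.j → i ∉ T → ¬ TwoGood A A' wh i := by
  intro i hi hij hiT ⟨w₁, w₂, hw12, g1, g2⟩
  have hpj := h.side.bounds hA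
  have hp1 := h.side.pos (hi.trans hij)
  rcases lt_trichotomy i p with h6 | rfl | h6
  · have h7 : 2 ≤ p := by omega
    have h8 : cross A A' p p' ≤ w₁ := by
      rcases Nat.eq_zero_or_pos p' with h8 | h8
      · rw [cross, if_pos (.inr h8)]; exact g1.pos.le
      · have hp' := h.side'.bounds hA'
        rw [cross_le_iff (hs _ _ hp1 hpj h8 hp') hp1 h8]
        have := g1.left p hp1 hpj
        have := g1.right p' h8 hp'
        linarith
    have h9 : A.brk p < w₂ := (hc h7).trans_lt ((max_le h8 g1.le).trans_lt hw12)
    exact absurd (g2.left p hp1 hpj) (not_le.2 (lin_lt_of_lt (hA.mono i p hi h6 hpj)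
      (hA.sup A.j p i le_rfl h.side.anc h7 hi hij) h9))
  · rcases h.side.ends with h7 | h7
    · omega
    · exact hiT (List.mem_of_mem_head? h7.1)
  · exact h.side.skip i h6 hij hiT ⟨w₁, w₂, hw12, g1, g2⟩

/-- No break lies beyond both `cross` and `wh`. The half face then ends with a horizontal edge if
`wh` is the larger and positive, with an apex if the chains meet first, and at infinity if `wh = 0`
and `cross ≤ 0`; in this last case the values at `w = 0`, which are the constants `S`, control the
directions of recession. -/
theorem WalkInv.finish {A A' : Hull} {wh : ℝ} {T T' : List ℕ} {p p' : ℕ} (hA : A.Valid)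
    (hA' : A'.Valid) (hs : Sep A A') (h : WalkInv A A' wh T T' p p')
    (hc : 2 ≤ p → A.brk p ≤ max (cross A A' p p') wh)
    (hc' : 2 ≤ p' → A'.brk p' ≤ max (cross A A' p p') wh) :
    WalkEnd A A' wh T T' p p' := by
  obtain ⟨B, h1, h2, h3, h4, h5⟩ := h.cur
  have hpj := h.side.bounds hA
  have hpj' := h.side'.bounds hA'
  refine ⟨h.side, h.side', h.skip_end hA hA' hs hc,
    h.symm.skip_end hA' hA hs.symm (by rwa [cross_symm]), ?_, ?_, ?_⟩
  · intro h0 hx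
    rw [max_eq_right hx.le] at hc hc'
    have key : 1 ≤ p → 1 ≤ p' → A.g p wh + A'.g p' wh < 0 := fun a b =>
      (cross_lt_iff (hs _ _ a hpj b hpj') a b).1 hx
    exact ⟨fun a => h.good hA hA' h3 h4 h2.le hc hc' h0 le_rfl fun b => (key a b).le,
      fun b => h.symm.good hA' hA h4 h3 h2.le hc' hc h0 le_rfl fun a => by
        rw [add_comm]; exact (key a b).le, key⟩
  · intro h0 hx
    rw [max_eq_left hx] at hc hc'
    have hpos : 1 ≤ p ∧ 1 ≤ p' := by
      by_contra h6
      rw [cross, if_pos (by omega)] at h0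
      exact lt_irrefl _ h0
    have hXX := hs _ _ hpos.1 hpj hpos.2 hpj'
    have he := g_cross hXX hpos.1 hpos.2
    have hB : cross A A' p p' < B := (cross_lt_iff hXX hpos.1 hpos.2).2 (h5 hpos.1 hpos.2)
    exact ⟨h.good hA hA' h3 h4 hB.le hc hc' h0 hx fun _ => he.le,
      h.symm.good hA' hA h4 h3 hB.le hc' hc h0 hx fun _ => by rw [add_comm]; exact he.le, he⟩
  · intro h0 hx
    rw [h0, max_eq_right hx] at hc hc'
    have e : ∀ (A : Hull) i, A.g i 0 = A.S i := fun A i => by simp [g, lin]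
    refine ⟨fun i hi hij => ?_, fun i hi hij => ?_, fun a b => ?_⟩
    · have := hA.max_between h.side.anc (h3.max i hi hij) h1.le hc hi hij
      simpa [lin] using this
    · have := hA'.max_between h.side'.anc (h4.max i hi hij) h1.le hc' hi hij
      simpa [lin] using this
    · have := (cross_le_iff (hs _ _ a hpj b hpj') a b).1 hx
      simpa [e] using this

theorem WalkEnd.symm {A A' : Hull} {wh : ℝ} {T T' : List ℕ} {p p' : ℕ}
    (h : WalkEnd A A' wh T T' p p') : WalkEnd A' A wh T' T p' p := by
  obtain ⟨h1, h2, h3, h4, h5, h6, h7⟩ := h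
  rw [cross_symm] at h5 h6 h7
  refine ⟨h2, h1, h4, h3, fun a b => ?_, fun a b => ?_, fun a b => ?_⟩
  · exact ⟨(h5 a b).2.1, (h5 a b).1, fun c d => by rw [add_comm]; exact (h5 a b).2.2 d c⟩
  · exact ⟨(h6 a b).2.1, (h6 a b).1, by rw [add_comm]; exact (h6 a b).2.2⟩
  · exact ⟨(h7 a b).2.1, (h7 a b).1, fun c d => by rw [add_comm]; exact (h7 a b).2.2 d c⟩

/-- Two different faces do not step past the same `k`. -/
theorem Stepped.lt_absurd {X S X' S' : ℕ → ℝ} {nx nx' nx₂ : ℕ → ℕ} {m j₁ j₂ k : ℕ}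
    (hX : ∀ i, 1 ≤ i → i ≤ m → X' (m + 1 - i) = -X i)
    (hS : ∀ i, 1 ≤ i → i ≤ m → S' (m + 1 - i) = -S i) (hT : HullTree X S nx m)
    (h12 : j₁ < j₂) (h2 : j₂ ≤ m)
    (hs₁ : Stepped ⟨X, S, nx, j₁⟩ ⟨X', S', nx', m - j₁⟩ k)
    (hs₂ : Stepped ⟨X, S, nx, j₂⟩ ⟨X', S', nx₂, m - j₂⟩ k) : False := by
  -- Line `j₁ + 1` is on the left of face `j₂` and on the right of face `j₁`: at the break of `k` it
  -- is not above `k` by the first fact and strictly above `k` by the second.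
  have h3 := hT.sup j₂ k (j₁ + 1) h2 hs₂.1 hs₂.2.1 (by omega) (by omega)
  have h4 := hs₁.2.2 (m - j₁) (by omega) le_rfl
  have e : m - j₁ = m + 1 - (j₁ + 1) := by omega
  simp only [g, brk] at h4
  rw [e] at h4
  simp only [lin] at h3 h4
  rw [hX _ (by omega) (by omega), hS _ (by omega) (by omega)] at h4
  linarith

open Classical in
/-- The number of functions that the walk may step past on the chain `A`. -/
noncomputable def steps (A A' : Hull) : ℕ :=
  ((Finset.Icc 1 A.j).filter fun k => Stepped A A' k).card

/-- For different faces the sets of functions stepped past are disjoint subsets of `1, …, m`. This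
is the amortization behind the linear running time, and it takes the place of the zone theorem. -/
theorem sum_steps_le {X S X' S' : ℕ → ℝ} {nx nx' : ℕ → ℕ} {m : ℕ}
    (hX : ∀ i, 1 ≤ i → i ≤ m → X' (m + 1 - i) = -X i)
    (hS : ∀ i, 1 ≤ i → i ≤ m → S' (m + 1 - i) = -S i) (hT : HullTree X S nx m) :
    ∑ j ∈ Finset.range (m + 1), steps ⟨X, S, nx, j⟩ ⟨X', S', nx', m - j⟩ ≤ m := by
  classical
  unfold steps
  rw [← Finset.card_biUnion]
  · calc _ ≤ (Finset.Icc 1 m).card := by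
          refine Finset.card_le_card fun k hk => ?_
          simp only [Finset.mem_biUnion, Finset.mem_range, Finset.mem_filter,
            Finset.mem_Icc] at hk ⊢
          omega
      _ = m := by simp
  · intro j₁ h1 j₂ h2 hne
    simp only [Finset.coe_range, Set.mem_Iio] at h1 h2
    rw [Function.onFun, Finset.disjoint_left]
    intro k hk1 hk2
    simp only [Finset.mem_filter] at hk1 hk2
    rcases lt_or_gt_of_ne hne with h | h
    · exact hk1.2.lt_absurd hX hS hT h (by omega) hk2.2
    · exact hk2.2.lt_absurd hX hS hT h (by omega) hk1.2

end Hull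


/-! ## A face in local coordinates -/

/-- The face bounded on the left by the lines `x = X i + S i y` (`1 ≤ i ≤ j`), on the right by
`-x = X' i + S' i y` (`1 ≤ i ≤ j'`), above by `wh y = 1` and below by `-wd y = 1`, where a zero
value of `wh` or `wd` means that there is no such bound. -/
structure Geo where
  X : ℕ → ℝ
  S : ℕ → ℝ
  X' : ℕ → ℝ
  S' : ℕ → ℝ
  j : ℕ
  j' : ℕ
  wh : ℝ
  wd : ℝ

/-- The kinds of edges: left, right, top, bottom. -/
inductive Tag where
  | L (v : ℕ)
  | R (v : ℕ)
  | T
  | B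

namespace Geo

def F (G : Geo) : Tag → Plane → ℝ
  | .L v, p => p.1 - G.X v - G.S v * p.2
  | .R v, p => -p.1 - G.X' v - G.S' v * p.2
  | .T, p => 1 - G.wh * p.2
  | .B, p => 1 + G.wd * p.2

/-- The direction of an edge, counterclockwise. -/
def dir (G : Geo) : Tag → Plane
  | .L v => (-G.S v, -1)
  | .R v => (-G.S' v, 1)
  | .T => (-G.wh, 0)
  | .B => (G.wd, 0)

/-- The closed face. -/
def K (G : Geo) : Set Plane :=
  {p | (∀ i, 1 ≤ i → i ≤ G.j → 0 ≤ G.F (.L i) p) ∧ (∀ i, 1 ≤ i → i ≤ G.j' → 0 ≤ G.F (.R i) p) ∧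
    0 ≤ G.F .T p ∧ 0 ≤ G.F .B p}

/-- Rotation by 180 degrees. -/
def rot (G : Geo) : Geo := ⟨G.X', fun i => -G.S' i, G.X, fun i => -G.S i, G.j', G.j, G.wd, G.wh⟩

end Geo

def Tag.rot : Tag → Tag
  | .L v => .R v
  | .R v => .L v
  | .T => .B
  | .B => .T

namespace Geo

theorem F_rot (G : Geo) (t : Tag) (p : Plane) : G.rot.F t.rot (-p) = G.F t p := by
  cases t <;> simp only [F, rot, Tag.rot, Prod.fst_neg, Prod.snd_neg] <;> ring

theorem dir_rot (G : Geo) (t : Tag) : G.rot.dir t.rot = -G.dir t := by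
  cases t <;> simp [dir, rot, Tag.rot]

theorem mem_K_rot {G : Geo} {p : Plane} : -p ∈ G.rot.K ↔ p ∈ G.K := by
  have hL := fun i => G.F_rot (.L i) p
  have hR := fun i => G.F_rot (.R i) p
  have hT := G.F_rot .T p
  have hB := G.F_rot .B p
  simp only [Tag.rot] at hL hR hT hB
  have e1 : G.rot.j = G.j' := rfl
  have e2 : G.rot.j' = G.j := rfl
  simp only [K, Set.mem_ofPred_eq, hL, hR, hT, hB, e1, e2]
  tauto

/-- `dir t` is the gradient of `F t` turned clockwise by a right angle, so the cross product of two
directions is the rate at which one bound changes along the other edge. -/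
theorem F_add (G : Geo) (t t' : Tag) (p : Plane) (s : ℝ) :
    G.F t' (p + s • G.dir t) = G.F t' p - s * ZoneRAM.cross (G.dir t) (G.dir t') := by
  cases t <;> cases t' <;> simp [F, dir, ZoneRAM.cross] <;> ring

def Rec (G : Geo) (d : Plane) : Prop := ∀ p ∈ G.K, ∀ s : ℝ, 0 ≤ s → p + s • d ∈ G.K

/-- Between the consecutive edges `t` and `t'` there is a vertex, or the face is unbounded. -/
def Gap (G : Geo) (t t' : Tag) : Prop :=
  (0 < ZoneRAM.cross (G.dir t) (G.dir t') ∧ ∃ p ∈ G.K, G.F t p = 0 ∧ G.F t' p = 0) ∨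
    (G.Rec (G.dir t) ∧ G.Rec (-G.dir t'))

theorem rec_rot {G : Geo} {d : Plane} : G.rot.Rec (-d) ↔ G.Rec d := by
  constructor
  · intro h p hp s hs
    have := h (-p) (mem_K_rot.2 hp) s hs
    rwa [smul_neg, ← neg_add, mem_K_rot] at this
  · intro h p hp s hs
    have h1 := mem_K_rot.1 ((neg_neg p).symm ▸ hp)
    have := h (-p) h1 s hs
    rw [← mem_K_rot] at this
    simpa [add_comm] using this

theorem gap_rot {G : Geo} {t t' : Tag} : G.rot.Gap t.rot t'.rot ↔ G.Gap t t' := by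
  unfold Gap
  rw [dir_rot, dir_rot, rec_rot, rec_rot]
  have e : ZoneRAM.cross (-G.dir t) (-G.dir t') = ZoneRAM.cross (G.dir t) (G.dir t') := by
    simp [ZoneRAM.cross]
  rw [e]
  refine or_congr (and_congr_right fun _ => ?_) Iff.rfl
  constructor
  · rintro ⟨p, h1, h2, h3⟩
    refine ⟨-p, mem_K_rot.1 ((neg_neg p).symm ▸ h1), ?_, ?_⟩
    · rw [← F_rot, neg_neg]; exact h2
    · rw [← F_rot, neg_neg]; exact h3
  · rintro ⟨p, h1, h2, h3⟩
    exact ⟨-p, mem_K_rot.2 h1, by rwa [F_rot], by rwa [F_rot]⟩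

/-- Dividing `x = X i + S i y` by `y` and writing `w = 1 / y` turns the line into the function `X i
* w + S i` for the ratio `x / y`. Base points become slopes, and going up from the base line becomes
decreasing `w`. -/
def upL (G : Geo) (nx : ℕ → ℕ) : Hull := ⟨G.X, G.S, nx, G.j⟩
def upR (G : Geo) (nx : ℕ → ℕ) : Hull := ⟨G.X', G.S', nx, G.j'⟩

def Two (G : Geo) (t : Tag) : Prop := ∃ p ∈ G.K, ∃ q ∈ G.K, p ≠ q ∧ G.F t p = 0 ∧ G.F t q = 0

/-- What the walk along the upper halves of both chains shows about the face. -/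
structure TopPart (G : Geo) (TL TR : List ℕ) (p q : ℕ) (top : Prop) : Prop where
  endsL : (TL = [] ∧ p = 0 ∧ G.j = 0) ∨ (TL.head? = some p ∧ TL.getLast? = some G.j ∧ 1 ≤ p)
  endsR : (TR = [] ∧ q = 0 ∧ G.j' = 0) ∨ (TR.head? = some q ∧ TR.getLast? = some G.j' ∧ 1 ≤ q)
  chainL : TL.IsChain fun v' v => v' < v ∧ G.Gap (.L v') (.L v)
  chainR : TR.IsChain fun v' v => v' < v ∧ G.Gap (.R v) (.R v')
  memL : ∀ v ∈ TL, 1 ≤ v ∧ v ≤ G.j ∧ G.Two (.L v) ∧ ∃ P ∈ G.K, G.F (.L v) P = 0 ∧ 0 < P.2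
  memR : ∀ v ∈ TR, 1 ≤ v ∧ v ≤ G.j' ∧ G.Two (.R v) ∧ ∃ P ∈ G.K, G.F (.R v) P = 0 ∧ 0 < P.2
  skipL : ∀ i, 1 ≤ i → i ≤ G.j → i ∉ TL → ∀ P ∈ G.K, ∀ Q ∈ G.K, G.F (.L i) P = 0 →
    G.F (.L i) Q = 0 → 0 < P.2 → 0 < Q.2 → P = Q
  skipR : ∀ i, 1 ≤ i → i ≤ G.j' → i ∉ TR → ∀ P ∈ G.K, ∀ Q ∈ G.K, G.F (.R i) P = 0 →
    G.F (.R i) Q = 0 → 0 < P.2 → 0 < Q.2 → P = Q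
  flat : top → 0 < G.wh ∧ (1 ≤ G.j → G.Gap .T (.L p)) ∧ (1 ≤ G.j' → G.Gap (.R q) .T) ∧
    (G.j = 0 → G.Rec (G.dir .T)) ∧ (G.j' = 0 → G.Rec (-G.dir .T)) ∧ G.Two .T
  apex : ¬ top → (1 ≤ G.j → 1 ≤ G.j' → G.Gap (.R q) (.L p)) ∧
    (1 ≤ G.j → G.j' = 0 → G.Rec (-G.dir (.L p))) ∧ (G.j = 0 → 1 ≤ G.j' → G.Rec (G.dir (.R q))) ∧
    (0 < G.wh → ∀ P ∈ G.K, ∀ Q ∈ G.K, G.F .T P = 0 → G.F .T Q = 0 → P = Q)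

variable {G : Geo} {nx nx' : ℕ → ℕ}

/-- The point at height `1 / w` whose ratio `x / y` is the value of the envelope. The lower bound is
automatic at positive heights. -/
theorem good_mem (hwd : 0 ≤ G.wd) {v : ℕ} {w : ℝ}
    (h : Hull.Good (G.upL nx) (G.upR nx') G.wh v w) :
    ((G.upL nx).g v w / w, 1 / w) ∈ G.K ∧ G.F (.L v) ((G.upL nx).g v w / w, 1 / w) = 0 := by
  obtain ⟨h0, h1, h2, h3⟩ := h
  simp only [Hull.g, upL, upR] at *
  have hw : 0 < 1 / w := by positivity
  have e : ∀ i, lin G.X G.S i w / w = G.X i + G.S i * (1 / w) := fun i => by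
    simp only [lin]; field_simp
  have e' : ∀ i, lin G.X' G.S' i w / w = G.X' i + G.S' i * (1 / w) := fun i => by
    simp only [lin]; field_simp
  refine ⟨⟨fun i hi hij => ?_, fun i hi hij => ?_, ?_, ?_⟩, ?_⟩
  · have := div_le_div_of_nonneg_right (h2 i hi hij) h0.le
    rw [e] at this
    simp only [F]; linarith
  · have := div_le_div_of_nonneg_right (h3 i hi hij) h0.le
    rw [add_div, e', zero_div] at this
    simp only [F]; linarith
  · simp only [F]
    have : G.wh * (1 / w) ≤ 1 := by rw [mul_one_div, div_le_one h0]; exact h1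
    linarith
  · simp only [F]; positivity
  · simp only [F]; rw [e]; ring

theorem good_mem' (hwd : 0 ≤ G.wd) {v : ℕ} {w : ℝ}
    (h : Hull.Good (G.upR nx') (G.upL nx) G.wh v w) :
    (-((G.upR nx').g v w / w), 1 / w) ∈ G.K ∧
      G.F (.R v) (-((G.upR nx').g v w / w), 1 / w) = 0 := by
  obtain ⟨h0, h1, h2, h3⟩ := h
  simp only [Hull.g, upL, upR] at *
  have hw : 0 < 1 / w := by positivity
  have e : ∀ i, lin G.X G.S i w / w = G.X i + G.S i * (1 / w) := fun i => by
    simp only [lin]; field_simp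
  have e' : ∀ i, lin G.X' G.S' i w / w = G.X' i + G.S' i * (1 / w) := fun i => by
    simp only [lin]; field_simp
  refine ⟨⟨fun i hi hij => ?_, fun i hi hij => ?_, ?_, ?_⟩, ?_⟩
  · have := div_le_div_of_nonneg_right (h3 i hi hij) h0.le
    rw [add_div, e, zero_div] at this
    simp only [F]; linarith
  · have := div_le_div_of_nonneg_right (h2 i hi hij) h0.le
    rw [e'] at this
    simp only [F]; linarith
  · simp only [F]
    have : G.wh * (1 / w) ≤ 1 := by rw [mul_one_div, div_le_one h0]; exact h1
    linarith
  · simp only [F]; positivity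
  · simp only [F]; rw [e']; ring

theorem good_of_mem {v : ℕ} {P : Plane} (hP : P ∈ G.K) (h0 : 0 < P.2) (hv : G.F (.L v) P = 0) :
    Hull.Good (G.upL nx) (G.upR nx') G.wh v (1 / P.2) := by
  obtain ⟨h1, h2, h3, -⟩ := hP
  simp only [F] at *
  have e : ∀ i, lin G.X G.S i (1 / P.2) = (G.X i + G.S i * P.2) / P.2 := fun i => by
    simp only [lin]; field_simp
  have e' : ∀ i, lin G.X' G.S' i (1 / P.2) = (G.X' i + G.S' i * P.2) / P.2 := fun i => by
    simp only [lin]; field_simp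
  refine ⟨by positivity, ?_, fun i hi hij => ?_, fun i hi hij => ?_⟩
  · rw [le_div_iff₀ h0]; linarith
  · have := h1 i hi hij
    simp only [Hull.g, upL, e]
    exact div_le_div_of_nonneg_right (by linarith) h0.le
  · have := h2 i hi hij
    simp only [Hull.g, upL, upR, e, e']
    rw [← add_div]
    exact div_nonpos_of_nonpos_of_nonneg (by linarith) h0.le

theorem good_of_mem' {v : ℕ} {P : Plane} (hP : P ∈ G.K) (h0 : 0 < P.2) (hv : G.F (.R v) P = 0) :
    Hull.Good (G.upR nx') (G.upL nx) G.wh v (1 / P.2) := by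
  obtain ⟨h1, h2, h3, -⟩ := hP
  simp only [F] at *
  have e : ∀ i, lin G.X G.S i (1 / P.2) = (G.X i + G.S i * P.2) / P.2 := fun i => by
    simp only [lin]; field_simp
  have e' : ∀ i, lin G.X' G.S' i (1 / P.2) = (G.X' i + G.S' i * P.2) / P.2 := fun i => by
    simp only [lin]; field_simp
  refine ⟨by positivity, ?_, fun i hi hij => ?_, fun i hi hij => ?_⟩
  · rw [le_div_iff₀ h0]; linarith
  · have := h2 i hi hij
    simp only [Hull.g, upR, e']
    exact div_le_div_of_nonneg_right (by linarith) h0.le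
  · have := h1 i hi hij
    simp only [Hull.g, upL, upR, e, e']
    rw [← add_div]
    exact div_nonpos_of_nonpos_of_nonneg (by linarith) h0.le

theorem twoGood_of {A A' : Hull} {wh : ℝ} {v : ℕ} {y y' : ℝ} (h : Hull.Good A A' wh v (1 / y))
    (h' : Hull.Good A A' wh v (1 / y')) (hne : y ≠ y') : Hull.TwoGood A A' wh v := by
  have : 1 / y ≠ 1 / y' := fun h => hne (by simpa using h)
  rcases lt_or_gt_of_ne this with h1 | h1
  · exact ⟨_, _, h1, h, h'⟩
  · exact ⟨_, _, h1, h', h⟩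

/-- `good_mem`, `good_of_mem` and their mirror images identify the places `w` with the points of the
closed face at positive height, which turns the end of the walk into statements about edges and
vertices. -/
theorem topPart (hwh : 0 ≤ G.wh) (hwd : 0 ≤ G.wd) {TL TR : List ℕ} {p q : ℕ}
    (hA : ∀ i k, 1 ≤ i → i < k → k ≤ G.j → G.X i < G.X k)
    (hA' : ∀ i k, 1 ≤ i → i < k → k ≤ G.j' → G.X' i < G.X' k)
    (hs : Hull.Sep (G.upL nx) (G.upR nx'))
    (hp : p ≤ G.j) (hq : q ≤ G.j')
    (h : Hull.WalkEnd (G.upL nx) (G.upR nx') G.wh TL TR p q) :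
    TopPart G TL TR p q
      (Hull.cross (G.upL nx) (G.upR nx') p q < G.wh ∧ 0 < G.wh) := by
  have two : ∀ v, Hull.TwoGood (G.upL nx) (G.upR nx') G.wh v →
      G.Two (.L v) ∧ ∃ P ∈ G.K, G.F (.L v) P = 0 ∧ 0 < P.2 := by
    rintro v ⟨w₁, w₂, hw, g1, g2⟩
    obtain ⟨a1, a2⟩ := good_mem hwd g1
    obtain ⟨b1, b2⟩ := good_mem hwd g2
    refine ⟨⟨_, a1, _, b1, fun e => ?_, a2, b2⟩, ⟨_, a1, a2, by have := g1.pos; positivity⟩⟩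
    have := congrArg Prod.snd e
    simp only [one_div, inv_inj] at this
    exact hw.ne this
  have two' : ∀ v, Hull.TwoGood (G.upR nx') (G.upL nx) G.wh v →
      G.Two (.R v) ∧ ∃ P ∈ G.K, G.F (.R v) P = 0 ∧ 0 < P.2 := by
    rintro v ⟨w₁, w₂, hw, g1, g2⟩
    obtain ⟨a1, a2⟩ := good_mem' hwd g1
    obtain ⟨b1, b2⟩ := good_mem' hwd g2
    refine ⟨⟨_, a1, _, b1, fun e => ?_, a2, b2⟩, ⟨_, a1, a2, by have := g1.pos; positivity⟩⟩
    have := congrArg Prod.snd e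
    simp only [one_div, inv_inj] at this
    exact hw.ne this
  have e0 : ∀ i w, (G.upL nx).g i w = G.X i * w + G.S i := fun _ _ => rfl
  have e0' : ∀ i w, (G.upR nx').g i w = G.X' i * w + G.S' i := fun _ _ => rfl
  refine ⟨h.side.ends, h.side'.ends, ?_, ?_, ?_, ?_, ?_, ?_, ?_, ?_⟩
  · refine List.IsChain.imp_of_mem_imp ?_ h.side.chain
    rintro v' v hv' hv ⟨h1, w, g1, g2, e⟩
    refine ⟨h1, .inl ⟨?_, ?_⟩⟩
    -- Both functions agree at `w`, so the cross product `S v' - S v` equals `w * (X v - X v')`.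
    · have := hA v' v (h.side.mem v' hv').1 h1 (h.side.mem v hv).2.1
      have := g1.pos
      simp only [e0] at e
      simp only [dir, ZoneRAM.cross]; nlinarith
    · obtain ⟨a1, a2⟩ := good_mem hwd g1
      obtain ⟨b1, b2⟩ := good_mem hwd g2
      exact ⟨_, b1, b2, by rwa [← e]⟩
  · refine List.IsChain.imp_of_mem_imp ?_ h.side'.chain
    rintro v' v hv' hv ⟨h1, w, g1, g2, e⟩
    refine ⟨h1, .inl ⟨?_, ?_⟩⟩
    · have := hA' v' v (h.side'.mem v' hv').1 h1 (h.side'.mem v hv).2.1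
      have := g1.pos
      simp only [e0'] at e
      simp only [dir, ZoneRAM.cross]; nlinarith
    · obtain ⟨a1, a2⟩ := good_mem' hwd g1
      obtain ⟨b1, b2⟩ := good_mem' hwd g2
      exact ⟨_, b1, by rwa [← e], b2⟩
  · exact fun v hv => ⟨(h.side.mem v hv).1, (h.side.mem v hv).2.1, two v (h.side.mem v hv).2.2⟩
  · exact fun v hv => ⟨(h.side'.mem v hv).1, (h.side'.mem v hv).2.1, two' v (h.side'.mem v hv).2.2⟩
  · intro i hi hij hiT P hP Q hQ fP fQ yP yQ
    by_contra hne
    refine h.skip i hi hij hiT (twoGood_of (good_of_mem hP yP fP) (good_of_mem hQ yQ fQ) ?_)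
    intro e
    simp only [F] at fP fQ
    rw [e] at fP
    exact hne (Prod.ext (by linarith) e)
  · intro i hi hij hiT P hP Q hQ fP fQ yP yQ
    by_contra hne
    refine h.skip' i hi hij hiT (twoGood_of (good_of_mem' hP yP fP) (good_of_mem' hQ yQ fQ) ?_)
    intro e
    simp only [F] at fP fQ
    rw [e] at fP
    exact hne (Prod.ext (by linarith) e)
  · rintro ⟨hx, h0⟩
    obtain ⟨f1, f2, f3⟩ := h.flat h0 hx
    have hT : ∀ x, G.F .T (x, 1 / G.wh) = 0 := fun x => by simp only [F]; field_simp; ring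
    have r1 : G.j = 0 → G.Rec (G.dir .T) := by
      rintro hj P ⟨h1, h2, h3, h4⟩ s hs
      refine ⟨fun i _ _ => by omega, fun i hi hij => ?_, ?_, ?_⟩ <;> rw [F_add] <;>
        simp only [dir, ZoneRAM.cross]
      · nlinarith [h2 i hi hij, mul_nonneg hs hwh]
      · linarith
      · linarith
    have r2 : G.j' = 0 → G.Rec (-G.dir .T) := by
      rintro hj P ⟨h1, h2, h3, h4⟩ s hs
      rw [smul_neg, ← neg_smul]
      refine ⟨fun i hi hij => ?_, fun i _ _ => by omega, ?_, ?_⟩ <;> rw [F_add] <;>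
        simp only [dir, ZoneRAM.cross]
      · nlinarith [h1 i hi hij, mul_nonneg hs hwh]
      · linarith
      · linarith
    have two_of : ∀ x x', (x, 1 / G.wh) ∈ G.K → (x', 1 / G.wh) ∈ G.K → x ≠ x' → G.Two .T :=
      fun x x' h1 h2 hne => ⟨_, h1, _, h2, fun e => hne (congrArg Prod.fst e), hT x, hT x'⟩
    refine ⟨h0, fun hj => .inl ⟨?_, ?_⟩, fun hj => .inl ⟨?_, ?_⟩, r1, r2, ?_⟩
    · simp only [dir, ZoneRAM.cross]; linarith
    · obtain ⟨a1, a2⟩ := good_mem hwd (f1 (h.side.pos hj))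
      exact ⟨_, a1, hT _, a2⟩
    · simp only [dir, ZoneRAM.cross]; linarith
    · obtain ⟨a1, a2⟩ := good_mem' hwd (f2 (h.side'.pos hj))
      exact ⟨_, a1, a2, hT _⟩
    -- If a chain is missing, the top edge is unbounded on that side and a second point is found by
    -- moving along it; if both are present, its two corners differ because the width there is
    -- positive.
    · rcases Nat.eq_zero_or_pos G.j with hj | hj <;> rcases Nat.eq_zero_or_pos G.j' with hj' | hj'
      · refine two_of 0 1 ?_ ?_ zero_ne_one <;>
        · refine ⟨fun i _ _ => by omega, fun i _ _ => by omega, (hT _).ge, ?_⟩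
          simp only [F]; positivity
      · obtain ⟨a1, a2⟩ := good_mem' hwd (f2 (h.side'.pos hj'))
        have := r1 hj _ a1 1 zero_le_one
        simp only [dir, one_smul, Prod.mk_add_mk, add_zero] at this
        exact two_of _ _ a1 this (by intro e; linarith)
      · obtain ⟨a1, a2⟩ := good_mem hwd (f1 (h.side.pos hj))
        have := r2 hj' _ a1 1 zero_le_one
        simp only [dir, one_smul, Prod.neg_mk, neg_neg, neg_zero, Prod.mk_add_mk, add_zero] at this
        exact two_of _ _ a1 this (by intro e; linarith)
      · obtain ⟨a1, a2⟩ := good_mem hwd (f1 (h.side.pos hj))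
        obtain ⟨b1, b2⟩ := good_mem' hwd (f2 (h.side'.pos hj'))
        refine two_of _ _ a1 b1 fun e => ?_
        have h3 := f3 (h.side.pos hj) (h.side'.pos hj')
        field_simp at e
        linarith
  · intro hn
    have hcase : G.wh = 0 ∨ 0 < G.wh ∧ G.wh ≤ Hull.cross (G.upL nx) (G.upR nx') p q := by
      rcases hwh.eq_or_lt with h1 | h1
      · exact .inl h1.symm
      · exact .inr ⟨h1, not_lt.1 fun h2 => hn ⟨h2, h1⟩⟩
    -- Without a top bound and without a meeting point, the last line of either chain can be
    -- followed upwards for ever: its `S` is maximal in its chain, and `S p + S' q ≤ 0` keeps it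
    -- away from the other chain.
    have recs : G.wh = 0 → Hull.cross (G.upL nx) (G.upR nx') p q ≤ 0 →
        (1 ≤ G.j → G.Rec (-G.dir (.L p))) ∧ (1 ≤ G.j' → G.Rec (G.dir (.R q))) := by
      intro h0 hx
      obtain ⟨i1, i2, i3⟩ := h.inf h0 hx
      constructor
      · rintro hj P ⟨h1, h2, h3, h4⟩ s hs
        rw [smul_neg, ← neg_smul]
        refine ⟨fun i hi hij => ?_, fun i hi hij => ?_, ?_, ?_⟩ <;> rw [F_add] <;>
          simp only [dir, ZoneRAM.cross]
        · have := i1 i hi hij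
          have := h1 i hi hij
          simp only [upL] at *
          nlinarith
        · have := i2 i hi hij
          have := h2 i hi hij
          have := i3 (h.side.pos hj) (h.side'.pos (hi.trans hij))
          simp only [upL, upR] at *
          nlinarith
        · rw [h0]; linarith
        · nlinarith
      · rintro hj P ⟨h1, h2, h3, h4⟩ s hs
        refine ⟨fun i hi hij => ?_, fun i hi hij => ?_, ?_, ?_⟩ <;> rw [F_add] <;>
          simp only [dir, ZoneRAM.cross]
        · have := i1 i hi hij
          have := h1 i hi hij
          have := i3 (h.side.pos (hi.trans hij)) (h.side'.pos hj)
          simp only [upL, upR] at *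
          nlinarith
        · have := i2 i hi hij
          have := h2 i hi hij
          simp only [upR] at *
          nlinarith
        · rw [h0]; linarith
        · nlinarith
    have czero : p = 0 ∨ q = 0 → Hull.cross (G.upL nx) (G.upR nx') p q = 0 := fun h1 => if_pos h1
    have wzero : Hull.cross (G.upL nx) (G.upR nx') p q ≤ 0 → G.wh = 0 := fun h1 => by
      rcases hcase with h2 | h2
      · exact h2
      · linarith
    refine ⟨fun hj hj' => ?_, fun hj hj' => ?_, fun hj hj' => ?_, fun h0 P hP Q hQ fP fQ => ?_⟩
    · rcases le_or_gt (Hull.cross (G.upL nx) (G.upR nx') p q) 0 with hx | hx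
      · obtain ⟨a, b⟩ := recs (wzero hx) hx
        exact .inr ⟨b hj', a hj⟩
      · obtain ⟨g1, g2, g3⟩ := h.apex hx (by rcases hcase with h2 | h2 <;> linarith)
        obtain ⟨a1, a2⟩ := good_mem hwd g1
        obtain ⟨b1, b2⟩ := good_mem' hwd g2
        have hp1 := h.side.pos hj
        have hq1 := h.side'.pos hj'
        refine .inl ⟨?_, _, a1, ?_, a2⟩
        · have hX := hs p q hp1 hp hq1 hq
          rw [Hull.cross, if_neg (by omega)] at hx
          have := (div_pos_iff_of_pos_right (by linarith)).1 hx
          simp only [dir, ZoneRAM.cross]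
          simp only [upL, upR] at this
          linarith
        · convert b2 using 2
          rw [Prod.mk.injEq]
          refine ⟨?_, rfl⟩
          rw [← neg_div]; congr 1; linarith
    · exact (recs (wzero (czero (.inr (by omega))).le) (czero (.inr (by omega))).le).1 hj
    · exact (recs (wzero (czero (.inl (by omega))).le) (czero (.inl (by omega))).le).2 hj'
    · have hx : G.wh ≤ Hull.cross (G.upL nx) (G.upR nx') p q := by
        rcases hcase with h2 | h2 <;> linarith
      have hpq : 1 ≤ p ∧ 1 ≤ q := by
        by_contra h1
        rw [czero (by omega)] at hx
        linarith
      have hX := hs p q hpq.1 hp hpq.2 hq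
      have h1 := not_lt.1 (mt (Hull.cross_lt_iff hX hpq.1 hpq.2).2 (not_lt.2 hx))
      -- The bound is not below the apex, so at its height the lines `p` and `q` leave room for at
      -- most one point between them.
      have key : ∀ P ∈ G.K, G.F .T P = 0 → P = (G.X p + G.S p * (1 / G.wh), 1 / G.wh) := by
        rintro P ⟨k1, k2, -, -⟩ fP
        have hy : P.2 = 1 / G.wh := by
          simp only [F] at fP
          field_simp; linarith
        have k1 := k1 p hpq.1 hp
        have k2 := k2 q hpq.2 hq
        have h3 : 0 ≤ ((G.upL nx).g p G.wh + (G.upR nx').g q G.wh) * (1 / G.wh) := by positivity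
        have h4 : G.wh * (1 / G.wh) = 1 := by field_simp
        rw [e0, e0'] at h3
        have h5 : (G.X p * G.wh + G.S p + (G.X' q * G.wh + G.S' q)) * (1 / G.wh) =
            G.X p + G.S p * (1 / G.wh) + (G.X' q + G.S' q * (1 / G.wh)) := by
          linear_combination (G.X p + G.X' q) * h4
        simp only [F, hy] at k1 k2
        exact Prod.ext (by simp only; linarith) hy
      rw [key P hP fP, key Q hQ fQ]

end Geo


/-! ### The boundary cycle of a face, assembled from its chains -/

theorem List.glue {R : ℕ → ℕ → Prop} {a b : List ℕ} {j : ℕ} (ha : a.getLast? = some j)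
    (hb : b.getLast? = some j) (h1 : a.IsChain R) (h2 : b.IsChain fun x y => R y x) :
    (a ++ b.reverse.tail).IsChain R ∧ (a ++ b.reverse.tail).getLast? = b.head? ∧
      (a ++ b.reverse.tail).head? = a.head? := by
  obtain ⟨a, rfl⟩ := List.getLast?_eq_some_iff.1 ha
  obtain ⟨b, rfl⟩ := List.getLast?_eq_some_iff.1 hb
  -- The lists of the upper and the lower half of a chain both end with the base line `j`; the tail
  -- removes its second copy.
  have e : (b ++ [j]).reverse.tail = b.reverse := by simp
  rw [e]
  refine ⟨?_, ?_, ?_⟩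
  · refine List.IsChain.append_overlap h1 ?_ (by simp)
    have := List.isChain_reverse.2 (show List.IsChain (fun a b => R b a) (b ++ [j]) from h2)
    simpa using this
  · cases b with
    | nil => simp
    | cons x b => exact List.getLast?_eq_some_iff.2 ⟨a ++ j :: b.reverse, by simp⟩
  · cases a <;> simp

-- Counterclockwise the boundary consists of the left chain `l` downwards, the bottom `b`, the right
-- chain `r` upwards and the top `t`, where each of the four may be missing. `hf` and `tf` mean that
-- the head or the tail of an edge is at infinity; two such ends are always neighbours by `hR`,
-- since an unbounded face closes up through infinity. The proof goes through the sixteen cases.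
open Classical in
theorem List.cyclic_blocks {α : Type*} {R : α → α → Prop} {hf tf : α → Prop} {l r : List α}
    {x₀ x₁ y₀ y₁ b t : α} {hl hr top bot : Prop} (hR : ∀ x y, hf x → tf y → R x y)
    (l1 : hl → l.head? = some x₀ ∧ l.getLast? = some x₁ ∧ l.IsChain R) (l2 : ¬ hl → l = [])
    (r1 : hr → r.head? = some y₀ ∧ r.getLast? = some y₁ ∧ r.IsChain R) (r2 : ¬ hr → r = [])
    (t1 : top → (hl → R t x₀) ∧ (hr → R y₁ t) ∧ (¬ hl → hf t) ∧ (¬ hr → tf t))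
    (t2 : ¬ top → (hl → hr → R y₁ x₀) ∧ (hl → ¬ hr → tf x₀) ∧ (¬ hl → hr → hf y₁))
    (b1 : bot → (hr → R b y₀) ∧ (hl → R x₁ b) ∧ (¬ hr → hf b) ∧ (¬ hl → tf b))
    (b2 : ¬ bot → (hr → hl → R x₁ y₀) ∧ (hr → ¬ hl → tf y₀) ∧ (¬ hr → hl → hf x₁)) :
    (l ++ ((if bot then [b] else []) ++ (r ++ (if top then [t] else [])))).IsChain R ∧
    ∀ x ∈ (l ++ ((if bot then [b] else []) ++ (r ++ (if top then [t] else [])))).getLast?,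
    ∀ y ∈ (l ++ ((if bot then [b] else []) ++ (r ++ (if top then [t] else [])))).head?, R x y := by
  by_cases h1 : hl <;> by_cases h2 : hr <;> by_cases h3 : top <;> by_cases h4 : bot <;>
  simp only [h1, h2, h3, h4, true_imp_iff, false_imp_iff, not_true_eq_false, not_false_eq_true,
    and_true, true_and] at l1 l2 r1 r2 t1 t2 b1 b2 <;>
  simp_all [List.isChain_append, List.isChain_cons, List.getLast?_cons]

namespace Geo

variable {G : Geo}

theorem two_rot {t : Tag} : G.rot.Two t.rot ↔ G.Two t := by
  constructor
  · rintro ⟨p, hp, q, hq, hne, fp, fq⟩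
    refine ⟨-p, mem_K_rot.1 ((neg_neg p).symm ▸ hp), -q, mem_K_rot.1 ((neg_neg q).symm ▸ hq),
      fun e => hne (neg_injective e), ?_, ?_⟩
    · rw [← F_rot, neg_neg]; exact fp
    · rw [← F_rot, neg_neg]; exact fq
  · rintro ⟨p, hp, q, hq, hne, fp, fq⟩
    exact ⟨-p, mem_K_rot.2 hp, -q, mem_K_rot.2 hq, fun e => hne (neg_injective e), by rwa [F_rot],
      by rwa [F_rot]⟩

theorem rec_rot' {t t' : Tag} (h : t' = t.rot) : G.rot.Rec (G.rot.dir t') ↔ G.Rec (G.dir t) := by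
  rw [h, dir_rot, rec_rot]

theorem rec_rot_neg {t t' : Tag} (h : t' = t.rot) :
    G.rot.Rec (-G.rot.dir t') ↔ G.Rec (-G.dir t) := by
  rw [h, dir_rot, rec_rot]

/-- What the walk along the lower halves of both chains shows about the face. -/
theorem TopPart.lower {TL TR : List ℕ} {p q : ℕ} {bot : Prop}
    (h : TopPart G.rot TR TL q p bot) :
    ((TL = [] ∧ p = 0 ∧ G.j = 0) ∨ (TL.head? = some p ∧ TL.getLast? = some G.j ∧ 1 ≤ p)) ∧
    ((TR = [] ∧ q = 0 ∧ G.j' = 0) ∨ (TR.head? = some q ∧ TR.getLast? = some G.j' ∧ 1 ≤ q)) ∧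
    (TL.IsChain fun v' v => v' < v ∧ G.Gap (.L v) (.L v')) ∧
    (TR.IsChain fun v' v => v' < v ∧ G.Gap (.R v') (.R v)) ∧
    (∀ v ∈ TL, 1 ≤ v ∧ v ≤ G.j ∧ G.Two (.L v) ∧ ∃ P ∈ G.K, G.F (.L v) P = 0 ∧ P.2 < 0) ∧
    (∀ v ∈ TR, 1 ≤ v ∧ v ≤ G.j' ∧ G.Two (.R v) ∧ ∃ P ∈ G.K, G.F (.R v) P = 0 ∧ P.2 < 0) ∧
    (∀ i, 1 ≤ i → i ≤ G.j → i ∉ TL → ∀ P ∈ G.K, ∀ Q ∈ G.K, G.F (.L i) P = 0 →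
      G.F (.L i) Q = 0 → P.2 < 0 → Q.2 < 0 → P = Q) ∧
    (∀ i, 1 ≤ i → i ≤ G.j' → i ∉ TR → ∀ P ∈ G.K, ∀ Q ∈ G.K, G.F (.R i) P = 0 →
      G.F (.R i) Q = 0 → P.2 < 0 → Q.2 < 0 → P = Q) ∧
    (bot → 0 < G.wd ∧ (1 ≤ G.j' → G.Gap .B (.R q)) ∧ (1 ≤ G.j → G.Gap (.L p) .B) ∧
      (G.j' = 0 → G.Rec (G.dir .B)) ∧ (G.j = 0 → G.Rec (-G.dir .B)) ∧ G.Two .B) ∧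
    (¬ bot → (1 ≤ G.j' → 1 ≤ G.j → G.Gap (.L p) (.R q)) ∧
      (1 ≤ G.j' → G.j = 0 → G.Rec (-G.dir (.R q))) ∧
      (G.j' = 0 → 1 ≤ G.j → G.Rec (G.dir (.L p))) ∧
      (0 < G.wd → ∀ P ∈ G.K, ∀ Q ∈ G.K, G.F .B P = 0 → G.F .B Q = 0 → P = Q)) := by
  have gap : ∀ t t' : Tag, G.rot.Gap t.rot t'.rot → G.Gap t t' := fun t t' => gap_rot.1
  have mem : ∀ (t : Tag), (∃ P ∈ G.rot.K, G.rot.F t.rot P = 0 ∧ 0 < P.2) →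
      ∃ P ∈ G.K, G.F t P = 0 ∧ P.2 < 0 := by
    rintro t ⟨P, h1, h2, h3⟩
    refine ⟨-P, mem_K_rot.1 ((neg_neg P).symm ▸ h1), ?_, by simpa using h3⟩
    rw [← F_rot, neg_neg]; exact h2
  have skip : ∀ t : Tag, (∀ P ∈ G.rot.K, ∀ Q ∈ G.rot.K, G.rot.F t.rot P = 0 → G.rot.F t.rot Q = 0 →
      0 < P.2 → 0 < Q.2 → P = Q) → ∀ P ∈ G.K, ∀ Q ∈ G.K, G.F t P = 0 → G.F t Q = 0 →
      P.2 < 0 → Q.2 < 0 → P = Q := by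
    intro t h P hP Q hQ fP fQ yP yQ
    exact neg_injective (h (-P) (mem_K_rot.2 hP) (-Q) (mem_K_rot.2 hQ) (by rwa [F_rot])
      (by rwa [F_rot]) (by simpa using yP) (by simpa using yQ))
  refine ⟨h.endsR, h.endsL, ?_, ?_, ?_, ?_, ?_, ?_, ?_, ?_⟩
  · exact h.chainR.imp fun a b hab => ⟨hab.1, gap _ _ hab.2⟩
  · exact h.chainL.imp fun a b hab => ⟨hab.1, gap _ _ hab.2⟩
  · exact fun v hv => ⟨(h.memR v hv).1, (h.memR v hv).2.1, two_rot.1 (h.memR v hv).2.2.1,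
      mem (.L v) (h.memR v hv).2.2.2⟩
  · exact fun v hv => ⟨(h.memL v hv).1, (h.memL v hv).2.1, two_rot.1 (h.memL v hv).2.2.1,
      mem (.R v) (h.memL v hv).2.2.2⟩
  · exact fun i h1 h2 h3 => skip (.L i) (h.skipR i h1 h2 h3)
  · exact fun i h1 h2 h3 => skip (.R i) (h.skipL i h1 h2 h3)
  · intro hb
    obtain ⟨h1, h2, h3, h4, h5, h6⟩ := h.flat hb
    exact ⟨h1, fun a => gap .B (.R q) (h2 a), fun a => gap (.L p) .B (h3 a),
      fun a => (rec_rot' (t := .B) rfl).1 (h4 a), fun a => (rec_rot_neg (t := .B) rfl).1 (h5 a),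
      two_rot.1 h6⟩
  · intro hb
    obtain ⟨h1, h2, h3, h4⟩ := h.apex hb
    refine ⟨fun a b => gap (.L p) (.R q) (h1 a b), fun a b => (rec_rot_neg (t := .R q) rfl).1 (h2 a b),
      fun a b => (rec_rot' (t := .L p) rfl).1 (h3 a b), fun a P hP Q hQ fP fQ => ?_⟩
    exact neg_injective (h4 a (-P) (mem_K_rot.2 hP) (-Q) (mem_K_rot.2 hQ)
      (by rw [← fP]; exact G.F_rot .B P) (by rw [← fQ]; exact G.F_rot .B Q))

/-- A line that contributes to the boundary both above and below is the base line. -/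
theorem eq_of_sides (hA : ∀ i k, 1 ≤ i → i < k → k ≤ G.j → G.X i < G.X k) {i : ℕ} (hi : 1 ≤ i)
    (hij : i ≤ G.j) {P Q : Plane} (hP : P ∈ G.K) (hQ : Q ∈ G.K) (fP : G.F (.L i) P = 0)
    (fQ : G.F (.L i) Q = 0) (yP : 0 ≤ P.2) (yQ : Q.2 ≤ 0) : i = G.j := by
  by_contra hne
  have h1 := hA i G.j hi (by omega) le_rfl
  have h2 := hP.1 G.j (by omega) le_rfl
  have h3 := hQ.1 G.j (by omega) le_rfl
  simp only [F] at *
  -- On the base line, line `G.j` is strictly right of line `i`. It stays so above or below the base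
  -- line, depending on which `S` is larger, and thereby cuts off `P` or `Q`.
  rcases le_total (G.S i) (G.S G.j) with h | h
  · nlinarith [mul_nonneg (sub_nonneg.2 h) yP]
  · nlinarith [mul_nonneg (sub_nonneg.2 h) (neg_nonneg.2 yQ)]

theorem eq_of_sides' (hA : ∀ i k, 1 ≤ i → i < k → k ≤ G.j' → G.X' i < G.X' k) {i : ℕ} (hi : 1 ≤ i)
    (hij : i ≤ G.j') {P Q : Plane} (hP : P ∈ G.K) (hQ : Q ∈ G.K) (fP : G.F (.R i) P = 0)
    (fQ : G.F (.R i) Q = 0) (yP : 0 ≤ P.2) (yQ : Q.2 ≤ 0) : i = G.j' := by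
  by_contra hne
  have h1 := hA i G.j' hi (by omega) le_rfl
  have h2 := hP.2.1 G.j' (by omega) le_rfl
  have h3 := hQ.2.1 G.j' (by omega) le_rfl
  simp only [F] at *
  rcases le_total (G.S' i) (G.S' G.j') with h | h
  · nlinarith [mul_nonneg (sub_nonneg.2 h) yP]
  · nlinarith [mul_nonneg (sub_nonneg.2 h) (neg_nonneg.2 yQ)]

open Classical in
/-- The edges of the face in counterclockwise order. -/
noncomputable def faceTags (TL TR TL₂ TR₂ : List ℕ) (top bot : Prop) : List Tag :=
  (TL ++ TL₂.reverse.tail).map .L ++ ((if bot then [.B] else []) ++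
    ((TR₂ ++ TR.reverse.tail).map .R ++ (if top then [.T] else [])))

/-- `t` stands for one of the bounds of the face. -/
def IsBound (G : Geo) : Tag → Prop
  | .L v => 1 ≤ v ∧ v ≤ G.j
  | .R v => 1 ≤ v ∧ v ≤ G.j'
  | .T => 0 < G.wh
  | .B => 0 < G.wd

theorem pairwise_glue {a b : List ℕ} {j : ℕ} (ha : a.getLast? = some j)
    (hb : b.getLast? = some j) (h1 : a.IsChain (· < ·)) (h2 : b.IsChain (· < ·))
    (h3 : ∀ v ∈ a, v ∈ b → v = j) : (a ++ b.reverse.tail).Nodup := by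
  obtain ⟨a, rfl⟩ := List.getLast?_eq_some_iff.1 ha
  obtain ⟨b, rfl⟩ := List.getLast?_eq_some_iff.1 hb
  rw [List.isChain_iff_pairwise] at h1 h2
  have e : (b ++ [j]).reverse.tail = b.reverse := by simp
  rw [e, List.nodup_append]
  have hb := h2.imp fun {x y} h => Nat.ne_of_lt h
  have hb' : (b ++ [j]).Nodup := hb
  rw [List.nodup_append] at hb'
  refine ⟨h1.imp fun {x y} h => Nat.ne_of_lt h, List.nodup_reverse.2 hb'.1, ?_⟩
  rintro x hx y hy rfl
  rw [List.mem_reverse] at hy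
  have := h3 x hx (by simp [hy])
  exact hb'.2.2 x hy j (by simp) this

theorem nodup_append_tags {l l' : List ℕ} {b t : List Tag} (h : l.Nodup) (h' : l'.Nodup)
    (hb : b = [] ∨ b = [.B]) (ht : t = [] ∨ t = [.T]) :
    (l.map Tag.L ++ (b ++ (l'.map Tag.R ++ t))).Nodup := by
  have i1 : (l.map Tag.L).Nodup := h.map fun a b e => by injection e
  have i2 : (l'.map Tag.R).Nodup := h'.map fun a b e => by injection e
  rcases hb with rfl | rfl <;> rcases ht with rfl | rfl <;>
    simp [List.nodup_append, i1, i2] <;> aesop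

variable {TL TR TL₂ TR₂ : List ℕ} {p q p₂ q₂ : ℕ} {top bot : Prop}

theorem mem_faceTags {t : Tag} : t ∈ faceTags TL TR TL₂ TR₂ top bot ↔
    match t with
    | .L v => v ∈ TL ++ TL₂.reverse.tail
    | .R v => v ∈ TR₂ ++ TR.reverse.tail
    | .T => top
    | .B => bot := by
  cases t <;> by_cases h1 : top <;> by_cases h2 : bot <;>
    simp only [faceTags, h1, h2, if_true, if_false, List.mem_append, List.mem_map, Tag.L.injEq,
      Tag.R.injEq, List.mem_singleton, List.not_mem_nil] <;> simp

theorem mem_glue {a b : List ℕ} {j v : ℕ} (ha : a.getLast? = some j) (hb : b.getLast? = some j) :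
    v ∈ a ++ b.reverse.tail ↔ v ∈ a ∨ v ∈ b := by
  obtain ⟨a, rfl⟩ := List.getLast?_eq_some_iff.1 ha
  obtain ⟨b, rfl⟩ := List.getLast?_eq_some_iff.1 hb
  have e : (b ++ [j]).reverse.tail = b.reverse := by simp
  rw [e]; simp only [List.mem_append, List.mem_reverse, List.mem_singleton]; tauto

/-- The list of edges is complete, without repetition, and cyclically ordered. -/
theorem faceTags_spec (up : TopPart G TL TR p q top) (dn : TopPart G.rot TR₂ TL₂ q₂ p₂ bot)
    (hA : ∀ i k, 1 ≤ i → i < k → k ≤ G.j → G.X i < G.X k)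
    (hA' : ∀ i k, 1 ≤ i → i < k → k ≤ G.j' → G.X' i < G.X' k) :
    (faceTags TL TR TL₂ TR₂ top bot).Nodup ∧
    (faceTags TL TR TL₂ TR₂ top bot).IsChain G.Gap ∧
    (∀ x ∈ (faceTags TL TR TL₂ TR₂ top bot).getLast?,
      ∀ y ∈ (faceTags TL TR TL₂ TR₂ top bot).head?, G.Gap x y) ∧
    (∀ t ∈ faceTags TL TR TL₂ TR₂ top bot, G.IsBound t ∧ G.Two t) ∧
    ∀ t, G.IsBound t → G.Two t → t ∈ faceTags TL TR TL₂ TR₂ top bot := by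
  obtain ⟨d1, d2, d3, d4, d5, d6, d7, d8, d9, d10⟩ := dn.lower
  obtain ⟨u1, u2, u3, u4, u5, u6, u7, u8, u9, u10⟩ := up
  have ordL : (TL ++ TL₂.reverse.tail).Nodup := by
    rcases u1 with ⟨a1, -, a3⟩ | ⟨-, a2, -⟩ <;> rcases d1 with ⟨b1, -, b3⟩ | ⟨-, b2, -⟩
    · simp [a1, b1]
    · have := d5 G.j (List.mem_of_getLast? b2); omega
    · have := u5 G.j (List.mem_of_getLast? a2); omega
    · refine pairwise_glue a2 b2 (u3.imp fun _ _ h => h.1) (d3.imp fun _ _ h => h.1) ?_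
      intro v hv hv'
      obtain ⟨c1, c2, -, P, c3, c4, c5⟩ := u5 v hv
      obtain ⟨-, -, -, Q, e3, e4, e5⟩ := d5 v hv'
      exact eq_of_sides hA c1 c2 c3 e3 c4 e4 c5.le e5.le
  have ordR : (TR₂ ++ TR.reverse.tail).Nodup := by
    rcases u2 with ⟨a1, -, a3⟩ | ⟨-, a2, -⟩ <;> rcases d2 with ⟨b1, -, b3⟩ | ⟨-, b2, -⟩
    · simp [a1, b1]
    · have := d6 G.j' (List.mem_of_getLast? b2); omega
    · have := u6 G.j' (List.mem_of_getLast? a2); omega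
    · refine pairwise_glue b2 a2 (d4.imp fun _ _ h => h.1) (u4.imp fun _ _ h => h.1) ?_
      intro v hv' hv
      obtain ⟨c1, c2, -, P, c3, c4, c5⟩ := u6 v hv
      obtain ⟨-, -, -, Q, e3, e4, e5⟩ := d6 v hv'
      exact eq_of_sides' hA' c1 c2 c3 e3 c4 e4 c5.le e5.le
  have memL : ∀ v, v ∈ TL ++ TL₂.reverse.tail ↔ v ∈ TL ∨ v ∈ TL₂ := by
    intro v
    rcases u1 with ⟨a1, -, a3⟩ | ⟨-, a2, -⟩ <;> rcases d1 with ⟨b1, -, b3⟩ | ⟨-, b2, -⟩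
    · simp [a1, b1]
    · have := d5 G.j (List.mem_of_getLast? b2); omega
    · have := u5 G.j (List.mem_of_getLast? a2); omega
    · exact mem_glue a2 b2
  have memR : ∀ v, v ∈ TR₂ ++ TR.reverse.tail ↔ v ∈ TR₂ ∨ v ∈ TR := by
    intro v
    rcases u2 with ⟨a1, -, a3⟩ | ⟨-, a2, -⟩ <;> rcases d2 with ⟨b1, -, b3⟩ | ⟨-, b2, -⟩
    · simp [a1, b1]
    · have := d6 G.j' (List.mem_of_getLast? b2); omega
    · have := u6 G.j' (List.mem_of_getLast? a2); omega
    · exact mem_glue b2 a2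
  have blockL : (TL ++ TL₂.reverse.tail = [] ∧ G.j = 0) ∨ (1 ≤ G.j ∧
      ((TL ++ TL₂.reverse.tail).map Tag.L).head? = some (.L p) ∧
      ((TL ++ TL₂.reverse.tail).map Tag.L).getLast? = some (.L p₂) ∧
      ((TL ++ TL₂.reverse.tail).map Tag.L).IsChain G.Gap) := by
    rcases u1 with ⟨a1, -, a3⟩ | ⟨a1, a2, -⟩ <;> rcases d1 with ⟨b1, -, b3⟩ | ⟨b1, b2, -⟩
    · exact .inl ⟨by simp [a1, b1], a3⟩
    · have := d5 G.j (List.mem_of_getLast? b2); omega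
    · have := u5 G.j (List.mem_of_getLast? a2); omega
    · have h1 := u5 G.j (List.mem_of_getLast? a2)
      obtain ⟨g1, g2, g3⟩ := List.glue (R := fun v' v => G.Gap (.L v') (.L v)) a2 b2
        (u3.imp fun _ _ h => h.2) (d3.imp fun _ _ h => h.2)
      refine .inr ⟨by omega, ?_, ?_, ?_⟩
      · rw [List.head?_map, g3, a1]; rfl
      · rw [List.getLast?_map, g2, b1]; rfl
      · exact (List.isChain_map _).2 g1
  have blockR : (TR₂ ++ TR.reverse.tail = [] ∧ G.j' = 0) ∨ (1 ≤ G.j' ∧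
      ((TR₂ ++ TR.reverse.tail).map Tag.R).head? = some (.R q₂) ∧
      ((TR₂ ++ TR.reverse.tail).map Tag.R).getLast? = some (.R q) ∧
      ((TR₂ ++ TR.reverse.tail).map Tag.R).IsChain G.Gap) := by
    rcases u2 with ⟨a1, -, a3⟩ | ⟨a1, a2, -⟩ <;> rcases d2 with ⟨b1, -, b3⟩ | ⟨b1, b2, -⟩
    · exact .inl ⟨by simp [a1, b1], a3⟩
    · have := d6 G.j' (List.mem_of_getLast? b2); omega
    · have := u6 G.j' (List.mem_of_getLast? a2); omega
    · have h1 := u6 G.j' (List.mem_of_getLast? a2)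
      obtain ⟨g1, g2, g3⟩ := List.glue (R := fun v' v => G.Gap (.R v') (.R v)) b2 a2
        (d4.imp fun _ _ h => h.2) (u4.imp fun _ _ h => h.2)
      refine .inr ⟨by omega, ?_, ?_, ?_⟩
      · rw [List.head?_map, g3, b1]; rfl
      · rw [List.getLast?_map, g2, a1]; rfl
      · exact (List.isChain_map _).2 g1
  have cyc : (faceTags TL TR TL₂ TR₂ top bot).IsChain G.Gap ∧
      ∀ x ∈ (faceTags TL TR TL₂ TR₂ top bot).getLast?,
      ∀ y ∈ (faceTags TL TR TL₂ TR₂ top bot).head?, G.Gap x y := by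
    refine List.cyclic_blocks (hl := 1 ≤ G.j) (hr := 1 ≤ G.j') (hf := fun t => G.Rec (G.dir t))
      (tf := fun t => G.Rec (-G.dir t)) (x₀ := .L p) (x₁ := .L p₂) (y₀ := .R q₂) (y₁ := .R q)
      (fun x y hx hy => .inr ⟨hx, hy⟩) ?_ ?_ ?_ ?_ ?_ ?_ ?_ ?_
    · rintro h; rcases blockL with h' | h'
      · omega
      · exact h'.2
    · rintro h; rcases blockL with h' | h'
      · rw [h'.1]; rfl
      · omega
    · rintro h; rcases blockR with h' | h'
      · omega
      · exact h'.2
    · rintro h; rcases blockR with h' | h'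
      · rw [h'.1]; rfl
      · omega
    · rintro h
      exact ⟨(u9 h).2.1, (u9 h).2.2.1, fun a => (u9 h).2.2.2.1 (by omega),
        fun a => (u9 h).2.2.2.2.1 (by omega)⟩
    · rintro h
      exact ⟨(u10 h).1, fun a b => (u10 h).2.1 a (by omega), fun a b => (u10 h).2.2.1 (by omega) b⟩
    · rintro h
      exact ⟨(d9 h).2.1, (d9 h).2.2.1, fun a => (d9 h).2.2.2.1 (by omega),
        fun a => (d9 h).2.2.2.2.1 (by omega)⟩
    · rintro h
      exact ⟨(d10 h).1, fun a b => (d10 h).2.1 a (by omega), fun a b => (d10 h).2.2.1 (by omega) b⟩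
  refine ⟨?_, cyc.1, cyc.2, ?_, ?_⟩
  · unfold faceTags
    refine nodup_append_tags ordL ordR ?_ ?_
    · by_cases hb : bot <;> simp [hb]
    · by_cases ht : top <;> simp [ht]
  · intro t ht
    rw [mem_faceTags] at ht
    cases t with
    | L v =>
      rcases (memL v).1 ht with h | h
      · exact ⟨⟨(u5 v h).1, (u5 v h).2.1⟩, (u5 v h).2.2.1⟩
      · exact ⟨⟨(d5 v h).1, (d5 v h).2.1⟩, (d5 v h).2.2.1⟩
    | R v =>
      rcases (memR v).1 ht with h | h
      · exact ⟨⟨(d6 v h).1, (d6 v h).2.1⟩, (d6 v h).2.2.1⟩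
      · exact ⟨⟨(u6 v h).1, (u6 v h).2.1⟩, (u6 v h).2.2.1⟩
    | T => exact ⟨(u9 ht).1, (u9 ht).2.2.2.2.2⟩
    | B => exact ⟨(d9 ht).1, (d9 ht).2.2.2.2.2⟩
  · rintro t hbd ⟨P, hP, Q, hQ, hne, fP, fQ⟩
    rw [mem_faceTags]
    cases t with
    | L v =>
      obtain ⟨h1, h2⟩ := hbd
      refine (memL v).2 ?_
      by_contra hv
      rw [not_or] at hv
      -- Two points strictly on the same side of the base line are excluded by the two walks. In all
      -- other cases the line has points of the face at height `≥ 0` and at height `≤ 0`, hence is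
      -- the base line, which is always listed.
      have key : ∀ P ∈ G.K, ∀ Q ∈ G.K, G.F (.L v) P = 0 → G.F (.L v) Q = 0 → 0 ≤ P.2 → Q.2 ≤ 0 →
          False := fun P hP Q hQ fP fQ yP yQ => by
        have := eq_of_sides hA h1 h2 hP hQ fP fQ yP yQ
        rcases u1 with a | ⟨-, a2, -⟩
        · omega
        · exact hv.1 (this ▸ List.mem_of_getLast? a2)
      rcases lt_or_ge 0 P.2 with yP | yP <;> rcases lt_or_ge 0 Q.2 with yQ | yQ
      · exact hne (u7 v h1 h2 hv.1 P hP Q hQ fP fQ yP yQ)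
      · exact key P hP Q hQ fP fQ yP.le yQ
      · exact key Q hQ P hP fQ fP yQ.le yP
      · rcases yP.lt_or_eq with yP | yP
        · rcases yQ.lt_or_eq with yQ | yQ
          · exact hne (d7 v h1 h2 hv.2 P hP Q hQ fP fQ yP yQ)
          · exact key Q hQ Q hQ fQ fQ yQ.ge yQ.le
        · exact key P hP P hP fP fP yP.ge yP.le
    | R v =>
      obtain ⟨h1, h2⟩ := hbd
      refine (memR v).2 ?_
      by_contra hv
      rw [not_or] at hv
      have key : ∀ P ∈ G.K, ∀ Q ∈ G.K, G.F (.R v) P = 0 → G.F (.R v) Q = 0 → 0 ≤ P.2 → Q.2 ≤ 0 →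
          False := fun P hP Q hQ fP fQ yP yQ => by
        have := eq_of_sides' hA' h1 h2 hP hQ fP fQ yP yQ
        rcases u2 with a | ⟨-, a2, -⟩
        · omega
        · exact hv.2 (this ▸ List.mem_of_getLast? a2)
      rcases lt_or_ge 0 P.2 with yP | yP <;> rcases lt_or_ge 0 Q.2 with yQ | yQ
      · exact hne (u8 v h1 h2 hv.2 P hP Q hQ fP fQ yP yQ)
      · exact key P hP Q hQ fP fQ yP.le yQ
      · exact key Q hQ P hP fQ fP yQ.le yP
      · rcases yP.lt_or_eq with yP | yP
        · rcases yQ.lt_or_eq with yQ | yQ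
          · exact hne (d8 v h1 h2 hv.1 P hP Q hQ fP fQ yP yQ)
          · exact key Q hQ Q hQ fQ fQ yQ.ge yQ.le
        · exact key P hP P hP fP fP yP.ge yP.le
    | T =>
      by_contra ht
      exact hne ((u10 ht).2.2.2 hbd P hP Q hQ fP fQ)
    | B =>
      by_contra ht
      exact hne ((d10 ht).2.2.2 hbd P hP Q hQ fP fQ)

end Geo


/-! ## Cells as intersections of half-planes -/

namespace LineEq

/-- The value of the equation of `k` at `p`. -/
def val (k : LineEq) (p : Plane) : ℝ := k.a * p.1 + k.b * p.2 - k.c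

theorem mem_pts {k : LineEq} {p : Plane} : p ∈ k.pts ↔ k.val p = 0 := by
  simp only [pts, val, Set.mem_ofPred_eq, sub_eq_zero]

theorem continuous_val (k : LineEq) : Continuous k.val := by
  unfold val; fun_prop

theorem val_comb (k : LineEq) (p q : Plane) (t : ℝ) :
    k.val (q + t • (p - q)) = (1 - t) * k.val q + t * k.val p := by
  simp [val]; ring

end LineEq

variable {n : ℕ}

/-- The set of points that lie on the prescribed sides of all lines. -/
def cellOf (L : Fin n → LineEq) (o : Fin n → ℝ) : Set Plane := {p | ∀ i, 0 < o i * (L i).val p}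

def closedCellOf (L : Fin n → LineEq) (o : Fin n → ℝ) : Set Plane :=
  {p | ∀ i, 0 ≤ o i * (L i).val p}

theorem isOpen_cellOf (L : Fin n → LineEq) (o : Fin n → ℝ) : IsOpen (cellOf L o) := by
  have : cellOf L o = ⋂ i, {p | 0 < o i * (L i).val p} := by ext; simp [cellOf]
  rw [this]
  exact isOpen_iInter_of_finite fun i =>
    isOpen_lt continuous_const (continuous_const.mul (L i).continuous_val)

theorem isClosed_closedCellOf (L : Fin n → LineEq) (o : Fin n → ℝ) :
    IsClosed (closedCellOf L o) := by
  have : closedCellOf L o = ⋂ i, {p | 0 ≤ o i * (L i).val p} := by ext; simp [closedCellOf]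
  rw [this]
  exact isClosed_iInter fun i =>
    isClosed_le continuous_const (continuous_const.mul (L i).continuous_val)

theorem comb_mem_cellOf {L : Fin n → LineEq} {o : Fin n → ℝ} {p q : Plane} (hp : p ∈ cellOf L o)
    (hq : q ∈ closedCellOf L o) {t : ℝ} (h0 : 0 < t) (h1 : t ≤ 1) :
    q + t • (p - q) ∈ cellOf L o := by
  intro i
  have hp := hp i
  have hq := hq i
  rw [LineEq.val_comb]
  nlinarith [mul_pos h0 hp, mul_nonneg (sub_nonneg.2 h1) hq]

theorem convex_cellOf (L : Fin n → LineEq) (o : Fin n → ℝ) : Convex ℝ (cellOf L o) := by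
  intro p hp q hq a b ha hb hab i
  have hp := hp i
  have hq := hq i
  have e : o i * (L i).val (a • p + b • q) = a * (o i * (L i).val p) + b * (o i * (L i).val q) := by
    obtain rfl : a = 1 - b := by linarith
    simp [LineEq.val]; ring
  rw [e]
  rcases ha.eq_or_lt with rfl | ha
  · obtain rfl : b = 1 := by linarith
    linarith
  · have := mul_pos ha hp
    have := mul_nonneg hb hq.le
    linarith

/-- The segment from a point of the closed cell to a point of the open cell lies in the open cell
except perhaps for its first end, which it approaches. -/
theorem closure_cellOf {L : Fin n → LineEq} {o : Fin n → ℝ} (h : (cellOf L o).Nonempty) :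
    closure (cellOf L o) = closedCellOf L o := by
  refine subset_antisymm (closure_minimal (fun p hp i => (hp i).le) (isClosed_closedCellOf L o)) ?_
  intro q hq
  obtain ⟨p, hp⟩ := h
  have hc : ContinuousAt (fun t : ℝ => q + t • (p - q)) 0 := by fun_prop
  have h1 : Tendsto (fun t : ℝ => q + t • (p - q)) (nhdsWithin 0 (Set.Ioi 0)) (nhds q) := by
    have := hc.tendsto.mono_left (nhdsWithin_le_nhds (s := Set.Ioi 0))
    simpa using this
  refine mem_closure_of_tendsto h1 ?_
  filter_upwards [Ioc_mem_nhdsGT (zero_lt_one' ℝ)] with t ht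
  exact comb_mem_cellOf hp hq ht.1 ht.2

theorem cellOf_subset_compl (L : Fin n → LineEq) (o : Fin n → ℝ) :
    cellOf L o ⊆ (⋃ i, (L i).pts)ᶜ := by
  intro p hp
  simp only [Set.mem_compl_iff, Set.mem_iUnion, not_exists]
  intro i hi
  have := hp i
  rw [LineEq.mem_pts.1 hi, mul_zero] at this
  exact lt_irrefl _ this

theorem mul_pos_of_mul_pos {a b c : ℝ} (h : 0 < a * b) (h' : 0 < a * c) : 0 < b * c := by
  have h1 : 0 < a * b * (a * c) := mul_pos h h'
  have h2 : a * b * (a * c) = a ^ 2 * (b * c) := by ring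
  rw [h2] at h1
  exact pos_of_mul_pos_right h1 (sq_nonneg a)

theorem mem_cellOf_iff {L : Fin n → LineEq} {o : Fin n → ℝ} {p q : Plane} (hp : p ∈ cellOf L o) :
    q ∈ cellOf L o ↔ ∀ i, 0 < (L i).val p * (L i).val q := by
  refine forall_congr' fun i => ⟨fun h => mul_pos_of_mul_pos (hp i) h, fun h => ?_⟩
  have h1 := hp i
  rw [mul_comm] at h1
  exact mul_pos_of_mul_pos h1 h

theorem cellOf_eq {L : Fin n → LineEq} {o o' : Fin n → ℝ} {p : Plane} (h : p ∈ cellOf L o)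
    (h' : p ∈ cellOf L o') : cellOf L o = cellOf L o' := by
  ext q; rw [mem_cellOf_iff h, mem_cellOf_iff h']

/-- A cell is convex, hence connected. Conversely the equation of a line cannot change sign on a
connected set that avoids the line, by the intermediate value theorem. -/
theorem component_eq_cellOf {L : Fin n → LineEq} {o : Fin n → ℝ} {p : Plane}
    (hp : p ∈ cellOf L o) : connectedComponentIn (⋃ i, (L i).pts)ᶜ p = cellOf L o := by
  refine subset_antisymm ?_ ((convex_cellOf L o).isPreconnected.subset_connectedComponentIn hp
    (cellOf_subset_compl L o))
  intro q hq
  rw [mem_cellOf_iff hp]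
  intro i
  have hpre : IsPreconnected (connectedComponentIn (⋃ i, (L i).pts)ᶜ p) :=
    isPreconnected_connectedComponentIn
  have hpU := mem_connectedComponentIn (cellOf_subset_compl L o hp)
  have h0 : ∀ r ∈ connectedComponentIn (⋃ i, (L i).pts)ᶜ p, (L i).val r ≠ 0 := fun r hr h => by
    have := connectedComponentIn_subset _ _ hr
    simp only [Set.mem_compl_iff, Set.mem_iUnion, not_exists] at this
    exact this i (LineEq.mem_pts.2 h)
  have hcont := (L i).continuous_val.continuousOn (s := connectedComponentIn (⋃ i, (L i).pts)ᶜ p)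
  by_contra hneg
  have h1 := h0 p hpU
  have h2 := h0 q hq
  rcases lt_or_gt_of_ne h1 with h1 | h1 <;> rcases lt_or_gt_of_ne h2 with h2 | h2
  · exact hneg (mul_pos_of_neg_of_neg h1 h2)
  · obtain ⟨r, hr, hr0⟩ := hpre.intermediate_value hpU hq hcont ⟨h1.le, h2.le⟩
    exact h0 r hr hr0
  · obtain ⟨r, hr, hr0⟩ := hpre.intermediate_value hq hpU hcont ⟨h2.le, h1.le⟩
    exact h0 r hr hr0
  · exact hneg (mul_pos h1 h2)

theorem isFace_cellOf {L : Fin n → LineEq} {o : Fin n → ℝ} (h : (cellOf L o).Nonempty) :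
    IsFace L (cellOf L o) := by
  obtain ⟨p, hp⟩ := h
  exact ⟨p, cellOf_subset_compl L o hp, (component_eq_cellOf hp).symm⟩

theorem IsFace.exists_cellOf {L : Fin n → LineEq} {C : Set Plane} (h : IsFace L C) :
    ∃ o, C = cellOf L o ∧ C.Nonempty := by
  obtain ⟨p, hp, rfl⟩ := h
  have : p ∈ cellOf L fun i => (L i).val p := fun i => by
    simp only [Set.mem_compl_iff, Set.mem_iUnion, not_exists] at hp
    exact mul_self_pos.2 fun h => hp i (LineEq.mem_pts.2 h)
  exact ⟨_, component_eq_cellOf this, p, by rw [component_eq_cellOf this]; exact this⟩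

/-! ## Coordinates along a line -/

namespace LineEq

/-- Coordinates in which `l` is the horizontal axis. -/
def loc (l : LineEq) (p : Plane) : Plane := (l.b * p.1 - l.a * p.2, l.a * p.1 + l.b * p.2 - l.c)

def nsq (l : LineEq) : ℝ := l.a * l.a + l.b * l.b

theorem nsq_pos (l : LineEq) : 0 < l.nsq := by
  rcases l.nondeg with h | h
  · exact add_pos_of_pos_of_nonneg (mul_self_pos.2 h) (mul_self_nonneg _)
  · exact add_pos_of_nonneg_of_pos (mul_self_nonneg _) (mul_self_pos.2 h)

noncomputable def unloc (l : LineEq) (p : Plane) : Plane :=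
  ((l.b * p.1 + l.a * (p.2 + l.c)) / l.nsq, (l.b * (p.2 + l.c) - l.a * p.1) / l.nsq)

theorem loc_unloc (l : LineEq) (p : Plane) : l.loc (l.unloc p) = p := by
  have := l.nsq_pos.ne'
  refine Prod.ext ?_ ?_ <;> simp only [loc, unloc]
  · field_simp; rw [nsq]; ring
  · field_simp; rw [nsq]; ring

theorem unloc_loc (l : LineEq) (p : Plane) : l.unloc (l.loc p) = p := by
  have := l.nsq_pos.ne'
  refine Prod.ext ?_ ?_ <;> simp only [loc, unloc]
  · field_simp; rw [nsq]; ring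
  · field_simp; rw [nsq]; ring

/-- Up to the factor `nsq`, the line `k` is `al * x + be * y = ga` in the local coordinates of `l`.
So `al = 0` singles out the parallels of `l`, whose height is `ga / be`. -/
def al (l k : LineEq) : ℝ := k.a * l.b - k.b * l.a
def be (l k : LineEq) : ℝ := k.a * l.a + k.b * l.b
def ga (l k : LineEq) : ℝ := l.nsq * k.c - l.c * l.be k

/-- `k` is the line `x = X + S y` in the coordinates along `l`. -/
noncomputable def Xof (l k : LineEq) : ℝ := l.ga k / l.al k
noncomputable def Sof (l k : LineEq) : ℝ := -l.be k / l.al k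

theorem val_loc (l k : LineEq) (p : Plane) :
    l.nsq * k.val p = l.al k * (l.loc p).1 + l.be k * (l.loc p).2 - l.ga k := by
  simp only [nsq, val, al, be, ga, loc]; ring

theorem val_cross (l k : LineEq) (p : Plane) (h : l.al k ≠ 0) :
    l.nsq * k.val p = l.al k * ((l.loc p).1 - l.Xof k - l.Sof k * (l.loc p).2) := by
  rw [val_loc, Xof, Sof]; field_simp; ring

theorem be_ne {l k : LineEq} (h : l.al k = 0) : l.be k ≠ 0 := by
  intro h'
  simp only [al, be] at h h'
  have h1 : k.a * l.nsq = 0 := by simp only [nsq]; linear_combination l.b * h + l.a * h'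
  have h2 : k.b * l.nsq = 0 := by simp only [nsq]; linear_combination l.b * h' - l.a * h
  rcases k.nondeg with h3 | h3
  · exact h3 ((mul_eq_zero.1 h1).resolve_right l.nsq_pos.ne')
  · exact h3 ((mul_eq_zero.1 h2).resolve_right l.nsq_pos.ne')

theorem mem_pts_loc {l k : LineEq} {p : Plane} :
    p ∈ k.pts ↔ l.al k * (l.loc p).1 + l.be k * (l.loc p).2 = l.ga k := by
  rw [mem_pts, ← sub_eq_zero (b := l.ga k), ← val_loc, mul_eq_zero, or_iff_right l.nsq_pos.ne']

theorem mem_pts_self {l : LineEq} {p : Plane} : p ∈ l.pts ↔ (l.loc p).2 = 0 := by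
  rw [mem_pts]; rfl

theorem mem_pts_cross {l k : LineEq} {p : Plane} (h : l.al k ≠ 0) :
    p ∈ k.pts ↔ (l.loc p).1 = l.Xof k + l.Sof k * (l.loc p).2 := by
  rw [mem_pts, ← sub_eq_zero (b := _ + _), ← sub_sub]
  have := l.val_cross k p h
  constructor
  · intro h1
    rw [h1, mul_zero, eq_comm, mul_eq_zero] at this
    exact this.resolve_left h
  · intro h1
    rw [h1, mul_zero, mul_eq_zero] at this
    exact this.resolve_left l.nsq_pos.ne'

theorem ga_ne {l k : LineEq} (h : l.al k = 0) (hne : k.pts ≠ l.pts) : l.ga k ≠ 0 := by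
  intro h'
  refine hne (Set.ext fun p => ?_)
  rw [mem_pts_loc (l := l), mem_pts_self, h, h', zero_mul, zero_add, mul_eq_zero,
    or_iff_right (be_ne h)]

theorem crosses_iff {l k : LineEq} (hne : k.pts ≠ l.pts) :
    (l.pts ∩ k.pts).Nonempty ↔ l.al k ≠ 0 := by
  constructor
  · rintro ⟨p, h1, h2⟩ h
    rw [mem_pts_self] at h1
    rw [mem_pts_loc (l := l), h, h1] at h2
    exact ga_ne h hne (by linarith)
  · intro h
    refine ⟨l.unloc (l.Xof k, 0), mem_pts_self.2 (by rw [loc_unloc]), (mem_pts_cross h).2 ?_⟩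
    rw [loc_unloc]; simp

theorem pts_eq_of_cross {l k k' : LineEq} (h : l.al k ≠ 0) (h' : l.al k' ≠ 0)
    (hX : l.Xof k = l.Xof k') (hS : l.Sof k = l.Sof k') : k.pts = k'.pts := by
  ext p; rw [mem_pts_cross h, mem_pts_cross h', hX, hS]

end LineEq

/-- The lexicographic order of the lines that cross `l`. -/
def LexLt (l k k' : LineEq) : Prop :=
  l.Xof k < l.Xof k' ∨ (l.Xof k = l.Xof k' ∧ l.Sof k < l.Sof k')

/-- Two lines through the same base point have the horizontal distance `(S' - S) * y` at height `y`,
so a single positive height already shows which `S` is smaller. -/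
theorem Before.lexLt {l k k' : LineEq} (hk : l.al k ≠ 0) (hk' : l.al k' ≠ 0) (h : Before l k k') :
    LexLt l k k' := by
  obtain ⟨p, ⟨p1, p2⟩, p', ⟨p1', p2'⟩, h⟩ := h
  rw [LineEq.mem_pts_self] at p1 p1'
  rw [LineEq.mem_pts_cross hk, p1, mul_zero, add_zero] at p2
  rw [LineEq.mem_pts_cross hk', p1', mul_zero, add_zero] at p2'
  have e : ∀ p : Plane, dot (l.b, -l.a) p = (l.loc p).1 := fun p => by simp [dot, LineEq.loc]; ring
  have e' : ∀ p : Plane, dot (l.a, l.b) p = (l.loc p).2 + l.c := fun p => by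
    simp [dot, LineEq.loc]
  simp only [e, e'] at h
  rcases h with h | ⟨rfl, q, hq, q', hq', h1, h2, h3⟩
  · exact .inl (by rwa [← p2, ← p2'])
  · refine .inr ⟨by rw [← p2, ← p2'], ?_⟩
    rw [LineEq.mem_pts_cross hk] at hq
    rw [LineEq.mem_pts_cross hk'] at hq'
    have h4 : (l.loc q).2 = (l.loc q').2 := by linarith
    rw [hq, hq', ← p2, ← p2', ← h4] at h3
    have h5 : 0 < (l.loc q).2 := by linarith
    by_contra h6
    nlinarith [not_lt.1 h6]

/-- `s` lists the lines that cross `l` in lexicographic order. -/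
structure LexSorted (L : Fin n → LineEq) (l : LineEq) (s : List (Fin n)) : Prop where
  mem : ∀ i, i ∈ s ↔ l.al (L i) ≠ 0
  sorted : s.Pairwise fun i j => LexLt l (L i) (L j)

theorem IsSortedAlong.lexSorted {L : Fin n → LineEq} {l : LineEq} {s : List (Fin n)}
    (hl : ∀ i, (L i).pts ≠ l.pts) (h : IsSortedAlong L l s) : LexSorted L l s := by
  have hm : ∀ i, i ∈ s ↔ l.al (L i) ≠ 0 := fun i => by
    rw [h.1 i, LineEq.crosses_iff (hl i)]
  refine ⟨hm, h.2.imp_of_mem fun {a b} ha hb hab => hab.lexLt ((hm a).1 ha) ((hm b).1 hb)⟩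


variable {n : ℕ}

/-! ## The zone -/

theorem LexSorted.nodup {L : Fin n → LineEq} {l : LineEq} {s : List (Fin n)}
    (h : LexSorted L l s) : s.Nodup := by
  refine h.sorted.imp fun {a b} hab => ?_
  rintro rfl
  rcases hab with hab | hab
  · exact lt_irrefl _ hab
  · exact lt_irrefl _ hab.2

theorem LexSorted.lt {L : Fin n → LineEq} {l : LineEq} {s : List (Fin n)} (h : LexSorted L l s)
    {i k : ℕ} (hik : i < k) (hk : k < s.length) : LexLt l (L (s[i]'(hik.trans hk))) (L s[k]) :=
  List.pairwise_iff_getElem.1 h.sorted i k _ _ hik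

open Classical in
/-- Sides of the lines of `L`: the first `j` lines of `s` are on the left, the others on the right,
and the lines that do not cross `l` are on the same side as from `l`. -/
noncomputable def sides (L : Fin n → LineEq) (l : LineEq) (s : List (Fin n)) (j : ℕ) (i : Fin n) :
    ℝ :=
  if l.al (L i) = 0 then -l.ga (L i) else if s.idxOf i < j then l.al (L i) else -l.al (L i)

/-- For `j = 0, …, s.length` these are the faces that a parallel slightly above `l` passes through,
from left to right. -/
def zcell (L : Fin n → LineEq) (l : LineEq) (s : List (Fin n)) (j : ℕ) : Set Plane :=
  cellOf L (sides L l s j)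

theorem pos_iff_of_mul_eq {N a b : ℝ} (hN : 0 < N) (h : N * a = b) : 0 < a ↔ 0 < b := by
  rw [← h, mul_pos_iff_of_pos_left hN]

theorem nonneg_iff_of_mul_eq {N a b : ℝ} (hN : 0 < N) (h : N * a = b) : 0 ≤ a ↔ 0 ≤ b := by
  rw [← h, mul_nonneg_iff_of_pos_left hN]

section

variable {L : Fin n → LineEq} {l : LineEq} {s : List (Fin n)} {j : ℕ}

/-- `sides` in local coordinates. -/
theorem sides_mul (h : LexSorted L l s) (p : Plane) :
    (∀ i, l.al (L i) = 0 → l.nsq * (sides L l s j i * (L i).val p) =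
      -l.ga (L i) * (l.be (L i) * (l.loc p).2 - l.ga (L i))) ∧
    (∀ k (hk : k < s.length), k < j → l.nsq * (sides L l s j s[k] * (L s[k]).val p) =
      l.al (L s[k]) ^ 2 *
        ((l.loc p).1 - l.Xof (L s[k]) - l.Sof (L s[k]) * (l.loc p).2)) ∧
    (∀ k (hk : k < s.length), j ≤ k → l.nsq * (sides L l s j s[k] * (L s[k]).val p) =
      l.al (L s[k]) ^ 2 *
        (l.Xof (L s[k]) + l.Sof (L s[k]) * (l.loc p).2 - (l.loc p).1)) := by
  refine ⟨fun i hi => ?_, fun k hk hkj => ?_, fun k hk hkj => ?_⟩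
  · rw [sides, if_pos hi]
    have := l.val_loc (L i) p
    rw [hi] at this
    linear_combination (-l.ga (L i)) * this
  · have hne := (h.mem s[k]).1 (List.getElem_mem hk)
    rw [sides, if_neg hne, List.Nodup.idxOf_getElem h.nodup, if_pos hkj]
    linear_combination (l.al (L s[k])) * l.val_cross (L s[k]) p hne
  · have hne := (h.mem s[k]).1 (List.getElem_mem hk)
    rw [sides, if_neg hne, List.Nodup.idxOf_getElem h.nodup, if_neg (by omega)]
    linear_combination (-l.al (L s[k])) * l.val_cross (L s[k]) p hne

theorem LexSorted.forall_iff (h : LexSorted L l s) {P : Fin n → Prop} :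
    (∀ i, P i) ↔ (∀ i, l.al (L i) = 0 → P i) ∧ ∀ k (hk : k < s.length), P s[k] := by
  refine ⟨fun h' => ⟨fun i _ => h' i, fun k hk => h' _⟩, fun h' i => ?_⟩
  by_cases hi : l.al (L i) = 0
  · exact h'.1 i hi
  · obtain ⟨k, hk, rfl⟩ := List.getElem_of_mem ((h.mem i).2 hi)
    exact h'.2 k hk

theorem mem_zcell (h : LexSorted L l s) {p : Plane} : p ∈ zcell L l s j ↔
    (∀ i, l.al (L i) = 0 → 0 < -l.ga (L i) * (l.be (L i) * (l.loc p).2 - l.ga (L i))) ∧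
    (∀ k (hk : k < s.length), k < j →
      l.Xof (L s[k]) + l.Sof (L s[k]) * (l.loc p).2 < (l.loc p).1) ∧
    (∀ k (hk : k < s.length), j ≤ k →
      (l.loc p).1 < l.Xof (L s[k]) + l.Sof (L s[k]) * (l.loc p).2) := by
  obtain ⟨h1, h2, h3⟩ := sides_mul (j := j) h p
  have hsq : ∀ k (hk : k < s.length), 0 < l.al (L s[k]) ^ 2 := fun k hk =>
    sq_pos_of_ne_zero ((h.mem s[k]).1 (List.getElem_mem hk))
  unfold zcell cellOf
  rw [Set.mem_ofPred_eq, h.forall_iff]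
  refine and_congr ?_ ⟨fun h' => ⟨fun k hk hkj => ?_, fun k hk hkj => ?_⟩, fun h' k hk => ?_⟩
  · exact forall_congr' fun i => forall_congr' fun hi => pos_iff_of_mul_eq l.nsq_pos (h1 i hi)
  · have := (pos_iff_of_mul_eq l.nsq_pos (h2 k hk hkj)).1 (h' k hk)
    rw [mul_pos_iff_of_pos_left (hsq k hk)] at this
    linarith
  · have := (pos_iff_of_mul_eq l.nsq_pos (h3 k hk hkj)).1 (h' k hk)
    rw [mul_pos_iff_of_pos_left (hsq k hk)] at this
    linarith
  · rcases Nat.lt_or_ge k j with hkj | hkj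
    · refine (pos_iff_of_mul_eq l.nsq_pos (h2 k hk hkj)).2 (mul_pos (hsq k hk) ?_)
      linarith [h'.1 k hk hkj]
    · refine (pos_iff_of_mul_eq l.nsq_pos (h3 k hk hkj)).2 (mul_pos (hsq k hk) ?_)
      linarith [h'.2 k hk hkj]

theorem mem_closed_zcell (h : LexSorted L l s) {p : Plane} :
    p ∈ closedCellOf L (sides L l s j) ↔
    (∀ i, l.al (L i) = 0 → 0 ≤ -l.ga (L i) * (l.be (L i) * (l.loc p).2 - l.ga (L i))) ∧
    (∀ k (hk : k < s.length), k < j →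
      l.Xof (L s[k]) + l.Sof (L s[k]) * (l.loc p).2 ≤ (l.loc p).1) ∧
    (∀ k (hk : k < s.length), j ≤ k →
      (l.loc p).1 ≤ l.Xof (L s[k]) + l.Sof (L s[k]) * (l.loc p).2) := by
  obtain ⟨h1, h2, h3⟩ := sides_mul (j := j) h p
  have hsq : ∀ k (hk : k < s.length), 0 < l.al (L s[k]) ^ 2 := fun k hk =>
    sq_pos_of_ne_zero ((h.mem s[k]).1 (List.getElem_mem hk))
  unfold closedCellOf
  rw [Set.mem_ofPred_eq, h.forall_iff]
  refine and_congr ?_ ⟨fun h' => ⟨fun k hk hkj => ?_, fun k hk hkj => ?_⟩, fun h' k hk => ?_⟩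
  · exact forall_congr' fun i => forall_congr' fun hi => nonneg_iff_of_mul_eq l.nsq_pos (h1 i hi)
  · have := (nonneg_iff_of_mul_eq l.nsq_pos (h2 k hk hkj)).1 (h' k hk)
    rw [mul_nonneg_iff_of_pos_left (hsq k hk)] at this
    linarith
  · have := (nonneg_iff_of_mul_eq l.nsq_pos (h3 k hk hkj)).1 (h' k hk)
    rw [mul_nonneg_iff_of_pos_left (hsq k hk)] at this
    linarith
  · rcases Nat.lt_or_ge k j with hkj | hkj
    · refine (nonneg_iff_of_mul_eq l.nsq_pos (h2 k hk hkj)).2 (mul_nonneg (hsq k hk).le ?_)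
      linarith [h'.1 k hk hkj]
    · refine (nonneg_iff_of_mul_eq l.nsq_pos (h3 k hk hkj)).2 (mul_nonneg (hsq k hk).le ?_)
      linarith [h'.2 k hk hkj]

/-- On the parallel at height `ε`, the lines of `s` are strictly sorted, and this parallel is on
the same side of every non-crossing line as `l`. -/
structure GoodHeight (L : Fin n → LineEq) (l : LineEq) (s : List (Fin n)) (ε : ℝ) : Prop where
  pos : 0 < ε
  lt : ∀ i k (hk : k < s.length) (hik : i < k),
    l.Xof (L (s[i]'(hik.trans hk))) + l.Sof (L (s[i]'(hik.trans hk))) * ε <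
      l.Xof (L s[k]) + l.Sof (L s[k]) * ε
  par : ∀ i, l.al (L i) = 0 → 0 < -l.ga (L i) * (l.be (L i) * ε - l.ga (L i))

/-- Each condition is an affine inequality in the height that holds weakly at height `0` and
strictly at `ε`, hence strictly at all heights in between. -/
theorem GoodHeight.mono {ε δ : ℝ} (h : LexSorted L l s) (hl : ∀ i, (L i).pts ≠ l.pts)
    (hε : GoodHeight L l s ε) (h0 : 0 < δ) (h1 : δ ≤ ε) : GoodHeight L l s δ := by
  refine ⟨h0, fun i k hk hik => ?_, fun i hi => ?_⟩
  · have h2 := hε.lt i k hk hik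
    rcases h.lt hik hk with h3 | ⟨h3, h4⟩
    · rcases le_total (l.Sof (L (s[i]'(hik.trans hk)))) (l.Sof (L s[k])) with h5 | h5 <;> nlinarith
    · nlinarith
  · have h2 := hε.par i hi
    have h3 : 0 < l.ga (L i) ^ 2 := sq_pos_of_ne_zero (LineEq.ga_ne hi (hl i))
    rcases le_total (l.ga (L i) * l.be (L i)) 0 with h5 | h5 <;> nlinarith

/-- A strictly increasing sequence cuts the real line into intervals. -/
theorem exists_between_seq (f : ℕ → ℝ) (m : ℕ) (hf : ∀ i k, i < k → k < m → f i < f k) {j : ℕ}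
    (hj : j ≤ m) : ∃ x, (∀ k < m, k < j → f k < x) ∧ ∀ k < m, j ≤ k → x < f k := by
  have mono : ∀ i k, i ≤ k → k < m → f i ≤ f k := fun i k hik hk => by
    rcases hik.eq_or_lt with rfl | h
    · exact le_rfl
    · exact (hf i k h hk).le
  rcases Nat.eq_zero_or_pos j with rfl | h0
  · exact ⟨f 0 - 1, fun k _ hk => by omega, fun k hk _ => by linarith [mono 0 k (by omega) hk]⟩
  · rcases hj.eq_or_lt with rfl | h1
    · exact ⟨f (j - 1) + 1, fun k hk _ => by linarith [mono k (j - 1) (by omega) (by omega)],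
        fun k _ _ => by omega⟩
    · have := hf (j - 1) j (by omega) h1
      exact ⟨(f (j - 1) + f j) / 2, fun k hk hkj => by linarith [mono k (j - 1) (by omega) (by omega)],
        fun k hk hkj => by linarith [mono j k hkj hk]⟩

theorem exists_cut (f : ℕ → ℝ) (x : ℝ) (m : ℕ) (hf : ∀ i k, i < k → k < m → f i < f k)
    (hx : ∀ k < m, f k ≠ x) : ∃ j ≤ m, (∀ k < m, k < j → f k < x) ∧ ∀ k < m, j ≤ k → x < f k := by
  classical
  by_cases h : ∃ k, k < m ∧ x < f k
  · refine ⟨Nat.find h, (Nat.find_spec h).1.le, fun k hk hkj => ?_, fun k hk hkj => ?_⟩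
    · have := Nat.find_min h hkj
      exact lt_of_le_of_ne (not_lt.1 fun h' => this ⟨hk, h'⟩) (hx k hk)
    · rcases hkj.eq_or_lt with h1 | h1
      · rw [← h1]; exact (Nat.find_spec h).2
      · exact (Nat.find_spec h).2.trans (hf _ _ h1 hk)
  · push Not at h
    exact ⟨m, le_rfl, fun k hk _ => lt_of_le_of_ne (h k hk) (hx k hk), fun k hk hkj => by omega⟩

/-- The lines of `s` at height `ε`, as a sequence. -/
noncomputable def atHeight (L : Fin n → LineEq) (l : LineEq) (s : List (Fin n)) (ε : ℝ) (k : ℕ) : ℝ :=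
  if h : k < s.length then l.Xof (L s[k]) + l.Sof (L s[k]) * ε else 0

theorem exists_mem_zcell {ε : ℝ} (h : LexSorted L l s) (hε : GoodHeight L l s ε)
    (hj : j ≤ s.length) : ∃ p ∈ zcell L l s j, (l.loc p).2 = ε := by
  obtain ⟨x, h1, h2⟩ := exists_between_seq (atHeight L l s ε) s.length (fun i k hik hk => by
    simp only [atHeight, hk, hik.trans hk, dif_pos]; exact hε.lt i k hk hik) hj
  refine ⟨l.unloc (x, ε), ?_, by rw [LineEq.loc_unloc]⟩
  rw [mem_zcell h, LineEq.loc_unloc]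
  refine ⟨hε.par, fun k hk hkj => ?_, fun k hk hkj => ?_⟩
  · have := h1 k hk hkj; simpa only [atHeight, hk, dif_pos] using this
  · have := h2 k hk hkj; simpa only [atHeight, hk, dif_pos] using this

/-- Base points are weakly increasing, so the closed cell contains the base point of a line next to
it; if there is no crossing line, any point of `l` will do. -/
theorem zcell_mem_zone {ε : ℝ} (h : LexSorted L l s)
    (hε : GoodHeight L l s ε) (hj : j ≤ s.length) : zcell L l s j ∈ zone L l := by
  obtain ⟨p, hp, -⟩ := exists_mem_zcell h hε hj
  have hne : (cellOf L (sides L l s j)).Nonempty := ⟨p, hp⟩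
  refine ⟨isFace_cellOf hne, ?_⟩
  rw [zcell, closure_cellOf hne]
  have mono : ∀ i k (hk : k < s.length) (hik : i ≤ k),
      l.Xof (L (s[i]'(hik.trans_lt hk))) ≤ l.Xof (L s[k]) := fun i k hk hik => by
    rcases hik.eq_or_lt with rfl | h'
    · exact le_rfl
    · rcases h.lt h' hk with h3 | h3
      · exact h3.le
      · exact h3.1.le
  obtain ⟨x, hx1, hx2⟩ : ∃ x : ℝ, (∀ k (hk : k < s.length), k < j → l.Xof (L s[k]) ≤ x) ∧
      ∀ k (hk : k < s.length), j ≤ k → x ≤ l.Xof (L s[k]) := by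
    rcases Nat.eq_zero_or_pos j with rfl | h0
    · by_cases h1 : 0 < s.length
      · exact ⟨l.Xof (L s[0]), fun k hk hkj => by omega, fun k hk _ => mono 0 k hk (by omega)⟩
      · exact ⟨0, fun k hk hkj => by omega, fun k hk hkj => by omega⟩
    · have h1 : j - 1 < s.length := by omega
      exact ⟨l.Xof (L s[j - 1]), fun k hk hkj => mono k (j - 1) h1 (by omega),
        fun k hk hkj => mono (j - 1) k hk (by omega)⟩
  refine ⟨l.unloc (x, 0), (mem_closed_zcell h).2 ?_, LineEq.mem_pts_self.2 (by rw [LineEq.loc_unloc])⟩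
  rw [LineEq.loc_unloc]
  refine ⟨fun i hi => ?_, fun k hk hkj => ?_, fun k hk hkj => ?_⟩
  · nlinarith [sq_nonneg (l.ga (L i))]
  · simpa using hx1 k hk hkj
  · simpa using hx2 k hk hkj

/-- The segment from a point `q` on `l` to an interior point above `l` has interior points at
arbitrarily small positive height. Below `ε` the crossing lines are strictly sorted, and the
position of such a point among them is the number of the cell. -/
theorem eq_zcell_of_above {ε : ℝ} {o : Fin n → ℝ} {p q : Plane} (hl : ∀ i, (L i).pts ≠ l.pts)
    (h : LexSorted L l s) (hε : GoodHeight L l s ε) (hp : p ∈ cellOf L o) (hy : 0 < (l.loc p).2)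
    (hq : q ∈ closedCellOf L o) (hq0 : q ∈ l.pts) :
    ∃ j ≤ s.length, cellOf L o = zcell L l s j := by
  rw [LineEq.mem_pts_self] at hq0
  obtain ⟨t, ht0, ht1, htε⟩ : ∃ t : ℝ, 0 < t ∧ t ≤ 1 ∧ t * (l.loc p).2 ≤ ε := by
    refine ⟨min 1 (ε / (l.loc p).2), lt_min zero_lt_one (div_pos hε.pos hy), min_le_left _ _, ?_⟩
    rw [← le_div_iff₀ hy]; exact min_le_right _ _
  have hr := comb_mem_cellOf hp hq ht0 ht1
  set r := q + t • (p - q) with hrdef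
  have hry : (l.loc r).2 = t * (l.loc p).2 := by
    simp only [LineEq.loc] at hq0 ⊢
    simp only [hrdef, Prod.fst_add, Prod.smul_fst, Prod.fst_sub, Prod.snd_add, Prod.smul_snd,
      Prod.snd_sub, smul_eq_mul]
    linear_combination (1 - t) * hq0
  have hgood := hε.mono h hl (mul_pos ht0 hy) htε
  rw [← hry] at hgood
  obtain ⟨j, hj, h1, h2⟩ := exists_cut (atHeight L l s (l.loc r).2) (l.loc r).1 s.length
    (fun i k hik hk => by
      simp only [atHeight, hk, hik.trans hk, dif_pos]; exact hgood.lt i k hk hik)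
    (fun k hk => by
      simp only [atHeight, hk, dif_pos]
      intro he
      have h3 := (LineEq.mem_pts_cross ((h.mem s[k]).1 (List.getElem_mem hk))).2 he.symm
      have h4 := hr s[k]
      rw [LineEq.mem_pts.1 h3, mul_zero] at h4
      exact lt_irrefl _ h4)
  refine ⟨j, hj, cellOf_eq hr ((mem_zcell h).2 ⟨hgood.par, fun k hk hkj => ?_, fun k hk hkj => ?_⟩)⟩
  · have := h1 k hk hkj; simpa only [atHeight, hk, dif_pos] using this
  · have := h2 k hk hkj; simpa only [atHeight, hk, dif_pos] using this

theorem exists_above {o : Fin n → ℝ} {p : Plane} (hp : p ∈ cellOf L o) (h0 : (l.loc p).2 = 0) :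
    ∃ r ∈ cellOf L o, 0 < (l.loc r).2 := by
  have hc : ContinuousAt (fun t : ℝ => l.unloc ((l.loc p).1, t)) 0 := by
    unfold LineEq.unloc; fun_prop
  have h1 : ∀ᶠ t in nhds (0 : ℝ), l.unloc ((l.loc p).1, t) ∈ cellOf L o := by
    refine hc.eventually_mem ((isOpen_cellOf L o).mem_nhds ?_)
    rw [← h0, Prod.mk.eta, LineEq.unloc_loc]; exact hp
  have h2 : ∀ᶠ t in nhdsWithin (0 : ℝ) (Set.Ioi 0), l.unloc ((l.loc p).1, t) ∈ cellOf L o :=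
    mem_nhdsWithin_of_mem_nhds h1
  obtain ⟨t, h2, h3⟩ := (h2.and self_mem_nhdsWithin).exists
  exact ⟨_, h2, by rw [LineEq.loc_unloc]; exact h3⟩

/-- The same line with the opposite direction. -/
def LineEq.neg (l : LineEq) : LineEq :=
  ⟨-l.a, -l.b, -l.c, l.nondeg.imp neg_ne_zero.2 neg_ne_zero.2⟩

theorem LineEq.loc_neg (l : LineEq) (p : Plane) : l.neg.loc p = -l.loc p := by
  simp only [loc, neg, Prod.neg_mk]; refine Prod.ext ?_ ?_ <;> simp only <;> ring

theorem LineEq.pts_neg (l : LineEq) : l.neg.pts = l.pts := by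
  ext p; rw [mem_pts_self, mem_pts_self, loc_neg, Prod.snd_neg, neg_eq_zero]

/-- The lines number `j` and `j + 1` of `s` meet on `l`. -/
def Tie (L : Fin n → LineEq) (l : LineEq) (s : List (Fin n)) (j : ℕ) : Prop :=
  ∃ (h0 : 0 < j) (h : j < s.length), l.Xof (L (s[j - 1]'(by omega))) = l.Xof (L s[j])

theorem exists_on_of_not_tie (hl : ∀ i, (L i).pts ≠ l.pts) (h : LexSorted L l s)
    (hj : j ≤ s.length) (ht : ¬ Tie L l s j) : ∃ p ∈ zcell L l s j, (l.loc p).2 = 0 := by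
  have mono : ∀ i k (hk : k < s.length) (hik : i ≤ k),
      l.Xof (L (s[i]'(hik.trans_lt hk))) ≤ l.Xof (L s[k]) := fun i k hk hik => by
    rcases hik.eq_or_lt with rfl | h'
    · exact le_rfl
    · rcases h.lt h' hk with h3 | h3
      · exact h3.le
      · exact h3.1.le
  obtain ⟨x, hx1, hx2⟩ : ∃ x : ℝ, (∀ k (hk : k < s.length), k < j → l.Xof (L s[k]) < x) ∧
      ∀ k (hk : k < s.length), j ≤ k → x < l.Xof (L s[k]) := by
    rcases Nat.eq_zero_or_pos j with rfl | h0
    · by_cases h1 : 0 < s.length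
      · exact ⟨l.Xof (L s[0]) - 1, fun k hk hkj => by omega,
          fun k hk _ => by linarith [mono 0 k hk (by omega)]⟩
      · exact ⟨0, fun k hk hkj => by omega, fun k hk hkj => by omega⟩
    · have h1 : j - 1 < s.length := by omega
      rcases hj.eq_or_lt with rfl | h2
      · exact ⟨l.Xof (L (s[s.length - 1]'h1)) + 1,
          fun k hk hkj => by linarith [mono k (s.length - 1) h1 (by omega)], fun k hk hkj => by omega⟩
      · have h3 : l.Xof (L (s[j - 1]'h1)) < l.Xof (L s[j]) :=
          lt_of_le_of_ne (mono (j - 1) j h2 (by omega)) fun he => ht ⟨h0, h2, he⟩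
        exact ⟨(l.Xof (L (s[j - 1]'h1)) + l.Xof (L s[j])) / 2,
          fun k hk hkj => by linarith [mono k (j - 1) h1 (by omega)],
          fun k hk hkj => by linarith [mono j k hk hkj]⟩
  refine ⟨l.unloc (x, 0), (mem_zcell h).2 ?_, by rw [LineEq.loc_unloc]⟩
  rw [LineEq.loc_unloc]
  refine ⟨fun i hi => ?_, fun k hk hkj => ?_, fun k hk hkj => ?_⟩
  · have : 0 < l.ga (L i) ^ 2 := sq_pos_of_ne_zero (LineEq.ga_ne hi (hl i))
    nlinarith
  · simpa using hx1 k hk hkj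
  · simpa using hx2 k hk hkj

/-- Two lines through a common base point leave a gap in the order of the list only on the upper
side of `l`. -/
theorem above_of_tie (h : LexSorted L l s) (ht : Tie L l s j) {p : Plane}
    (hp : p ∈ zcell L l s j) : 0 < (l.loc p).2 := by
  obtain ⟨h0, hj, he⟩ := ht
  obtain ⟨-, h1, h2⟩ := (mem_zcell h).1 hp
  have h3 := h1 (j - 1) (by omega) (by omega)
  have h4 := h2 j hj le_rfl
  rcases h.lt (show j - 1 < j by omega) hj with h5 | h5
  · linarith
  · have := h5.2
    rw [he] at h3
    by_contra h6
    nlinarith [not_lt.1 h6]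

theorem zcell_inj {ε : ℝ} (h : LexSorted L l s) (hε : GoodHeight L l s ε) {j k : ℕ}
    (hjk : j < k) (hk : k ≤ s.length) : zcell L l s j ≠ zcell L l s k := by
  intro he
  obtain ⟨p, hp, -⟩ := exists_mem_zcell h hε (hjk.le.trans hk)
  have h1 := ((mem_zcell h).1 hp).2.2 j (by omega) le_rfl
  rw [he] at hp
  have h2 := ((mem_zcell h).1 hp).2.1 j (by omega) hjk
  linarith

end

open Classical in
/-- The cells of the zone, each once. -/
noncomputable def zoneCells (L : Fin n → LineEq) (l : LineEq) (s s' : List (Fin n)) :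
    List (Set Plane) :=
  (List.range (s.length + 1)).map (zcell L l s) ++
    ((List.range (s'.length + 1)).filter fun j => Tie L l.neg s' j).map (zcell L l.neg s')

/-- A face of the zone with a point above `l` is a cell of the first list. Any other face lies
strictly below `l`, since an open set that meets `l` has points above it; it is a cell of the
reversed line, and it avoids `l`, which forces a tie by `exists_on_of_not_tie`. Conversely cells at
ties of the reversed line lie strictly below `l`, so the two lists are disjoint. -/
theorem zoneCells_spec {L : Fin n → LineEq} {l : LineEq} {s s' : List (Fin n)} {ε ε' : ℝ}
    (hl : ∀ i, (L i).pts ≠ l.pts) (h : LexSorted L l s) (h' : LexSorted L l.neg s')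
    (hε : GoodHeight L l s ε) (hε' : GoodHeight L l.neg s' ε') :
    (zoneCells L l s s').Nodup ∧ ∀ C, C ∈ zoneCells L l s s' ↔ C ∈ zone L l := by
  classical
  have hl' : ∀ i, (L i).pts ≠ l.neg.pts := by simpa only [LineEq.pts_neg] using hl
  constructor
  · have inj : ∀ {l : LineEq} {s : List (Fin n)} {ε : ℝ}, LexSorted L l s → GoodHeight L l s ε →
        ∀ x ≤ s.length, ∀ y ≤ s.length, zcell L l s x = zcell L l s y → x = y := by
      intro l s ε h hε x hx y hy he
      rcases lt_trichotomy x y with h1 | h1 | h1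
      · exact absurd he (zcell_inj h hε h1 hy)
      · exact h1
      · exact absurd he.symm (zcell_inj h hε h1 hx)
    refine List.Nodup.append ?_ ?_ ?_
    · refine List.Nodup.map_on (fun x hx y hy he => ?_) List.nodup_range
      rw [List.mem_range] at hx hy
      exact inj h hε x (by omega) y (by omega) he
    · refine List.Nodup.map_on (fun x hx y hy he => ?_) (List.nodup_range.filter _)
      rw [List.mem_filter, List.mem_range] at hx hy
      exact inj h' hε' x (by omega) y (by omega) he
    · intro C hC hC'
      rw [List.mem_map] at hC hC'
      obtain ⟨j, hj, rfl⟩ := hC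
      obtain ⟨k, hk, he⟩ := hC'
      rw [List.mem_filter, List.mem_range, decide_eq_true_eq] at hk
      rw [List.mem_range] at hj
      obtain ⟨p, hp, hp2⟩ := exists_mem_zcell (j := j) h hε (by omega)
      rw [← he] at hp
      have := above_of_tie h' hk.2 hp
      rw [LineEq.loc_neg, Prod.snd_neg, hp2] at this
      linarith [hε.pos]
  · intro C
    rw [zoneCells, List.mem_append, List.mem_map, List.mem_map]
    constructor
    · rintro (⟨j, hj, rfl⟩ | ⟨j, hj, rfl⟩)
      · rw [List.mem_range] at hj
        exact zcell_mem_zone h hε (by omega)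
      · rw [List.mem_filter, List.mem_range] at hj
        have := zcell_mem_zone h' hε' (j := j) (by omega)
        rwa [zone, LineEq.pts_neg] at this
    · rintro ⟨hC, q, hq, hq0⟩
      obtain ⟨o, rfl, hne⟩ := hC.exists_cellOf
      rw [closure_cellOf hne] at hq
      by_cases hab : ∃ p ∈ cellOf L o, 0 < (l.loc p).2
      · obtain ⟨p, hp, hy⟩ := hab
        obtain ⟨j, hj, he⟩ := eq_zcell_of_above hl h hε hp hy hq hq0
        exact .inl ⟨j, List.mem_range.2 (by omega), he.symm⟩
      · obtain ⟨p, hp⟩ := hne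
        have hy : 0 < (l.neg.loc p).2 := by
          rw [LineEq.loc_neg, Prod.snd_neg, neg_pos]
          by_contra h1
          rcases (not_lt.1 h1).eq_or_lt with h2 | h2
          · exact hab (exists_above hp h2.symm)
          · exact hab ⟨p, hp, h2⟩
        obtain ⟨j, hj, he⟩ := eq_zcell_of_above hl' h' hε' hp hy hq (by rwa [LineEq.pts_neg])
        refine .inr ⟨j, ?_, he.symm⟩
        rw [List.mem_filter, List.mem_range, decide_eq_true_eq]
        refine ⟨by omega, ?_⟩
        by_contra ht
        obtain ⟨r, hr, hr0⟩ := exists_on_of_not_tie hl' h' hj ht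
        rw [← he] at hr
        rw [LineEq.loc_neg, Prod.snd_neg, neg_eq_zero] at hr0
        exact hab (exists_above hr hr0)

/-! ### Reduction to a line that meets all others in distinct points -/

/-- The parallel of `l` at height `ε`. -/
def LineEq.shift (l : LineEq) (ε : ℝ) : LineEq := ⟨l.a, l.b, l.c + ε, l.nondeg⟩

theorem LineEq.ga_shift (l k : LineEq) (ε : ℝ) : (l.shift ε).ga k = l.ga k - ε * l.be k := by
  simp only [ga, shift, nsq, be]; ring

theorem LineEq.Xof_shift (l k : LineEq) (ε : ℝ) :
    (l.shift ε).Xof k = l.Xof k + l.Sof k * ε := by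
  rw [Xof, ga_shift, Xof, Sof]
  have : (l.shift ε).al k = l.al k := rfl
  rw [this]; ring

/-- Only the parallels of `l` need an argument: a good height does not pass any of them, so their
sides are the same seen from `l` and from the shifted line. From here on, ties have disappeared. -/
theorem zcell_shift {L : Fin n → LineEq} {l : LineEq} {s : List (Fin n)} {ε : ℝ}
    (hε : GoodHeight L l s ε) (j : ℕ) : zcell L (l.shift ε) s j = zcell L l s j := by
  ext p
  refine forall_congr' fun i => ?_
  have e : (l.shift ε).al (L i) = l.al (L i) := rfl
  by_cases hi : l.al (L i) = 0
  · rw [sides, sides, e, if_pos hi, if_pos hi, LineEq.ga_shift]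
    have h1 := hε.par i hi
    have h2 : 0 < -l.ga (L i) * -(l.ga (L i) - ε * l.be (L i)) := by linarith
    constructor
    · intro h3
      exact mul_pos_of_mul_pos (by linarith) h3
    · intro h3
      exact mul_pos_of_mul_pos h2 h3
  · rw [sides, sides, e, if_neg hi, if_neg hi]

/-- `l` meets the lines of `s` in strictly increasing order. -/
structure StrictSorted (L : Fin n → LineEq) (l : LineEq) (s : List (Fin n)) : Prop where
  mem : ∀ i, i ∈ s ↔ l.al (L i) ≠ 0
  lt : ∀ i k (hk : k < s.length) (hik : i < k), l.Xof (L (s[i]'(hik.trans hk))) < l.Xof (L s[k])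
  ne : ∀ i, (L i).pts ≠ l.pts

theorem StrictSorted.lexSorted {L : Fin n → LineEq} {l : LineEq} {s : List (Fin n)}
    (h : StrictSorted L l s) : LexSorted L l s :=
  ⟨h.mem, List.pairwise_iff_getElem.2 fun i k _ hk hik => .inl (h.lt i k hk hik)⟩

theorem GoodHeight.strictSorted {L : Fin n → LineEq} {l : LineEq} {s : List (Fin n)} {ε : ℝ}
    (h : LexSorted L l s) (hε : GoodHeight L l s ε) : StrictSorted L (l.shift ε) s := by
  refine ⟨h.mem, fun i k hk hik => ?_, fun i he => ?_⟩
  · rw [LineEq.Xof_shift, LineEq.Xof_shift]; exact hε.lt i k hk hik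
  · have h0 : ∀ x, (l.shift ε).unloc (x, 0) ∈ (L i).pts := fun x => by
      rw [he, LineEq.mem_pts_self, LineEq.loc_unloc]
    have h1 : (l.shift ε).al (L i) = 0 := by
      have h2 := h0 0
      have h3 := h0 1
      rw [LineEq.mem_pts_loc (l := l.shift ε), LineEq.loc_unloc] at h2 h3
      simp only at h2 h3
      linarith
    have h2 := h0 0
    rw [LineEq.mem_pts_loc (l := l.shift ε), LineEq.loc_unloc, LineEq.ga_shift] at h2
    have h3 := hε.par i h1
    have h4 : l.be (L i) * ε - l.ga (L i) = 0 := by simp only at h2; linarith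
    rw [h4, mul_zero] at h3
    exact lt_irrefl _ h3


/-! ## Correct boundary descriptions -/

namespace Geo

variable {G : Geo}

theorem F_comb (t : Tag) (p q : Plane) (s : ℝ) :
    G.F t (q + s • (p - q)) = (1 - s) * G.F t q + s * G.F t p := by
  cases t <;> simp [F] <;> ring

theorem comb_mem_K {p q : Plane} (hp : p ∈ G.K) (hq : q ∈ G.K) {s : ℝ} (h0 : 0 ≤ s) (h1 : s ≤ 1) :
    q + s • (p - q) ∈ G.K := by
  have key : ∀ t, 0 ≤ G.F t p → 0 ≤ G.F t q → 0 ≤ G.F t (q + s • (p - q)) := fun t h2 h3 => by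
    rw [F_comb]; exact add_nonneg (mul_nonneg (by linarith) h3) (mul_nonneg h0 h2)
  exact ⟨fun i h2 h3 => key _ (hp.1 i h2 h3) (hq.1 i h2 h3),
    fun i h2 h3 => key _ (hp.2.1 i h2 h3) (hq.2.1 i h2 h3), key _ hp.2.2.1 hq.2.2.1,
    key _ hp.2.2.2 hq.2.2.2⟩

theorem F_nonneg {t : Tag} (ht : G.IsBound t) {p : Plane} (hp : p ∈ G.K) : 0 ≤ G.F t p := by
  cases t with
  | L v => exact hp.1 v ht.1 ht.2
  | R v => exact hp.2.1 v ht.1 ht.2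
  | T => exact hp.2.2.1
  | B => exact hp.2.2.2

/-- Two points of a bounding line differ by a multiple of its direction. -/
theorem exists_smul_dir {t : Tag} (ht : G.IsBound t) {p q : Plane} (hp : G.F t p = 0)
    (hq : G.F t q = 0) : ∃ s : ℝ, q = p + s • G.dir t := by
  cases t with
  | L v =>
    simp only [F] at hp hq
    refine ⟨p.2 - q.2, Prod.ext ?_ ?_⟩ <;> simp only [dir, Prod.fst_add, Prod.smul_fst,
      Prod.snd_add, Prod.smul_snd, smul_eq_mul]
    · linear_combination hq - hp
    · ring
  | R v =>
    simp only [F] at hp hq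
    refine ⟨q.2 - p.2, Prod.ext ?_ ?_⟩ <;> simp only [dir, Prod.fst_add, Prod.smul_fst,
      Prod.snd_add, Prod.smul_snd, smul_eq_mul]
    · linear_combination hp - hq
    · ring
  | T =>
    simp only [F] at hp hq
    have h0 : G.wh ≠ 0 := ne_of_gt ht
    refine ⟨(p.1 - q.1) / G.wh, Prod.ext ?_ ?_⟩ <;> simp only [dir, Prod.fst_add, Prod.smul_fst,
      Prod.snd_add, Prod.smul_snd, smul_eq_mul]
    · field_simp; ring
    · have := mul_left_cancel₀ h0 (show G.wh * q.2 = G.wh * p.2 by linarith)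
      rw [this]; ring
  | B =>
    simp only [F] at hp hq
    have h0 : G.wd ≠ 0 := ne_of_gt ht
    refine ⟨(q.1 - p.1) / G.wd, Prod.ext ?_ ?_⟩ <;> simp only [dir, Prod.fst_add, Prod.smul_fst,
      Prod.snd_add, Prod.smul_snd, smul_eq_mul]
    · field_simp; ring
    · have := mul_left_cancel₀ h0 (show G.wd * q.2 = G.wd * p.2 by linarith)
      rw [this]; ring

theorem dir_pos {t : Tag} (ht : G.IsBound t) : 0 < dot (G.dir t) (G.dir t) := by
  cases t with
  | L v => simp only [dir, dot]; nlinarith [mul_self_nonneg (G.S v)]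
  | R v => simp only [dir, dot]; nlinarith [mul_self_nonneg (G.S' v)]
  | T => have : 0 < G.wh := ht; simp only [dir, dot]; nlinarith
  | B => have : 0 < G.wd := ht; simp only [dir, dot]; nlinarith

theorem dot_smul_right (d e : Plane) (s : ℝ) : dot d (s • e) = s * dot d e := by
  simp only [dot, Prod.smul_fst, Prod.smul_snd, smul_eq_mul]; ring

/-- An edge is the part of its line between its end vertices. -/
theorem mem_K_iff {t₀ t t₁ : Tag} (ht : G.IsBound t) (ht₀ : G.IsBound t₀) (ht₁ : G.IsBound t₁)
    (g₀ : G.Gap t₀ t) (g₁ : G.Gap t t₁) (hne : ∃ q ∈ G.K, G.F t q = 0) {p : Plane}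
    (hp : G.F t p = 0) : p ∈ G.K ↔
      (0 < ZoneRAM.cross (G.dir t₀) (G.dir t) → ∀ v, G.F t₀ v = 0 → G.F t v = 0 →
        0 ≤ dot (G.dir t) (p - v)) ∧
      (0 < ZoneRAM.cross (G.dir t) (G.dir t₁) → ∀ v, G.F t v = 0 → G.F t₁ v = 0 →
        0 ≤ dot (G.dir t) (v - p)) := by
  obtain ⟨q, hqK, hq⟩ := hne
  have hd := dir_pos ht
  constructor
  · intro hpK
    constructor
    · intro hc v h0 h1
      obtain ⟨s, hs⟩ := exists_smul_dir ht hp h1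
      have h2 := F_nonneg ht₀ hpK
      have h3 : G.F t₀ v = G.F t₀ p - s * ZoneRAM.cross (G.dir t) (G.dir t₀) := by rw [hs, F_add]
      have h4 : ZoneRAM.cross (G.dir t) (G.dir t₀) = -ZoneRAM.cross (G.dir t₀) (G.dir t) := by
        simp only [ZoneRAM.cross]; ring
      have h5 : s ≤ 0 := by rw [h4] at h3; nlinarith
      rw [hs, show p - (p + s • G.dir t) = (-s) • G.dir t by simp, dot_smul_right]
      exact mul_nonneg (by linarith) hd.le
    · intro hc v h1 h0
      obtain ⟨s, hs⟩ := exists_smul_dir ht hp h1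
      have h2 := F_nonneg ht₁ hpK
      have h3 : G.F t₁ v = G.F t₁ p - s * ZoneRAM.cross (G.dir t) (G.dir t₁) := by rw [hs, F_add]
      have h5 : 0 ≤ s := by nlinarith
      rw [hs, show p + s • G.dir t - p = s • G.dir t by simp, dot_smul_right]
      exact mul_nonneg h5 hd.le
  · rintro ⟨a0, a1⟩
    -- Going backwards from `p` along the edge one finds its initial vertex or recedes for ever, and
    -- similarly forwards. By convexity, `p` then lies in the closed face; if both ends recede, the
    -- known point `q` of the edge serves as the start.
    have b0 : (∃ s : ℝ, 0 ≤ s ∧ p - s • G.dir t ∈ G.K) ∨ G.Rec (-G.dir t) := by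
      rcases g₀ with ⟨hc, v, hv, h0, h1⟩ | h
      · left
        obtain ⟨s, hs⟩ := exists_smul_dir ht hp h1
        have := a0 hc v h0 h1
        rw [hs, show p - (p + s • G.dir t) = (-s) • G.dir t by simp, dot_smul_right] at this
        refine ⟨-s, nonneg_of_mul_nonneg_left this hd, ?_⟩
        rw [neg_smul, sub_neg_eq_add, ← hs]; exact hv
      · exact .inr h.2
    have b1 : (∃ s : ℝ, 0 ≤ s ∧ p + s • G.dir t ∈ G.K) ∨ G.Rec (G.dir t) := by
      rcases g₁ with ⟨hc, v, hv, h1, h0⟩ | h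
      · left
        obtain ⟨s, hs⟩ := exists_smul_dir ht hp h1
        have := a1 hc v h1 h0
        rw [hs, show p + s • G.dir t - p = s • G.dir t by simp, dot_smul_right] at this
        exact ⟨s, nonneg_of_mul_nonneg_left this hd, hs ▸ hv⟩
      · exact .inr h.1
    rcases b0 with ⟨s₀, hs₀, hK₀⟩ | hr₀ <;> rcases b1 with ⟨s₁, hs₁, hK₁⟩ | hr₁
    · rcases (add_nonneg hs₀ hs₁).eq_or_lt with h | h
      · obtain rfl : s₀ = 0 := by linarith
        simpa using hK₀
      · have := comb_mem_K hK₁ hK₀ (s := s₀ / (s₀ + s₁)) (by positivity)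
          (by rw [div_le_one h]; linarith)
        have e : p - s₀ • G.dir t + (s₀ / (s₀ + s₁)) • (p + s₁ • G.dir t - (p - s₀ • G.dir t)) =
            p := by
          rw [show p + s₁ • G.dir t - (p - s₀ • G.dir t) = (s₀ + s₁) • G.dir t by module, smul_smul,
            div_mul_cancel₀ _ h.ne']
          simp
        rwa [e] at this
    · have := hr₁ _ hK₀ s₀ hs₀
      simpa using this
    · have := hr₀ _ hK₁ s₁ hs₁
      simpa using this
    · obtain ⟨s, hs⟩ := exists_smul_dir ht hq hp
      rw [hs]
      rcases le_total 0 s with h | h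
      · exact hr₁ q hqK s h
      · have := hr₀ q hqK (-s) (by linarith)
        simpa using this

end Geo

variable {n : ℕ}

/-- `w` is the maximum of `0` and of `σ / y` for the lines at height `y ≠ 0`, attained at `h`. -/
structure ParMax (L : Fin n → LineEq) (l : LineEq) (σ w : ℝ) (h : ℕ) : Prop where
  nonneg : 0 ≤ w
  le : ∀ i, l.al (L i) = 0 → σ * (l.be (L i) / l.ga (L i)) ≤ w
  attained : 0 < w → ∃ i : Fin n, (i : ℕ) = h ∧ l.al (L i) = 0 ∧
    σ * (l.be (L i) / l.ga (L i)) = w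

/-- `G` is the local description of the cell number `j`; `id` gives the lines of the edges. -/
structure FaceData (L : Fin n → LineEq) (l : LineEq) (s : List (Fin n)) (j : ℕ) (G : Geo)
    (id : Tag → ℕ) : Prop where
  sorted : StrictSorted L l s
  le : j ≤ s.length
  j_eq : G.j = j
  j'_eq : G.j' = s.length - j
  left : ∀ k (hk : k < s.length), k < j → G.X (k + 1) = l.Xof (L s[k]) ∧
    G.S (k + 1) = l.Sof (L s[k]) ∧ id (.L (k + 1)) = (s[k] : ℕ)
  right : ∀ k (hk : k < s.length), j ≤ k → G.X' (s.length - k) = -l.Xof (L s[k]) ∧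
    G.S' (s.length - k) = -l.Sof (L s[k]) ∧ id (.R (s.length - k)) = (s[k] : ℕ)
  top : ParMax L l 1 G.wh (id .T)
  bot : ParMax L l (-1) G.wd (id .B)

namespace FaceData

variable {L : Fin n → LineEq} {l : LineEq} {s : List (Fin n)} {j : ℕ} {G : Geo} {id : Tag → ℕ}

theorem bound_left {t : Tag} (h : FaceData L l s j G id) {v : ℕ} (ht : t = .L v)
    (hb : G.IsBound t) : ∃ k, ∃ _ : k < s.length, k < j ∧ v = k + 1 := by
  subst ht
  have h1 := hb.1
  have h2 := hb.2
  rw [h.j_eq] at h2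
  have := h.le
  exact ⟨v - 1, by omega, by omega, by omega⟩

theorem bound_right {t : Tag} (h : FaceData L l s j G id) {v : ℕ} (ht : t = .R v)
    (hb : G.IsBound t) : ∃ k, ∃ _ : k < s.length, j ≤ k ∧ v = s.length - k := by
  subst ht
  have h1 := hb.1
  have h2 := hb.2
  rw [h.j'_eq] at h2
  have := h.le
  exact ⟨s.length - v, by omega, by omega, by omega⟩

/-- A parallel imposes a condition that is linear in the inverse of its height. The largest inverse
on each side of `l` therefore implies all the others, and the value `0` imposes nothing. -/
theorem par_iff {w w' : ℝ} {h h' : ℕ} (hl : ∀ i, (L i).pts ≠ l.pts) (h1 : ParMax L l 1 w h)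
    (h2 : ParMax L l (-1) w' h') (y : ℝ) :
    (∀ i, l.al (L i) = 0 → 0 ≤ -l.ga (L i) * (l.be (L i) * y - l.ga (L i))) ↔
      0 ≤ 1 - w * y ∧ 0 ≤ 1 + w' * y := by
  have key : ∀ i, l.al (L i) = 0 → (0 ≤ -l.ga (L i) * (l.be (L i) * y - l.ga (L i)) ↔
      l.be (L i) / l.ga (L i) * y ≤ 1) := fun i hi => by
    have hg := LineEq.ga_ne hi (hl i)
    have h3 : 0 < l.ga (L i) ^ 2 := sq_pos_of_ne_zero hg
    have h4 : -l.ga (L i) * (l.be (L i) * y - l.ga (L i)) =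
        l.ga (L i) ^ 2 * (1 - l.be (L i) / l.ga (L i) * y) := by field_simp; ring
    rw [h4, mul_nonneg_iff_of_pos_left h3, sub_nonneg]
  constructor
  · intro h3
    constructor
    · rcases h1.nonneg.eq_or_lt with h0 | h0
      · rw [← h0]; simp
      · obtain ⟨i, -, hi, he⟩ := h1.attained h0
        have := (key i hi).1 (h3 i hi)
        rw [← he]; linarith
    · rcases h2.nonneg.eq_or_lt with h0 | h0
      · rw [← h0]; simp
      · obtain ⟨i, -, hi, he⟩ := h2.attained h0
        have := (key i hi).1 (h3 i hi)
        rw [← he]; linarith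
  · rintro ⟨h3, h4⟩ i hi
    rw [key i hi]
    have h5 := h1.le i hi
    have h6 := h2.le i hi
    rcases le_total 0 y with hy | hy <;> nlinarith

theorem mem_K (h : FaceData L l s j G id) {p : Plane} :
    p ∈ closedCellOf L (sides L l s j) ↔ l.loc p ∈ G.K := by
  rw [mem_closed_zcell h.sorted.lexSorted, par_iff h.sorted.ne h.top h.bot]
  have hj := h.le
  constructor
  · rintro ⟨h1, h2, h3⟩
    refine ⟨fun v hv hvj => ?_, fun v hv hvj => ?_, h1.1, h1.2⟩
    · obtain ⟨k, hk, hkj, rfl⟩ := h.bound_left rfl (show G.IsBound (.L v) from ⟨hv, hvj⟩)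
      obtain ⟨e1, e2, -⟩ := h.left k hk hkj
      simp only [Geo.F, e1, e2]
      linarith [h2 k hk hkj]
    · obtain ⟨k, hk, hkj, rfl⟩ := h.bound_right rfl (show G.IsBound (.R v) from ⟨hv, hvj⟩)
      obtain ⟨e1, e2, -⟩ := h.right k hk hkj
      simp only [Geo.F, e1, e2]
      linarith [h3 k hk hkj]
  · rintro ⟨h1, h2, h3, h4⟩
    refine ⟨⟨h3, h4⟩, fun k hk hkj => ?_, fun k hk hkj => ?_⟩
    · obtain ⟨e1, e2, -⟩ := h.left k hk hkj
      have := h1 (k + 1) (by omega) (by rw [h.j_eq]; omega)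
      simp only [Geo.F, e1, e2] at this
      linarith
    · obtain ⟨e1, e2, -⟩ := h.right k hk hkj
      have := h2 (s.length - k) (by omega) (by rw [h.j'_eq]; omega)
      simp only [Geo.F, e1, e2] at this
      linarith

/-- The bounds of the face are lines of the arrangement. -/
theorem line_of_bound (h : FaceData L l s j G id) {t : Tag} (ht : G.IsBound t) :
    ∃ i : Fin n, (i : ℕ) = id t ∧ ∃ c : ℝ, c ≠ 0 ∧
      G.dir t = (c * l.be (L i), -(c * l.al (L i))) ∧
      ∀ p, G.F t (l.loc p) = c * (l.nsq * (L i).val p) := by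
  cases t with
  | L v =>
    obtain ⟨k, hk, hkj, rfl⟩ := h.bound_left rfl ht
    obtain ⟨e1, e2, e3⟩ := h.left k hk hkj
    have hne := (h.sorted.mem s[k]).1 (List.getElem_mem hk)
    refine ⟨s[k], e3.symm, (l.al (L s[k]))⁻¹, inv_ne_zero hne, ?_, fun p => ?_⟩
    · simp only [Geo.dir, e2, LineEq.Sof]
      refine Prod.ext ?_ ?_ <;> simp only <;> field_simp
    · simp only [Geo.F, e1, e2]
      rw [l.val_cross _ _ hne, inv_mul_cancel_left₀ hne]
  | R v =>
    obtain ⟨k, hk, hkj, rfl⟩ := h.bound_right rfl ht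
    obtain ⟨e1, e2, e3⟩ := h.right k hk hkj
    have hne := (h.sorted.mem s[k]).1 (List.getElem_mem hk)
    refine ⟨s[k], e3.symm, -(l.al (L s[k]))⁻¹, neg_ne_zero.2 (inv_ne_zero hne), ?_, fun p => ?_⟩
    · simp only [Geo.dir, e2, LineEq.Sof]
      refine Prod.ext ?_ ?_ <;> simp only <;> field_simp
    · simp only [Geo.F, e1, e2]
      rw [l.val_cross _ _ hne]; field_simp; ring
  | T =>
    obtain ⟨i, e1, e2, e3⟩ := h.top.attained ht
    have hg := LineEq.ga_ne e2 (h.sorted.ne i)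
    refine ⟨i, e1, -(l.ga (L i))⁻¹, neg_ne_zero.2 (inv_ne_zero hg), ?_, fun p => ?_⟩
    · simp only [Geo.dir, ← e3, e2]
      refine Prod.ext ?_ ?_ <;> simp only
      · field_simp
      · simp
    · simp only [Geo.F, ← e3]
      rw [l.val_loc, e2]; field_simp; ring
  | B =>
    obtain ⟨i, e1, e2, e3⟩ := h.bot.attained ht
    have hg := LineEq.ga_ne e2 (h.sorted.ne i)
    refine ⟨i, e1, -(l.ga (L i))⁻¹, neg_ne_zero.2 (inv_ne_zero hg), ?_, fun p => ?_⟩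
    · simp only [Geo.dir, ← e3, e2]
      refine Prod.ext ?_ ?_ <;> simp only
      · field_simp
      · simp
    · simp only [Geo.F, ← e3]
      rw [l.val_loc, e2]; field_simp; ring

theorem F_pos (h : FaceData L l s j G id) {t : Tag} (ht : G.IsBound t) {p : Plane}
    (hp : p ∈ zcell L l s j) : 0 < G.F t (l.loc p) := by
  obtain ⟨i, -, c, hc, -, hF⟩ := h.line_of_bound ht
  refine lt_of_le_of_ne (Geo.F_nonneg ht (h.mem_K.1 fun i => (hp i).le)) fun h0 => ?_
  rw [hF, eq_comm, mul_eq_zero, or_iff_right hc, mul_eq_zero, or_iff_right l.nsq_pos.ne'] at h0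
  have := hp i
  rw [h0, mul_zero] at this
  exact lt_irrefl _ this

/-- Crossing lines are listed once, top and bottom are parallels of `l` and hence different from all
of these, and the heights of top and bottom have opposite signs. -/
theorem id_inj (h : FaceData L l s j G id) {t t' : Tag} (ht : G.IsBound t) (ht' : G.IsBound t')
    (he : id t = id t') : t = t' := by
  have hnd := h.sorted.lexSorted.nodup
  have hcr : ∀ k (hk : k < s.length), l.al (L s[k]) ≠ 0 := fun k hk =>
    (h.sorted.mem s[k]).1 (List.getElem_mem hk)
  have eqk : ∀ k k' (hk : k < s.length) (hk' : k' < s.length), (s[k] : ℕ) = (s[k'] : ℕ) → k = k' :=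
    fun k k' hk hk' h1 => (hnd.getElem_inj_iff).1 (Fin.ext h1)
  have hT : ∀ {w σ h₀}, ParMax L l σ w h₀ → 0 < w → ∀ k (hk : k < s.length), (s[k] : ℕ) ≠ h₀ := by
    intro w σ h₀ h1 h2 k hk h3
    obtain ⟨i, h4, h5, -⟩ := h1.attained h2
    rw [← h4] at h3
    exact hcr k hk (by rw [Fin.ext h3]; exact h5)
  have hTB : 0 < G.wh → 0 < G.wd → id .T ≠ id .B := fun h1 h2 h3 => by
    obtain ⟨i, h4, -, h5⟩ := h.top.attained h1
    obtain ⟨i', h4', -, h5'⟩ := h.bot.attained h2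
    obtain rfl : i = i' := Fin.ext (by omega)
    linarith
  cases t with
  | L v =>
    obtain ⟨k, hk, hkj, rfl⟩ := h.bound_left rfl ht
    obtain ⟨-, -, e3⟩ := h.left k hk hkj
    rw [e3] at he
    cases t' with
    | L v' =>
      obtain ⟨k', hk', hkj', rfl⟩ := h.bound_left rfl ht'
      obtain ⟨-, -, e3'⟩ := h.left k' hk' hkj'
      rw [e3'] at he
      rw [eqk k k' hk hk' he]
    | R v' =>
      obtain ⟨k', hk', hkj', rfl⟩ := h.bound_right rfl ht'
      obtain ⟨-, -, e3'⟩ := h.right k' hk' hkj'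
      rw [e3'] at he
      have := eqk k k' hk hk' he
      omega
    | T => exact absurd he (hT h.top ht' k hk)
    | B => exact absurd he (hT h.bot ht' k hk)
  | R v =>
    obtain ⟨k, hk, hkj, rfl⟩ := h.bound_right rfl ht
    obtain ⟨-, -, e3⟩ := h.right k hk hkj
    rw [e3] at he
    cases t' with
    | L v' =>
      obtain ⟨k', hk', hkj', rfl⟩ := h.bound_left rfl ht'
      obtain ⟨-, -, e3'⟩ := h.left k' hk' hkj'
      rw [e3'] at he
      have := eqk k k' hk hk' he
      omega
    | R v' =>
      obtain ⟨k', hk', hkj', rfl⟩ := h.bound_right rfl ht'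
      obtain ⟨-, -, e3'⟩ := h.right k' hk' hkj'
      rw [e3'] at he
      rw [eqk k k' hk hk' he]
    | T => exact absurd he (hT h.top ht' k hk)
    | B => exact absurd he (hT h.bot ht' k hk)
  | T =>
    cases t' with
    | L v' =>
      obtain ⟨k', hk', hkj', rfl⟩ := h.bound_left rfl ht'
      obtain ⟨-, -, e3'⟩ := h.left k' hk' hkj'
      rw [e3'] at he
      exact absurd he.symm (hT h.top ht k' hk')
    | R v' =>
      obtain ⟨k', hk', hkj', rfl⟩ := h.bound_right rfl ht'
      obtain ⟨-, -, e3'⟩ := h.right k' hk' hkj'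
      rw [e3'] at he
      exact absurd he.symm (hT h.top ht k' hk')
    | T => rfl
    | B => exact absurd he (hTB ht ht')
  | B =>
    cases t' with
    | L v' =>
      obtain ⟨k', hk', hkj', rfl⟩ := h.bound_left rfl ht'
      obtain ⟨-, -, e3'⟩ := h.left k' hk' hkj'
      rw [e3'] at he
      exact absurd he.symm (hT h.bot ht k' hk')
    | R v' =>
      obtain ⟨k', hk', hkj', rfl⟩ := h.bound_right rfl ht'
      obtain ⟨-, -, e3'⟩ := h.right k' hk' hkj'
      rw [e3'] at he
      exact absurd he.symm (hT h.bot ht k' hk')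
    | T => exact absurd he.symm (hTB ht' ht)
    | B => rfl

/-- Every line that contributes to the boundary is one of the bounds. -/
theorem exists_bound (h : FaceData L l s j G id) (hL : Function.Injective fun i => (L i).pts)
    {i : Fin n} {p : Plane} (hp : p ∈ closedCellOf L (sides L l s j)) (hi : p ∈ (L i).pts) :
    ∃ t, G.IsBound t ∧ id t = i := by
  have hj := h.le
  by_cases hal : l.al (L i) = 0
  · have hg := LineEq.ga_ne hal (h.sorted.ne i)
    have hb := LineEq.be_ne hal
    rw [LineEq.mem_pts_loc (l := l), hal, zero_mul, zero_add] at hi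
    obtain ⟨-, -, h1, h2⟩ := h.mem_K.1 hp
    simp only [Geo.F] at h1 h2
    have hw : l.be (L i) / l.ga (L i) * (l.loc p).2 = 1 := by field_simp; exact hi
    -- A parallel of `l` is determined by the inverse `be / ga` of its height; since the lines are
    -- distinct, so is its index.
    have same : ∀ i' : Fin n, l.al (L i') = 0 →
        l.be (L i') / l.ga (L i') = l.be (L i) / l.ga (L i) → i' = i := fun i' h3 h4 => by
      have hg' := LineEq.ga_ne h3 (h.sorted.ne i')
      apply hL
      ext q
      simp only
      rw [LineEq.mem_pts_loc (l := l), LineEq.mem_pts_loc (l := l), hal, h3, zero_mul,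
        zero_add, zero_add]
      have e1 : l.be (L i') = l.be (L i) / l.ga (L i) * l.ga (L i') := by rw [← h4]; field_simp
      have e2 : l.be (L i) = l.be (L i) / l.ga (L i) * l.ga (L i) := by field_simp
      have e3 : l.be (L i) / l.ga (L i) ≠ 0 := div_ne_zero hb hg
      constructor
      · intro h5
        rw [e1] at h5
        have h6 : l.be (L i) / l.ga (L i) * (l.loc q).2 = 1 :=
          mul_right_cancel₀ hg' (by linear_combination h5)
        rw [e2]; linear_combination l.ga (L i) * h6
      · intro h5
        rw [e2] at h5
        have h6 : l.be (L i) / l.ga (L i) * (l.loc q).2 = 1 :=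
          mul_right_cancel₀ hg (by linear_combination h5)
        rw [e1]; linear_combination l.ga (L i') * h6
    rcases lt_trichotomy (l.loc p).2 0 with hy | hy | hy
    · have h3 := h.bot.le i hal
      -- The maximum is at least the inverse height of the line through `p`, and at most that
      -- because `p` satisfies the bound.
      have h4 : G.wd = -1 * (l.be (L i) / l.ga (L i)) := by nlinarith
      have h5 : 0 < G.wd := by nlinarith
      obtain ⟨i', e1, e2, e3⟩ := h.bot.attained h5
      exact ⟨.B, h5, by rw [← e1, same i' e2 (by linarith)]⟩
    · rw [hy, mul_zero] at hw; exact absurd hw zero_ne_one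
    · have h3 := h.top.le i hal
      have h4 : G.wh = l.be (L i) / l.ga (L i) := by nlinarith
      have h5 : 0 < G.wh := by nlinarith
      obtain ⟨i', e1, e2, e3⟩ := h.top.attained h5
      exact ⟨.T, h5, by rw [← e1, same i' e2 (by linarith)]⟩
  · obtain ⟨k, hk, rfl⟩ := List.getElem_of_mem ((h.sorted.mem i).2 hal)
    rcases Nat.lt_or_ge k j with hkj | hkj
    · refine ⟨.L (k + 1), ⟨by omega, by rw [h.j_eq]; omega⟩, (h.left k hk hkj).2.2⟩
    · refine ⟨.R (s.length - k), ⟨by omega, by rw [h.j'_eq]; omega⟩, (h.right k hk hkj).2.2⟩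

end FaceData


/-! ### From edges in local coordinates to edges in the plane -/

/-- The vector whose dot and cross products are those of `d` with local coordinates. -/
def LineEq.pull (l : LineEq) (d : Plane) : Plane := (l.b * d.1 + l.a * d.2, -l.a * d.1 + l.b * d.2)

theorem LineEq.dot_pull (l : LineEq) (d p q : Plane) :
    dot (l.pull d) (p - q) = dot d (l.loc p - l.loc q) := by
  simp only [dot, pull, loc, Prod.fst_sub, Prod.snd_sub]; ring

theorem LineEq.cross_pull (l : LineEq) (d p q : Plane) :
    cross (l.pull d) (p - q) = cross d (l.loc p - l.loc q) := by
  simp only [cross, pull, loc, Prod.fst_sub, Prod.snd_sub]; ring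

theorem Geo.F_sub (G : Geo) (t : Tag) (p q : Plane) :
    ZoneRAM.cross (G.dir t) (p - q) = G.F t p - G.F t q := by
  cases t <;> simp [ZoneRAM.cross, Geo.dir, Geo.F] <;> ring

theorem eq_zero_of_cross {d e w : Plane} (h : cross d e ≠ 0) (hd : cross d w = 0)
    (he : cross e w = 0) : w = 0 := by
  simp only [cross] at h hd he
  refine Prod.ext (mul_left_cancel₀ h ?_) (mul_left_cancel₀ h ?_)
  · simp only [Prod.fst_zero]; linear_combination e.1 * hd - d.1 * he
  · simp only [Prod.snd_zero]; linear_combination e.2 * hd - d.2 * he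

variable {n : ℕ}

theorem frontier_cellOf_inter {L : Fin n → LineEq} {o : Fin n → ℝ} (h : (cellOf L o).Nonempty)
    (i : Fin n) : frontier (cellOf L o) ∩ (L i).pts = closedCellOf L o ∩ (L i).pts := by
  rw [frontier, closure_cellOf h, (isOpen_cellOf L o).interior_eq]
  ext p
  simp only [Set.mem_inter_iff, Set.mem_sdiff]
  refine ⟨fun hp => ⟨hp.1.1, hp.2⟩, fun hp => ⟨⟨hp.1, fun h' => ?_⟩, hp.2⟩⟩
  have := h' i
  rw [LineEq.mem_pts.1 hp.2, mul_zero] at this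
  exact lt_irrefl _ this

/-- The common point of the lines number `i` and `k`. -/
noncomputable def meetPt (a b c : ℕ → ℝ) (i k : ℕ) : Plane :=
  ((c i * b k - c k * b i) / (a i * b k - a k * b i),
    (a i * c k - a k * c i) / (a i * b k - a k * b i))

/-- The vertex between two consecutive edges. -/
noncomputable def Geo.vertex (G : Geo) (id : Tag → ℕ) (a b c : ℕ → ℝ) (t t' : Tag) : Option Plane :=
  if 0 < ZoneRAM.cross (G.dir t) (G.dir t') then some (meetPt a b c (id t) (id t')) else none

/-- `E` consists of the edges `D`, with the given vertices between consecutive ones. -/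
structure EdgesOf (D : List Tag) (id : Tag → ℕ) (vt : Tag → Tag → Option Plane)
    (E : List BoundaryEdge) : Prop where
  length_eq : E.length = D.length
  line_eq : ∀ k (h : k < E.length) (h' : k < D.length), E[k].line = id D[k]
  head_eq : ∀ k k' (h : k < E.length) (_ : k' < E.length) (hk : k < D.length) (hk' : k' < D.length),
    k' = (k + 1) % D.length → E[k].head = vt D[k] D[k']
  tail_eq : ∀ k k' (_ : k < E.length) (h : k' < E.length) (hk : k < D.length) (hk' : k' < D.length),
    k' = (k + 1) % D.length → E[k'].tail = vt D[k] D[k']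

namespace FaceData

variable {L : Fin n → LineEq} {l : LineEq} {s : List (Fin n)} {j : ℕ} {G : Geo} {id : Tag → ℕ}
  {a b c : ℕ → ℝ}

/-- Cramer's rule; its determinant is, up to a nonzero factor, the cross product of the two edge
directions. -/
theorem meetPt_spec (h : FaceData L l s j G id) (ha : ∀ i : Fin n, a i = (L i).a)
    (hb : ∀ i : Fin n, b i = (L i).b) (hc : ∀ i : Fin n, c i = (L i).c) {t t' : Tag}
    (ht : G.IsBound t) (ht' : G.IsBound t')
    (hx : ZoneRAM.cross (G.dir t) (G.dir t') ≠ 0) {i k : Fin n} (hi : (i : ℕ) = id t)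
    (hk : (k : ℕ) = id t') : (L i).val (meetPt a b c (id t) (id t')) = 0 ∧
      (L k).val (meetPt a b c (id t) (id t')) = 0 := by
  obtain ⟨i', e1, r, hr, e2, -⟩ := h.line_of_bound ht
  obtain ⟨k', f1, r', hr', f2, -⟩ := h.line_of_bound ht'
  obtain rfl : i' = i := Fin.ext (by omega)
  obtain rfl : k' = k := Fin.ext (by omega)
  have hdet : (L i').a * (L k').b - (L k').a * (L i').b ≠ 0 := fun h0 => hx <| by
    rw [e2, f2]
    simp only [cross, LineEq.al, LineEq.be]
    linear_combination (r * r' * (l.a * l.a + l.b * l.b)) * h0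
  rw [← hi, ← hk]
  simp only [LineEq.val, meetPt, ha, hb, hc]
  constructor <;> rw [← mul_div_assoc, ← mul_div_assoc, ← add_div, sub_eq_zero, div_eq_iff hdet] <;>
    ring

theorem F_meetPt (h : FaceData L l s j G id) (ha : ∀ i : Fin n, a i = (L i).a)
    (hb : ∀ i : Fin n, b i = (L i).b) (hc : ∀ i : Fin n, c i = (L i).c) {t t' : Tag}
    (ht : G.IsBound t) (ht' : G.IsBound t') (hx : ZoneRAM.cross (G.dir t) (G.dir t') ≠ 0) :
    G.F t (l.loc (meetPt a b c (id t) (id t'))) = 0 ∧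
      G.F t' (l.loc (meetPt a b c (id t) (id t'))) = 0 := by
  obtain ⟨i, e1, r, hr, -, e2⟩ := h.line_of_bound ht
  obtain ⟨k, f1, r', hr', -, f2⟩ := h.line_of_bound ht'
  obtain ⟨h1, h2⟩ := h.meetPt_spec ha hb hc ht ht' hx e1 f1
  rw [e2, f2, h1, h2]
  simp

/-- The description of an edge by its end vertices is `Geo.mem_K_iff`, transported to the plane:
`pull` turns the local direction into a direction of the line, and the face is on its left because
`F t` is positive inside. -/
theorem isEdgeOf (h : FaceData L l s j G id) (hne : (zcell L l s j).Nonempty)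
    (ha : ∀ i : Fin n, a i = (L i).a)
    (hb : ∀ i : Fin n, b i = (L i).b) (hc : ∀ i : Fin n, c i = (L i).c) {t₀ t t₁ : Tag}
    (ht : G.IsBound t) (ht₀ : G.IsBound t₀) (ht₁ : G.IsBound t₁)
    (g₀ : G.Gap t₀ t) (g₁ : G.Gap t t₁) (h2 : G.Two t) {e : BoundaryEdge} (he : e.line = id t)
    (hh : e.head = G.vertex id a b c t t₁) (htl : e.tail = G.vertex id a b c t₀ t) :
    IsEdgeOf L (zcell L l s j) e := by
  obtain ⟨i, hi, r, hr, hd, hF⟩ := h.line_of_bound ht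
  have hF0 : ∀ p, p ∈ (L i).pts ↔ G.F t (l.loc p) = 0 := fun p => by
    rw [hF, LineEq.mem_pts, mul_eq_zero, or_iff_right hr, mul_eq_zero,
      or_iff_right l.nsq_pos.ne']
  have hfr : frontier (zcell L l s j) ∩ (L i).pts =
      {p | l.loc p ∈ G.K ∧ G.F t (l.loc p) = 0} := by
    rw [zcell, frontier_cellOf_inter hne]
    ext p
    rw [Set.mem_inter_iff, h.mem_K, hF0]; rfl
  have on_head : ∀ v ∈ e.head, 0 < ZoneRAM.cross (G.dir t) (G.dir t₁) ∧
      G.F t (l.loc v) = 0 ∧ G.F t₁ (l.loc v) = 0 := fun v hv => by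
    rw [hh, Geo.vertex] at hv
    split_ifs at hv with hx
    · obtain rfl := Option.some_injective _ hv
      exact ⟨hx, h.F_meetPt ha hb hc ht ht₁ hx.ne'⟩
    · cases hv
  have on_tail : ∀ v ∈ e.tail, 0 < ZoneRAM.cross (G.dir t₀) (G.dir t) ∧
      G.F t₀ (l.loc v) = 0 ∧ G.F t (l.loc v) = 0 := fun v hv => by
    rw [htl, Geo.vertex] at hv
    split_ifs at hv with hx
    · obtain rfl := Option.some_injective _ hv
      exact ⟨hx, h.F_meetPt ha hb hc ht₀ ht hx.ne'⟩
    · cases hv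
  -- Lines with nonzero cross product have only one common point, so the computed vertex is the
  -- vertex of `Geo.mem_K_iff`.
  have uniq : ∀ {t' t'' : Tag} {v w : Plane}, 0 < ZoneRAM.cross (G.dir t') (G.dir t'') →
      G.F t' v = 0 → G.F t'' v = 0 → G.F t' w = 0 → G.F t'' w = 0 → w = v :=
    fun hx h3 h4 h5 h6 => sub_eq_zero.1 (eq_zero_of_cross hx.ne' (by rw [Geo.F_sub, h3, h5, sub_zero])
      (by rw [Geo.F_sub, h4, h6, sub_zero]))
  obtain ⟨p, hp, q, hq, hpq, hp0, hq0⟩ := h2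
  refine ⟨i, he.trans hi.symm, ?_, fun v hv => (hF0 v).2 (on_tail v hv).2.2,
    fun v hv => (hF0 v).2 (on_head v hv).2.1,
    l.pull (G.dir t), ?_, fun q hq p hp => ?_, ?_⟩
  · rw [hfr]
    refine ⟨l.unloc p, ?_, l.unloc q, ?_, fun h3 => hpq ?_⟩
    · simpa only [Set.mem_ofPred_eq, LineEq.loc_unloc] using ⟨hp, hp0⟩
    · simpa only [Set.mem_ofPred_eq, LineEq.loc_unloc] using ⟨hq, hq0⟩
    · rw [← l.loc_unloc p, h3, l.loc_unloc]
  · rw [hd]; simp only [LineEq.pull, LineEq.al, LineEq.be]; ring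
  · rw [l.cross_pull, Geo.F_sub, (hF0 q).1 hq, sub_zero]
    exact h.F_pos ht hp
  · rw [hfr]
    ext x
    simp only [Set.mem_ofPred_eq, hF0, l.dot_pull]
    rw [and_comm]
    refine and_congr_right fun hx => ?_
    rw [Geo.mem_K_iff ht ht₀ ht₁ g₀ g₁ ⟨p, hp, hp0⟩ hx]
    refine and_congr ⟨fun h3 v hv => ?_, fun h3 hc' v hv0 hv => ?_⟩
      ⟨fun h3 v hv => ?_, fun h3 hc' v hv hv0 => ?_⟩
    · obtain ⟨c1, c2, c3⟩ := on_tail v hv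
      exact h3 c1 _ c2 c3
    · obtain ⟨c2, c3⟩ := h.F_meetPt ha hb hc ht₀ ht hc'.ne'
      rw [uniq hc' c2 c3 hv0 hv]
      exact h3 _ (by rw [htl, Geo.vertex, if_pos hc']; rfl)
    · obtain ⟨c1, c2, c3⟩ := on_head v hv
      exact h3 c1 _ c2 c3
    · obtain ⟨c2, c3⟩ := h.F_meetPt ha hb hc ht ht₁ hc'.ne'
      rw [uniq hc' c2 c3 hv hv0]
      exact h3 _ (by rw [hh, Geo.vertex, if_pos hc']; rfl)

theorem gap_cyclic {D : List Tag} (h1 : D.IsChain G.Gap)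
    (h2 : ∀ x ∈ D.getLast?, ∀ y ∈ D.head?, G.Gap x y) (k : ℕ) (hk : k < D.length)
    (hk' : (k + 1) % D.length < D.length) : G.Gap D[k] D[(k + 1) % D.length] := by
  rcases Nat.lt_or_ge (k + 1) D.length with h3 | h3
  · have := List.isChain_iff_getElem.1 h1 k h3
    simpa only [Nat.mod_eq_of_lt h3] using this
  · obtain rfl : k = D.length - 1 := by omega
    have e : (D.length - 1 + 1) % D.length = 0 := by
      rw [Nat.sub_add_cancel (by omega), Nat.mod_self]
    simp only [e]
    refine h2 _ ?_ _ ?_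
    · rw [List.getLast?_eq_getElem?, List.getElem?_eq_getElem hk]; rfl
    · rw [List.head?_eq_getElem?, List.getElem?_eq_getElem]; rfl

theorem describesFace (h : FaceData L l s j G id) (hL : Function.Injective fun i => (L i).pts)
    (hne : (zcell L l s j).Nonempty) (ha : ∀ i : Fin n, a i = (L i).a)
    (hb : ∀ i : Fin n, b i = (L i).b) (hc : ∀ i : Fin n, c i = (L i).c) {D : List Tag}
    (d1 : D.Nodup) (d2 : D.IsChain G.Gap) (d3 : ∀ x ∈ D.getLast?, ∀ y ∈ D.head?, G.Gap x y)
    (d4 : ∀ t ∈ D, G.IsBound t ∧ G.Two t) (d5 : ∀ t, G.IsBound t → G.Two t → t ∈ D)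
    {E : List BoundaryEdge} (hE : EdgesOf D id (G.vertex id a b c) E) :
    DescribesFace L E (zcell L l s j) := by
  have hmap : E.map BoundaryEdge.line = D.map id := by
    refine List.ext_getElem (by simp [hE.length_eq]) fun k h1 h2 => ?_
    simp only [List.length_map] at h1 h2
    simpa using hE.line_eq k h1 h2
  refine ⟨fun e he => ?_, ?_, fun i hi => ?_, ?_⟩
  · obtain ⟨k, hk, rfl⟩ := List.getElem_of_mem he
    have hkD : k < D.length := hE.length_eq ▸ hk
    have hpos : 0 < D.length := by omega
    -- The cyclic predecessor of `k`; for a single edge it is the edge itself.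
    have hp : (k + (D.length - 1)) % D.length < D.length := Nat.mod_lt _ hpos
    have hq : (k + 1) % D.length < D.length := Nat.mod_lt _ hpos
    have e : k = ((k + (D.length - 1)) % D.length + 1) % D.length := by
      rw [Nat.mod_add_mod, show k + (D.length - 1) + 1 = k + D.length by omega, Nat.add_mod_right,
        Nat.mod_eq_of_lt hkD]
    have g := gap_cyclic d2 d3 _ hp (by rwa [← e])
    simp only [← e] at g
    exact h.isEdgeOf hne ha hb hc (d4 _ (List.getElem_mem hkD)).1 (d4 _ (List.getElem_mem hp)).1
      (d4 _ (List.getElem_mem hq)).1 g (gap_cyclic d2 d3 k hkD hq)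
      (d4 _ (List.getElem_mem hkD)).2 (hE.line_eq k hk hkD)
      (hE.head_eq k _ hk (hE.length_eq ▸ hq) hkD hq rfl)
      (hE.tail_eq _ k (hE.length_eq ▸ hp) hk hp hkD e)
  · rw [hmap]
    exact d1.map_on fun t ht t' ht' he => h.id_inj (d4 t ht).1 (d4 t' ht').1 he
  · rw [zcell, frontier_cellOf_inter hne] at hi
    obtain ⟨p, ⟨hp, hpi⟩, q, ⟨hq, hqi⟩, hpq⟩ := hi
    obtain ⟨t, ht, hid⟩ := h.exists_bound hL hp hpi
    obtain ⟨i', e1, r, hr, -, hF⟩ := h.line_of_bound ht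
    obtain rfl : i' = i := Fin.ext (by omega)
    rw [hmap]
    refine List.mem_map.2 ⟨t, d5 t ht ⟨l.loc p, h.mem_K.1 hp, l.loc q, h.mem_K.1 hq, fun e => hpq ?_,
      ?_, ?_⟩, hid⟩
    · rw [← l.unloc_loc p, e, l.unloc_loc]
    · rw [hF, LineEq.mem_pts.1 hpi]; simp
    · rw [hF, LineEq.mem_pts.1 hqi]; simp
  · refine List.ext_getElem (by simp) fun k h1 h2 => ?_
    simp only [List.length_map] at h1
    have hk : k < D.length := hE.length_eq ▸ h1
    have hq : (k + 1) % D.length < D.length := Nat.mod_lt _ (by omega)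
    rw [List.getElem_rotate]
    simp only [List.getElem_map, List.length_map, hE.length_eq]
    rw [hE.head_eq k _ h1 (hE.length_eq ▸ hq) hk hq rfl,
      hE.tail_eq k _ h1 (hE.length_eq ▸ hq) hk hq rfl]

end FaceData


/-! ## Total correctness with a bound on the running time -/

/-- Started in `σ`, the program `P` terminates within `c` steps in a state that satisfies `Q`. -/
def Runs (P : Prog) (σ : State) (c : ℕ) (Q : State → Prop) : Prop :=
  ∃ t τ, Exec P σ t τ ∧ t ≤ c ∧ Q τ

theorem Runs.mono {P : Prog} {σ : State} {c c' : ℕ} {Q R : State → Prop} (h : Runs P σ c Q)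
    (hc : c ≤ c') (hQ : ∀ τ, Q τ → Frame P σ τ → R τ) : Runs P σ c' R := by
  obtain ⟨t, τ, h1, h2, h3⟩ := h
  exact ⟨t, τ, h1, h2.trans hc, hQ _ h3 h1.frame⟩

theorem Runs.seq {P R : Prog} {σ : State} {c c' : ℕ} {Q Q' : State → Prop} (h : Runs P σ c Q')
    (h' : ∀ τ, Q' τ → Frame P σ τ → Runs R τ c' Q) : Runs (.seq P R) σ (c + c') Q := by
  obtain ⟨t, τ, h1, h2, h3⟩ := h
  obtain ⟨s, ρ, h4, h5, h6⟩ := h' τ h3 h1.frame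
  exact ⟨t + s, ρ, .seq h1 h4, by omega, h6⟩

/-- For concrete code `worst` evaluates to a numeral, so a generous round number can serve as `c`
and be checked by computation. -/
theorem Runs.eff {P : Prog} {σ : State} {c : ℕ} {Q : State → Prop} (hP : P.loopFree = true)
    (hc : P.worst ≤ c) (h : Q (P.eff σ)) : Runs P σ c Q := by
  obtain ⟨t, ht, h1⟩ := P.exec_eff hP σ
  exact ⟨t, _, h1, ht.trans hc, h⟩

theorem Runs.ite {b : BExpr} {P R : Prog} {σ : State} {c : ℕ} {Q : State → Prop}
    (h1 : b.holds σ → Runs P σ c Q) (h2 : ¬ b.holds σ → Runs R σ c Q) :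
    Runs (.ite b P R) σ (b.cost + c) Q := by
  by_cases hb : b.holds σ
  · obtain ⟨t, τ, h3, h4, h5⟩ := h1 hb
    exact ⟨_, τ, .ite_true hb h3, by omega, h5⟩
  · obtain ⟨t, τ, h3, h4, h5⟩ := h2 hb
    exact ⟨_, τ, .ite_false hb h3, by omega, h5⟩

/-- A loop whose iterations are paid for by a potential. -/
theorem Runs.while {b : BExpr} {P : Prog} {σ : State} (I : ℕ → State → Prop) {φ : ℕ} (h0 : I φ σ)
    (hs : ∀ φ τ, I φ τ → Frame P σ τ → b.holds τ → ∃ φ' c, φ' + c + b.cost ≤ φ ∧ Runs P τ c (I φ')) :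
    Runs (.loop b P) σ (φ + b.cost) fun τ => (∃ φ', I φ' τ) ∧ ¬ b.holds τ ∧ Frame P σ τ := by
  suffices H : ∀ φ τ, I φ τ → Frame P σ τ → Runs (.loop b P) τ (φ + b.cost) fun ρ =>
      (∃ φ', I φ' ρ) ∧ ¬ b.holds ρ ∧ Frame P σ ρ from H φ σ h0 Frame.rfl'
  intro φ
  induction φ using Nat.strong_induction_on with
  | _ φ ih =>
    intro τ hI hF
    by_cases hb : b.holds τ
    · obtain ⟨φ', c, h1, t, ρ, h2, h3, h4⟩ := hs φ τ hI hF hb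
      have hp := b.cost_pos
      obtain ⟨s, ω, h5, h6, h7⟩ := ih φ' (by omega) ρ h4 (hF.trans' h2.frame)
      exact ⟨b.cost + t + s, ω, .loop_step hb h2 h5, by omega, h7⟩
    · exact ⟨_, τ, Exec.loop_stop hb, by omega, ⟨φ, hI⟩, hb, hF⟩

/-- A counting loop with variable costs: `body` increments the counter `x`. -/
theorem Runs.loopSum {x : ℕ} {bd : NExpr} {body : Prog} {σ : State} (J : ℕ → State → Prop)
    (f : ℕ → ℕ) (hi : ℕ) (hx : σ.nvar x ≤ hi) (h0 : J (σ.nvar x) σ)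
    (hbd : ∀ τ, Frame body σ τ → bd.eval τ = hi)
    (hs : ∀ k τ, τ.nvar x = k → σ.nvar x ≤ k → k < hi → J k τ → Frame body σ τ →
      Runs body τ (f k) fun ρ => ρ.nvar x = k + 1 ∧ J (k + 1) ρ) :
    Runs (.loop (.nlt (.var x) bd) body) σ
      (∑ i ∈ Finset.Ico (σ.nvar x) hi, (f i + (bd.cost + 2)) + (bd.cost + 2))
      fun τ => τ.nvar x = hi ∧ J hi τ ∧ Frame body σ τ := by
  have hcost : (BExpr.nlt (.var x) bd).cost = bd.cost + 2 := by
    simp only [BExpr.cost, NExpr.cost]; omega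
  have := Runs.while (b := .nlt (.var x) bd) (P := body) (σ := σ)
    (fun φ τ => ∃ k, τ.nvar x = k ∧ σ.nvar x ≤ k ∧ k ≤ hi ∧ J k τ ∧
      φ = ∑ i ∈ Finset.Ico k hi, (f i + (bd.cost + 2))) ⟨_, rfl, le_rfl, hx, h0, rfl⟩ ?_
  · rw [hcost] at this
    refine this.mono le_rfl ?_
    rintro τ ⟨⟨_, k, hk, hk1, hk2, hJ, -⟩, hb, hF⟩ -
    simp only [BExpr.holds, NExpr.eval, hk, hbd τ hF] at hb
    obtain rfl : k = hi := by omega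
    exact ⟨hk, hJ, hF⟩
  · rintro φ τ ⟨k, hk, hk1, hk2, hJ, rfl⟩ hF hb
    simp only [BExpr.holds, NExpr.eval, hk, hbd τ hF] at hb
    rw [Finset.sum_eq_sum_Ico_succ_bot hb, hcost]
    refine ⟨∑ i ∈ Finset.Ico (k + 1) hi, (f i + (bd.cost + 2)), f k, by omega,
      (hs k τ hk hk1 hb hJ hF).mono le_rfl ?_⟩
    rintro ρ ⟨h1, h2⟩ -
    exact ⟨k + 1, h1, by omega, by omega, h2, rfl⟩

theorem Frame.of_nset {x : ℕ} {e : NExpr} {body : Prog} {σ τ : State}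
    (h : Frame body (Prog.eff (.nset x e) σ) τ) : Frame (.seq (.nset x e) body) σ τ := by
  refine ⟨fun y hy => ?_, fun y hy => ?_, fun y hy => ?_, fun y hy => ?_⟩ <;>
    simp only [Prog.nvars, Prog.rvars, Prog.narrs, Prog.rarrs, List.mem_append, not_or,
      List.mem_singleton] at hy
  · exact (h.nvar y hy.2).trans (Function.update_of_ne hy.1 _ _)
  · exact h.rvar y hy.2
  · exact h.narr y hy.2
  · exact h.rarr y hy.2

/-- A counting loop with variable costs, including the initialization of the counter. -/
theorem Runs.forSum {x : ℕ} {e bd : NExpr} {body : Prog} {σ : State} (J : ℕ → State → Prop)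
    (f : ℕ → ℕ) (lo hi : ℕ) (he : e.eval σ = lo) (hx : lo ≤ hi) (h0 : J lo (Prog.eff (.nset x e) σ))
    (hbd : ∀ τ, Frame (.seq (.nset x e) body) σ τ → bd.eval τ = hi)
    (hs : ∀ k τ, τ.nvar x = k → lo ≤ k → k < hi → J k τ → Frame (.seq (.nset x e) body) σ τ →
      Runs body τ (f k) fun ρ => ρ.nvar x = k + 1 ∧ J (k + 1) ρ) :
    Runs (.seq (.nset x e) (.loop (.nlt (.var x) bd) body)) σ
      (∑ i ∈ Finset.Ico lo hi, (f i + (bd.cost + 2)) + (e.cost + bd.cost + 3))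
      fun τ => τ.nvar x = hi ∧ J hi τ := by
  have ex : (Prog.eff (.nset x e) σ).nvar x = lo := by simp [Prog.eff, he]
  refine (Runs.seq (c := e.cost + 1)
    (c' := ∑ i ∈ Finset.Ico lo hi, (f i + (bd.cost + 2)) + (bd.cost + 2)) (Q' := fun τ => τ = Prog.eff (.nset x e) σ)
    (Runs.eff rfl le_rfl rfl) ?_).mono (by omega) fun τ h _ => h
  rintro τ rfl -
  refine (Runs.loopSum J f hi (by rwa [ex]) (by rwa [ex]) (fun τ hF => hbd τ hF.of_nset)
    fun k τ h1 h2 h3 h4 h5 => hs k τ h1 (ex ▸ h2) h3 h4 h5.of_nset).mono (by rw [ex]) ?_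
  rintro τ ⟨h1, h2, -⟩ -
  exact ⟨h1, h2⟩

theorem Runs.for {x : ℕ} {e bd : NExpr} {body : Prog} {σ : State} (J : ℕ → State → Prop)
    (C lo hi : ℕ) (he : e.eval σ = lo) (hx : lo ≤ hi) (h0 : J lo (Prog.eff (.nset x e) σ))
    (hbd : ∀ τ, Frame (.seq (.nset x e) body) σ τ → bd.eval τ = hi)
    (hs : ∀ k τ, τ.nvar x = k → lo ≤ k → k < hi → J k τ → Frame (.seq (.nset x e) body) σ τ →
      Runs body τ C fun ρ => ρ.nvar x = k + 1 ∧ J (k + 1) ρ) :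
    Runs (.seq (.nset x e) (.loop (.nlt (.var x) bd) body)) σ
      ((C + (bd.cost + 2)) * (hi - lo) + (e.cost + bd.cost + 3))
      fun τ => τ.nvar x = hi ∧ J hi τ := by
  have := Runs.forSum J (fun _ => C) lo hi he hx h0 hbd hs
  rw [Finset.sum_const, Nat.card_Ico, smul_eq_mul, mul_comm] at this
  exact this

infixr:60 " ;; " => Prog.seq

/-! ### Memory layout of the lines -/

/-- The lines are in the input arrays. -/
structure Coeffs {n : ℕ} (L : Fin n → LineEq) (σ : State) : Prop where
  n_eq : σ.nvar 0 = n
  a_eq : ∀ i : Fin n, σ.rarr 0 i = (L i).a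
  b_eq : ∀ i : Fin n, σ.rarr 1 i = (L i).b
  c_eq : ∀ i : Fin n, σ.rarr 2 i = (L i).c

/-- The line `l` is the current line. -/
structure Current (l : LineEq) (σ : State) : Prop where
  a_eq : σ.rvar 0 = l.a
  b_eq : σ.rvar 1 = l.b
  c_eq : σ.rvar 9 = l.c

theorem Coeffs.frame {n : ℕ} {L : Fin n → LineEq} {P : Prog} {σ τ : State} (h : Coeffs L σ)
    (hF : Frame P σ τ) (h0 : 0 ∉ P.nvars) (h1 : 0 ∉ P.rarrs) (h2 : 1 ∉ P.rarrs)
    (h3 : 2 ∉ P.rarrs) : Coeffs L τ := by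
  refine ⟨(hF.nvar 0 h0).trans h.n_eq, fun i => ?_, fun i => ?_, fun i => ?_⟩
  · rw [hF.rarr 0 h1, h.a_eq]
  · rw [hF.rarr 1 h2, h.b_eq]
  · rw [hF.rarr 2 h3, h.c_eq]

theorem Current.frame {l : LineEq} {P : Prog} {σ τ : State} (h : Current l σ) (hF : Frame P σ τ)
    (h0 : 0 ∉ P.rvars) (h1 : 1 ∉ P.rvars) (h2 : 9 ∉ P.rvars) : Current l τ :=
  ⟨(hF.rvar 0 h0).trans h.a_eq, (hF.rvar 1 h1).trans h.b_eq, (hF.rvar 9 h2).trans h.c_eq⟩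

/-- The list `s` is in the integer array `k`, from position `o` on. -/
def Stored {n : ℕ} (k o : ℕ) (s : List (Fin n)) (σ : State) : Prop :=
  ∀ i (h : i < s.length), σ.narr k (i + o) = (s[i] : ℕ)

def alE (k : NExpr) : RExpr := .sub (.mul (.get 0 k) (.var 1)) (.mul (.get 1 k) (.var 0))
def beE (k : NExpr) : RExpr := .add (.mul (.get 0 k) (.var 0)) (.mul (.get 1 k) (.var 1))
def gaE (k : NExpr) : RExpr :=
  .sub (.mul (.add (.mul (.var 0) (.var 0)) (.mul (.var 1) (.var 1))) (.get 2 k))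
    (.mul (.var 9) (beE k))

section

variable {n : ℕ} {L : Fin n → LineEq} {l : LineEq} {σ : State} {k : NExpr} {i : Fin n}

theorem eval_alE (h : Coeffs L σ) (hl : Current l σ) (hk : k.eval σ = i) :
    (alE k).eval σ = l.al (L i) := by
  simp only [alE, RExpr.eval, hk, h.a_eq, h.b_eq, hl.a_eq, hl.b_eq, LineEq.al]

theorem eval_beE (h : Coeffs L σ) (hl : Current l σ) (hk : k.eval σ = i) :
    (beE k).eval σ = l.be (L i) := by
  simp only [beE, RExpr.eval, hk, h.a_eq, h.b_eq, hl.a_eq, hl.b_eq, LineEq.be]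

theorem eval_gaE (h : Coeffs L σ) (hl : Current l σ) (hk : k.eval σ = i) :
    (gaE k).eval σ = l.ga (L i) := by
  simp only [gaE, RExpr.eval, hk, h.c_eq, hl.a_eq, hl.b_eq, hl.c_eq, LineEq.ga, LineEq.nsq,
    eval_beE h hl hk]

end

/-! ## Local coordinates of the lines -/

/-- Positions are counted from `1`; index `0` represents an empty chain. Arrays `9, 10, 11` hold
`X`, `S`, `-S` by position from the left, arrays `12, 13, 14` the mirror images `-X`, `-S`, `S` by
position from the right. The third array of each triple serves the lower halves of the faces. -/
def crossingBody : Prog :=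
  .rset 6 (.div (gaE (.get 5 (.add (.var 5) (.const 1)))) (alE (.get 5 (.add (.var 5) (.const 1)))))
  ;; .rset 7 (.div (beE (.get 5 (.add (.var 5) (.const 1)))) (alE (.get 5 (.add (.var 5) (.const 1)))))
  ;; .rput 9 (.add (.var 5) (.const 1)) (.var 6)
  ;; .rput 10 (.add (.var 5) (.const 1)) (.sub (.const 0) (.var 7))
  ;; .rput 11 (.add (.var 5) (.const 1)) (.var 7)
  ;; .rput 12 (.sub (.var 1) (.var 5)) (.sub (.const 0) (.var 6))
  ;; .rput 13 (.sub (.var 1) (.var 5)) (.var 7)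
  ;; .rput 14 (.sub (.var 1) (.var 5)) (.sub (.const 0) (.var 7))
  ;; .nput 6 (.sub (.var 1) (.var 5)) (.get 5 (.add (.var 5) (.const 1)))
  ;; .nset 5 (.add (.var 5) (.const 1))

def crossings : Prog := .nset 5 (.const 0) ;; .loop (.nlt (.var 5) (.var 1)) crossingBody

structure CrossingAt {n : ℕ} (L : Fin n → LineEq) (l : LineEq) (s : List (Fin n)) (k : ℕ)
    (hk : k < s.length) (τ : State) : Prop where
  X : τ.rarr 9 (k + 1) = l.Xof (L s[k])
  S : τ.rarr 10 (k + 1) = l.Sof (L s[k])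
  nS : τ.rarr 11 (k + 1) = -l.Sof (L s[k])
  Xr : τ.rarr 12 (s.length - k) = -l.Xof (L s[k])
  Sr : τ.rarr 13 (s.length - k) = -l.Sof (L s[k])
  nSr : τ.rarr 14 (s.length - k) = l.Sof (L s[k])
  ordR : τ.narr 6 (s.length - k) = (s[k] : ℕ)

theorem CrossingAt.frame {n : ℕ} {L : Fin n → LineEq} {l : LineEq} {s : List (Fin n)} {k : ℕ}
    {hk : k < s.length} {P : Prog} {σ τ : State} (h : CrossingAt L l s k hk σ) (hF : Frame P σ τ)
    (h1 : ∀ a ∈ [9, 10, 11, 12, 13, 14], a ∉ P.rarrs) (h2 : 6 ∉ P.narrs) :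
    CrossingAt L l s k hk τ := by
  obtain ⟨c1, c2, c3, c4, c5, c6, c7⟩ := h
  refine ⟨?_, ?_, ?_, ?_, ?_, ?_, by rwa [hF.narr 6 h2]⟩ <;> rwa [hF.rarr _ (h1 _ (by decide))]

/-- The slopes are stored with both signs. -/
structure NegArrays (τ : State) : Prop where
  left : ∀ v, τ.rarr 11 v = -τ.rarr 10 v
  right : ∀ v, τ.rarr 14 v = -τ.rarr 13 v

theorem NegArrays.frame {P : Prog} {σ τ : State} (h : NegArrays σ) (hF : Frame P σ τ)
    (h1 : ∀ a ∈ [10, 11, 13, 14], a ∉ P.rarrs) : NegArrays τ := by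
  obtain ⟨c1, c2⟩ := h
  constructor
  · rwa [hF.rarr 11 (h1 _ (by decide)), hF.rarr 10 (h1 _ (by decide))]
  · rwa [hF.rarr 14 (h1 _ (by decide)), hF.rarr 13 (h1 _ (by decide))]

/-- The relation is kept at all indices, also at unused ones, because `Geo.rot` negates the whole
sequence of slopes. -/
theorem NegArrays.crossingBody {τ : State} (h : NegArrays τ) : NegArrays (crossingBody.eff τ) := by
  constructor <;> intro v
  · by_cases hv : v = τ.nvar 5 + 1 <;>
      simp [ZoneRAM.crossingBody, Prog.eff, NExpr.eval, RExpr.eval, hv, h.left]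
  · by_cases hv : v = τ.nvar 1 - τ.nvar 5 <;>
      simp [ZoneRAM.crossingBody, Prog.eff, NExpr.eval, RExpr.eval, hv, h.right]

theorem crossings_spec {n : ℕ} {L : Fin n → LineEq} {l : LineEq} {s : List (Fin n)} {σ : State}
    (hL : Coeffs L σ) (hl : Current l σ) (hs : Stored 5 1 s σ) (hm : σ.nvar 1 = s.length)
    (hn : NegArrays σ) :
    Runs crossings σ (150 * s.length + 10) fun τ =>
      NegArrays τ ∧ ∀ k hk, CrossingAt L l s k hk τ := by
  refine (Runs.for (bd := .var 1) (fun k τ => NegArrays τ ∧ ∀ i hi, i < k → CrossingAt L l s i hi τ)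
    130 0 s.length rfl (Nat.zero_le _) ⟨⟨hn.1, hn.2⟩, by omega⟩ (fun τ hF => (hF.nvar 1 (by decide)).trans hm)
    fun k τ hk _ hks hJ hF => ?_).mono (by simp only [NExpr.cost]; omega)
    fun τ h _ => ⟨h.2.1, fun k hk => h.2.2 k hk hk⟩
  have hL' := hL.frame hF (by decide) (by decide) (by decide) (by decide)
  have hl' := hl.frame hF (by decide) (by decide) (by decide)
  have hm' : τ.nvar 1 = s.length := (hF.nvar 1 (by decide)).trans hm
  have hs' : τ.narr 5 (k + 1) = (s[k] : ℕ) := by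
    rw [hF.narr 5 (by decide)]; exact hs k hks
  refine Runs.eff rfl (Nat.le_of_ble_eq_true rfl) ⟨?_, hJ.1.crossingBody, fun i hi hik => ?_⟩
  · simp [crossingBody, Prog.eff, NExpr.eval, hk]
  · have ek : (NExpr.get 5 (.add (.var 5) (.const 1))).eval τ = (s[k] : ℕ) := by
      simpa [NExpr.eval, hk] using hs'
    rcases Nat.lt_succ_iff_lt_or_eq.1 hik with h | rfl
    · have h1 := hJ.2 i hi h
      have h2 : i ≠ k := by omega
      have h3 : s.length - i ≠ s.length - k := by omega
      constructor <;>
      simp [crossingBody, Prog.eff, NExpr.eval, hk, hm', h2, h3, h1.X, h1.S,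
        h1.nS, h1.Xr, h1.Sr, h1.nSr, h1.ordR]
    · have hl'' : ∀ x, Current l ⟨τ.nvar, Function.update τ.rvar 6 x, τ.narr, τ.rarr⟩ :=
        fun x => ⟨hl'.1, hl'.2, hl'.3⟩
      have hL'' : ∀ x, Coeffs L ⟨τ.nvar, Function.update τ.rvar 6 x, τ.narr, τ.rarr⟩ :=
        fun x => ⟨hL'.1, hL'.2, hL'.3, hL'.4⟩
      have e1 := fun x => eval_alE (k := .get 5 (.add (.var 5) (.const 1))) (hL'' x) (hl'' x) ek
      have e2 := fun x => eval_beE (k := .get 5 (.add (.var 5) (.const 1))) (hL'' x) (hl'' x) ek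
      constructor <;>
      simp [crossingBody, Prog.eff, NExpr.eval, RExpr.eval, hk, hm',
        eval_gaE hL' hl' ek, eval_alE hL' hl' ek, e1, e2,
        LineEq.Xof, LineEq.Sof, hs', neg_div]

/-- `be / ga` is the inverse of the height of a parallel. With inverses the nearest line on either
side is a maximum, and `0` stands for a missing bound. -/
def parallelBody : Prog :=
  .ite (.req (alE (.var 5)) (.const 0))
    (.rset 5 (.div (beE (.var 5)) (gaE (.var 5)))
      ;; .ite (.rlt (.var 3) (.var 5)) (.rset 3 (.var 5) ;; .nset 14 (.var 5)) .skip
      ;; .ite (.rlt (.var 4) (.sub (.const 0) (.var 5)))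
        (.rset 4 (.sub (.const 0) (.var 5)) ;; .nset 15 (.var 5)) .skip)
    .skip
  ;; .nset 5 (.add (.var 5) (.const 1))

def parallels : Prog :=
  (.rset 3 (.const 0) ;; .rset 4 (.const 0))
    ;; .nset 5 (.const 0) ;; .loop (.nlt (.var 5) (.var 0)) parallelBody

/-- The maximum over the first `k` lines. -/
structure ParMaxBelow {n : ℕ} (L : Fin n → LineEq) (l : LineEq) (σ w : ℝ) (h k : ℕ) : Prop where
  nonneg : 0 ≤ w
  le : ∀ i : Fin n, (i : ℕ) < k → l.al (L i) = 0 → σ * (l.be (L i) / l.ga (L i)) ≤ w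
  attained : 0 < w → ∃ i : Fin n, (i : ℕ) = h ∧ l.al (L i) = 0 ∧
    σ * (l.be (L i) / l.ga (L i)) = w

section

variable {n : ℕ} {L : Fin n → LineEq} {l : LineEq} {σ w : ℝ} {h k : ℕ}

theorem ParMaxBelow.skip (H : ParMaxBelow L l σ w h k)
    (hk : ∀ i : Fin n, (i : ℕ) = k → l.al (L i) = 0 → σ * (l.be (L i) / l.ga (L i)) ≤ w) :
    ParMaxBelow L l σ w h (k + 1) :=
  ⟨H.nonneg, fun i hi h0 => (Nat.lt_succ_iff_lt_or_eq.1 hi).elim (fun h1 => H.le i h1 h0)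
    fun h1 => hk i h1 h0, H.attained⟩

theorem ParMaxBelow.set (H : ParMaxBelow L l σ w h k) (i : Fin n) (hi : (i : ℕ) = k)
    (h0 : l.al (L i) = 0) (hw : w < σ * (l.be (L i) / l.ga (L i))) :
    ParMaxBelow L l σ (σ * (l.be (L i) / l.ga (L i))) k (k + 1) := by
  refine ⟨H.nonneg.trans hw.le, fun i' hi' h0' => ?_, fun _ => ⟨i, hi, h0, rfl⟩⟩
  rcases Nat.lt_succ_iff_lt_or_eq.1 hi' with h1 | h1
  · exact (H.le i' h1 h0').trans hw.le
  · rw [Fin.ext (h1.trans hi.symm)]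

theorem parallels_spec {σ : State} (hL : Coeffs L σ) (hl : Current l σ) :
    Runs parallels σ (150 * n + 20) fun τ =>
      ParMax L l 1 (τ.rvar 3) (τ.nvar 14) ∧ ParMax L l (-1) (τ.rvar 4) (τ.nvar 15) := by
  refine (Runs.seq (c := 4) (c' := 150 * n + 10) (Q' := fun τ => τ.rvar 3 = 0 ∧ τ.rvar 4 = 0)
    (Runs.eff rfl (Nat.le_of_ble_eq_true rfl) ?_) ?_).mono (by omega) fun τ h _ => h
  · simp [Prog.eff, RExpr.eval]
  rintro τ ⟨h3, h4⟩ hF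
  replace hL := hL.frame hF (by decide) (by decide) (by decide) (by decide)
  replace hl := hl.frame hF (by decide) (by decide) (by decide)
  clear hF
  refine (Runs.for (bd := .var 0) (fun k τ => ParMaxBelow L l 1 (τ.rvar 3) (τ.nvar 14) k ∧
    ParMaxBelow L l (-1) (τ.rvar 4) (τ.nvar 15) k) 130 0 n rfl (Nat.zero_le _) ?_
    (fun τ hF => (hF.nvar 0 (by decide)).trans hL.n_eq) fun k τ hk _ hkn hJ hF => ?_).mono
    (by simp only [NExpr.cost]; omega) fun τ h _ => ?_
  · simp only [Prog.eff, h3, h4]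
    exact ⟨⟨le_rfl, fun i hi => by omega, fun h => absurd h (lt_irrefl _)⟩,
      ⟨le_rfl, fun i hi => by omega, fun h => absurd h (lt_irrefl _)⟩⟩
  · have hL' := hL.frame hF (by decide) (by decide) (by decide) (by decide)
    have hl' := hl.frame hF (by decide) (by decide) (by decide)
    have ek : (NExpr.var 5).eval τ = (⟨k, hkn⟩ : Fin n) := hk
    have h1 : (alE (.var 5)).eval τ = _ := eval_alE hL' hl' ek
    have h2 : (beE (.var 5)).eval τ = _ := eval_beE hL' hl' ek
    have h3 : (gaE (.var 5)).eval τ = _ := eval_gaE hL' hl' ek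
    refine Runs.eff rfl (Nat.le_of_ble_eq_true rfl) ?_
    obtain ⟨J1, J2⟩ := hJ
    simp only [parallelBody, Prog.eff, BExpr.holds, RExpr.eval, NExpr.eval, h1, h2, h3, hk]
    by_cases h0 : l.al (L ⟨k, hkn⟩) = 0
    · generalize hr : l.be (L ⟨k, hkn⟩) / l.ga (L ⟨k, hkn⟩) = r
      have K1 : ∀ {σ w h}, ParMaxBelow L l σ w h k → ¬ w < σ * r → ParMaxBelow L l σ w h (k + 1) :=
        fun H hw => H.skip fun i hi _ => by
          obtain rfl : i = ⟨k, hkn⟩ := Fin.ext hi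
          rw [hr]; exact not_lt.1 hw
      have K2 : ∀ {σ w h}, ParMaxBelow L l σ w h k → w < σ * r → ParMaxBelow L l σ (σ * r) k (k + 1) :=
        fun H hw => hr ▸ H.set ⟨k, hkn⟩ rfl h0 (hr.symm ▸ hw)
      by_cases c1 : τ.rvar 3 < r <;> by_cases c2 : τ.rvar 4 < -r <;>
        simp [h0, c1, c2, hk]
      · exact ⟨by simpa using K2 J1 (by simpa using c1), by simpa using K2 J2 (by simpa using c2)⟩
      · exact ⟨by simpa using K2 J1 (by simpa using c1), K1 J2 (by simpa using c2)⟩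
      · exact ⟨K1 J1 (by simpa using c1), by simpa using K2 J2 (by simpa using c2)⟩
      · exact ⟨K1 J1 (by simpa using c1), K1 J2 (by simpa using c2)⟩
    · have K3 : ∀ i : Fin n, (i : ℕ) = k → l.al (L i) ≠ 0 := fun i hi h1 =>
        h0 (by rwa [show (⟨k, hkn⟩ : Fin n) = i from Fin.ext hi.symm])
      simp only [Rat.cast_zero, h0, if_false, Function.update_self]
      exact ⟨by rw [hk], J1.skip fun i hi h1 => absurd h1 (K3 i hi),
        J2.skip fun i hi h1 => absurd h1 (K3 i hi)⟩
  · exact ⟨⟨h.2.1.1, fun i => h.2.1.2 i i.2, h.2.1.3⟩, ⟨h.2.2.1, fun i => h.2.2.2 i i.2, h.2.2.3⟩⟩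

end


/-! ## A parallel line close to the given one -/

def lowerBody (bound : RExpr) : Prog :=
  .rset 5 bound ;; .ite (.rlt (.var 5) (.var 10)) (.rset 10 (.var 5)) .skip

/-- Two neighbours that approach each other upwards meet at height `(X' - X) / (S - S')`; half of it
leaves them strictly ordered. Similarly `heightInit` stays at half the height of the lowest parallel
above `l`. The ties recorded in array `7` refer to the original line `l`. -/
def heightBody : Prog :=
  .ite (.rlt (.get 10 (.add (.var 5) (.const 2))) (.get 10 (.add (.var 5) (.const 1))))
    (lowerBody (.div
      (.sub (.get 9 (.add (.var 5) (.const 2))) (.get 9 (.add (.var 5) (.const 1))))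
      (.mul (.const 2)
        (.sub (.get 10 (.add (.var 5) (.const 1))) (.get 10 (.add (.var 5) (.const 2)))))))
    .skip
  ;; .ite (.req (.get 9 (.add (.var 5) (.const 1))) (.get 9 (.add (.var 5) (.const 2))))
    (.nput 7 (.add (.var 5) (.const 1)) (.const 1)) (.nput 7 (.add (.var 5) (.const 1)) (.const 0))
  ;; .nset 5 (.add (.var 5) (.const 1))

def heightInit : Prog :=
  .rset 10 (.const 1)
  ;; .ite (.rlt (.const 0) (.var 3)) (lowerBody (.div (.const 1) (.mul (.const 2) (.var 3)))) .skip
  ;; .nput 7 (.const 0) (.const 0) ;; .nput 7 (.var 1) (.const 0)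

def height : Prog :=
  heightInit ;; (.nset 5 (.const 0) ;; .loop (.nlt (.var 5) (.sub (.var 1) (.const 1))) heightBody)
    ;; .rset 9 (.add (.var 9) (.var 10))

section

variable {n : ℕ} {L : Fin n → LineEq} {l : LineEq} {s : List (Fin n)}

theorem lt_at_lower {a b c d ε δ : ℝ} (h : a < b ∨ (a = b ∧ c < d)) (hε : a + c * ε < b + d * ε)
    (h0 : 0 < δ) (h1 : δ ≤ ε) : a + c * δ < b + d * δ := by
  rcases h with h | ⟨rfl, h⟩
  · rcases le_total c d with h5 | h5 <;> nlinarith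
  · nlinarith

/-- Neighbours suffice by transitivity, and among the parallels the one with maximal inverse height
suffices. Parallels below `l` are no obstacle to a positive height. -/
theorem goodHeight_of_adjacent (hl : ∀ i, (L i).pts ≠ l.pts) {w ε : ℝ}
    {id : ℕ} (hw : ParMax L l 1 w id) (h0 : 0 < ε) (h1 : w * ε < 1)
    (ha : ∀ i (hi : i + 1 < s.length), l.Xof (L s[i]) + l.Sof (L s[i]) * ε <
      l.Xof (L s[i + 1]) + l.Sof (L s[i + 1]) * ε) : GoodHeight L l s ε := by
  refine ⟨h0, fun i k hk hik => ?_, fun i hi => ?_⟩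
  · induction k with
    | zero => omega
    | succ k ih =>
      rcases Nat.lt_succ_iff_lt_or_eq.1 hik with h2 | rfl
      · exact (ih (by omega) h2).trans (ha k hk)
      · exact ha i hk
  · have hg := LineEq.ga_ne hi (hl i)
    have h3 : 0 < l.ga (L i) ^ 2 := sq_pos_of_ne_zero hg
    have h4 : -l.ga (L i) * (l.be (L i) * ε - l.ga (L i)) =
        l.ga (L i) ^ 2 * (1 - l.be (L i) / l.ga (L i) * ε) := by field_simp; ring
    have h5 := hw.le i hi
    rw [h4]
    refine mul_pos h3 ?_
    nlinarith

theorem lt_at_bound {a b c d ε : ℝ} (h : d < c) (h' : a < b) (hε : ε ≤ (b - a) / (2 * (c - d))) :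
    a + c * ε < b + d * ε := by
  rw [le_div_iff₀ (by linarith)] at hε
  linarith

theorem lowerBody_eff (b : RExpr) (σ : State) : (lowerBody b).eff σ =
    ⟨σ.nvar, Function.update (Function.update σ.rvar 5 (b.eval σ)) 10 (min (b.eval σ) (σ.rvar 10)),
      σ.narr, σ.rarr⟩ := by
  simp only [lowerBody, Prog.eff, BExpr.holds, RExpr.eval, Function.update_self]
  rw [Function.update_of_ne (by decide : (10 : ℕ) ≠ 5)]
  split_ifs with h
  · rw [min_eq_left h.le]
  · rw [min_eq_right (not_lt.1 h)]
    congr 1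
    rw [eq_comm, Function.update_eq_self_iff, Function.update_of_ne (by decide)]

theorem heightInit_spec {σ : State} (h0 : 0 ≤ σ.rvar 3) :
    0 < (heightInit.eff σ).rvar 10 ∧ σ.rvar 3 * (heightInit.eff σ).rvar 10 < 1 ∧
      (heightInit.eff σ).narr 7 0 = 0 ∧ (heightInit.eff σ).narr 7 (σ.nvar 1) = 0 := by
  simp only [heightInit, Prog.eff, BExpr.holds, lowerBody_eff, RExpr.eval, NExpr.eval]
  rcases h0.eq_or_lt with c1 | c1
  · simp [← c1, Function.update_apply]
  · have h2 : σ.rvar 3 * (1 / (2 * σ.rvar 3)) = 1 / 2 := by field_simp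
    have h3 : σ.rvar 3 * min (1 / (2 * σ.rvar 3)) 1 ≤ σ.rvar 3 * (1 / (2 * σ.rvar 3)) :=
      mul_le_mul_of_nonneg_left (min_le_left _ _) h0
    have h4 : 0 < min (1 / (2 * σ.rvar 3)) 1 := lt_min (by positivity) one_pos
    have h5 : σ.rvar 3 * min (1 / (2 * σ.rvar 3)) 1 < 1 := by linarith
    simpa [c1, Function.update_apply] using And.intro h4 h5

/-- The part of the goal that concerns the first `k + 1` lines. -/
structure HeightInv (L : Fin n → LineEq) (l : LineEq) (s : List (Fin n)) (w : ℝ) (k : ℕ)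
    (τ : State) : Prop where
  pos : 0 < τ.rvar 10
  par : w * τ.rvar 10 < 1
  lt : ∀ i (hi : i + 1 < s.length), i < k → l.Xof (L s[i]) + l.Sof (L s[i]) * τ.rvar 10 <
    l.Xof (L s[i + 1]) + l.Sof (L s[i + 1]) * τ.rvar 10
  tie : ∀ i (hi : i + 1 < s.length), i < k →
    (τ.narr 7 (i + 1) = 1 ↔ l.Xof (L s[i]) = l.Xof (L s[i + 1]))
  first : τ.narr 7 0 = 0
  last : τ.narr 7 s.length = 0

theorem heightBody_spec {τ : State} {w : ℝ} {k : ℕ} (hw : 0 ≤ w)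
    (hc : ∀ k hk, CrossingAt L l s k hk τ) (h : LexSorted L l s)
    (hk : τ.nvar 5 = k) (hks : k + 1 < s.length) (hJ : HeightInv L l s w k τ) :
    (heightBody.eff τ).nvar 5 = k + 1 ∧ HeightInv L l s w (k + 1) (heightBody.eff τ) := by
  obtain ⟨j1, j2, j3, j4, j5, j6⟩ := hJ
  have hlex := h.lt (Nat.lt_succ_self k) hks
  have c0 := hc k (by omega)
  have c1 := hc (k + 1) hks
  have x0 := c0.X
  have s0 := c0.S
  have x1 : τ.rarr 9 (k + 2) = _ := c1.X
  have s1 : τ.rarr 10 (k + 2) = _ := c1.S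
  have key : ∃ ε, (heightBody.eff τ).rvar 10 = ε ∧ 0 < ε ∧ ε ≤ τ.rvar 10 ∧
      l.Xof (L s[k]) + l.Sof (L s[k]) * ε < l.Xof (L s[k + 1]) + l.Sof (L s[k + 1]) * ε := by
    simp only [heightBody, Prog.eff, BExpr.holds, lowerBody_eff, RExpr.eval, NExpr.eval, hk, x0, s0,
      x1, s1]
    by_cases hS : l.Sof (L s[k + 1]) < l.Sof (L s[k])
    · have hX : l.Xof (L s[k]) < l.Xof (L s[k + 1]) := by
        rcases hlex with h1 | ⟨-, h1⟩
        · exact h1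
        · exact absurd h1 hS.not_gt
      refine ⟨min ((l.Xof (L s[k + 1]) - l.Xof (L s[k])) /
        (2 * (l.Sof (L s[k]) - l.Sof (L s[k + 1])))) (τ.rvar 10), ?_, lt_min ?_ j1,
        min_le_right _ _, lt_at_bound hS hX (min_le_left _ _)⟩
      · rw [if_pos hS]; split_ifs <;> simp
      · exact div_pos (by linarith) (by linarith)
    · refine ⟨τ.rvar 10, ?_, j1, le_rfl, ?_⟩
      · rw [if_neg hS]; split_ifs <;> simp
      · rcases hlex with h1 | ⟨h1, h2⟩ <;> nlinarith
  obtain ⟨ε, e1, e2, e3, e4⟩ := key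
  have ht : (heightBody.eff τ).narr 7 = Function.update (τ.narr 7) (k + 1)
      (if l.Xof (L s[k]) = l.Xof (L s[k + 1]) then 1 else 0) := by
    simp only [heightBody, Prog.eff, BExpr.holds, lowerBody_eff, RExpr.eval, NExpr.eval, hk, x0, s0,
      x1, s1]
    by_cases hS : l.Sof (L s[k + 1]) < l.Sof (L s[k]) <;>
      by_cases hX : l.Xof (L s[k]) = l.Xof (L s[k + 1]) <;> simp [hS, hX, hk, x0, x1]
  have hx : (heightBody.eff τ).nvar 5 = k + 1 := by
    simp only [heightBody, Prog.eff, BExpr.holds, lowerBody_eff, RExpr.eval, NExpr.eval, hk, x0, s0,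
      x1, s1]
    split_ifs <;> simp [hk]
  refine ⟨hx, by rwa [e1], ?_, fun i hi hik => ?_, fun i hi hik => ?_, ?_, ?_⟩
  · rw [e1]; exact (mul_le_mul_of_nonneg_left e3 hw).trans_lt j2
  · rw [e1]
    rcases Nat.lt_succ_iff_lt_or_eq.1 hik with h2 | rfl
    · exact lt_at_lower (h.lt (Nat.lt_succ_self i) hi) (j3 i hi h2) e2 e3
    · exact e4
  · rw [ht]
    rcases Nat.lt_succ_iff_lt_or_eq.1 hik with h2 | rfl
    · rw [Function.update_of_ne (by omega)]; exact j4 i hi h2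
    · simp
  · rw [ht, Function.update_of_ne (by omega), j5]
  · rw [ht, Function.update_of_ne (by omega), j6]

theorem height_spec {σ : State} (hl : Current l σ) (hm : σ.nvar 1 = s.length)
    (hc : ∀ k hk, CrossingAt L l s k hk σ) (h : LexSorted L l s) (hne : ∀ i, (L i).pts ≠ l.pts)
    {id : ℕ} (hw : ParMax L l 1 (σ.rvar 3) id) :
    Runs height σ (150 * s.length + 50) fun τ => GoodHeight L l s (τ.rvar 10) ∧
      Current (l.shift (τ.rvar 10)) τ ∧ ∀ j ≤ s.length, τ.narr 7 j = 1 ↔ Tie L l s j := by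
  refine (Runs.seq (c := 30) (c' := 150 * s.length + 20) (Q' := HeightInv L l s (σ.rvar 3) 0)
    (Runs.eff rfl (Nat.le_of_ble_eq_true rfl) ?_) ?_).mono (by omega) fun τ h _ => h
  · obtain ⟨h1, h2, h3, h4⟩ := heightInit_spec hw.nonneg
    exact ⟨h1, h2, fun i _ hi => by omega, fun i _ hi => by omega, h3, hm ▸ h4⟩
  intro τ hJ hF
  replace hl := hl.frame hF (by decide) (by decide) (by decide)
  replace hc := fun k hk => (hc k hk).frame hF (by decide) (by decide)
  replace hm := (hF.nvar 1 (by decide)).trans hm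
  clear hF
  refine (Runs.seq (c := 140 * (s.length - 1) + 10) (c' := 5) (Runs.mono (Runs.for
    (bd := .sub (.var 1) (.const 1)) (fun k ρ => HeightInv L l s (σ.rvar 3) k ρ) 130 0 (s.length - 1)
    rfl (Nat.zero_le _) ⟨hJ.1, hJ.2, hJ.3, hJ.4, hJ.5, hJ.6⟩ (fun ρ hF => ?_) fun k ρ hk _ hks hJ hF => ?_)
    (by simp only [NExpr.cost]; omega) fun ρ h hF => And.intro h.2 hF) fun ρ h _ =>
      Runs.eff rfl (Nat.le_of_ble_eq_true rfl) ?_).mono (by omega) fun τ h _ => h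
  · simp only [NExpr.eval, hF.nvar 1 (by decide), hm]
  · exact Runs.eff rfl (Nat.le_of_ble_eq_true rfl) (heightBody_spec hw.nonneg
      (fun k hk => (hc k hk).frame hF (by decide) (by decide)) h hk (by omega) hJ)
  · obtain ⟨⟨j1, j2, j3, j4, j5, j6⟩, hF⟩ := h
    replace hl := hl.frame hF (by decide) (by decide) (by decide)
    simp only [Prog.eff, RExpr.eval]
    rw [Function.update_of_ne (by decide)]
    refine ⟨goodHeight_of_adjacent hne hw j1 j2 fun i hi => j3 i hi (by omega),
      ⟨hl.1, hl.2, ?_⟩, fun j hj => ?_⟩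
    · simp [hl.3, LineEq.shift]
    · rcases Nat.eq_zero_or_pos j with rfl | h0
      · simp [j5, Tie]
      rcases hj.eq_or_lt with rfl | h1
      · simp [j6, Tie]
      obtain ⟨i, rfl⟩ : ∃ i, j = i + 1 := ⟨j - 1, by omega⟩
      rw [j4 i h1 (by omega)]
      exact ⟨fun h => ⟨h0, h1, h⟩, fun ⟨_, _, h⟩ => h⟩

end


/-! ## Building a hull tree -/

theorem Runs.loop_step {b : BExpr} {P : Prog} {σ : State} {c c' : ℕ} {Q Q' : State → Prop}
    (hb : b.holds σ) (h : Runs P σ c Q')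
    (h' : ∀ τ, Q' τ → Frame P σ τ → Runs (.loop b P) τ c' Q) :
    Runs (.loop b P) σ (b.cost + c + c') Q := by
  obtain ⟨t, τ, h1, h2, h3⟩ := h
  obtain ⟨s, ρ, h4, h5, h6⟩ := h' τ h3 h1.frame
  exact ⟨_, ρ, .loop_step hb h1 h4, by omega, h6⟩

theorem Runs.loop_stop {b : BExpr} {P : Prog} {σ : State} {Q : State → Prop}
    (hb : ¬ b.holds σ) (h : Q σ) : Runs (.loop b P) σ b.cost Q :=
  ⟨_, σ, Exec.loop_stop hb, le_rfl, h⟩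

section

variable (x s nx cl : ℕ)

/-- The place where the functions number `var 6` and `var 5 + 1` agree. -/
def meetE : RExpr :=
  .div (.sub (.get s (.var 6)) (.get s (.add (.var 5) (.const 1))))
    (.sub (.get x (.add (.var 5) (.const 1))) (.get x (.var 6)))

def searchTest : BExpr :=
  .and (.nlt (.const 1) (.var 6)) (.not (.rlt (.get cl (.var 6)) (.var 5)))

def searchBody : Prog := .nset 6 (.get nx (.var 6)) ;; .rset 5 (meetE x s)

def hullBody : Prog :=
  (.nset 6 (.var 5) ;; .rset 5 (meetE x s)) ;; .loop (searchTest cl) (searchBody x s nx)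
  ;; (.nput nx (.add (.var 5) (.const 1)) (.var 6) ;; .rput cl (.add (.var 5) (.const 1)) (.var 5)
    ;; .nset 5 (.add (.var 5) (.const 1)))

/-- Graham's scan in which discarded functions remain in memory and the stack is replaced by
pointers. The entries `0` and `1` of `cl` have no break point; their value `0` makes every walk stop
there. -/
def hull : Prog :=
  (.rput cl (.const 0) (.const 0) ;; .rput cl (.const 1) (.const 0) ;; .nset 5 (.const 1))
  ;; .loop (.nlt (.var 5) (.var 1)) (hullBody x s nx cl)

end

variable {x s nx cl : ℕ}

/-- The tree is stored in the arrays `nx` and `cl`. -/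
structure HullAt (x s nx cl m : ℕ) (τ : State) : Prop where
  tree : HullTree (τ.rarr x) (τ.rarr s) (τ.narr nx) m
  brk : ∀ p, 2 ≤ p → p ≤ m → τ.rarr cl p = brk (τ.rarr x) (τ.rarr s) (τ.narr nx) p
  zero : τ.rarr cl 0 = 0
  one : τ.rarr cl 1 = 0

/-- `dep` is the depth in the tree. Every search step ascends by one level, so the number `d` of
steps is bounded by the loss of depth. -/
theorem search_spec {m : ℕ} {dep : ℕ → ℕ} {σ : State} (h : HullAt x s nx cl m σ)
    (hd : ∀ p, 2 ≤ p → p ≤ m → dep p = dep (σ.narr nx p) + 1)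
    (hX : ∀ i, 1 ≤ i → i ≤ m → σ.rarr x i < σ.rarr x (m + 1)) (h5 : σ.nvar 5 = m) (p : ℕ)
    (h6 : σ.nvar 6 = p) (hs : Search (σ.rarr x) (σ.rarr s) (σ.narr nx) m p)
    (hr : σ.rvar 5 = meet (σ.rarr x) (σ.rarr s) p (m + 1)) :
    ∃ p' d, d + dep p' ≤ dep p ∧ Runs (.loop (searchTest cl) (searchBody x s nx)) σ (30 * d + 10)
      fun τ => τ.nvar 6 = p' ∧ Search (σ.rarr x) (σ.rarr s) (σ.narr nx) m p' ∧
        τ.rvar 5 = meet (σ.rarr x) (σ.rarr s) p' (m + 1) ∧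
        (2 ≤ p' → brk (σ.rarr x) (σ.rarr s) (σ.narr nx) p' <
          meet (σ.rarr x) (σ.rarr s) p' (m + 1)) := by
  induction p using Nat.strong_induction_on generalizing σ with
  | _ p ih =>
    have hpm := h.tree.anc_le le_rfl hs.1
    have hcost : (searchTest cl).cost = 9 := rfl
    have hb : (searchTest cl).holds σ ↔ 2 ≤ p ∧
        meet (σ.rarr x) (σ.rarr s) p (m + 1) ≤ σ.rarr cl p := by
      simp only [searchTest, BExpr.holds, NExpr.eval, RExpr.eval, h6, hr, not_lt]; rfl
    by_cases hc : 2 ≤ p ∧ meet (σ.rarr x) (σ.rarr s) p (m + 1) ≤ σ.rarr cl p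
    · obtain ⟨h2, h3⟩ := hc
      have hn := h.tree.nx_lt p h2 hpm
      rw [h.brk p h2 hpm] at h3
      obtain ⟨p', d, h7, h8⟩ := ih (σ.narr nx p) hn.2 (σ := (searchBody x s nx).eff σ)
        ⟨h.1, h.2, h.3, h.4⟩ hd hX h5 (by simp [searchBody, Prog.eff, NExpr.eval, h6])
        (hs.next h.tree hX h2 h3)
        (by simp [searchBody, Prog.eff, NExpr.eval, RExpr.eval, meetE, h6, h5, meet])
      refine ⟨p', d + 1, by rw [hd p h2 hpm]; omega, ?_⟩
      refine (Runs.loop_step (c := 20) (c' := 30 * d + 10) (Q' := fun τ => τ = (searchBody x s nx).eff σ)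
        (hb.2 ⟨h2, by rwa [h.brk p h2 hpm]⟩) (Runs.eff rfl (Nat.le_of_ble_eq_true rfl) rfl)
        (fun τ hτ _ => hτ ▸ h8)).mono (by omega) fun τ hτ _ => hτ
    · refine ⟨p, 0, by omega, (Runs.loop_stop (mt hb.1 hc) ⟨h6, hs, hr, fun h2 => ?_⟩).mono
        (by omega) fun τ hτ _ => hτ⟩
      rw [← h.brk p h2 hpm]
      exact not_le.1 fun h3 => hc ⟨h2, h3⟩

theorem hull_spec {m : ℕ} {σ : State} (hm : σ.nvar 1 = m) (h1 : cl ≠ x) (h2 : cl ≠ s)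
    (hX : ∀ i k, 1 ≤ i → i < k → k ≤ m → σ.rarr x i < σ.rarr x k) :
    Runs (hull x s nx cl) σ (100 * m + 20) fun τ => HullAt x s nx cl m τ := by
  refine (Runs.seq (c := 10) (c' := 100 * m + 10)
    (Q' := fun τ => τ.nvar 5 = 1 ∧ τ.rarr cl 0 = 0 ∧ τ.rarr cl 1 = 0)
    (Runs.eff rfl (Nat.le_of_ble_eq_true rfl) ?_) ?_).mono (by omega) fun τ h _ => h
  · simp [Prog.eff, NExpr.eval, RExpr.eval]
  rintro σ' ⟨h5, hz, ho⟩ hF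
  have ex : σ'.rarr x = σ.rarr x := hF.rarr x (by simpa [Prog.rarrs] using h1.symm)
  replace hm := (hF.nvar 1 (by simp [Prog.nvars])).trans hm
  rw [← ex] at hX
  clear hF ex
  -- The potential is `80` for every function still to come and `30` for every level above the
  -- current node: a search step costs at most `30` and removes a level, and an insertion adds one.
  -- The bound `max m 1` covers `m = 0`, where the loop leaves the tree with the single node `1`.
  refine (Runs.while (φ := 80 * (m - 1)) (fun φ τ => ∃ k dep, τ.nvar 5 = k ∧ 1 ≤ k ∧ k ≤ max m 1 ∧
    HullAt x s nx cl k τ ∧ (∀ p, 2 ≤ p → p ≤ k → dep p = dep (τ.narr nx p) + 1) ∧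
    φ = 80 * (m - k) + 30 * dep k) ⟨1, fun _ => 0, h5, le_rfl, le_max_right _ _,
      ⟨HullTree.one _ _ _, fun p _ _ => by omega, hz, ho⟩, fun p _ _ => by omega, ?_⟩ ?_).mono ?_ ?_
  · simp
  · rintro φ τ ⟨k, dep, hk, hk1, hkm, hH, hd, rfl⟩ hF hb
    have hm' : τ.nvar 1 = m := (hF.nvar 1 (by simp [Prog.nvars, hullBody, searchBody])).trans hm
    have hrx : τ.rarr x = σ'.rarr x :=
      hF.rarr x (by simpa [Prog.rarrs, hullBody, searchBody] using h1.symm)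
    simp only [BExpr.holds, NExpr.eval, hk, hm'] at hb
    have hX' : ∀ i, 1 ≤ i → i ≤ k → τ.rarr x i < τ.rarr x (k + 1) := fun i hi hik => by
      rw [hrx]; exact hX i (k + 1) hi (by omega) (by omega)
    obtain ⟨p, d, h6, h7⟩ := search_spec (σ := (Prog.nset 6 (.var 5) ;; .rset 5 (meetE x s)).eff τ)
      (m := k) ⟨hH.1, hH.2, hH.3, hH.4⟩ hd hX' hk k (by simp [Prog.eff, NExpr.eval, hk])
      (Search.init hk1) (by simp [Prog.eff, NExpr.eval, RExpr.eval, meetE, hk, meet])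
    refine ⟨80 * (m - (k + 1)) + 30 * (dep p + 1), 30 * d + 45, ?_, ?_⟩
    · simp only [BExpr.cost, NExpr.cost]; omega
    refine (Runs.seq (c := 20) (c' := 30 * d + 25)
      (Q' := fun ρ => ρ = (Prog.nset 6 (.var 5) ;; .rset 5 (meetE x s)).eff τ)
      (Runs.eff rfl (Nat.le_of_ble_eq_true rfl) rfl) ?_).mono (by omega) fun τ h _ => h
    rintro ρ rfl -
    refine (Runs.seq (c' := 15) (h7.mono le_rfl fun ρ h hF => And.intro h hF) ?_).mono (by omega)
      fun τ h _ => h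
    rintro ρ ⟨⟨q1, q2, q3, q4⟩, hF⟩ -
    refine Runs.eff rfl (Nat.le_of_ble_eq_true rfl) ?_
    have e1 : ρ.nvar 5 = k := (hF.nvar 5 (by simp [Prog.nvars, searchBody])).trans hk
    have e2 : ρ.narr = τ.narr := funext fun a => hF.narr a (by simp [searchBody, Prog.narrs])
    have e3 : ρ.rarr = τ.rarr := funext fun a => hF.rarr a (by simp [searchBody, Prog.rarrs])
    have hpk := hH.tree.anc_le le_rfl q2.1
    have hext := hH.tree.extend hX' q2 q4
    have f1 : ∀ i, i ≤ k → Function.update (τ.narr nx) (k + 1) p i = τ.narr nx i := fun i hi =>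
      Function.update_of_ne (by omega) _ _
    have g1 : (Prog.eff (.nput nx (.add (.var 5) (.const 1)) (.var 6) ;;
        .rput cl (.add (.var 5) (.const 1)) (.var 5) ;; .nset 5 (.add (.var 5) (.const 1))) ρ) =
        ⟨Function.update ρ.nvar 5 (k + 1), ρ.rvar,
          Function.update τ.narr nx (Function.update (τ.narr nx) (k + 1) p),
          Function.update τ.rarr cl (Function.update (τ.rarr cl) (k + 1)
            (meet (τ.rarr x) (τ.rarr s) p (k + 1)))⟩ := by
      simp only [Prog.eff, NExpr.eval, RExpr.eval, e1, e2, e3, q1, q3]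
    rw [g1]
    refine ⟨k + 1, Function.update dep (k + 1) (dep p + 1), by simp, by omega,
      by omega, ⟨?_, fun i hi hik => ?_, ?_, ?_⟩, fun i hi hik => ?_, ?_⟩
    · simpa [Function.update_of_ne h1.symm, Function.update_of_ne h2.symm] using hext
    · simp only [Function.update_self, Function.update_of_ne h1.symm, Function.update_of_ne h2.symm]
      rcases Nat.lt_succ_iff_lt_or_eq.1 (Nat.lt_succ_of_le hik) with h | rfl
      · rw [Function.update_of_ne (by omega), hH.brk i hi (by omega), brk, brk, f1 i (by omega)]
      · rw [Function.update_self, brk, Function.update_self]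
    · simp only [Function.update_self]
      rw [Function.update_of_ne (by omega)]; exact hH.zero
    · simp only [Function.update_self]
      rw [Function.update_of_ne (by omega)]; exact hH.one
    · simp only [Function.update_self]
      rcases Nat.lt_succ_iff_lt_or_eq.1 (Nat.lt_succ_of_le hik) with h | rfl
      · have := hH.tree.nx_lt i hi (by omega)
        rw [Function.update_of_ne (by omega), f1 i (by omega), Function.update_of_ne (by omega)]
        exact hd i hi (by omega)
      · rw [Function.update_self, Function.update_self, Function.update_of_ne (by omega)]
    · rw [Function.update_self]
  · simp only [BExpr.cost, NExpr.cost]; omega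
  · rintro τ ⟨⟨φ, k, dep, hk, hk1, hkm, hH, hd, -⟩, hb, hF⟩ -
    have hm' : τ.nvar 1 = m := (hF.nvar 1 (by simp [Prog.nvars, hullBody, searchBody])).trans hm
    simp only [BExpr.holds, NExpr.eval, hk, hm'] at hb
    exact ⟨hH.tree.restrict (by omega), fun p h3 h4 => hH.brk p h3 (by omega), hH.zero, hH.one⟩


/-! ## The walk along the chains of a face -/

namespace Hull

/-- A state of the walk; all functions but the current ones have been stepped past. -/
structure WalkState (A A' : Hull) (wh : ℝ) (T T' : List ℕ) (p q : ℕ) : Prop where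
  inv : WalkInv A A' wh T T' p q
  tail : ∀ v ∈ T.tail, Stepped A A' v
  tail' : ∀ v ∈ T'.tail, Stepped A' A v

variable {A A' : Hull} {wh : ℝ} {T T' : List ℕ} {p q : ℕ}

theorem WalkState.symm (h : WalkState A A' wh T T' p q) : WalkState A' A wh T' T q p :=
  ⟨h.inv.symm, h.tail', h.tail⟩

theorem WalkState.start (hA : A.Valid) (hA' : A'.Valid) (hs : Sep A A') :
    WalkState A A' wh (startList A.j) (startList A'.j) A.j A'.j := by
  refine ⟨.start hA hA' hs, fun v hv => ?_, fun v hv => ?_⟩ <;>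
    · unfold startList at hv; split_ifs at hv <;> simp at hv

theorem WalkState.length_le (hA : A.Valid) (h : WalkState A A' wh T T' p q) :
    T.length ≤ steps A A' + 1 := by
  classical
  have hnd : T.Nodup := by
    have h1 : T.IsChain (· < ·) := h.inv.side.chain.imp fun _ _ h => h.1
    exact (List.isChain_iff_pairwise.1 h1).imp fun h => h.ne
  have h2 : T.tail.toFinset ⊆ (Finset.Icc 1 A.j).filter fun k => Stepped A A' k := fun v hv => by
    rw [List.mem_toFinset] at hv
    have h3 := h.tail v hv
    have h4 := hA.anc_le le_rfl h3.1
    have h5 := h3.2.1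
    exact Finset.mem_filter.2 ⟨Finset.mem_Icc.2 ⟨by omega, h4⟩, h3⟩
  have h3 := Finset.card_le_card h2
  rw [List.toFinset_card_of_nodup (hnd.sublist (List.tail_sublist T)), List.length_tail] at h3
  have e : steps A A' = ((Finset.Icc 1 A.j).filter fun k => Stepped A A' k).card := by
    unfold steps; congr
  omega

theorem WalkState.step (hA : A.Valid) (hA' : A'.Valid) (hs : Sep A A')
    (h : WalkState A A' wh T T' p q) (hp : 2 ≤ p) (hc : 2 ≤ q → A'.brk q ≤ A.brk p)
    (hx : cross A A' p q < A.brk p) (h0 : 0 ≤ wh) (hw : wh < A.brk p) :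
    WalkState A A' wh (A.nx p :: T) T' (A.nx p) q := by
  have hx' : 1 ≤ q → A.g p (A.brk p) + A'.g q (A.brk p) < 0 := fun hq =>
    (cross_lt_iff (hs p q (by omega) (h.inv.side.bounds hA) hq (h.inv.side'.bounds hA')) (by omega)
      hq).1 hx
  refine ⟨h.inv.step hA hA' hp hc hx' (h0.trans_lt hw) hw, fun v hv => ?_, h.tail'⟩
  rcases h.inv.side.ends with ⟨h1, h2, -⟩ | ⟨h1, -⟩
  · omega
  · rw [List.tail_cons] at hv
    cases T with
    | nil => cases hv
    | cons a T =>
      obtain rfl : a = p := Option.some_injective _ h1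
      rcases List.mem_cons.1 hv with rfl | hv
      · exact stepped_of_walk hA' h.inv hp hc hx'
      · exact h.tail v hv

end Hull

/-- The arrays and variables used by a walk: data of both hulls, stacks, heights of the stacks,
the bound, and the flag for an edge at the bound. -/
structure WalkRegs where
  x : ℕ
  s : ℕ
  x' : ℕ
  s' : ℕ
  nx : ℕ
  nx' : ℕ
  cl : ℕ
  cl' : ℕ
  st : ℕ
  st' : ℕ
  tl : ℕ
  tl' : ℕ
  wv : ℕ
  fl : ℕ

structure WalkRegs.OK (W : WalkRegs) : Prop where
  st : W.st ≠ W.st'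
  nx : W.nx ≠ W.st ∧ W.nx ≠ W.st'
  nx' : W.nx' ≠ W.st ∧ W.nx' ≠ W.st'
  tl : W.tl ≠ 8 ∧ W.tl ≠ 9 ∧ W.tl ≠ W.tl' ∧ W.tl ≠ W.fl
  tl' : W.tl' ≠ 8 ∧ W.tl' ≠ 9 ∧ W.tl' ≠ W.fl
  wv : W.wv ≠ 5

section

variable (W : WalkRegs)

def pushP (st tl v : ℕ) : Prog := .nput st (.var tl) (.var v) ;; .nset tl (.add (.var tl) (.const 1))

def crossP : Prog :=
  .ite (.or (.neq (.var 8) (.const 0)) (.neq (.var 9) (.const 0))) (.rset 5 (.const 0))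
    (.rset 5 (.div (.add (.get W.s (.var 8)) (.get W.s' (.var 9)))
      (.sub (.sub (.const 0) (.get W.x (.var 8))) (.get W.x' (.var 9)))))

/-- The sweep continues while the break of one of the chains lies strictly beyond both the meeting
place of the current functions and the bound. As the bound is nonnegative, the default break `0`
never passes the test. -/
def walkTest : BExpr :=
  .or (.and (.rlt (.var 5) (.get W.cl (.var 8))) (.rlt (.var W.wv) (.get W.cl (.var 8))))
    (.and (.rlt (.var 5) (.get W.cl' (.var 9))) (.rlt (.var W.wv) (.get W.cl' (.var 9))))

def walkBody : Prog :=
  .ite (.rlt (.get W.cl (.var 8)) (.get W.cl' (.var 9)))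
    (.nset 9 (.get W.nx' (.var 9)) ;; pushP W.st' W.tl' 9)
    (.nset 8 (.get W.nx (.var 8)) ;; pushP W.st W.tl 8)
  ;; crossP W

def walkInit : Prog :=
  (.nset 8 (.var 4) ;; .nset 9 (.sub (.var 1) (.var 4)) ;; .nset W.tl (.const 0)
    ;; .nset W.tl' (.const 0))
  ;; .ite (.neq (.var 8) (.const 0)) .skip (pushP W.st W.tl 8)
  ;; .ite (.neq (.var 9) (.const 0)) .skip (pushP W.st' W.tl' 9)
  ;; crossP W

def walkFlag : Prog :=
  .ite (.and (.rlt (.var 5) (.var W.wv)) (.rlt (.const 0) (.var W.wv)))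
    (.nset W.fl (.const 1)) (.nset W.fl (.const 0))

def walk : Prog := walkInit W ;; .loop (walkTest W) (walkBody W) ;; walkFlag W

end

/-- The list `T` is on the stack `st`, the first element on top. -/
def OnStack (st tl : ℕ) (T : List ℕ) (τ : State) : Prop :=
  T.reverse = (List.range (τ.nvar tl)).map (τ.narr st)

theorem OnStack.length {st tl : ℕ} {T : List ℕ} {τ : State} (h : OnStack st tl T τ) :
    τ.nvar tl = T.length := by
  have := congrArg List.length h
  simpa using this.symm

/-- The current state of a walk. -/
structure WalkAt (W : WalkRegs) (A A' : Hull) (wh : ℝ) (T T' : List ℕ) (p q : ℕ) (τ : State) :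
    Prop where
  x : τ.rarr W.x = A.X
  s : τ.rarr W.s = A.S
  x' : τ.rarr W.x' = A'.X
  s' : τ.rarr W.s' = A'.S
  nx : τ.narr W.nx = A.nx
  nx' : τ.narr W.nx' = A'.nx
  wv : τ.rvar W.wv = wh
  cur : τ.nvar 8 = p
  cur' : τ.nvar 9 = q
  st : OnStack W.st W.tl T τ
  st' : OnStack W.st' W.tl' T' τ
  cross : τ.rvar 5 = Hull.cross A A' p q
  cl : ∀ p, p ≤ A.j → τ.rarr W.cl p = if 2 ≤ p then A.brk p else 0
  cl' : ∀ p, p ≤ A'.j → τ.rarr W.cl' p = if 2 ≤ p then A'.brk p else 0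

section

variable {W : WalkRegs} {A A' : Hull} {wh : ℝ} {T T' : List ℕ} {p q : ℕ} {τ : State}

theorem crossP_eff (A A' : Hull) (h1 : τ.rarr W.x = A.X) (h2 : τ.rarr W.s = A.S)
    (h3 : τ.rarr W.x' = A'.X) (h4 : τ.rarr W.s' = A'.S) : (crossP W).eff τ = ⟨τ.nvar,
      Function.update τ.rvar 5 (Hull.cross A A' (τ.nvar 8) (τ.nvar 9)), τ.narr, τ.rarr⟩ := by
  simp only [crossP, Prog.eff, BExpr.holds, NExpr.eval, RExpr.eval, Hull.cross, h1, h2, h3, h4]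
  split_ifs <;> simp

theorem OnStack.push {st tl v : ℕ} {T : List ℕ} (h : OnStack st tl T τ) :
    OnStack st tl (τ.nvar v :: T) ((pushP st tl v).eff τ) := by
  unfold OnStack at *
  simp only [pushP, Prog.eff, NExpr.eval, Function.update_self]
  rw [List.reverse_cons, h, List.range_succ, List.map_append]
  congr 1
  · refine List.map_congr_left fun i hi => ?_
    rw [Function.update_of_ne (by have := List.mem_range.1 hi; omega)]
  · simp

theorem OnStack.congr {st tl : ℕ} {T : List ℕ} {ρ : State} (h : OnStack st tl T τ)
    (h1 : ρ.nvar tl = τ.nvar tl) (h2 : ρ.narr st = τ.narr st) : OnStack st tl T ρ := by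
  unfold OnStack; rw [h1, h2]; exact h

theorem walkBody_left (hW : W.OK) (h : WalkAt W A A' wh T T' p q τ)
    (hc : ¬ τ.rarr W.cl p < τ.rarr W.cl' q) :
    WalkAt W A A' wh (A.nx p :: T) T' (A.nx p) q ((walkBody W).eff τ) := by
  have hρ := OnStack.push (v := 8) (τ := (Prog.nset 8 (.get W.nx (.var 8))).eff τ)
    (h.st.congr (by simp [Prog.eff, hW.tl.1]) rfl)
  have e8 : ((Prog.nset 8 (.get W.nx (.var 8))).eff τ).nvar 8 = A.nx p := by
    simp [Prog.eff, NExpr.eval, h.cur, h.nx]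
  rw [e8] at hρ
  have e : (walkBody W).eff τ =
      (crossP W).eff ((pushP W.st W.tl 8).eff ((Prog.nset 8 (.get W.nx (.var 8))).eff τ)) := by
    simp only [walkBody, Prog.eff]
    rw [if_neg (by simpa [BExpr.holds, NExpr.eval, RExpr.eval, h.cur, h.cur'] using hc)]
  have f8 : ((pushP W.st W.tl 8).eff ((Prog.nset 8 (.get W.nx (.var 8))).eff τ)).nvar 8 =
      A.nx p := by
    simp [pushP, Prog.eff, NExpr.eval, hW.tl.1.symm, h.cur, h.nx]
  have f9 : ((pushP W.st W.tl 8).eff ((Prog.nset 8 (.get W.nx (.var 8))).eff τ)).nvar 9 = q := by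
    simp [pushP, Prog.eff, NExpr.eval, hW.tl.2.1.symm, h.cur']
  rw [e, crossP_eff (τ := (pushP W.st W.tl 8).eff ((Prog.nset 8 (.get W.nx (.var 8))).eff τ)) A A' h.x
    h.s h.x' h.s', f8, f9]
  refine ⟨h.x, h.s, h.x', h.s', ?_, ?_, ?_, f8, f9, hρ.congr rfl rfl, h.st'.congr ?_ ?_,
    by simp only [Function.update_self], h.cl, h.cl'⟩
  · simp [pushP, Prog.eff, hW.nx.1, h.nx]
  · simp [pushP, Prog.eff, hW.nx'.1, h.nx']
  · simp [pushP, Prog.eff, hW.wv, h.wv]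
  · simp [pushP, Prog.eff, hW.tl'.1, hW.tl.2.2.1.symm]
  · simp [pushP, Prog.eff, hW.st.symm]

theorem walkBody_right (hW : W.OK) (h : WalkAt W A A' wh T T' p q τ)
    (hc : τ.rarr W.cl p < τ.rarr W.cl' q) :
    WalkAt W A A' wh T (A'.nx q :: T') p (A'.nx q) ((walkBody W).eff τ) := by
  have hρ := OnStack.push (v := 9) (τ := (Prog.nset 9 (.get W.nx' (.var 9))).eff τ)
    (h.st'.congr (by simp [Prog.eff, hW.tl'.2.1]) rfl)
  have e8 : ((Prog.nset 9 (.get W.nx' (.var 9))).eff τ).nvar 9 = A'.nx q := by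
    simp [Prog.eff, NExpr.eval, h.cur', h.nx']
  rw [e8] at hρ
  have e : (walkBody W).eff τ =
      (crossP W).eff ((pushP W.st' W.tl' 9).eff ((Prog.nset 9 (.get W.nx' (.var 9))).eff τ)) := by
    simp only [walkBody, Prog.eff]
    rw [if_pos (by simpa [BExpr.holds, NExpr.eval, RExpr.eval, h.cur, h.cur'] using hc)]
  have f8 : ((pushP W.st' W.tl' 9).eff ((Prog.nset 9 (.get W.nx' (.var 9))).eff τ)).nvar 9 =
      A'.nx q := by
    simp [pushP, Prog.eff, NExpr.eval, hW.tl'.2.1.symm, h.cur', h.nx']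
  have f9 : ((pushP W.st' W.tl' 9).eff ((Prog.nset 9 (.get W.nx' (.var 9))).eff τ)).nvar 8 = p := by
    simp [pushP, Prog.eff, NExpr.eval, hW.tl'.1.symm, h.cur]
  rw [e, crossP_eff (τ := (pushP W.st' W.tl' 9).eff ((Prog.nset 9 (.get W.nx' (.var 9))).eff τ)) A A'
    h.x h.s h.x' h.s', f8, f9]
  refine ⟨h.x, h.s, h.x', h.s', ?_, ?_, ?_, f9, f8, h.st.congr ?_ ?_, hρ.congr rfl rfl,
    by simp only [Function.update_self], h.cl, h.cl'⟩
  · simp [pushP, Prog.eff, hW.nx.2, h.nx]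
  · simp [pushP, Prog.eff, hW.nx'.2, h.nx']
  · simp [pushP, Prog.eff, hW.wv, h.wv]
  · simp [pushP, Prog.eff, hW.tl.2.1, hW.tl.2.2.1]
  · simp [pushP, Prog.eff, hW.st]

theorem OnStack.start {st tl v j : ℕ} (hv : τ.nvar v = j) (h0 : τ.nvar tl = 0) :
    ∃ ρ, ρ = (Prog.ite (.neq (.var v) (.const 0)) .skip (pushP st tl v)).eff τ ∧
      OnStack st tl (Hull.startList j) ρ ∧ (∀ x, x ≠ tl → ρ.nvar x = τ.nvar x) ∧
      (∀ k, k ≠ st → ρ.narr k = τ.narr k) ∧ ρ.rvar = τ.rvar ∧ ρ.rarr = τ.rarr := by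
  refine ⟨_, rfl, ?_⟩
  simp only [Prog.eff, BExpr.holds, NExpr.eval, hv, Hull.startList]
  split_ifs with h
  · exact ⟨by simp [OnStack, h0], fun _ _ => rfl, fun _ _ => rfl, rfl, rfl⟩
  · refine ⟨?_, fun x hx => Function.update_of_ne hx _ _, fun k hk => Function.update_of_ne hk _ _,
      rfl, rfl⟩
    have := OnStack.push (τ := τ) (st := st) (tl := tl) (v := v) (T := []) (by simp [OnStack, h0])
    rwa [hv] at this

theorem walkInit_spec (hW : W.OK) {m j : ℕ} {σ : State} (hm : σ.nvar 1 = m)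
    (hj : σ.nvar 4 = j)
    (hjm : j ≤ m) (h : HullAt W.x W.s W.nx W.cl m σ) (h' : HullAt W.x' W.s' W.nx' W.cl' m σ) :
    WalkAt W ⟨σ.rarr W.x, σ.rarr W.s, σ.narr W.nx, j⟩
      ⟨σ.rarr W.x', σ.rarr W.s', σ.narr W.nx', m - j⟩ (σ.rvar W.wv) (Hull.startList j)
      (Hull.startList (m - j)) j (m - j) ((walkInit W).eff σ) := by
  have key : ∀ {x s nx cl k}, HullAt x s nx cl m σ → k ≤ m → ∀ p, p ≤ k → σ.rarr cl p =
      if 2 ≤ p then (⟨σ.rarr x, σ.rarr s, σ.narr nx, k⟩ : Hull).brk p else 0 := by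
    intro x s nx cl k h hk p hp
    split_ifs with h2
    · exact h.brk p h2 (hp.trans hk)
    · rcases (by omega : p = 0 ∨ p = 1) with rfl | rfl
      · exact h.zero
      · exact h.one
  obtain ⟨w1, ⟨w2, w3⟩, ⟨w4, w5⟩, ⟨w6, w7, w8, w9⟩, ⟨w10, w11, w12⟩, w13⟩ := hW
  have e0 : (walkInit W).eff σ = (crossP W).eff
      ((Prog.ite (.neq (.var 9) (.const 0)) .skip (pushP W.st' W.tl' 9)).eff
      ((Prog.ite (.neq (.var 8) (.const 0)) .skip (pushP W.st W.tl 8)).eff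
      ((Prog.nset 8 (.var 4) ;; .nset 9 (.sub (.var 1) (.var 4)) ;; .nset W.tl (.const 0)
        ;; .nset W.tl' (.const 0)).eff σ))) := rfl
  obtain ⟨ρ₁, h1⟩ : ∃ ρ₁, ρ₁ = (Prog.nset 8 (.var 4) ;; .nset 9 (.sub (.var 1) (.var 4)) ;;
    .nset W.tl (.const 0) ;; .nset W.tl' (.const 0)).eff σ := ⟨_, rfl⟩
  have a1 : ρ₁.nvar 8 = j := by
    rw [h1]; simp [Prog.eff, NExpr.eval, w6.symm, w10.symm, hj]
  have a2 : ρ₁.nvar 9 = m - j := by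
    rw [h1]; simp [Prog.eff, NExpr.eval, w7.symm, w11.symm, hj, hm]
  have a3 : ρ₁.nvar W.tl = 0 := by
    rw [h1]; simp [Prog.eff, NExpr.eval, w8]
  have a4 : ρ₁.nvar W.tl' = 0 := by
    rw [h1]; simp [Prog.eff, NExpr.eval]
  have a5 : ρ₁.rvar = σ.rvar ∧ ρ₁.rarr = σ.rarr ∧ ρ₁.narr = σ.narr := by
    rw [h1]; exact ⟨rfl, rfl, rfl⟩
  rw [e0, ← h1]
  clear h1 e0
  obtain ⟨ρ₂, h2, b1, b2, b3, b4, b5⟩ := OnStack.start (st := W.st) (tl := W.tl) a1 a3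
  rw [← h2]
  obtain ⟨ρ₃, h3, c1, c2, c3, c4, c5⟩ := OnStack.start (st := W.st') (tl := W.tl') (v := 9)
    ((b2 _ w7.symm).trans a2) ((b2 _ w8.symm).trans a4)
  rw [← h3]
  have d1 : ρ₃.rarr = σ.rarr := c5.trans (b5.trans a5.2.1)
  have d2 : ρ₃.rvar = σ.rvar := c4.trans (b4.trans a5.1)
  have d3 : ∀ k, k ≠ W.st → k ≠ W.st' → ρ₃.narr k = σ.narr k := fun k hk hk' => by
    rw [c3 k hk', b3 k hk, a5.2.2]
  have d4 : ρ₃.nvar 8 = j := by rw [c2 _ w10.symm, b2 _ w6.symm, a1]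
  have d5 : ρ₃.nvar 9 = m - j := by rw [c2 _ w11.symm, b2 _ w7.symm, a2]
  rw [crossP_eff (τ := ρ₃) ⟨σ.rarr W.x, σ.rarr W.s, σ.narr W.nx, j⟩
    ⟨σ.rarr W.x', σ.rarr W.s', σ.narr W.nx', m - j⟩ (by rw [d1]) (by rw [d1]) (by rw [d1])
    (by rw [d1]), d4, d5]
  refine ⟨by simp only [d1], by simp only [d1], by simp only [d1], by simp only [d1], d3 _ w2 w3,
    d3 _ w4 w5, ?_, d4, d5, b1.congr (c2 _ w8) (c3 _ w1), c1, by simp only [Function.update_self],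
    fun p hp => ?_, fun p hp => ?_⟩
  · simp only; rw [Function.update_of_ne w13, d2]
  · simp only [d1]; exact key h hjm p hp
  · simp only [d1]; exact key h' (Nat.sub_le _ _) p hp

theorem walk_spec (hW : W.OK) {m j : ℕ} {σ : State} (hm : σ.nvar 1 = m) (hj : σ.nvar 4 = j)
    (hjm : j ≤ m) (h : HullAt W.x W.s W.nx W.cl m σ) (h' : HullAt W.x' W.s' W.nx' W.cl' m σ)
    (hA : A = ⟨σ.rarr W.x, σ.rarr W.s, σ.narr W.nx, j⟩)
    (hA' : A' = ⟨σ.rarr W.x', σ.rarr W.s', σ.narr W.nx', m - j⟩) (hwh : σ.rvar W.wv = wh)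
    (h0 : 0 ≤ wh) (hs : Hull.Sep A A') :
    Runs (walk W) σ (100 * (Hull.steps A A' + Hull.steps A' A) + 300) fun τ =>
      ∃ T T' p q, Hull.WalkEnd A A' wh T T' p q ∧ p ≤ A.j ∧ q ≤ A'.j ∧ OnStack W.st W.tl T τ ∧
        OnStack W.st' W.tl' T' τ ∧ T.length ≤ Hull.steps A A' + 1 ∧
        T'.length ≤ Hull.steps A' A + 1 ∧
        (τ.nvar W.fl = 1 ↔ Hull.cross A A' p q < wh ∧ 0 < wh) := by
  have vA : A.Valid := by rw [hA]; exact h.tree.restrict hjm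
  have vA' : A'.Valid := by rw [hA']; exact h'.tree.restrict (Nat.sub_le _ _)
  refine (Runs.seq (c := 60) (c' := 100 * (Hull.steps A A' + Hull.steps A' A) + 240)
    (Q' := fun τ => WalkAt W A A' wh (Hull.startList A.j) (Hull.startList A'.j) A.j A'.j τ)
    (Runs.eff rfl (Nat.le_of_ble_eq_true rfl) ?_) ?_).mono (by omega) fun τ h _ => h
  · rw [hA, hA', ← hwh]; exact walkInit_spec hW hm hj hjm h h'
  intro τ hτ _
  have hcost : (walkTest W).cost = 19 := rfl
  -- Each iteration pushes one entry onto a stack, and `WalkState.length_le` limits the stacks; the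
  -- potential counts the pushes that are still possible.
  refine (Runs.seq (c := 100 * (Hull.steps A A' + Hull.steps A' A) + 221) (c' := 19) ((Runs.while
    (φ := 100 * (Hull.steps A A' + 1 - (Hull.startList A.j).length) +
      100 * (Hull.steps A' A + 1 - (Hull.startList A'.j).length))
    (fun φ τ => ∃ T T' p q, WalkAt W A A' wh T T' p q τ ∧ Hull.WalkState A A' wh T T' p q ∧
      φ = 100 * (Hull.steps A A' + 1 - T.length) + 100 * (Hull.steps A' A + 1 - T'.length))
    ⟨_, _, _, _, hτ, .start vA vA' hs, rfl⟩ ?_).mono ?_ fun τ h _ => h) ?_).mono (by omega)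
      fun τ h _ => h
  · rintro φ ρ ⟨T, T', p, q, hρ, hst, rfl⟩ - hb
    have hp := hst.inv.side.bounds vA
    have hq := hst.inv.side'.bounds vA'
    have l1 := hst.length_le vA
    have l2 := hst.symm.length_le vA'
    have c1 := hρ.cl p hp
    have c2 := hρ.cl' q hq
    simp only [walkTest, BExpr.holds, RExpr.eval, NExpr.eval, hρ.cur, hρ.cur', hρ.cross,
      hρ.wv] at hb
    by_cases hc : ρ.rarr W.cl p < ρ.rarr W.cl' q
    -- Whichever break has passed the test, the larger one passes it too.
    · have h1 : Hull.cross A A' p q < ρ.rarr W.cl' q ∧ wh < ρ.rarr W.cl' q := by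
        rcases hb with hb | hb
        · exact ⟨hb.1.trans hc, hb.2.trans hc⟩
        · exact hb
      have h2 : 2 ≤ q := by
        by_contra h2
        rw [c2, if_neg h2] at h1
        linarith [h1.2]
      rw [c2, if_pos h2] at h1 hc
      have hst' := (hst.symm.step vA' vA hs.symm h2
        (fun h3 => by rw [c1, if_pos h3] at hc; exact hc.le) (by rw [Hull.cross_symm]; exact h1.1)
        h0 h1.2).symm
      have l3 := hst'.symm.length_le vA'
      rw [List.length_cons] at l3
      refine ⟨_, 70, ?_, Runs.eff rfl (Nat.le_of_ble_eq_true rfl) ⟨_, _, _, _,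
        walkBody_right hW hρ (by rwa [c2, if_pos h2]), hst', rfl⟩⟩
      rw [hcost, List.length_cons]; omega
    · have h1 : Hull.cross A A' p q < ρ.rarr W.cl p ∧ wh < ρ.rarr W.cl p := by
        rw [not_lt] at hc
        rcases hb with hb | hb
        · exact hb
        · exact ⟨hb.1.trans_le hc, hb.2.trans_le hc⟩
      have h2 : 2 ≤ p := by
        by_contra h2
        rw [c1, if_neg h2] at h1
        linarith [h1.2]
      have hb' := walkBody_left hW hρ hc
      rw [c1, if_pos h2] at h1 hc
      have hst' := hst.step vA vA' hs h2
        (fun h3 => by rw [c2, if_pos h3] at hc; exact not_lt.1 hc) h1.1 h0 h1.2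
      have l3 := hst'.length_le vA
      rw [List.length_cons] at l3
      refine ⟨_, 70, ?_, Runs.eff rfl (Nat.le_of_ble_eq_true rfl) ⟨_, _, _, _, hb', hst', rfl⟩⟩
      rw [hcost, List.length_cons]; omega
  · rw [hcost]; omega
  · rintro ρ ⟨⟨φ, T, T', p, q, hρ, hst, -⟩, hb, -⟩ -
    have hp := hst.inv.side.bounds vA
    have hq := hst.inv.side'.bounds vA'
    have c1 := hρ.cl p hp
    have c2 := hρ.cl' q hq
    simp only [walkTest, BExpr.holds, RExpr.eval, NExpr.eval, hρ.cur, hρ.cur', hρ.cross, hρ.wv, not_or,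
      not_and_or, not_lt, ← le_max_iff] at hb
    have key : Prog.eff (walkFlag W) ρ = ⟨Function.update ρ.nvar W.fl
        (if Hull.cross A A' p q < wh ∧ 0 < wh then 1 else 0), ρ.rvar, ρ.narr, ρ.rarr⟩ := by
      simp only [walkFlag, Prog.eff, BExpr.holds, RExpr.eval, hρ.cross, hρ.wv, Rat.cast_zero]
      split_ifs <;> rfl
    refine Runs.eff rfl (Nat.le_of_ble_eq_true rfl) ⟨T, T', p, q, hst.inv.finish vA vA' hs
      (fun h2 => ?_) (fun h2 => ?_), hp, hq, hρ.st.congr ?_ ?_, hρ.st'.congr ?_ ?_,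
      hst.length_le vA, hst.symm.length_le vA', ?_⟩
    · simpa only [c1, if_pos h2] using hb.1
    · simpa only [c2, if_pos h2] using hb.2
    · rw [key]; exact Function.update_of_ne hW.tl.2.2.2 _ _
    · rw [key]
    · rw [key]; exact Function.update_of_ne hW.tl'.2.2 _ _
    · rw [key]
    · rw [key]; simp

end


/-! ## Writing the edges of a face -/

theorem Frame.subset {P Q : Prog} {σ τ : State} (h : Frame P σ τ) (h1 : P.nvars ⊆ Q.nvars)
    (h2 : P.rvars ⊆ Q.rvars) (h3 : P.narrs ⊆ Q.narrs) (h4 : P.rarrs ⊆ Q.rarrs) : Frame Q σ τ :=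
  ⟨fun x hx => h.nvar x fun h' => hx (h1 h'), fun x hx => h.rvar x fun h' => hx (h2 h'),
   fun x hx => h.narr x fun h' => hx (h3 h'), fun x hx => h.rarr x fun h' => hx (h4 h')⟩

def emitRec (i : NExpr) (dx dy : RExpr) : Prog :=
  .nput 1 (.var 3) i ;; .rput 7 (.var 3) dx ;; .rput 8 (.var 3) dy
  ;; .nset 3 (.add (.var 3) (.const 1))

def emitBody (st ord : ℕ) (idx : NExpr) (dx dy : RExpr) : Prog :=
  .nset 7 (.get st idx) ;; emitRec (.get ord (.var 7)) dx dy ;; .nset 5 (.add (.var 5) (.const 1))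

def emitLoop (st ord : ℕ) (bd idx : NExpr) (dx dy : RExpr) : Prog :=
  .nset 5 (.const 0) ;; .loop (.nlt (.var 5) bd) (emitBody st ord idx dx dy)

/-- Write out a stack from top to bottom. -/
def emitDown (st tl ord : ℕ) (dx dy : RExpr) : Prog :=
  emitLoop st ord (.var tl) (.sub (.sub (.var tl) (.const 1)) (.var 5)) dx dy

/-- Write out a stack from bottom to top, without its lowest entry. -/
def emitUp (st tl ord : ℕ) (dx dy : RExpr) : Prog :=
  emitLoop st ord (.sub (.var tl) (.const 1)) (.add (.var 5) (.const 1)) dx dy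

def leftDx : RExpr := .sub (.const 0) (.get 10 (.var 7))
def rightDx : RExpr := .sub (.const 0) (.get 13 (.var 7))

def emitBottom : Prog :=
  .ite (.neq (.var 18) (.const 1)) (emitRec (.var 15) (.var 4) (.const 0)) .skip

def emitTop : Prog :=
  .ite (.neq (.var 17) (.const 1)) (emitRec (.var 14) (.sub (.const 0) (.var 3)) (.const 0)) .skip

/-- Counterclockwise from the top left. The stack of an upper half has the highest edge on top, that
of a lower half the lowest one, and both have the base line at the bottom. So each side is one stack
read downwards followed by the other read upwards without its lowest entry. -/
def emitRecs : Prog :=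
  emitDown 12 10 5 leftDx (.const (-1)) ;; emitUp 14 12 5 leftDx (.const (-1)) ;; emitBottom
  ;; emitDown 15 13 6 rightDx (.const 1) ;; emitUp 13 11 6 rightDx (.const 1) ;; emitTop

/-- The registers contain the data of the face. -/
structure FaceRegs (G : Geo) (id : Tag → ℕ) (τ : State) : Prop where
  S : τ.rarr 10 = G.S
  S' : τ.rarr 13 = G.S'
  wh : τ.rvar 3 = G.wh
  wd : τ.rvar 4 = G.wd
  idL : ∀ v, τ.narr 5 v = id (.L v)
  idR : ∀ v, τ.narr 6 v = id (.R v)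
  idT : τ.nvar 14 = id .T
  idB : τ.nvar 15 = id .B

theorem FaceRegs.frame {G : Geo} {id : Tag → ℕ} {P : Prog} {σ τ : State} (h : FaceRegs G id σ)
    (hF : Frame P σ τ) (h1 : 10 ∉ P.rarrs ∧ 13 ∉ P.rarrs) (h2 : 3 ∉ P.rvars ∧ 4 ∉ P.rvars)
    (h3 : 5 ∉ P.narrs ∧ 6 ∉ P.narrs) (h4 : 14 ∉ P.nvars ∧ 15 ∉ P.nvars) : FaceRegs G id τ := by
  obtain ⟨a1, a2, a3, a4, a5, a6, a7, a8⟩ := h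
  exact ⟨by rwa [hF.rarr _ h1.1], by rwa [hF.rarr _ h1.2], by rwa [hF.rvar _ h2.1],
    by rwa [hF.rvar _ h2.2], by rwa [hF.narr _ h3.1], by rwa [hF.narr _ h3.2],
    by rwa [hF.nvar _ h4.1], by rwa [hF.nvar _ h4.2]⟩

/-- The edges `D` are written from position `e` on, and the edges before are as in `N`. -/
structure Recs (G : Geo) (id : Tag → ℕ) (e : ℕ) (N : ℕ → ℕ) (D : List Tag) (τ : State) : Prop where
  count : τ.nvar 3 = e + D.length
  id_eq : ∀ k (h : k < D.length), τ.narr 1 (e + k) = id D[k]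
  dir₁ : ∀ k (h : k < D.length), τ.rarr 7 (e + k) = (G.dir D[k]).1
  dir₂ : ∀ k (h : k < D.length), τ.rarr 8 (e + k) = (G.dir D[k]).2
  old : ∀ k < e, τ.narr 1 k = N k

section

variable {G : Geo} {id : Tag → ℕ} {e : ℕ} {N : ℕ → ℕ} {D : List Tag} {σ τ : State} {t : Tag}
  {i : NExpr} {dx dy : RExpr}

theorem forall_getElem_append {α : Type*} {D : List α} {t : α} {P : ℕ → α → Prop}
    (h : ∀ k (h : k < D.length), P k D[k]) (ht : P D.length t) :
    ∀ k (h : k < (D ++ [t]).length), P k (D ++ [t])[k] := by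
  intro k hk
  rw [List.length_append, List.length_singleton] at hk
  rcases Nat.lt_succ_iff_lt_or_eq.1 hk with h1 | rfl
  · rw [List.getElem_append_left h1]; exact h k h1
  · simpa using ht

theorem Recs.emitRec (h : Recs G id e N D τ) (hi : i.eval τ = id t)
    (hx : ∀ f, dx.eval ⟨τ.nvar, τ.rvar, Function.update τ.narr 1 f, τ.rarr⟩ = (G.dir t).1)
    (hy : ∀ f g, dy.eval ⟨τ.nvar, τ.rvar, Function.update τ.narr 1 f, Function.update τ.rarr 7 g⟩ =
      (G.dir t).2) :
    Recs G id e N (D ++ [t]) ((emitRec i dx dy).eff τ) := by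
  have hF : (ZoneRAM.emitRec i dx dy).eff τ = ⟨Function.update τ.nvar 3 (e + D.length + 1), τ.rvar,
      Function.update τ.narr 1 (Function.update (τ.narr 1) (e + D.length) (id t)),
      Function.update (Function.update τ.rarr 7
        (Function.update (τ.rarr 7) (e + D.length) (G.dir t).1)) 8
        (Function.update (τ.rarr 8) (e + D.length) (G.dir t).2)⟩ := by
    simp [ZoneRAM.emitRec, Prog.eff, NExpr.eval, h.count, hi, hx, hy]
  rw [hF]
  have key : ∀ k, k < D.length → e + k ≠ e + D.length := fun k hk => by omega
  refine ⟨by simp; omega, forall_getElem_append (P := fun k t' => _ = id t') (fun k hk => ?_) ?_,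
    forall_getElem_append (P := fun k t' => _ = (G.dir t').1) (fun k hk => ?_) ?_,
    forall_getElem_append (P := fun k t' => _ = (G.dir t').2) (fun k hk => ?_) ?_, fun k hk => ?_⟩
  · simp [h.id_eq k hk, hk.ne]
  · simp
  · simp [h.dir₁ k hk, hk.ne]
  · simp
  · simp [h.dir₂ k hk, hk.ne]
  · simp
  · simp only [Function.update_self]
    rw [Function.update_of_ne (by omega), h.old k hk]

theorem frame_emitRecs (h : Frame emitRecs σ τ) (v : ℕ) (f : ℕ → ℕ) (g : ℕ → ℝ) :
    Frame emitRecs σ ⟨Function.update τ.nvar 7 v, τ.rvar, Function.update τ.narr 1 f, τ.rarr⟩ ∧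
    Frame emitRecs σ ⟨Function.update τ.nvar 7 v, τ.rvar, Function.update τ.narr 1 f,
      Function.update τ.rarr 7 g⟩ := by
  have h1 : ∀ x, x ∉ emitRecs.nvars → Function.update τ.nvar 7 v x = σ.nvar x := fun x hx => by
    rw [Function.update_of_ne (by rintro rfl; exact hx (by decide))]; exact h.nvar x hx
  have h2 : ∀ x, x ∉ emitRecs.narrs → Function.update τ.narr 1 f x = σ.narr x := fun x hx => by
    rw [Function.update_of_ne (by rintro rfl; exact hx (by decide))]; exact h.narr x hx
  have h3 : ∀ x, x ∉ emitRecs.rarrs → Function.update τ.rarr 7 g x = σ.rarr x := fun x hx => by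
    rw [Function.update_of_ne (by rintro rfl; exact hx (by decide))]; exact h.rarr x hx
  exact ⟨⟨h1, h.rvar, h2, h.rarr⟩, ⟨h1, h.rvar, h2, h3⟩⟩

theorem emitLoop_spec {st ord c : ℕ} {bd idx : NExpr} {tag : ℕ → Tag} {W : List ℕ}
    (h : Recs G id e N D σ)
    (hbd : ∀ τ, Frame emitRecs σ τ → bd.eval τ = W.length)
    (hidx : ∀ τ k (hk : k < W.length), Frame emitRecs σ τ → τ.nvar 5 = k →
      (NExpr.get st idx).eval τ = W[k])
    (hord : ∀ τ v, Frame emitRecs σ τ → τ.narr ord v = id (tag v))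
    (hx : ∀ τ v, Frame emitRecs σ τ → τ.nvar 7 = v → dx.eval τ = (G.dir (tag v)).1)
    (hy : ∀ τ v, Frame emitRecs σ τ → τ.nvar 7 = v → dy.eval τ = (G.dir (tag v)).2)
    (hc : (emitBody st ord idx dx dy).worst + bd.cost + 2 ≤ c) :
    Runs (emitLoop st ord bd idx dx dy) σ (c * W.length + c)
      fun τ => Recs G id e N (D ++ W.map tag) τ := by
  have sub : ∀ {τ}, Frame (.nset 5 (.const 0) ;; emitBody st ord idx dx dy) σ τ → Frame emitRecs σ τ :=
    fun hF => hF.subset (by decide : [5, 7, 3, 5] ⊆ emitRecs.nvars)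
      (by decide : [] ⊆ emitRecs.rvars) (by decide : [1] ⊆ emitRecs.narrs)
      (by decide : [7, 8] ⊆ emitRecs.rarrs)
  have hw : 2 ≤ (emitBody st ord idx dx dy).worst := by
    simp only [emitBody, Prog.worst, NExpr.cost]; omega
  refine (Runs.for (fun k τ => Recs G id e N (D ++ (W.take k).map tag) τ)
    (emitBody st ord idx dx dy).worst 0 W.length rfl (Nat.zero_le _) ?_ (fun τ hF => hbd τ (sub hF))
    fun k τ hk _ hkW hJ hF => ?_).mono ?_ fun τ hτ _ => ?_
  · simpa using (⟨h.1, h.2, h.3, h.4, h.5⟩ : Recs G id e N D (Prog.eff (.nset 5 (.const 0)) σ))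
  · have hF' := sub hF
    have hv := hidx τ k hkW hF' hk
    obtain ⟨ρ, hρ⟩ : ∃ ρ, ρ = (Prog.nset 7 (.get st idx)).eff τ := ⟨_, rfl⟩
    have e7 : ρ = ⟨Function.update τ.nvar 7 W[k], τ.rvar, τ.narr, τ.rarr⟩ := by
      rw [hρ, Prog.eff, hv]
    have f1 : ∀ f, Frame emitRecs σ ⟨ρ.nvar, ρ.rvar, Function.update ρ.narr 1 f, ρ.rarr⟩ := fun f => by
      rw [e7]; exact (frame_emitRecs hF' _ _ 0).1
    have f2 : ∀ f g, Frame emitRecs σ ⟨ρ.nvar, ρ.rvar, Function.update ρ.narr 1 f,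
        Function.update ρ.rarr 7 g⟩ := fun f g => by
      rw [e7]; exact (frame_emitRecs hF' _ _ g).2
    have hJ' : Recs G id e N (D ++ (W.take k).map tag) ρ := by
      rw [e7]; exact ⟨by rw [← hJ.1]; simp, hJ.2, hJ.3, hJ.4, hJ.5⟩
    have n7 : ρ.nvar 7 = W[k] := by rw [e7]; simp
    have h5 := hJ'.emitRec (t := tag W[k]) (i := .get ord (.var 7)) (dx := dx) (dy := dy)
      (by simp only [NExpr.eval, n7]; rw [e7]; exact hord τ _ hF') (fun f => hx _ _ (f1 f) n7)
      (fun f g => hy _ _ (f2 f g) n7)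
    refine Runs.eff rfl le_rfl ?_
    have e8 : (emitBody st ord idx dx dy).eff τ = (Prog.nset 5 (.add (.var 5) (.const 1))).eff
      ((ZoneRAM.emitRec (.get ord (.var 7)) dx dy).eff ρ) := by rw [hρ]; rfl
    have n5 : ((ZoneRAM.emitRec (.get ord (.var 7)) dx dy).eff ρ).nvar 5 = k := by
      rw [e7]; simp [ZoneRAM.emitRec, Prog.eff, hk]
    rw [e8]
    refine ⟨by simp [Prog.eff, NExpr.eval, n5], ?_⟩
    have e9 : D ++ (W.take (k + 1)).map tag = D ++ (W.take k).map tag ++ [tag W[k]] := by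
      rw [List.take_succ_eq_append_getElem hkW, List.map_append, List.append_assoc]; rfl
    rw [e9]
    exact ⟨h5.1, h5.2, h5.3, h5.4, h5.5⟩
  · simp only [NExpr.cost, Nat.sub_zero]
    have : (emitBody st ord idx dx dy).worst * W.length + (bd.cost + 2) * W.length ≤ c * W.length := by
      rw [← add_mul]; exact Nat.mul_le_mul_right _ (by omega)
    rw [add_mul]; omega
  · simpa using hτ.2

theorem OnStack.down {st tl : ℕ} {T : List ℕ} (h : OnStack st tl T τ) (k : ℕ) (hk : k < T.length) :
    τ.narr st (τ.nvar tl - 1 - k) = T[k] := by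
  have hl := h.length
  have h1 : T.reverse[T.length - 1 - k]? = some T[k] := by
    rw [List.getElem?_reverse (by omega), List.getElem?_eq_getElem (by omega)]
    congr 2; omega
  rw [h, List.getElem?_map, List.getElem?_range (by omega)] at h1
  rw [hl]
  exact Option.some_injective _ h1

theorem OnStack.up {st tl : ℕ} {T : List ℕ} (h : OnStack st tl T τ) (k : ℕ)
    (hk : k < T.reverse.tail.length) : τ.narr st (k + 1) = T.reverse.tail[k] := by
  have hl := h.length
  simp only [List.length_tail, List.length_reverse] at hk
  rw [List.getElem_tail]
  have h1 : T.reverse[k + 1]? = some (T.reverse[k + 1]'(by rw [List.length_reverse]; omega)) :=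
    List.getElem?_eq_getElem _
  rw [← Option.some_inj, ← h1, h, List.getElem?_map, List.getElem?_range (by omega)]
  rfl

theorem emitDown_spec {st tl ord : ℕ} {tag : ℕ → Tag} {W : List ℕ} {c : ℚ}
    (h : Recs G id e N D σ) (hs : OnStack st tl W σ) (hst : st ∉ emitRecs.narrs)
    (htl : tl ∉ emitRecs.nvars) (hor : ord ∉ emitRecs.narrs)
    (hord : ∀ v, σ.narr ord v = id (tag v))
    (hx : ∀ τ v, Frame emitRecs σ τ → τ.nvar 7 = v → dx.eval τ = (G.dir (tag v)).1)
    (hy : ∀ v, ((c : ℚ) : ℝ) = (G.dir (tag v)).2) (hc : dx.cost ≤ 10) :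
    Runs (emitDown st tl ord dx (.const c)) σ (50 * W.length + 50)
      fun τ => Recs G id e N (D ++ W.map tag) τ := by
  refine emitLoop_spec (c := 50) (dy := .const c) h (fun τ hF => ?_) (fun τ k hk hF h5 => ?_) (fun τ v hF => ?_) hx
    (fun τ v _ _ => hy v) ?_
  · simp only [NExpr.eval]; rw [hF.nvar _ htl, hs.length]
  · simp only [NExpr.eval]; rw [hF.nvar _ htl, hF.narr _ hst, h5, hs.down k hk]
  · rw [hF.narr _ hor, hord]
  · simp only [emitBody, ZoneRAM.emitRec, Prog.worst, NExpr.cost, RExpr.cost]; omega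

theorem emitUp_spec {st tl ord : ℕ} {tag : ℕ → Tag} {W : List ℕ} {c : ℚ}
    (h : Recs G id e N D σ) (hs : OnStack st tl W σ) (hst : st ∉ emitRecs.narrs)
    (htl : tl ∉ emitRecs.nvars) (hor : ord ∉ emitRecs.narrs)
    (hord : ∀ v, σ.narr ord v = id (tag v))
    (hx : ∀ τ v, Frame emitRecs σ τ → τ.nvar 7 = v → dx.eval τ = (G.dir (tag v)).1)
    (hy : ∀ v, ((c : ℚ) : ℝ) = (G.dir (tag v)).2) (hc : dx.cost ≤ 10) :
    Runs (emitUp st tl ord dx (.const c)) σ (50 * W.length + 50)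
      fun τ => Recs G id e N (D ++ W.reverse.tail.map tag) τ := by
  refine (emitLoop_spec (c := 50) (dy := .const c) h (fun τ hF => ?_) (fun τ k hk hF h5 => ?_) (fun τ v hF => ?_) hx
    (fun τ v _ _ => hy v) ?_).mono ?_ fun τ h _ => h
  · simp only [NExpr.eval]; rw [hF.nvar _ htl, hs.length]; simp
  · simp only [NExpr.eval]; rw [hF.narr _ hst, h5, hs.up k hk]
  · rw [hF.narr _ hor, hord]
  · simp only [emitBody, ZoneRAM.emitRec, Prog.worst, NExpr.cost, RExpr.cost]; omega
  · rw [List.length_tail, List.length_reverse]; omega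

end


/-! ### The vertices of a face and the output format -/

def vertTest : BExpr :=
  .rlt (.const 0) (.sub (.mul (.get 7 (.var 5)) (.get 8 (.var 20)))
    (.mul (.get 8 (.var 5)) (.get 7 (.var 20))))

def vertPut : Prog :=
  .nset 6 (.get 1 (.var 5)) ;; .nset 7 (.get 1 (.var 20))
  ;; .rset 6 (.sub (.mul (.get 0 (.var 6)) (.get 1 (.var 7))) (.mul (.get 0 (.var 7)) (.get 1 (.var 6))))
  ;; .rset 7 (.div (.sub (.mul (.get 2 (.var 6)) (.get 1 (.var 7)))
    (.mul (.get 2 (.var 7)) (.get 1 (.var 6)))) (.var 6))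
  ;; .rset 8 (.div (.sub (.mul (.get 0 (.var 6)) (.get 2 (.var 7)))
    (.mul (.get 0 (.var 7)) (.get 2 (.var 6)))) (.var 6))
  ;; .nput 3 (.var 5) (.const 1) ;; .rput 5 (.var 5) (.var 7) ;; .rput 6 (.var 5) (.var 8)
  ;; .nput 2 (.var 20) (.const 1) ;; .rput 3 (.var 20) (.var 7) ;; .rput 4 (.var 20) (.var 8)

/-- The successor of the last edge is the first one, whose number is in variable `19`. Every vertex
is written twice, as head of an edge and as tail of the next. A face with a single edge is its own
successor; the cross product then vanishes and both ends are put at infinity. -/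
def vertBody : Prog :=
  (.nset 20 (.add (.var 5) (.const 1)) ;; .ite (.nlt (.var 20) (.var 3)) .skip (.nset 20 (.var 19)))
  ;; .ite vertTest vertPut (.nput 3 (.var 5) (.const 0) ;; .nput 2 (.var 20) (.const 0))
  ;; .nset 5 (.add (.var 5) (.const 1))

def emitVerts : Prog := .nset 5 (.var 19) ;; .loop (.nlt (.var 5) (.var 3)) vertBody

def emitFace : Prog :=
  .nset 19 (.var 3) ;; emitRecs ;; emitVerts
  ;; (.nput 4 (.add (.var 2) (.const 1)) (.var 3) ;; .nset 2 (.add (.var 2) (.const 1)))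

/-- The faces `out` are written. -/
structure Output (out : List (List BoundaryEdge)) (τ : State) : Prop where
  eq : outputOf τ = out
  last : τ.narr 4 (τ.nvar 2) = τ.nvar 3
  le : ∀ k ≤ τ.nvar 2, τ.narr 4 k ≤ τ.nvar 3

theorem Output.frame {out : List (List BoundaryEdge)} {P : Prog} {σ τ : State} (h : Output out σ)
    (hF : Frame P σ τ) (h1 : ∀ a ∈ [2, 3], a ∉ P.nvars) (h2 : ∀ a ∈ [1, 2, 3, 4], a ∉ P.narrs)
    (h3 : ∀ a ∈ [3, 4, 5, 6], a ∉ P.rarrs) : Output out τ := by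
  have n2 := hF.nvar 2 (h1 _ (by decide))
  have n3 := hF.nvar 3 (h1 _ (by decide))
  have n4 := hF.narr 4 (h2 _ (by decide))
  have he : edgeAt τ = edgeAt σ := by
    funext j
    simp only [edgeAt, hF.narr 1 (h2 _ (by decide)), hF.narr 2 (h2 _ (by decide)),
      hF.narr 3 (h2 _ (by decide)), hF.rarr 3 (h3 _ (by decide)), hF.rarr 4 (h3 _ (by decide)),
      hF.rarr 5 (h3 _ (by decide)), hF.rarr 6 (h3 _ (by decide))]
  exact ⟨by rw [← h.eq, outputOf, outputOf, n2, n4, he], by rw [n2, n3, n4]; exact h.last,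
    by rw [n2, n3, n4]; exact h.le⟩

theorem Output.append {out : List (List BoundaryEdge)} {σ τ : State} (h : Output out σ)
    (h1 : τ.nvar 2 = σ.nvar 2 + 1)
    (h2 : τ.narr 4 = Function.update (σ.narr 4) (σ.nvar 2 + 1) (τ.nvar 3))
    (h3 : σ.nvar 3 ≤ τ.nvar 3) (h4 : ∀ j < σ.nvar 3, edgeAt τ j = edgeAt σ j) :
    Output (out ++ [(List.range' (σ.nvar 3) (τ.nvar 3 - σ.nvar 3)).map (edgeAt τ)]) τ := by
  have old : ∀ k ≤ σ.nvar 2, τ.narr 4 k = σ.narr 4 k := fun k hk => by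
    rw [h2, Function.update_of_ne (by omega)]
  have new : τ.narr 4 (σ.nvar 2 + 1) = τ.nvar 3 := by rw [h2, Function.update_self]
  refine ⟨?_, by rw [h1, new], fun k hk => ?_⟩
  · rw [← h.eq, outputOf, outputOf, h1, List.range_succ, List.map_append, List.map_singleton, new,
      old _ le_rfl, h.last]
    congr 1
    refine List.map_congr_left fun k hk => ?_
    have hk := List.mem_range.1 hk
    rw [old k hk.le, old (k + 1) hk]
    refine List.map_congr_left fun j hj => h4 j ?_
    have h5 := h.le (k + 1) hk
    rw [List.mem_range'_1] at hj
    omega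
  · rw [h1] at hk
    rcases Nat.lt_succ_iff_lt_or_eq.1 (Nat.lt_succ_of_le hk) with h5 | rfl
    · rw [old k (by omega)]; exact (h.le k (by omega)).trans h3
    · rw [new]

section

variable {G : Geo} {id : Tag → ℕ} {e : ℕ} {N : ℕ → ℕ} {D : List Tag} {σ τ : State}
  {TL TR TL₂ TR₂ : List ℕ} {top bot : Prop}

open Classical in
theorem emitBottom_spec {bot : Prop} (h : Recs G id e N D σ) (hr : FaceRegs G id σ)
    (hb : σ.nvar 18 = 1 ↔ bot) :
    Runs emitBottom σ 30 (Recs G id e N (D ++ if bot then [.B] else [])) := by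
  refine Runs.eff rfl (Nat.le_of_ble_eq_true rfl) ?_
  by_cases hb' : bot
  · have h1 := h.emitRec (t := .B) (i := .var 15) (dx := .var 4) (dy := .const 0) hr.idB
      (fun f => hr.wd) (fun f g => by simp [RExpr.eval, Geo.dir])
    simpa only [emitBottom, Prog.eff, BExpr.holds, NExpr.eval, hb, hb', if_true] using h1
  · simpa only [emitBottom, Prog.eff, BExpr.holds, NExpr.eval, hb, hb', if_false,
      List.append_nil] using h

open Classical in
theorem emitTop_spec {top : Prop} (h : Recs G id e N D σ) (hr : FaceRegs G id σ)
    (ht : σ.nvar 17 = 1 ↔ top) :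
    Runs emitTop σ 30 (Recs G id e N (D ++ if top then [.T] else [])) := by
  refine Runs.eff rfl (Nat.le_of_ble_eq_true rfl) ?_
  by_cases ht' : top
  · have h1 := h.emitRec (t := .T) (i := .var 14) (dx := .sub (.const 0) (.var 3)) (dy := .const 0)
      hr.idT (fun f => by simp [RExpr.eval, Geo.dir, hr.wh]) (fun f g => by simp [RExpr.eval, Geo.dir])
    simpa only [emitTop, Prog.eff, BExpr.holds, NExpr.eval, ht, ht', if_true] using h1
  · simpa only [emitTop, Prog.eff, BExpr.holds, NExpr.eval, ht, ht', if_false,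
      List.append_nil] using h

theorem emitRecs_spec (hr : FaceRegs G id σ) (s1 : OnStack 12 10 TL σ) (s2 : OnStack 13 11 TR σ)
    (s3 : OnStack 14 12 TL₂ σ) (s4 : OnStack 15 13 TR₂ σ) (ht : σ.nvar 17 = 1 ↔ top)
    (hb : σ.nvar 18 = 1 ↔ bot) :
    Runs emitRecs σ (50 * (TL.length + TR.length + TL₂.length + TR₂.length) + 300)
      (Recs G id (σ.nvar 3) (σ.narr 1) (Geo.faceTags TL TR TL₂ TR₂ top bot)) := by
  classical
  have hL : ∀ {σ' : State}, FaceRegs G id σ' → ∀ τ v, Frame emitRecs σ' τ → τ.nvar 7 = v →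
      leftDx.eval τ = (G.dir (.L v)).1 := fun hr τ v hF hv => by
    simp [leftDx, RExpr.eval, NExpr.eval, hv, hF.rarr 10 (by decide), hr.S, Geo.dir]
  have hR : ∀ {σ' : State}, FaceRegs G id σ' → ∀ τ v, Frame emitRecs σ' τ → τ.nvar 7 = v →
      rightDx.eval τ = (G.dir (.R v)).1 := fun hr τ v hF hv => by
    simp [rightDx, RExpr.eval, NExpr.eval, hv, hF.rarr 13 (by decide), hr.S', Geo.dir]
  have fr : ∀ {τ}, Frame emitRecs σ τ → FaceRegs G id τ := fun hF =>
    hr.frame hF (by decide) (by decide) (by decide) (by decide)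
  have fs : ∀ {τ st tl T}, OnStack st tl T σ → Frame emitRecs σ τ → st ∉ emitRecs.narrs →
      tl ∉ emitRecs.nvars → OnStack st tl T τ := fun h hF h1 h2 => h.congr (hF.nvar _ h2) (hF.narr _ h1)
  have r0 : Recs G id (σ.nvar 3) (σ.narr 1) [] σ :=
    ⟨rfl, fun k hk => by simp at hk, fun k hk => by simp at hk, fun k hk => by simp at hk,
      fun _ _ => rfl⟩
  refine (Runs.seq (emitDown_spec (tag := .L) r0 s1 (by decide) (by decide) (by decide) hr.idL
    (hL hr) (fun v => by simp [Geo.dir]) (by decide)) (c' := 50 * (TR.length + TL₂.length +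
      TR₂.length) + 250) fun τ r1 hF => ?_).mono (by omega) fun τ h _ => h
  replace hF : Frame emitRecs σ τ := hF.subset (by decide) (by decide) (by decide) (by decide)
  refine (Runs.seq (emitUp_spec (tag := .L) r1 (fs s3 hF (by decide) (by decide)) (by decide)
    (by decide) (by decide) (fr hF).idL
    (hL (fr hF)) (fun v => by simp [Geo.dir]) (by decide)) (c' := 50 * (TR.length +
      TR₂.length) + 200) fun ρ r2 hF' => ?_).mono (by omega) fun τ h _ => h
  replace hF : Frame emitRecs σ ρ := hF.trans' (hF'.subset (by decide) (by decide) (by decide) (by decide))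
  clear hF' r1
  refine (Runs.seq (emitBottom_spec (bot := bot) r2 (fr hF) (by rwa [hF.nvar 18 (by decide)]))
    (c' := 50 * (TR.length + TR₂.length) + 150) fun τ r3 hF' => ?_).mono (by omega) fun τ h _ => h
  replace hF : Frame emitRecs σ τ := hF.trans' (hF'.subset (by decide) (by decide) (by decide) (by decide))
  clear hF' r2
  refine (Runs.seq (emitDown_spec (tag := .R) r3 (fs s4 hF (by decide) (by decide)) (by decide)
    (by decide) (by decide) (fr hF).idR
    (hR (fr hF)) (fun v => by simp [Geo.dir]) (by decide)) (c' := 50 * TR.length + 100)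
    fun ρ r4 hF' => ?_).mono (by omega) fun τ h _ => h
  replace hF : Frame emitRecs σ ρ := hF.trans' (hF'.subset (by decide) (by decide) (by decide) (by decide))
  clear hF' r3
  refine (Runs.seq (emitUp_spec (tag := .R) r4 (fs s2 hF (by decide) (by decide)) (by decide)
    (by decide) (by decide) (fr hF).idR
    (hR (fr hF)) (fun v => by simp [Geo.dir]) (by decide)) (c' := 30)
    fun τ r5 hF' => ?_).mono (by omega) fun τ h _ => h
  replace hF : Frame emitRecs σ τ := hF.trans' (hF'.subset (by decide) (by decide) (by decide) (by decide))
  clear hF' r4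
  refine (emitTop_spec (top := top) r5 (fr hF) (by rwa [hF.nvar 17 (by decide)])).mono le_rfl fun τ h _ => ?_
  convert h using 1
  simp [Geo.faceTags, List.append_assoc]

open Classical in
theorem eff_vertBody {τ : State} {k k' : ℕ} (hk : τ.nvar 5 = k)
    (hk' : k' = if k + 1 < τ.nvar 3 then k + 1 else τ.nvar 19) {V : Option Plane}
    (hV : V = if 0 < τ.rarr 7 k * τ.rarr 8 k' - τ.rarr 8 k * τ.rarr 7 k' then
      some (meetPt (τ.rarr 0) (τ.rarr 1) (τ.rarr 2) (τ.narr 1 k) (τ.narr 1 k')) else none) :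
    (vertBody.eff τ).nvar 5 = k + 1 ∧
      (∀ j, (edgeAt (vertBody.eff τ) j).head = if j = k then V else (edgeAt τ j).head) ∧
      ∀ j, (edgeAt (vertBody.eff τ) j).tail = if j = k' then V else (edgeAt τ j).tail := by
  obtain ⟨ρ, hρ⟩ : ∃ ρ, ρ = Prog.eff (.nset 20 (.add (.var 5) (.const 1)) ;;
    .ite (.nlt (.var 20) (.var 3)) .skip (.nset 20 (.var 19))) τ := ⟨_, rfl⟩
  have e1 : ρ = ⟨Function.update τ.nvar 20 k', τ.rvar, τ.narr, τ.rarr⟩ := by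
    rw [hρ, hk']
    split_ifs with h <;> simp [Prog.eff, BExpr.holds, NExpr.eval, hk, h]
  have e2 : vertBody.eff τ = Prog.eff (.ite vertTest vertPut
    (.nput 3 (.var 5) (.const 0) ;; .nput 2 (.var 20) (.const 0)) ;;
      .nset 5 (.add (.var 5) (.const 1))) ρ := by rw [hρ]; rfl
  rw [e2]
  have n5 : ρ.nvar 5 = k := by rw [e1]; simpa using hk
  have n20 : ρ.nvar 20 = k' := by rw [e1]; simp
  have ht : vertTest.holds ρ ↔ 0 < τ.rarr 7 k * τ.rarr 8 k' - τ.rarr 8 k * τ.rarr 7 k' := by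
    simp only [vertTest, BExpr.holds, RExpr.eval, NExpr.eval, n5, n20, Rat.cast_zero]
    rw [e1]
  by_cases h : 0 < τ.rarr 7 k * τ.rarr 8 k' - τ.rarr 8 k * τ.rarr 7 k'
  · rw [if_pos h] at hV
    simp only [Prog.eff, ht, h, if_true]
    subst hV
    refine ⟨by simp [vertPut, Prog.eff, NExpr.eval, n5], fun j => ?_, fun j => ?_⟩
    · by_cases hj : j = k
      · simp [edgeAt, vertPut, Prog.eff, NExpr.eval, RExpr.eval, n5, n20, hj, meetPt]
        simp [e1]
      · simp [edgeAt, vertPut, Prog.eff, NExpr.eval, RExpr.eval, n5, n20, hj]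
        simp [e1]
    · by_cases hj : j = k'
      · simp [edgeAt, vertPut, Prog.eff, NExpr.eval, RExpr.eval, n5, n20, hj, meetPt]
        simp [e1]
      · simp [edgeAt, vertPut, Prog.eff, NExpr.eval, RExpr.eval, n5, n20, hj]
        simp [e1]
  · rw [if_neg h] at hV
    simp only [Prog.eff, ht, h, if_false]
    subst hV
    refine ⟨by simp [NExpr.eval, n5], fun j => ?_, fun j => ?_⟩
    · by_cases hj : j = k
      · simp [edgeAt, NExpr.eval, n5, n20, hj]
      · simp [edgeAt, NExpr.eval, n5, n20, hj]
        simp [e1]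
    · by_cases hj : j = k'
      · simp [edgeAt, NExpr.eval, n5, n20, hj]
      · simp [edgeAt, NExpr.eval, n5, n20, hj]
        simp [e1]

theorem next_eq {i n : ℕ} (h : i < n) : (i + 1) % n = if i + 1 < n then i + 1 else 0 := by
  split_ifs with h1
  · exact Nat.mod_eq_of_lt h1
  · rw [show i + 1 = n by omega, Nat.mod_self]

theorem emitVerts_spec (h : Recs G id e N D σ) (he : σ.nvar 19 = e) :
    Runs emitVerts σ (200 * D.length + 10) fun τ => (∀ j < e, edgeAt τ j = edgeAt σ j) ∧
      EdgesOf D id (G.vertex id (σ.rarr 0) (σ.rarr 1) (σ.rarr 2))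
        ((List.range' e D.length).map (edgeAt τ)) := by
  classical
  refine (Runs.for (e := .var 19) (bd := .var 3) (fun k τ => (∀ j < e, edgeAt τ j = edgeAt σ j) ∧
    ∀ i i' (hi : i < D.length) (hi' : i' < D.length), i' = (i + 1) % D.length → e + i < k →
      (edgeAt τ (e + i)).head = G.vertex id (σ.rarr 0) (σ.rarr 1) (σ.rarr 2) D[i] D[i'] ∧
      (edgeAt τ (e + i')).tail = G.vertex id (σ.rarr 0) (σ.rarr 1) (σ.rarr 2) D[i] D[i'])
    180 e (e + D.length) he (Nat.le_add_right _ _) ⟨fun j _ => rfl, fun i i' _ _ _ _ => by omega⟩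
    (fun τ hF => (hF.nvar 3 (by decide)).trans h.count) fun k τ hk hek hke hJ hF => ?_).mono
    (by simp only [NExpr.cost]; omega) fun τ hJ hF => ⟨hJ.2.1, ?_⟩
  · obtain ⟨i, rfl⟩ := Nat.exists_eq_add_of_le hek
    have hi : i < D.length := by omega
    have hi' : (i + 1) % D.length < D.length := Nat.mod_lt _ (by omega)
    have hn := next_eq hi
    have n1 : τ.narr 1 = σ.narr 1 := hF.narr 1 (by decide)
    have n3 : τ.nvar 3 = e + D.length := (hF.nvar 3 (by decide)).trans h.count
    obtain ⟨h1, h2, h3⟩ := eff_vertBody (k' := e + (i + 1) % D.length)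
      (V := G.vertex id (σ.rarr 0) (σ.rarr 1) (σ.rarr 2) D[i] (D[(i + 1) % D.length]'hi')) hk
      (by rw [n3, hF.nvar 19 (by decide), he, hn]
          split_ifs <;> omega)
      (by rw [n1, hF.rarr 0 (by decide), hF.rarr 1 (by decide), hF.rarr 2 (by decide),
            hF.rarr 7 (by decide), hF.rarr 8 (by decide), h.dir₁ i hi, h.dir₂ i hi,
            h.dir₁ _ hi', h.dir₂ _ hi', h.id_eq i hi, h.id_eq _ hi']
          rfl)
    refine Runs.eff rfl (Nat.le_of_ble_eq_true rfl) ⟨h1, fun j hj => ?_, fun q q' hq hq' hqq hlt => ?_⟩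
    · have a1 := h2 j
      have a2 := h3 j
      rw [if_neg (by omega), hJ.1 j hj] at a1 a2
      have a3 : (edgeAt (vertBody.eff τ) j).line = (edgeAt σ j).line := by
        rw [← hJ.1 j hj]
        exact congrFun (((vertBody.exec_eff rfl τ).choose_spec.2.frame).narr 1 (by decide)) j
      revert a1 a2 a3
      cases edgeAt (vertBody.eff τ) j
      cases edgeAt σ j
      rintro rfl rfl rfl
      rfl
    · have hn' := next_eq hq
      rw [h2, h3]
      rcases Nat.lt_succ_iff_lt_or_eq.1 hlt with h4 | h4
      · rw [if_neg (by omega), if_neg (by rw [hqq, hn, hn']; split_ifs <;> omega)]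
        exact hJ.2 q q' hq hq' hqq h4
      · obtain rfl : q = i := by omega
        subst hqq
        simp
  · refine ⟨by simp, fun k h1 h2 => ?_, fun k k' h1 h1' hk hk' h2 => ?_, fun k k' h1 h1' hk hk' h2 => ?_⟩
    · simp only [List.getElem_map, List.getElem_range', one_mul]
      rw [← h.id_eq k h2, ← hF.narr 1 (by decide)]
      rfl
    · simp only [List.getElem_map, List.getElem_range', one_mul]
      exact (hJ.2.2 k k' hk hk' h2 (by omega)).1
    · simp only [List.getElem_map, List.getElem_range', one_mul]
      exact (hJ.2.2 k k' hk hk' h2 (by omega)).2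

theorem length_faceTags_le :
    (Geo.faceTags TL TR TL₂ TR₂ top bot).length ≤
      TL.length + TR.length + TL₂.length + TR₂.length + 2 := by
  have h1 : ∀ {p : Prop} [Decidable p] {t : Tag}, (if p then [t] else []).length ≤ 1 := by
    intro p _ t; split_ifs <;> simp
  have h2 := @h1 top (Classical.propDecidable _) .T
  have h3 := @h1 bot (Classical.propDecidable _) .B
  simp only [Geo.faceTags, List.length_append, List.length_map, List.length_tail,
    List.length_reverse]
  omega

theorem emitFace_spec {out : List (List BoundaryEdge)} (ho : Output out σ)
    (hr : FaceRegs G id σ) (s1 : OnStack 12 10 TL σ) (s2 : OnStack 13 11 TR σ)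
    (s3 : OnStack 14 12 TL₂ σ) (s4 : OnStack 15 13 TR₂ σ) (ht : σ.nvar 17 = 1 ↔ top)
    (hb : σ.nvar 18 = 1 ↔ bot) :
    Runs emitFace σ (250 * (TL.length + TR.length + TL₂.length + TR₂.length) + 800) fun τ =>
      ∃ E, EdgesOf (Geo.faceTags TL TR TL₂ TR₂ top bot) id
        (G.vertex id (σ.rarr 0) (σ.rarr 1) (σ.rarr 2)) E ∧ Output (out ++ [E]) τ := by
  refine (Runs.seq (c := 2)
    (c' := 250 * (TL.length + TR.length + TL₂.length + TR₂.length) + 750)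
    (Q' := fun τ => τ.nvar 19 = σ.nvar 3) (Runs.eff rfl le_rfl rfl)
    fun τ e19 hF => ?_).mono (by omega) fun τ h _ => h
  have e3 : τ.nvar 3 = σ.nvar 3 := hF.nvar 3 (by decide)
  have ho' := ho.frame hF (by decide) (by decide) (by decide)
  have e4 : ∀ k, τ.rarr k = σ.rarr k := fun k => hF.rarr k (by simp [Prog.rarrs])
  simp only [← e4]
  rw [← e3] at e19
  replace hr := hr.frame hF (by decide) (by decide) (by decide) (by decide)
  replace s1 : OnStack 12 10 TL τ := s1.congr (hF.nvar _ (by decide)) (hF.narr _ (by decide))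
  replace s2 : OnStack 13 11 TR τ := s2.congr (hF.nvar _ (by decide)) (hF.narr _ (by decide))
  replace s3 : OnStack 14 12 TL₂ τ := s3.congr (hF.nvar _ (by decide)) (hF.narr _ (by decide))
  replace s4 : OnStack 15 13 TR₂ τ := s4.congr (hF.nvar _ (by decide)) (hF.narr _ (by decide))
  replace ht : τ.nvar 17 = 1 ↔ top := by rwa [hF.nvar 17 (by decide)]
  replace hb : τ.nvar 18 = 1 ↔ bot := by rwa [hF.nvar 18 (by decide)]
  clear ho hF e3 e4
  have hD := length_faceTags_le (TL := TL) (TR := TR) (TL₂ := TL₂) (TR₂ := TR₂) (top := top)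
    (bot := bot)
  refine (Runs.seq (emitRecs_spec hr s1 s2 s3 s4 ht hb)
    (c' := 200 * (TL.length + TR.length + TL₂.length + TR₂.length) + 430)
    fun ρ hR hF => ?_).mono (by omega) fun τ h _ => h
  have f19 : ρ.nvar 19 = τ.nvar 3 := (hF.nvar 19 (by decide)).trans e19
  refine (Runs.seq (emitVerts_spec hR f19) (c' := 20) fun ω hV hF' => ?_).mono
    (by omega) fun τ h _ => h
  refine Runs.eff rfl (Nat.le_of_ble_eq_true rfl) ⟨(List.range' (τ.nvar 3) (Geo.faceTags TL TR TL₂ TR₂ top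
    bot).length).map (edgeAt ω), ?_, ?_⟩
  · simpa only [hF.rarr 0 (by decide), hF.rarr 1 (by decide), hF.rarr 2 (by decide)] using hV.2
  · have g3 : ω.nvar 3 = τ.nvar 3 + (Geo.faceTags TL TR TL₂ TR₂ top bot).length :=
      (hF'.nvar 3 (by decide)).trans hR.count
    have g2 : ω.nvar 2 = τ.nvar 2 := (hF'.nvar 2 (by decide)).trans (hF.nvar 2 (by decide))
    have g4 : ω.narr 4 = τ.narr 4 := (hF'.narr 4 (by decide)).trans (hF.narr 4 (by decide))
    obtain ⟨ν, hν⟩ : ∃ ν, ν = Prog.eff (.nput 4 (.add (.var 2) (.const 1)) (.var 3) ;;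
      .nset 2 (.add (.var 2) (.const 1))) ω := ⟨_, rfl⟩
    have eν : edgeAt ν = edgeAt ω := by rw [hν]; rfl
    have n3 : ν.nvar 3 = ω.nvar 3 := by rw [hν]; rfl
    rw [← hν]
    have := ho'.append (τ := ν) (by rw [hν]; simp [Prog.eff, NExpr.eval, g2])
      (by rw [hν]; simp [Prog.eff, NExpr.eval, g2, g4]) (by omega) fun j hj => by
        rw [eν, hV.1 j hj]
        simp only [edgeAt, hF.rarr 3 (by decide), hF.rarr 4 (by decide), hF.rarr 5 (by decide),
          hF.rarr 6 (by decide), hF.narr 2 (by decide), hF.narr 3 (by decide), hR.old j hj]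
    rwa [n3, g3, Nat.add_sub_cancel_left, eν] at this

end


/-! ## The faces along a line -/

/-- Reflection in the base line negates the slopes `S`, keeps the base points, and turns the lower
half of the face into an upper half. So `downRegs` uses the negated slopes with trees, stacks and a
bound of its own. -/
def upRegs : WalkRegs := ⟨9, 10, 12, 13, 8, 10, 15, 17, 12, 13, 10, 11, 3, 17⟩
def downRegs : WalkRegs := ⟨9, 11, 12, 14, 9, 11, 16, 18, 14, 15, 12, 13, 4, 18⟩

def face : Prog := walk upRegs ;; walk downRegs ;; emitFace

/-- With the flag `16` unset all faces are written; otherwise only those at a tie. -/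
def facesBody : Prog :=
  .ite (.or (.neq (.var 16) (.const 0)) (.neq (.get 7 (.var 4)) (.const 1))) face .skip
  ;; .nset 4 (.add (.var 4) (.const 1))

def faces : Prog :=
  .nset 4 (.const 0) ;; .loop (.nlt (.var 4) (.add (.var 1) (.const 1))) facesBody

def hulls : Prog := hull 9 10 8 15 ;; hull 9 11 9 16 ;; hull 12 13 10 17 ;; hull 12 14 11 18

/-- The data of the lines along `l`, ready for the walks. -/
structure Ready {n : ℕ} (L : Fin n → LineEq) (l : LineEq) (s : List (Fin n)) (τ : State) : Prop where
  coeffs : Coeffs L τ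
  sorted : StrictSorted L l s
  length_eq : τ.nvar 1 = s.length
  stored : Stored 5 1 s τ
  crossing : ∀ k hk, CrossingAt L l s k hk τ
  neg : NegArrays τ
  top : ParMax L l 1 (τ.rvar 3) (τ.nvar 14)
  bot : ParMax L l (-1) (τ.rvar 4) (τ.nvar 15)

structure Hulls (m : ℕ) (τ : State) : Prop where
  upL : HullAt 9 10 8 15 m τ
  downL : HullAt 9 11 9 16 m τ
  upR : HullAt 12 13 10 17 m τ
  downR : HullAt 12 14 11 18 m τ

section

variable {n : ℕ} {L : Fin n → LineEq} {l : LineEq} {s : List (Fin n)} {σ τ : State} {P : Prog}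

theorem HullAt.frame {x s nx cl m : ℕ} (h : HullAt x s nx cl m σ) (hF : Frame P σ τ)
    (h1 : x ∉ P.rarrs) (h2 : s ∉ P.rarrs) (h3 : nx ∉ P.narrs) (h4 : cl ∉ P.rarrs) :
    HullAt x s nx cl m τ := by
  obtain ⟨c1, c2, c3, c4⟩ := h
  constructor <;> simpa only [hF.rarr x h1, hF.rarr s h2, hF.narr nx h3, hF.rarr cl h4]

theorem Hulls.frame {m : ℕ} (h : Hulls m σ) (hF : Frame P σ τ)
    (h1 : ∀ a ∈ [9, 10, 11, 12, 13, 14, 15, 16, 17, 18], a ∉ P.rarrs)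
    (h2 : ∀ a ∈ [8, 9, 10, 11], a ∉ P.narrs) : Hulls m τ := by
  obtain ⟨c1, c2, c3, c4⟩ := h
  exact ⟨c1.frame hF (h1 _ (by decide)) (h1 _ (by decide)) (h2 _ (by decide)) (h1 _ (by decide)),
    c2.frame hF (h1 _ (by decide)) (h1 _ (by decide)) (h2 _ (by decide)) (h1 _ (by decide)),
    c3.frame hF (h1 _ (by decide)) (h1 _ (by decide)) (h2 _ (by decide)) (h1 _ (by decide)),
    c4.frame hF (h1 _ (by decide)) (h1 _ (by decide)) (h2 _ (by decide)) (h1 _ (by decide))⟩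

theorem Ready.frame (h : Ready L l s σ) (hF : Frame P σ τ)
    (h1 : ∀ a ∈ [0, 1, 2, 9, 10, 11, 12, 13, 14], a ∉ P.rarrs) (h2 : ∀ a ∈ [5, 6], a ∉ P.narrs)
    (h3 : ∀ a ∈ [0, 1, 14, 15], a ∉ P.nvars) (h4 : ∀ a ∈ [3, 4], a ∉ P.rvars) : Ready L l s τ := by
  obtain ⟨c1, c2, c3, c4, c5, c6, c7, c8⟩ := h
  refine ⟨c1.frame hF (h3 _ (by decide)) (h1 _ (by decide)) (h1 _ (by decide)) (h1 _ (by decide)), c2,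
    (hF.nvar 1 (h3 _ (by decide))).trans c3, fun i hi => ?_, fun k hk => (c5 k hk).frame hF
      (fun a ha => h1 a (by revert a; decide)) (h2 _ (by decide)),
    c6.frame hF (fun a ha => h1 a (by revert a; decide)), ?_, ?_⟩
  · rw [hF.narr 5 (h2 _ (by decide))]; exact c4 i hi
  · rwa [hF.rvar 3 (h4 _ (by decide)), hF.nvar 14 (h3 _ (by decide))]
  · rwa [hF.rvar 4 (h4 _ (by decide)), hF.nvar 15 (h3 _ (by decide))]

def geoAt (τ : State) (m j : ℕ) : Geo :=
  ⟨τ.rarr 9, τ.rarr 10, τ.rarr 12, τ.rarr 13, j, m - j, τ.rvar 3, τ.rvar 4⟩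

def tagId (τ : State) : Tag → ℕ
  | .L v => τ.narr 5 v
  | .R v => τ.narr 6 v
  | .T => τ.nvar 14
  | .B => τ.nvar 15

theorem Ready.faceData (h : Ready L l s σ) {j : ℕ} (hj : j ≤ s.length) :
    FaceData L l s j (geoAt σ s.length j) (tagId σ) :=
  ⟨h.sorted, hj, rfl, rfl, fun k hk _ => ⟨(h.crossing k hk).X, (h.crossing k hk).S, h.stored k hk⟩,
    fun k hk _ => ⟨(h.crossing k hk).Xr, (h.crossing k hk).Sr, (h.crossing k hk).ordR⟩, h.top, h.bot⟩

theorem Ready.mono (h : Ready L l s σ) (i k : ℕ) (hi : 1 ≤ i) (hik : i < k) (hk : k ≤ s.length) :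
    σ.rarr 9 i < σ.rarr 9 k := by
  have h1 := (h.crossing (i - 1) (by omega)).X
  have h2 := (h.crossing (k - 1) (by omega)).X
  rw [Nat.sub_add_cancel (by omega)] at h1 h2
  rw [h1, h2]
  exact h.sorted.lt _ _ _ (by omega)

theorem Ready.reflect (h : Ready L l s σ) (i : ℕ) (hi : 1 ≤ i) (him : i ≤ s.length) :
    σ.rarr 12 (s.length + 1 - i) = -σ.rarr 9 i ∧ σ.rarr 13 (s.length + 1 - i) = -σ.rarr 10 i ∧
      σ.rarr 14 (s.length + 1 - i) = -σ.rarr 11 i := by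
  have h1 := h.crossing (i - 1) (by omega)
  obtain ⟨c1, c2, c3, c4, c5, c6, -⟩ := h1
  rw [Nat.sub_add_cancel hi] at c1 c2 c3
  rw [show s.length - (i - 1) = s.length + 1 - i by omega] at c4 c5 c6
  rw [c1, c2, c3, c4, c5, c6]
  simp

theorem Ready.mono' (h : Ready L l s σ) (i k : ℕ) (hi : 1 ≤ i) (hik : i < k) (hk : k ≤ s.length) :
    σ.rarr 12 i < σ.rarr 12 k := by
  have h1 := (h.reflect (s.length + 1 - i) (by omega) (by omega)).1
  have h2 := (h.reflect (s.length + 1 - k) (by omega) (by omega)).1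
  rw [show s.length + 1 - (s.length + 1 - i) = i by omega] at h1
  rw [show s.length + 1 - (s.length + 1 - k) = k by omega] at h2
  rw [h1, h2, neg_lt_neg_iff]
  exact h.mono _ _ (by omega) (by omega) (by omega)

theorem Ready.sep (h : Ready L l s σ) (j i k : ℕ) (hi : 1 ≤ i) (hij : i ≤ j)
    (hk : 1 ≤ k) (hkj : k ≤ s.length - j) : σ.rarr 9 i + σ.rarr 12 k < 0 := by
  have h2 := (h.reflect (s.length + 1 - k) (by omega) (by omega)).1
  rw [show s.length + 1 - (s.length + 1 - k) = k by omega] at h2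
  have := h.mono i (s.length + 1 - k) hi (by omega) (by omega)
  rw [h2]; linarith

theorem hulls_spec (h : Ready L l s σ) :
    Runs hulls σ (400 * s.length + 80) (Hulls s.length) := by
  have hm := h.length_eq
  refine (Runs.seq (hull_spec hm (by decide) (by decide) fun i k h1 h2 h3 => h.mono i k h1 h2 h3)
    (c' := 300 * s.length + 60) fun τ q1 hF => ?_).mono (by omega) fun τ h _ => h
  replace h := h.frame hF (by decide) (by decide) (by decide) (by decide)
  clear hF
  refine (Runs.seq (hull_spec h.length_eq (by decide) (by decide) fun i k h1 h2 h3 =>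
    h.mono i k h1 h2 h3) (c' := 200 * s.length + 40) fun τ q2 hF => ?_).mono (by omega) fun τ h _ => h
  replace h := h.frame hF (by decide) (by decide) (by decide) (by decide)
  replace q1 := q1.frame hF (by decide) (by decide) (by decide) (by decide)
  clear hF
  refine (Runs.seq (hull_spec h.length_eq (by decide) (by decide) fun i k h1 h2 h3 =>
    h.mono' i k h1 h2 h3) (c' := 100 * s.length + 20) fun τ q3 hF => ?_).mono (by omega) fun τ h _ => h
  replace h := h.frame hF (by decide) (by decide) (by decide) (by decide)
  replace q1 := q1.frame hF (by decide) (by decide) (by decide) (by decide)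
  replace q2 := q2.frame hF (by decide) (by decide) (by decide) (by decide)
  clear hF
  refine (hull_spec h.length_eq (by decide) (by decide) fun i k h1 h2 h3 =>
    h.mono' i k h1 h2 h3).mono le_rfl fun τ q4 hF => ?_
  exact ⟨q1.frame hF (by decide) (by decide) (by decide) (by decide),
    q2.frame hF (by decide) (by decide) (by decide) (by decide),
    q3.frame hF (by decide) (by decide) (by decide) (by decide), q4⟩

/-- The number of functions that the four walks of face number `j` step past. -/
noncomputable def faceSteps (σ : State) (m j : ℕ) : ℕ :=
  Hull.steps ⟨σ.rarr 9, σ.rarr 10, σ.narr 8, j⟩ ⟨σ.rarr 12, σ.rarr 13, σ.narr 10, m - j⟩ +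
  Hull.steps ⟨σ.rarr 12, σ.rarr 13, σ.narr 10, m - j⟩ ⟨σ.rarr 9, σ.rarr 10, σ.narr 8, j⟩ +
  (Hull.steps ⟨σ.rarr 9, σ.rarr 11, σ.narr 9, j⟩ ⟨σ.rarr 12, σ.rarr 14, σ.narr 11, m - j⟩ +
  Hull.steps ⟨σ.rarr 12, σ.rarr 14, σ.narr 11, m - j⟩ ⟨σ.rarr 9, σ.rarr 11, σ.narr 9, j⟩)

theorem sum_steps_reflect_le {X S X' S' : ℕ → ℝ} {nx nx' : ℕ → ℕ} {m : ℕ}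
    (hX : ∀ i, 1 ≤ i → i ≤ m → X (m + 1 - i) = -X' i)
    (hS : ∀ i, 1 ≤ i → i ≤ m → S (m + 1 - i) = -S' i) (hT : HullTree X' S' nx' m) :
    ∑ j ∈ Finset.range (m + 1), Hull.steps ⟨X', S', nx', m - j⟩ ⟨X, S, nx, j⟩ ≤ m := by
  rw [← Finset.sum_range_reflect]
  refine le_trans (Finset.sum_le_sum fun j hj => ?_) (Hull.sum_steps_le (nx' := nx) hX hS hT)
  have hj := Finset.mem_range.1 hj
  rw [show m - (m + 1 - 1 - j) = j by omega, show m + 1 - 1 - j = m - j by omega]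

/-- One summand `m` for each of the two chains in each of the two halves; for right chains the faces
are counted from the other end. -/
theorem Ready.sum_faceSteps_le (h : Ready L l s σ) (hh : Hulls s.length σ) :
    ∑ j ∈ Finset.range (s.length + 1), faceSteps σ s.length j ≤ 4 * s.length := by
  have r1 := fun i h1 h2 => (h.reflect i h1 h2).1
  have r2 := fun i h1 h2 => (h.reflect i h1 h2).2.1
  have r3 := fun i h1 h2 => (h.reflect i h1 h2).2.2
  have swap : ∀ {f g : ℕ → ℝ}, (∀ i, 1 ≤ i → i ≤ s.length → f (s.length + 1 - i) = -g i) →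
      ∀ i, 1 ≤ i → i ≤ s.length → g (s.length + 1 - i) = -f i := fun hfg i h1 h2 => by
    have := hfg (s.length + 1 - i) (by omega) (by omega)
    rw [show s.length + 1 - (s.length + 1 - i) = i by omega] at this
    rw [this, neg_neg]
  simp only [faceSteps, Finset.sum_add_distrib]
  have a1 := Hull.sum_steps_le (nx' := σ.narr 10) r1 r2 hh.upL.tree
  have a2 := Hull.sum_steps_le (nx' := σ.narr 11) r1 r3 hh.downL.tree
  have a3 := sum_steps_reflect_le (nx := σ.narr 8) (swap r1) (swap r2) hh.upR.tree
  have a4 := sum_steps_reflect_le (nx := σ.narr 9) (swap r1) (swap r3) hh.downR.tree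
  omega

theorem face_spec {j : ℕ} {out : List (List BoundaryEdge)} (h : Ready L l s σ)
    (hh : Hulls s.length σ) (hj : σ.nvar 4 = j) (hjm : j ≤ s.length) (ho : Output out σ)
    (hL : Function.Injective fun i => (L i).pts) (hne : (zcell L l s j).Nonempty) :
    Runs face σ (350 * faceSteps σ s.length j + 2400) fun τ =>
      ∃ E, DescribesFace L E (zcell L l s j) ∧ Output (out ++ [E]) τ := by
  have hup : upRegs.OK := ⟨by decide, by decide, by decide, by decide, by decide, by decide⟩
  have hdn : downRegs.OK := ⟨by decide, by decide, by decide, by decide, by decide, by decide⟩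
  have n11 : σ.rarr 11 = fun i => -σ.rarr 10 i := funext h.neg.left
  have n14 : σ.rarr 14 = fun i => -σ.rarr 13 i := funext h.neg.right
  have mX : ∀ i k, 1 ≤ i → i < k → k ≤ j → σ.rarr 9 i < σ.rarr 9 k := fun i k h1 h2 h3 =>
    h.mono i k h1 h2 (by omega)
  have mX' : ∀ i k, 1 ≤ i → i < k → k ≤ s.length - j → σ.rarr 12 i < σ.rarr 12 k :=
    fun i k h1 h2 h3 => h.mono' i k h1 h2 (by omega)
  set G := geoAt σ s.length j with hG
  have sepU : Hull.Sep (G.upL (σ.narr 8)) (G.upR (σ.narr 10)) := fun i k h1 h2 h3 h4 =>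
    h.sep j i k h1 h2 h3 h4
  have sepD : Hull.Sep (G.rot.upL (σ.narr 11)) (G.rot.upR (σ.narr 9)) := Hull.Sep.symm
    fun i k h1 h2 h3 h4 => h.sep j i k h1 h2 h3 h4
  simp only [faceSteps]
  generalize hu : Hull.steps ⟨σ.rarr 9, σ.rarr 10, σ.narr 8, j⟩
    ⟨σ.rarr 12, σ.rarr 13, σ.narr 10, s.length - j⟩ = u
  generalize hu' : Hull.steps ⟨σ.rarr 12, σ.rarr 13, σ.narr 10, s.length - j⟩
    ⟨σ.rarr 9, σ.rarr 10, σ.narr 8, j⟩ = u'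
  generalize hd : Hull.steps ⟨σ.rarr 9, σ.rarr 11, σ.narr 9, j⟩
    ⟨σ.rarr 12, σ.rarr 14, σ.narr 11, s.length - j⟩ = d
  generalize hd' : Hull.steps ⟨σ.rarr 12, σ.rarr 14, σ.narr 11, s.length - j⟩
    ⟨σ.rarr 9, σ.rarr 11, σ.narr 9, j⟩ = d'
  refine (Runs.seq (c := 100 * (u + u') + 300) (c' := 250 * (u + u') + 350 * (d + d') + 2100)
    ((walk_spec hup h.length_eq hj hjm hh.upL hh.upR rfl rfl rfl h.top.nonneg sepU).mono
      (by rw [← hu, ← hu']; rfl) fun τ h _ => h) ?_).mono (by omega) fun τ h _ => h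
  rintro τ ⟨TL, TR, p, q, hw, hp, hq, s1, s2, l1, l2, hfl⟩ hF
  have tu := Geo.topPart (G := G) h.top.nonneg h.bot.nonneg mX mX' sepU hp hq hw
  replace l1 : TL.length ≤ u + 1 := hu ▸ l1
  replace l2 : TR.length ≤ u' + 1 := hu' ▸ l2
  have f0 : FaceRegs G (tagId σ) σ := ⟨rfl, rfl, rfl, rfl, fun _ => rfl, fun _ => rfl, rfl, rfl⟩
  have f1 := f0.frame hF (by decide) (by decide) (by decide) (by decide)
  have h1 := h.frame hF (by decide) (by decide) (by decide) (by decide)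
  have hh1 := hh.frame hF (by decide) (by decide)
  have ho1 := ho.frame hF (by decide) (by decide) (by decide)
  have j1 : τ.nvar 4 = j := (hF.nvar 4 (by decide)).trans hj
  have r9 : τ.rarr 9 = σ.rarr 9 := hF.rarr 9 (by decide)
  have r11 : τ.rarr 11 = σ.rarr 11 := hF.rarr 11 (by decide)
  have r12 : τ.rarr 12 = σ.rarr 12 := hF.rarr 12 (by decide)
  have r14 : τ.rarr 14 = σ.rarr 14 := hF.rarr 14 (by decide)
  have a9 : τ.narr 9 = σ.narr 9 := hF.narr 9 (by decide)
  have a11 : τ.narr 11 = σ.narr 11 := hF.narr 11 (by decide)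
  have v4 : τ.rvar 4 = σ.rvar 4 := hF.rvar 4 (by decide)
  refine (Runs.seq (c := 100 * (d + d') + 300) (c' := 250 * (u + u') + 250 * (d + d') + 1800)
    ((walk_spec hdn (A := ⟨σ.rarr 9, σ.rarr 11, σ.narr 9, j⟩)
      (A' := ⟨σ.rarr 12, σ.rarr 14, σ.narr 11, s.length - j⟩) h1.length_eq j1 hjm hh1.downL hh1.downR
      (by simp only [downRegs, r9, r11, a9]) (by simp only [downRegs, r12, r14, a11]) v4
      h.bot.nonneg (Hull.Sep.symm sepD)).mono
      (by rw [← hd, ← hd']) fun τ h _ => h) ?_).mono (by omega) fun τ h _ => h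
  rintro ρ ⟨TL₂, TR₂, p₂, q₂, hw₂, hp₂, hq₂, s3, s4, l3, l4, hfl₂⟩ hF'
  rw [hd] at l3
  rw [hd'] at l4
  -- The program reflects the lower half while `Geo.rot` rotates it by 180 degrees, which exchanges
  -- the two chains; hence the result of the walk is used with its sides swapped.
  have td : Geo.TopPart G.rot TR₂ TL₂ q₂ p₂ _ := Geo.topPart (G := G.rot) (nx := σ.narr 11)
    (nx' := σ.narr 9) h.bot.nonneg h.top.nonneg mX' mX
    sepD hq₂ hp₂ (by have := hw₂.symm; rw [n11, n14] at this; exact this)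
  have e11 : σ.rarr 0 = ρ.rarr 0 := ((hF'.rarr 0 (by decide)).trans (hF.rarr 0 (by decide))).symm
  have hc := (h1.frame hF' (by decide) (by decide) (by decide) (by decide)).coeffs
  refine (emitFace_spec (ho1.frame hF' (by decide) (by decide) (by decide))
    (f1.frame hF' (by decide) (by decide) (by decide) (by decide))
    (s1.congr (hF'.nvar _ (by decide)) (hF'.narr _ (by decide)))
    (s2.congr (hF'.nvar _ (by decide)) (hF'.narr _ (by decide))) s3 s4
    ((by rw [hF'.nvar 17 (by decide)] : ρ.nvar 17 = 1 ↔ τ.nvar 17 = 1).trans hfl) hfl₂).mono (by omega) fun ω hω hF => ?_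
  obtain ⟨E, hE, hout⟩ := hω
  refine ⟨E, ?_, hout⟩
  rw [Hull.cross_symm ⟨σ.rarr 9, σ.rarr 11, _, _⟩, n11, n14] at hE
  obtain ⟨d1, d2, d3, d4, d5⟩ := Geo.faceTags_spec tu td mX mX'
  exact (h.faceData hjm).describesFace hL hne hc.a_eq hc.b_eq hc.c_eq d1 d2 d3 d4 d5 hE

open Classical in
theorem faces_spec {out : List (List BoundaryEdge)} {T : ℕ → Prop} (h : Ready L l s σ)
    (hh : Hulls s.length σ) (ho : Output out σ) (hL : Function.Injective fun i => (L i).pts)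
    (hne : ∀ j ≤ s.length, (zcell L l s j).Nonempty)
    (hT : ∀ j ≤ s.length, (σ.nvar 16 = 0 ∨ σ.narr 7 j = 1) ↔ T j) :
    Runs faces σ (4000 * (s.length + 1)) fun τ => ∃ Es,
      List.Forall₂ (DescribesFace L) Es
        (((List.range (s.length + 1)).filter T).map (zcell L l s)) ∧
      Output (out ++ Es) τ := by
  have hsum := h.sum_faceSteps_le hh
  refine (Runs.forSum (bd := .add (.var 1) (.const 1)) (fun k τ => ∃ Es,
      List.Forall₂ (DescribesFace L) Es (((List.range k).filter T).map (zcell L l s)) ∧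
      Output (out ++ Es) τ) (fun j => 350 * faceSteps σ s.length j + 2420) 0 (s.length + 1) rfl
    (Nat.zero_le _) ⟨[], by simp, ?_⟩ (fun τ hF => ?_) fun k τ hk _ hks hJ hF => ?_).mono ?_
    fun τ h _ => h.2
  · rw [List.append_nil]
    exact ho.frame (P := .nset 4 (.const 0)) ⟨fun x hx => Function.update_of_ne (by
      simpa [Prog.nvars] using hx) _ _, fun _ _ => rfl, fun _ _ => rfl, fun _ _ => rfl⟩
      (by decide) (by decide) (by decide)
  · simp only [NExpr.eval]
    rw [hF.nvar 1 (by decide), h.length_eq]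
  · obtain ⟨Es, hEs, hout⟩ := hJ
    have h1 := h.frame hF (by decide) (by decide) (by decide) (by decide)
    have hh1 := hh.frame hF (by decide) (by decide)
    have hT' : (BExpr.or (.neq (.var 16) (.const 0)) (.neq (.get 7 (.var 4)) (.const 1))).holds τ ↔
        T k := by
      simp only [BExpr.holds, NExpr.eval, hk]
      rw [hF.nvar 16 (by decide), hF.narr 7 (by decide)]
      exact hT k (by omega)
    have hfs : faceSteps τ s.length k = faceSteps σ s.length k := by
      simp only [faceSteps, hF.rarr 9 (by decide), hF.rarr 10 (by decide), hF.rarr 11 (by decide),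
        hF.rarr 12 (by decide), hF.rarr 13 (by decide), hF.rarr 14 (by decide),
        hF.narr 8 (by decide), hF.narr 9 (by decide), hF.narr 10 (by decide), hF.narr 11 (by decide)]
    refine (Runs.seq (c := 8 + (350 * faceSteps σ s.length k + 2400)) (c' := 10)
      (Q' := fun τ => τ.nvar 4 = k ∧ ∃ Es, List.Forall₂ (DescribesFace L) Es
        (((List.range (k + 1)).filter T).map (zcell L l s)) ∧ Output (out ++ Es) τ)
      (Runs.ite (fun hb => ?_) fun hb => ?_) fun ρ hρ _ => ?_).mono (by omega) fun τ h _ => h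
    · refine (face_spec h1 hh1 hk (by omega) hout hL (hne k (by omega))).mono (by rw [hfs])
        fun ρ hρ hF' => ⟨(hF'.nvar 4 (by decide)).trans hk, ?_⟩
      obtain ⟨E, hE, ho'⟩ := hρ
      refine ⟨Es ++ [E], ?_, by rwa [← List.append_assoc]⟩
      rw [List.range_succ, List.filter_append, List.map_append,
        List.filter_singleton, decide_eq_true (hT'.1 hb)]
      exact List.rel_append hEs (.cons hE .nil)
    · refine Runs.eff rfl (by simp [Prog.worst]) ⟨hk, Es, ?_, hout⟩
      rw [List.range_succ, List.filter_append, List.filter_singleton,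
        decide_eq_false (mt hT'.2 hb), cond_false,
        List.append_nil]
      exact hEs
    · obtain ⟨h4, Es, h5, h6⟩ := hρ
      refine Runs.eff rfl (Nat.le_of_ble_eq_true rfl) ⟨by simp [Prog.eff, NExpr.eval, h4], Es, h5, ?_⟩
      exact h6.frame (P := .nset 4 (.add (.var 4) (.const 1))) ⟨fun x hx => Function.update_of_ne (by
        simpa [Prog.nvars] using hx) _ _, fun _ _ => rfl, fun _ _ => rfl, fun _ _ => rfl⟩
        (by decide) (by decide) (by decide)
  · rw [Nat.Ico_zero_eq_range, Finset.sum_add_distrib, Finset.sum_add_distrib, ← Finset.mul_sum]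
    simp only [Finset.sum_const, Finset.card_range, smul_eq_mul, NExpr.cost]
    omega

end


/-! ## The faces on one side of a line -/

/-- The coordinates of the lines are computed twice: relative to `l`, to find a good height and the
ties, and then relative to the parallel at that height, on which the walks rely. Variable `9` holds
the constant term of the current line, so that the input in variable `2` survives the shift. -/
def prepare : Prog :=
  .rset 9 (.var 2) ;; crossings ;; parallels ;; height ;; crossings ;; parallels ;; hulls

def pass : Prog := prepare ;; faces

/-- The lines, the line `l`, and the sorted list `s` are in memory. -/
structure Loaded {n : ℕ} (L : Fin n → LineEq) (l : LineEq) (s : List (Fin n)) (σ : State) :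
    Prop where
  coeffs : Coeffs L σ
  a_eq : σ.rvar 0 = l.a
  b_eq : σ.rvar 1 = l.b
  c_eq : σ.rvar 2 = l.c
  length_eq : σ.nvar 1 = s.length
  stored : Stored 5 1 s σ
  neg : NegArrays σ

section

variable {n : ℕ} {L : Fin n → LineEq} {l : LineEq} {s : List (Fin n)} {σ : State}

theorem Stored.frame {k o : ℕ} {P : Prog} {σ τ : State} (h : Stored k o s σ) (hF : Frame P σ τ)
    (h1 : k ∉ P.narrs) : Stored k o s τ := fun i hi => by rw [hF.narr k h1]; exact h i hi

theorem LexSorted.length_le (h : LexSorted L l s) : s.length ≤ n := by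
  simpa using h.nodup.length_le_card

theorem prepare_spec (h : Loaded L l s σ) (hs : LexSorted L l s) (hl : ∀ i, (L i).pts ≠ l.pts) :
    Runs prepare σ (1500 * n + 200) fun τ => ∃ ε, GoodHeight L l s ε ∧ Ready L (l.shift ε) s τ ∧
      Hulls s.length τ ∧ ∀ j ≤ s.length, τ.narr 7 j = 1 ↔ Tie L l s j := by
  have hmn := hs.length_le
  obtain ⟨hco, ha, hb, hc, hm, hst, hn⟩ := h
  have coeffs : ∀ {τ}, Frame prepare σ τ → Coeffs L τ := fun hF =>
    hco.frame hF (by decide) (by decide) (by decide) (by decide)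
  have stored : ∀ {τ}, Frame prepare σ τ → Stored 5 1 s τ := fun hF => hst.frame hF (by decide)
  have len : ∀ {τ}, Frame prepare σ τ → τ.nvar 1 = s.length := fun hF =>
    (hF.nvar 1 (by decide)).trans hm
  have sub : ∀ {P τ ρ}, Frame prepare σ τ → Frame P τ ρ → (P.nvars ⊆ prepare.nvars ∧
      P.rvars ⊆ prepare.rvars ∧ P.narrs ⊆ prepare.narrs ∧ P.rarrs ⊆ prepare.rarrs) →
      Frame prepare σ ρ := fun hF hF' h1 => hF.trans' (hF'.subset h1.1 h1.2.1 h1.2.2.1 h1.2.2.2)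
  refine (Runs.seq (c := 2) (c' := 1500 * n + 190) (Q' := fun τ => Current l τ ∧ NegArrays τ)
    (Runs.eff (P := .rset 9 (.var 2)) (σ := σ) rfl le_rfl ⟨⟨by simpa [Prog.eff] using ha, by simpa [Prog.eff] using hb,
    by simp [Prog.eff, RExpr.eval, hc]⟩, ⟨hn.1, hn.2⟩⟩) fun τ hτ hF => ?_).mono (by omega)
    fun τ h _ => h
  obtain ⟨hcu, hn⟩ := hτ
  replace hF := sub Frame.rfl' hF (by decide)
  refine (Runs.seq (crossings_spec (coeffs hF) hcu (stored hF) (len hF) hn) (c' := 1200 * n + 180)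
    fun ρ hρ hF' => ?_).mono (by omega) fun τ h _ => h
  obtain ⟨hn, hcr⟩ := hρ
  replace hcu := hcu.frame hF' (by decide) (by decide) (by decide)
  replace hF := sub hF hF' (by decide)
  clear hF'
  refine (Runs.seq (parallels_spec (coeffs hF) hcu) (c' := 1050 * n + 160)
    fun τ hτ hF' => ?_).mono (by omega) fun τ h _ => h
  have hpar := hτ.1
  clear hτ
  replace hcu := hcu.frame hF' (by decide) (by decide) (by decide)
  replace hcr := fun k hk => (hcr k hk).frame hF' (by decide) (by decide)
  replace hn := hn.frame hF' (by decide)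
  replace hF := sub hF hF' (by decide)
  clear hF'
  refine (Runs.seq (height_spec hcu (len hF) hcr hs hl hpar) (c' := 850 * n + 110)
    fun ρ hρ hF' => ?_).mono (by omega) fun τ h _ => h
  obtain ⟨hε, hcu, ht⟩ := hρ
  replace hn := hn.frame hF' (by decide)
  replace hF := sub hF hF' (by decide)
  clear hF' hpar hcr
  generalize ρ.rvar 10 = ε at hε hcu
  refine (Runs.seq (crossings_spec (coeffs hF) hcu (stored hF) (len hF) hn) (c' := 700 * n + 100)
    fun τ hτ hF' => ?_).mono (by omega) fun τ h _ => h
  obtain ⟨hn, hcr⟩ := hτ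
  replace hcu := hcu.frame hF' (by decide) (by decide) (by decide)
  replace hF := sub hF hF' (by decide)
  have ht : ∀ j ≤ s.length, τ.narr 7 j = 1 ↔ Tie L l s j := by rwa [hF'.narr 7 (by decide)]
  clear hF'
  refine (Runs.seq (parallels_spec (coeffs hF) hcu) (c' := 400 * n + 80)
    fun ρ hρ hF' => ?_).mono (by omega) fun τ h _ => h
  replace hcr := fun k hk => (hcr k hk).frame hF' (by decide) (by decide)
  replace hn := hn.frame hF' (by decide)
  replace hF := sub hF hF' (by decide)
  have ht : ∀ j ≤ s.length, ρ.narr 7 j = 1 ↔ Tie L l s j := by rwa [hF'.narr 7 (by decide)]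
  have hr : Ready L (l.shift ε) s ρ :=
    ⟨coeffs hF, hε.strictSorted hs, len hF, stored hF, hcr, hn, hρ.1, hρ.2⟩
  refine (hulls_spec hr).mono (by omega) fun ω hω hF' => ⟨ε, hε, hr.frame hF' (by decide) (by decide)
    (by decide) (by decide), hω, by rwa [hF'.narr 7 (by decide)]⟩

open Classical in
theorem pass_spec {out : List (List BoundaryEdge)} (h : Loaded L l s σ) (hs : LexSorted L l s)
    (hl : ∀ i, (L i).pts ≠ l.pts) (hL : Function.Injective fun i => (L i).pts)
    (ho : Output out σ) :
    Runs pass σ (6000 * (n + 1)) fun τ => Loaded L l s τ ∧ (∃ ε, GoodHeight L l s ε) ∧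
      (∀ j ≤ s.length, τ.narr 7 j = 1 ↔ Tie L l s j) ∧ ∃ Es,
        List.Forall₂ (DescribesFace L) Es (((List.range (s.length + 1)).filter fun j =>
          σ.nvar 16 = 0 ∨ Tie L l s j).map (zcell L l s)) ∧ Output (out ++ Es) τ := by
  have hmn := hs.length_le
  suffices H : Runs pass σ (6000 * (n + 1)) fun τ => NegArrays τ ∧ (∃ ε, GoodHeight L l s ε) ∧
      (∀ j ≤ s.length, τ.narr 7 j = 1 ↔ Tie L l s j) ∧ ∃ Es,
        List.Forall₂ (DescribesFace L) Es (((List.range (s.length + 1)).filter fun j =>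
          σ.nvar 16 = 0 ∨ Tie L l s j).map (zcell L l s)) ∧ Output (out ++ Es) τ by
    refine H.mono le_rfl fun τ hτ hF => ⟨⟨h.coeffs.frame hF (by decide) (by decide) (by decide)
      (by decide), ?_, ?_, ?_, (hF.nvar 1 (by decide)).trans h.length_eq,
      h.stored.frame hF (by decide), hτ.1⟩, hτ.2⟩
    · rw [hF.rvar 0 (by decide), h.a_eq]
    · rw [hF.rvar 1 (by decide), h.b_eq]
    · rw [hF.rvar 2 (by decide), h.c_eq]
  refine (Runs.seq (prepare_spec h hs hl) (c' := 4000 * (s.length + 1)) fun τ hτ hF => ?_).mono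
    (by omega) fun τ h _ => h
  obtain ⟨ε, hε, hr, hh, ht⟩ := hτ
  have e : zcell L (l.shift ε) s = zcell L l s := funext fun j => zcell_shift hε j
  refine (faces_spec (T := fun j => σ.nvar 16 = 0 ∨ Tie L l s j) hr hh
    (ho.frame hF (by decide) (by decide) (by decide)) hL (fun j hj => ?_) fun j hj => ?_).mono le_rfl
    fun ρ hρ hF' => ⟨hr.neg.frame hF' (by decide), ⟨ε, hε⟩, ?_, ?_⟩
  · rw [e]
    obtain ⟨p, hp, -⟩ := exists_mem_zcell hs hε hj
    exact ⟨p, hp⟩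
  · rw [ht j hj, hF.nvar 16 (by decide)]
  · rwa [hF'.narr 7 (by decide)]
  · rw [e] at hρ
    convert hρ

end


/-! ## The sorted list of the opposite line -/

section

variable {n : ℕ} {L : Fin n → LineEq} {l : LineEq} {s : List (Fin n)} {σ τ : State}

/-- Reversing `l` rotates the local coordinates by half a turn. Base points change sign while `S`
does not, so the order of distinct base points is reversed but concurrent lines keep their order. -/
theorem LineEq.Xof_neg (l k : LineEq) : l.neg.Xof k = -l.Xof k := by
  simp only [Xof, ga, nsq, be, al, neg]
  rw [← div_neg]
  congr 1 <;> ring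

theorem LineEq.Sof_neg (l k : LineEq) : l.neg.Sof k = l.Sof k := by
  simp only [Sof, be, al, neg]
  rw [← neg_div_neg_eq]
  congr 1 <;> ring

/-- `a` is the first index of the group of lines that meet on `l` and contain number `i`. -/
structure IsStart (T : ℕ → Prop) (i a : ℕ) : Prop where
  le : a ≤ i
  tie : ∀ u, a < u → u ≤ i → T u
  halt : ¬ T a

structure IsEnd (T : ℕ → Prop) (i b : ℕ) : Prop where
  le : i ≤ b
  tie : ∀ u, i < u → u ≤ b → T u
  halt : ¬ T (b + 1)

/-- The place of the line number `i` in the list of the opposite line. -/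
def flipPos (m i a b : ℕ) : ℕ := (m - 1 - b) + (i - a)

/-- In the reversed list a line is preceded by the `m - 1 - b` lines of the later groups and by the
`i - a` lines before it in its own group. So the order within a group is kept and that of the groups
is reversed. -/
theorem flipPos_lt {T : ℕ → Prop} {m i k a b c d : ℕ} (hik : i < k) (hd : d < m)
    (ha : IsStart T i a) (hb : IsEnd T i b) (hc : IsStart T k c) (hdd : IsEnd T k d) :
    ((∀ u, i < u → u ≤ k → T u) → flipPos m i a b < flipPos m k c d) ∧
    ((¬ ∀ u, i < u → u ≤ k → T u) → flipPos m k c d < flipPos m i a b) := by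
  have h1 := ha.le
  have h2 := hb.le
  have h3 := hc.le
  have h4 := hdd.le
  unfold flipPos
  refine ⟨fun h => ?_, fun h => ?_⟩
  · have e1 : a = c := by
      rcases lt_trichotomy a c with h5 | h5 | h5
      · refine absurd ?_ hc.halt
        rcases Nat.lt_or_ge i c with h6 | h6
        · exact h c h6 h3
        · exact ha.tie c h5 h6
      · exact h5
      · exact absurd (hc.tie a h5 (by omega)) ha.halt
    have e2 : b = d := by
      rcases lt_trichotomy b d with h5 | h5 | h5
      · refine absurd ?_ hb.halt
        rcases Nat.lt_or_ge k (b + 1) with h6 | h6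
        · exact hdd.tie _ h6 (by omega)
        · exact h _ (by omega) h6
      · exact h5
      · exact absurd (hb.tie _ (by omega) (by omega)) hdd.halt
    omega
  · push Not at h
    obtain ⟨u, h5, h6, h7⟩ := h
    have h8 : b < u := by
      by_contra h8
      exact h7 (hb.tie u h5 (by omega))
    have h9 : u ≤ c := by
      by_contra h9
      exact h7 (hc.tie u (by omega) h6)
    omega

theorem tie_chain_iff (h : LexSorted L l s) {i k : ℕ} (hik : i < k) (hk : k < s.length) :
    (∀ u, i < u → u ≤ k → Tie L l s u) ↔ l.Xof (L s[i]) = l.Xof (L s[k]) := by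
  have mono : ∀ {i k} (hk : k < s.length) (hik : i < k),
      l.Xof (L (s[i]'(hik.trans hk))) ≤ l.Xof (L s[k]) := fun hk hik =>
    (h.lt hik hk).elim le_of_lt fun h => h.1.le
  constructor
  · intro ht
    obtain ⟨d, rfl⟩ := Nat.exists_eq_add_of_lt hik
    induction d with
    | zero => exact (ht (i + 0 + 1) (by omega) le_rfl).2.2
    | succ d ih =>
      rw [ih (by omega) (by omega) fun u h1 h2 => ht u h1 (by omega)]
      exact (ht (i + (d + 1) + 1) (by omega) le_rfl).2.2
  · intro he u h1 h2
    refine ⟨by omega, by omega, le_antisymm (mono (by omega) (by omega)) ?_⟩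
    have a1 : l.Xof (L s[u]) ≤ l.Xof (L s[k]) := by
      rcases h2.eq_or_lt with rfl | h2
      · exact le_rfl
      · exact mono hk h2
    have a2 : l.Xof (L s[i]) ≤ l.Xof (L (s[u - 1]'(by omega))) := by
      rcases (Nat.le_sub_one_of_lt h1).eq_or_lt with h3 | h3
      · simp only [h3]; exact le_rfl
      · exact mono (by omega) h3
    linarith

/-- A memory state with every line at its place holds a sorted list of the opposite line. -/
theorem exists_flipped (h : LexSorted L l s) {st en : ℕ → ℕ}
    (hst : ∀ i < s.length, IsStart (Tie L l s) i (st i))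
    (hen : ∀ i < s.length, en i < s.length ∧ IsEnd (Tie L l s) i (en i))
    (hv : ∀ i (hi : i < s.length), τ.narr 5 (flipPos s.length i (st i) (en i) + 1) = (s[i] : ℕ)) :
    ∃ s' : List (Fin n), s'.length = s.length ∧ LexSorted L l.neg s' ∧ Stored 5 1 s' τ := by
  classical
  have lt : ∀ i k, i < k → k < s.length → _ := fun i k hik hk =>
    flipPos_lt hik (hen k hk).1 (hst i (by omega)) (hen i (by omega)).2 (hst k hk) (hen k hk).2
  have pos_lt : ∀ i < s.length, flipPos s.length i (st i) (en i) < s.length := fun i hi => by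
    have h1 := (hst i hi).le
    have h2 := (hen i hi).2.le
    have h3 := (hen i hi).1
    unfold flipPos; omega
  let f : Fin s.length → Fin s.length := fun i => ⟨_, pos_lt i i.2⟩
  have ne : ∀ i k, i < k → k < s.length →
      flipPos s.length i (st i) (en i) ≠ flipPos s.length k (st k) (en k) := fun i k hik hk => by
    rcases lt i k hik hk with ⟨h1, h2⟩
    by_cases h3 : ∀ u, i < u → u ≤ k → Tie L l s u
    · exact (h1 h3).ne
    · exact (h2 h3).ne'
  have hf : Function.Injective f := fun i k he => by
    have he : flipPos s.length i (st i) (en i) = flipPos s.length k (st k) (en k) := congrArg Fin.val he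
    rcases lt_trichotomy i k with h1 | h1 | h1
    · exact absurd he (ne i k h1 k.2)
    · exact h1
    · exact absurd he.symm (ne k i h1 i.2)
  -- Injectivity on a finite set gives an inverse `g` of the placement; position `p` of the reversed
  -- list holds line number `g p` of `s`.
  obtain ⟨g, -, hg⟩ := Function.bijective_iff_has_inverse.1 (Finite.injective_iff_bijective.1 hf)
  have lex : ∀ i k : Fin s.length, (f i : ℕ) < f k →
      LexLt l.neg (L s[(i : ℕ)]) (L s[(k : ℕ)]) := by
    intro i k hlt
    replace hlt : flipPos s.length i (st i) (en i) < flipPos s.length k (st k) (en k) := hlt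
    simp only [LexLt, LineEq.Xof_neg, LineEq.Sof_neg, neg_lt_neg_iff, neg_inj]
    rcases lt_trichotomy (i : ℕ) k with h1 | h1 | h1
    · have h2 := lt i k h1 k.2
      simp only [tie_chain_iff h h1 k.2] at h2
      by_cases h3 : l.Xof (L s[(i : ℕ)]) = l.Xof (L s[(k : ℕ)])
      · rcases h.lt h1 k.2 with h4 | h4
        · exact absurd h3 h4.ne
        · exact .inr h4
      · have := h2.2 h3
        omega
    · rw [h1] at hlt; omega
    · have h2 := lt k i h1 i.2
      simp only [tie_chain_iff h h1 i.2] at h2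
      by_cases h3 : l.Xof (L s[(k : ℕ)]) = l.Xof (L s[(i : ℕ)])
      · have := h2.1 h3
        omega
      · rcases h.lt h1 i.2 with h4 | h4
        · exact .inl h4
        · exact absurd h4.1 h3
  refine ⟨List.ofFn fun p => s[g p], List.length_ofFn, ⟨fun i => ?_, ?_⟩, fun p hp => ?_⟩
  · have e : l.neg.al (L i) = -l.al (L i) := by simp only [LineEq.al, LineEq.neg]; ring
    rw [e, neg_ne_zero, ← h.mem, List.mem_ofFn]
    constructor
    · rintro ⟨p, rfl⟩; exact List.getElem_mem _
    · intro hi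
      obtain ⟨k, hk, rfl⟩ := List.getElem_of_mem hi
      refine ⟨f ⟨k, hk⟩, ?_⟩
      have : g (f ⟨k, hk⟩) = ⟨k, hk⟩ := hf (hg _)
      simp only [this, Fin.getElem_fin]
  · rw [List.pairwise_ofFn]
    intro p q hpq
    have hp : f (g p) = p := hg p
    have hq : f (g q) = q := hg q
    have hlt : (f (g p) : ℕ) < f (g q) := by rw [hp, hq]; exact hpq
    exact lex _ _ hlt
  · rw [List.length_ofFn] at hp
    have h1 : (f (g ⟨p, hp⟩) : ℕ) = p := by rw [show f (g ⟨p, hp⟩) = ⟨p, hp⟩ from hg _]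
    rw [List.getElem_ofFn]
    have h2 := hv (g ⟨p, hp⟩) (g ⟨p, hp⟩).2
    rw [show flipPos s.length (g ⟨p, hp⟩) (st (g ⟨p, hp⟩)) (en (g ⟨p, hp⟩)) = p from h1] at h2
    simpa using h2

end

/-! ### Computing the list of the reversed line -/

def copyList : Prog :=
  .nset 5 (.const 0) ;; .loop (.nlt (.var 5) (.var 1))
    (.nput 5 (.add (.var 5) (.const 1)) (.get 0 (.var 5)) ;; .nset 5 (.add (.var 5) (.const 1)))

def startsBody : Prog :=
  .ite (.neq (.get 7 (.var 5)) (.const 1)) .skip (.nset 6 (.var 5))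
  ;; .nput 16 (.var 5) (.var 6) ;; .nset 5 (.add (.var 5) (.const 1))

def starts : Prog := .nset 5 (.const 0) ;; .loop (.nlt (.var 5) (.var 1)) startsBody

/-- The positions are visited from last to first, so that variable `6` holds the last index of the
current group; the first index was tabulated in array `16` by the upward pass. The lines are read
from array `0`, which the writes to array `5` leave intact. -/
def flipBody : Prog :=
  .nset 7 (.sub (.sub (.var 1) (.const 1)) (.var 5))
  ;; .ite (.neq (.get 7 (.add (.var 7) (.const 1))) (.const 1)) .skip (.nset 6 (.var 7))
  ;; .nput 5 (.add (.add (.sub (.sub (.var 1) (.const 1)) (.var 6))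
    (.sub (.var 7) (.get 16 (.var 7)))) (.const 1)) (.get 0 (.var 7))
  ;; .nset 5 (.add (.var 5) (.const 1))

def flip : Prog := .nset 5 (.const 0) ;; .loop (.nlt (.var 5) (.var 1)) flipBody

section

variable {n : ℕ} {L : Fin n → LineEq} {l : LineEq} {s : List (Fin n)} {σ : State}

theorem copyList_spec (hm : σ.nvar 1 = s.length) (h : Stored 0 0 s σ) :
    Runs copyList σ (20 * s.length + 10) (Stored 5 1 s) := by
  refine (Runs.for (bd := .var 1) (fun k τ => ∀ i (hi : i < s.length), i < k →
    τ.narr 5 (i + 1) = (s[i] : ℕ)) 12 0 s.length rfl (Nat.zero_le _) (fun i _ hi => by omega)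
    (fun τ hF => (hF.nvar 1 (by decide)).trans hm) fun k τ hk _ hks hJ hF => ?_).mono
    (by simp only [NExpr.cost]; omega) fun τ hτ _ i hi => hτ.2 i hi hi
  refine Runs.eff rfl (Nat.le_of_ble_eq_true rfl) ⟨by simp [Prog.eff, NExpr.eval, hk],
    fun i hi hik => ?_⟩
  rcases Nat.lt_succ_iff_lt_or_eq.1 hik with h1 | rfl
  · simp [Prog.eff, NExpr.eval, hk, h1.ne, hJ i hi h1]
  · simp [Prog.eff, NExpr.eval, hk]
    rw [hF.narr 0 (by decide)]
    exact h i hi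

theorem starts_spec {T : ℕ → Prop} {m : ℕ} (hm : σ.nvar 1 = m) (h0 : ¬ T 0)
    (hT : ∀ j ≤ m, σ.narr 7 j = 1 ↔ T j) :
    Runs starts σ (30 * m + 10) fun τ => ∀ i < m, IsStart T i (τ.narr 16 i) := by
  refine (Runs.for (bd := .var 1) (fun k τ => (∀ i, k = i + 1 → IsStart T i (τ.nvar 6)) ∧
    ∀ i < k, IsStart T i (τ.narr 16 i)) 20 0 m rfl (Nat.zero_le _)
    ⟨fun i hi => by omega, fun i hi => by omega⟩
    (fun τ hF => (hF.nvar 1 (by decide)).trans hm) fun k τ hk _ hks hJ hF => ?_).mono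
    (by simp only [NExpr.cost]; omega) fun τ hτ _ => hτ.2.2
  have h7 : τ.narr 7 k = 1 ↔ T k := by rw [hF.narr 7 (by decide)]; exact hT k (by omega)
  refine Runs.eff rfl (Nat.le_of_ble_eq_true rfl) ?_
  by_cases hk7 : T k
  · have e : startsBody.eff τ = Prog.eff (.nput 16 (.var 5) (.var 6) ;;
        .nset 5 (.add (.var 5) (.const 1))) τ := by
      simp [startsBody, Prog.eff, BExpr.holds, NExpr.eval, hk, h7, hk7]
    obtain ⟨i, rfl⟩ : ∃ i, k = i + 1 := ⟨k - 1, by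
      have : k ≠ 0 := by rintro rfl; exact h0 hk7
      omega⟩
    have h1 := hJ.1 i rfl
    have h2 : IsStart T (i + 1) (τ.nvar 6) := ⟨by have := h1.le; omega, fun u h3 h4 => by
      rcases h4.eq_or_lt with rfl | h4
      · exact hk7
      · exact h1.tie u h3 (by omega), h1.halt⟩
    rw [e]
    refine ⟨by simp [Prog.eff, NExpr.eval, hk], fun i' hi' => ?_, fun i' hi' => ?_⟩
    · obtain rfl : i' = i + 1 := by omega
      simpa [Prog.eff, NExpr.eval] using h2
    · rcases Nat.lt_succ_iff_lt_or_eq.1 hi' with h3 | rfl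
      · simpa [Prog.eff, NExpr.eval, hk, h3.ne] using hJ.2 i' h3
      · simpa [Prog.eff, NExpr.eval, hk] using h2
  · have e : startsBody.eff τ = Prog.eff (.nput 16 (.var 5) (.var 6) ;;
        .nset 5 (.add (.var 5) (.const 1))) (Prog.eff (.nset 6 (.var 5)) τ) := by
      simp [startsBody, Prog.eff, BExpr.holds, NExpr.eval, hk, h7, hk7]
    have h2 : IsStart T k k := ⟨le_rfl, fun u h3 h4 => by omega, hk7⟩
    rw [e]
    refine ⟨by simp [Prog.eff, NExpr.eval, hk], fun i' hi' => ?_, fun i' hi' => ?_⟩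
    · obtain rfl : i' = k := by omega
      simpa [Prog.eff, NExpr.eval, hk] using h2
    · rcases Nat.lt_succ_iff_lt_or_eq.1 hi' with h3 | rfl
      · simpa [Prog.eff, NExpr.eval, hk, h3.ne] using hJ.2 i' h3
      · simpa [Prog.eff, NExpr.eval, hk] using h2

theorem flip_spec (hs : LexSorted L l s) (hm : σ.nvar 1 = s.length) (h : Stored 0 0 s σ)
    (hT : ∀ j ≤ s.length, σ.narr 7 j = 1 ↔ Tie L l s j)
    (hst : ∀ i < s.length, IsStart (Tie L l s) i (σ.narr 16 i)) :
    Runs flip σ (50 * s.length + 10) fun τ =>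
      ∃ s' : List (Fin n), s'.length = s.length ∧ LexSorted L l.neg s' ∧ Stored 5 1 s' τ := by
  refine (Runs.for (bd := .var 1) (fun k τ =>
    (∀ i, i + k = s.length → 0 < k → τ.nvar 6 < s.length ∧ IsEnd (Tie L l s) i (τ.nvar 6)) ∧
    ∀ i (hi : i < s.length), s.length ≤ i + k → ∃ e, (e < s.length ∧ IsEnd (Tie L l s) i e) ∧
      τ.narr 5 (flipPos s.length i (σ.narr 16 i) e + 1) = (s[i] : ℕ)) 40 0 s.length rfl
    (Nat.zero_le _) ⟨fun i _ hi => by omega, fun i hi hi' => by omega⟩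
    (fun τ hF => (hF.nvar 1 (by decide)).trans hm) fun k τ hk _ hks hJ hF => ?_).mono
    (by simp only [NExpr.cost]; omega) fun τ hτ _ => ?_
  · obtain ⟨i, hi⟩ : ∃ i, i + (k + 1) = s.length := ⟨s.length - (k + 1), by omega⟩
    have hm' : τ.nvar 1 = s.length := (hF.nvar 1 (by decide)).trans hm
    have ei : s.length - 1 - k = i := by omega
    have h7 : τ.narr 7 (i + 1) = 1 ↔ Tie L l s (i + 1) := by
      rw [hF.narr 7 (by decide)]; exact hT _ (by omega)
    have h0 : τ.narr 0 i = (s[i] : ℕ) := by rw [hF.narr 0 (by decide)]; exact h i (by omega)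
    obtain ⟨e, he, hend, heff⟩ : ∃ e, e < s.length ∧ IsEnd (Tie L l s) i e ∧ flipBody.eff τ =
        ⟨Function.update (Function.update (Function.update τ.nvar 7 i) 6 e) 5 (k + 1), τ.rvar,
          Function.update τ.narr 5 (Function.update (τ.narr 5)
            (flipPos s.length i (σ.narr 16 i) e + 1) s[i]), τ.rarr⟩ := by
      by_cases hk7 : Tie L l s (i + 1)
      · have hk0 : 0 < k := by obtain ⟨-, h2, -⟩ := hk7; omega
        obtain ⟨h1, h2⟩ := hJ.1 (i + 1) (by omega) hk0
        refine ⟨τ.nvar 6, h1, ⟨by have := h2.le; omega, fun u h3 h4 => ?_, h2.halt⟩, ?_⟩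
        · rcases Nat.eq_or_lt_of_le h3 with rfl | h3
          · exact hk7
          · exact h2.tie u h3 h4
        · have e6 : Function.update (Function.update τ.nvar 7 i) 6 (τ.nvar 6) =
              Function.update τ.nvar 7 i := by
            rw [Function.update_eq_iff]; simp
          simp [flipBody, Prog.eff, BExpr.holds, NExpr.eval, hk, hm', ei, h7, hk7, flipPos, h0,
            hF.narr 16 (by decide), e6]
      · refine ⟨i, by omega, ⟨le_rfl, fun u h3 h4 => by omega, hk7⟩, ?_⟩
        simp [flipBody, Prog.eff, BExpr.holds, NExpr.eval, hk, hm', ei, h7, hk7, flipPos, h0,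
          hF.narr 16 (by decide)]
    refine Runs.eff rfl (Nat.le_of_ble_eq_true rfl) ?_
    rw [heff]
    refine ⟨by simp, fun i' hi' _ => ?_, fun i' hi' h1 => ?_⟩
    · obtain rfl : i' = i := by omega
      simpa using ⟨he, hend⟩
    · rcases Nat.eq_or_lt_of_le (show i ≤ i' by omega) with rfl | h2
      · exact ⟨e, ⟨he, hend⟩, by simp⟩
      · obtain ⟨e', he', h3⟩ := hJ.2 i' hi' (by omega)
        refine ⟨e', he', ?_⟩
        -- Different lines have different places, so the new entry overwrites none of the earlier
        -- ones.
        have h4 := flipPos_lt h2 he'.1 (hst i (by omega)) hend (hst i' hi') he'.2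
        have h5 : flipPos s.length i' (σ.narr 16 i') e' ≠ flipPos s.length i (σ.narr 16 i) e := by
          by_cases h6 : ∀ u, i < u → u ≤ i' → Tie L l s u
          · exact (h4.1 h6).ne'
          · exact (h4.2 h6).ne
        simpa [h5] using h3
  · have h1 : ∀ i, ∃ e, ∀ hi : i < s.length, (e < s.length ∧ IsEnd (Tie L l s) i e) ∧
        τ.narr 5 (flipPos s.length i (σ.narr 16 i) e + 1) = (s[i] : ℕ) := fun i => by
      by_cases hi : i < s.length
      · obtain ⟨e, he⟩ := hτ.2.2 i hi (by omega)
        exact ⟨e, fun _ => he⟩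
      · exact ⟨0, fun h => absurd h hi⟩
    choose en hen using h1
    exact exists_flipped hs hst (fun i hi => (hen i hi).1) fun i hi => (hen i hi).2

end


/-! ## The zone of a line from the sorted list -/

def initOutput : Prog :=
  .nset 2 (.const 0) ;; .nset 3 (.const 0) ;; .nput 4 (.const 0) (.const 0) ;; .nset 16 (.const 0)

/-- The flag restricts the second pass to the faces at ties of the reversed line, which are the ones
that the first pass missed. -/
def turn : Prog :=
  .rset 0 (.sub (.const 0) (.var 0)) ;; .rset 1 (.sub (.const 0) (.var 1))
  ;; .rset 2 (.sub (.const 0) (.var 2)) ;; .nset 16 (.const 1)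

def zoneSorted : Prog := initOutput ;; copyList ;; pass ;; starts ;; flip ;; turn ;; pass

section

variable {n : ℕ} {L : Fin n → LineEq} {l : LineEq} {s : List (Fin n)} {σ : State}

theorem zoneSorted_spec (hco : Coeffs L σ) (ha : σ.rvar 0 = l.a) (hb : σ.rvar 1 = l.b)
    (hc : σ.rvar 2 = l.c) (hm : σ.nvar 1 = s.length) (h : Stored 0 0 s σ) (hn : NegArrays σ)
    (hs : LexSorted L l s) (hl : ∀ i, (L i).pts ≠ l.pts)
    (hL : Function.Injective fun i => (L i).pts) :
    Runs zoneSorted σ (13000 * (n + 1)) fun τ => DescribesZone L l (outputOf τ) := by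
  classical
  have hmn := hs.length_le
  have hl' : ∀ i, (L i).pts ≠ l.neg.pts := by simpa only [LineEq.pts_neg] using hl
  refine (Runs.seq (c := 20) (c' := 13000 * n + 12900) (Q' := fun τ => Output [] τ ∧ τ.nvar 16 = 0)
    (Runs.eff rfl (Nat.le_of_ble_eq_true rfl) ⟨⟨?_, ?_, ?_⟩, ?_⟩) fun τ hτ hF => ?_).mono (by omega)
    fun τ h _ => h
  · simp [outputOf, initOutput, Prog.eff, NExpr.eval]
  · simp [initOutput, Prog.eff, NExpr.eval]
  · simp [initOutput, Prog.eff, NExpr.eval]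
  · simp [initOutput, Prog.eff, NExpr.eval]
  obtain ⟨ho, h16⟩ := hτ
  replace hco := hco.frame hF (by decide) (by decide) (by decide) (by decide)
  rw [← hF.rvar 0 (by decide)] at ha
  rw [← hF.rvar 1 (by decide)] at hb
  rw [← hF.rvar 2 (by decide)] at hc
  replace hm := (hF.nvar 1 (by decide)).trans hm
  replace h := h.frame hF (by decide)
  replace hn := hn.frame hF (by decide)
  clear hF
  refine (Runs.seq (copyList_spec hm h) (c' := 12900 * n + 12800) fun ρ hρ hF => ?_).mono (by omega)
    fun τ h _ => h
  have hld : Loaded L l s ρ := ⟨hco.frame hF (by decide) (by decide) (by decide) (by decide),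
    by rwa [hF.rvar 0 (by decide)], by rwa [hF.rvar 1 (by decide)], by rwa [hF.rvar 2 (by decide)],
    (hF.nvar 1 (by decide)).trans hm, hρ, hn.frame hF (by decide)⟩
  replace h := h.frame hF (by decide)
  replace ho := ho.frame hF (by decide) (by decide) (by decide)
  rw [← hF.nvar 16 (by decide)] at h16
  clear hF hco ha hb hc hm hn
  refine (Runs.seq (pass_spec hld hs hl hL ho) (c' := 6700 * n + 6700) fun τ hτ hF => ?_).mono
    (by omega) fun τ h _ => h
  obtain ⟨hld, ⟨ε, hε⟩, hT, Es, hEs, ho⟩ := hτ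
  replace h := h.frame hF (by decide)
  clear hF
  refine (Runs.seq (starts_spec hld.length_eq (fun h => by obtain ⟨h1, -⟩ := h; omega) hT)
    (c' := 6600 * n + 6600) fun ρ hst hF => ?_).mono (by omega) fun τ h _ => h
  replace h := h.frame hF (by decide)
  replace ho := ho.frame hF (by decide) (by decide) (by decide)
  have hT : ∀ j ≤ s.length, ρ.narr 7 j = 1 ↔ Tie L l s j := by rwa [hF.narr 7 (by decide)]
  replace hco := hld.coeffs.frame hF (by decide) (by decide) (by decide) (by decide)
  have ha := (hF.rvar 0 (by decide)).trans hld.a_eq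
  have hb := (hF.rvar 1 (by decide)).trans hld.b_eq
  have hc := (hF.rvar 2 (by decide)).trans hld.c_eq
  have hm := (hF.nvar 1 (by decide)).trans hld.length_eq
  have hn := hld.neg.frame hF (by decide)
  clear hF hld
  refine (Runs.seq (flip_spec hs hm h hT hst) (c' := 6500 * n + 6500) fun τ hτ hF => ?_).mono
    (by omega) fun τ h _ => h
  obtain ⟨s', hlen, hs', hst'⟩ := hτ
  replace ho := ho.frame hF (by decide) (by decide) (by decide)
  replace hco := hco.frame hF (by decide) (by decide) (by decide) (by decide)
  rw [← hF.rvar 0 (by decide)] at ha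
  rw [← hF.rvar 1 (by decide)] at hb
  rw [← hF.rvar 2 (by decide)] at hc
  replace hm := (hF.nvar 1 (by decide)).trans hm
  replace hn := hn.frame hF (by decide)
  clear hF hT hst h
  refine (Runs.seq (c := 20) (c' := 6000 * (n + 1)) (Q' := fun ρ => ρ.rvar 0 = -l.a ∧
    ρ.rvar 1 = -l.b ∧ ρ.rvar 2 = -l.c ∧ ρ.nvar 16 = 1) (Runs.eff rfl (Nat.le_of_ble_eq_true rfl) ?_)
    fun ρ hρ hF => ?_).mono (by omega) fun τ h _ => h
  · simp [turn, Prog.eff, RExpr.eval, NExpr.eval, ha, hb, hc]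
  obtain ⟨ha', hb', hc', h16'⟩ := hρ
  have hld : Loaded L l.neg s' ρ := ⟨hco.frame hF (by decide) (by decide) (by decide) (by decide),
    ha', hb', hc', ((hF.nvar 1 (by decide)).trans hm).trans hlen.symm, hst'.frame hF (by decide),
    hn.frame hF (by decide)⟩
  refine (pass_spec hld hs' hl' hL (ho.frame hF (by decide) (by decide) (by decide))).mono le_rfl
    fun ω hω _ => ?_
  obtain ⟨-, ⟨ε', hε'⟩, -, Es', hEs', ho'⟩ := hω
  obtain ⟨z1, z2⟩ := zoneCells_spec hl hs hs' hε hε'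
  refine ⟨zoneCells L l s s', z1, z2, ?_⟩
  rw [ho'.eq, List.nil_append, zoneCells]
  refine List.rel_append ?_ ?_
  · simpa [h16] using hEs
  · simpa [h16'] using hEs'

theorem Runs.exists {P : Prog} {c : ℕ} {Q : State → Prop} (h : Runs P σ c Q) :
    ∃ t τ, t ≤ c ∧ Exec P σ t τ ∧ Q τ := by
  obtain ⟨t, τ, h1, h2, h3⟩ := h
  exact ⟨t, τ, h2, h1, h3⟩

theorem zone_of_sortedInput (hL : Function.Injective fun i => (L i).pts)
    (hl : ∀ i, (L i).pts ≠ l.pts) (h : IsSortedAlong L l s) :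
    Runs zoneSorted (sortedInputState L l s) (13000 * (n + 1)) fun τ =>
      DescribesZone L l (outputOf τ) := by
  refine zoneSorted_spec (s := s) ⟨rfl, fun i => ?_, fun i => ?_, fun i => ?_⟩ ?_ ?_ ?_ ?_
    (fun i hi => ?_) ⟨fun v => ?_, fun v => ?_⟩ (h.lexSorted hl) hl hL
  all_goals simp [sortedInputState, inputState]
  simp [hi]

end


/-! ## Sorting -/

def slice (f : ℕ → ℕ) (a b : ℕ) : List ℕ := (List.range' a (b - a)).map f

section

variable {f g : ℕ → ℕ} {a b c : ℕ}

theorem slice_of_le (h : b ≤ a) : slice f a b = [] := by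
  rw [slice, Nat.sub_eq_zero_of_le h]; rfl

theorem slice_cons (h : a < b) : slice f a b = f a :: slice f (a + 1) b := by
  rw [slice, slice, show b - a = b - (a + 1) + 1 by omega, List.range'_succ]; rfl

theorem slice_concat (h : a ≤ b) : slice f a (b + 1) = slice f a b ++ [f b] := by
  rw [slice, slice, show b + 1 - a = b - a + 1 by omega, List.range'_1_concat, List.map_append,
    show a + (b - a) = b by omega]; rfl

theorem slice_append (h : a ≤ b) (h' : b ≤ c) : slice f a b ++ slice f b c = slice f a c := by
  rw [slice, slice, slice, ← List.map_append]
  have := @List.range'_append a (b - a) (c - b) 1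
  rw [one_mul, show a + (b - a) = b by omega, show b - a + (c - b) = c - a by omega] at this
  rw [this]

theorem slice_congr (h : ∀ i, a ≤ i → i < b → f i = g i) : slice f a b = slice g a b := by
  refine List.map_congr_left fun i hi => ?_
  rw [List.mem_range'_1] at hi
  exact h i (by omega) (by omega)

end

open Classical in
/-- The lexicographic order of the keys. -/
noncomputable def keyLe (X S : ℕ → ℝ) (a b : ℕ) : Bool :=
  decide (¬ (X b < X a ∨ (X b = X a ∧ S b < S a)))

theorem keyLe_iff {X S : ℕ → ℝ} {a b : ℕ} :
    keyLe X S a b = true ↔ ¬ (X b < X a ∨ (X b = X a ∧ S b < S a)) := by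
  rw [keyLe, decide_eq_true_iff]

theorem keyLe_trans {X S : ℕ → ℝ} (a b c : ℕ) (h : keyLe X S a b = true)
    (h' : keyLe X S b c = true) : keyLe X S a c = true := by
  rw [keyLe_iff] at *
  push Not at *
  refine ⟨h.1.trans h'.1, fun he => ?_⟩
  have e1 : X b = X a := le_antisymm (he ▸ h'.1) h.1
  exact (h.2 e1).trans (h'.2 (he.trans e1.symm))

theorem keyLe_total {X S : ℕ → ℝ} (a b : ℕ) : (keyLe X S a b || keyLe X S b a) = true := by
  rw [Bool.or_eq_true, keyLe_iff, keyLe_iff]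
  by_contra h
  push Not at h
  obtain ⟨h1 | h1, h2 | h2⟩ := h <;> linarith [h1, h2]

def keyLt : BExpr :=
  .or (.rlt (.get 19 (.get 0 (.var 7))) (.get 19 (.get 0 (.var 6))))
    (.and (.req (.get 19 (.get 0 (.var 7))) (.get 19 (.get 0 (.var 6))))
      (.rlt (.get 20 (.get 0 (.var 7))) (.get 20 (.get 0 (.var 6)))))

def mergeTest : BExpr :=
  .and (.nlt (.var 6) (.var 23)) (.or (.neq (.var 7) (.var 24)) (.not keyLt))

def mergeBody : Prog :=
  .ite mergeTest
    (.nput 17 (.var 5) (.get 0 (.var 6)) ;; .nset 6 (.add (.var 6) (.const 1)))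
    (.nput 17 (.var 5) (.get 0 (.var 7)) ;; .nset 7 (.add (.var 7) (.const 1)))
  ;; .nset 5 (.add (.var 5) (.const 1))

def mergeLoop : Prog := .nset 5 (.var 22) ;; .loop (.nlt (.var 5) (.var 24)) mergeBody

/-- For truncated subtraction `m - (m - x)` is the minimum of `x` and `m`; this cuts off the last
blocks at the end of the list. -/
def mergeInit : Prog :=
  .nset 23 (.sub (.var 1) (.sub (.var 1) (.add (.var 22) (.var 21))))
  ;; .nset 24 (.sub (.var 1) (.sub (.var 1) (.add (.var 23) (.var 21))))
  ;; .nset 6 (.var 22) ;; .nset 7 (.var 23)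

def mergeBlock : Prog := mergeInit ;; mergeLoop ;; .nset 22 (.var 24)

def mergeAll : Prog := .nset 22 (.const 0) ;; .loop (.nlt (.var 22) (.var 1)) mergeBlock

def copyBack : Prog :=
  .nset 5 (.const 0) ;; .loop (.nlt (.var 5) (.var 1))
    (.nput 0 (.var 5) (.get 17 (.var 5)) ;; .nset 5 (.add (.var 5) (.const 1)))

def sortBody : Prog := mergeAll ;; copyBack ;; .nset 21 (.add (.var 21) (.var 21))

def mergeSort : Prog := .nset 21 (.const 1) ;; .loop (.nlt (.var 21) (.var 1)) sortBody

section

variable {σ : State}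

theorem mergeLoop_spec {lo mid hi : ℕ} (h1 : lo ≤ mid) (h2 : mid ≤ hi) (e22 : σ.nvar 22 = lo)
    (e6 : σ.nvar 6 = lo) (e7 : σ.nvar 7 = mid) (e23 : σ.nvar 23 = mid) (e24 : σ.nvar 24 = hi) :
    Runs mergeLoop σ (60 * (hi - lo) + 10) fun τ => (∀ i < lo, τ.narr 17 i = σ.narr 17 i) ∧
      slice (τ.narr 17) lo hi = (slice (σ.narr 0) lo mid).merge (slice (σ.narr 0) mid hi)
        (keyLe (σ.rarr 19) (σ.rarr 20)) := by
  -- The invariant: what has been written, followed by the merge of the two remainders, is the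
  -- complete merge.
  refine (Runs.for (e := .var 22) (bd := .var 24) (fun k τ => ∃ p q, τ.nvar 6 = p ∧ τ.nvar 7 = q ∧
      lo ≤ p ∧ p ≤ mid ∧ mid ≤ q ∧ q ≤ hi ∧ k + mid = p + q ∧
      (∀ i < lo, τ.narr 17 i = σ.narr 17 i) ∧
      slice (τ.narr 17) lo k ++ (slice (σ.narr 0) p mid).merge (slice (σ.narr 0) q hi)
        (keyLe (σ.rarr 19) (σ.rarr 20)) = (slice (σ.narr 0) lo mid).merge (slice (σ.narr 0) mid hi)
        (keyLe (σ.rarr 19) (σ.rarr 20))) 50 lo hi e22 (h1.trans h2)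
    ⟨lo, mid, by simp [Prog.eff, e6], by simp [Prog.eff, e7], le_rfl, h1, le_rfl, h2, rfl,
      fun _ _ => rfl, by rw [slice_of_le le_rfl, List.nil_append]⟩
    (fun τ hF => (hF.nvar 24 (by decide)).trans e24) fun k τ hk hlk hkh hJ hF => ?_).mono
    (by simp only [NExpr.cost]; omega) fun τ hτ _ => ?_
  · obtain ⟨p, q, rfl, rfl, c1, c2, c3, c4, c5, hold, hs⟩ := hJ
    have a0 : τ.narr 0 = σ.narr 0 := hF.narr 0 (by decide)
    have a23 : τ.nvar 23 = mid := (hF.nvar 23 (by decide)).trans e23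
    have a24 : τ.nvar 24 = hi := (hF.nvar 24 (by decide)).trans e24
    have hkey : keyLt.holds τ ↔ ¬ keyLe (σ.rarr 19) (σ.rarr 20) (σ.narr 0 (τ.nvar 6))
        (σ.narr 0 (τ.nvar 7)) = true := by
      rw [keyLe_iff, not_not]
      simp only [keyLt, BExpr.holds, RExpr.eval, NExpr.eval, a0, hF.rarr 19 (by decide),
        hF.rarr 20 (by decide)]
    have htest : mergeTest.holds τ ↔ τ.nvar 6 < mid ∧ (τ.nvar 7 = hi ∨
        keyLe (σ.rarr 19) (σ.rarr 20) (σ.narr 0 (τ.nvar 6)) (σ.narr 0 (τ.nvar 7)) = true) := by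
      simp only [mergeTest, BExpr.holds, NExpr.eval, a23, a24, hkey, not_not]
    have write : ∀ v, slice (Function.update (τ.narr 17) k v) lo (k + 1) =
        slice (τ.narr 17) lo k ++ [v] := fun v => by
      rw [slice_concat hlk, Function.update_self]
      congr 1
      exact slice_congr fun i _ hi => Function.update_of_ne hi.ne _ _
    have keep : ∀ v, ∀ i < lo, Function.update (τ.narr 17) k v i = σ.narr 17 i := fun v i hi => by
      rw [Function.update_of_ne (by omega), hold i hi]
    refine Runs.eff rfl (Nat.le_of_ble_eq_true rfl) ?_
    by_cases ht : mergeTest.holds τ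
    · have e : mergeBody.eff τ = ⟨Function.update (Function.update τ.nvar 6 (τ.nvar 6 + 1)) 5 (k + 1),
          τ.rvar, Function.update τ.narr 17 (Function.update (τ.narr 17) k (σ.narr 0 (τ.nvar 6))),
          τ.rarr⟩ := by
        simp [mergeBody, Prog.eff, NExpr.eval, ht, hk, a0]
      rw [htest] at ht
      rw [e]
      refine ⟨by simp, τ.nvar 6 + 1, τ.nvar 7, by simp, by simp, by omega, by omega, c3, c4, by omega,
        by simpa using keep _, ?_⟩
      simp only [Function.update_self]
      rw [write, ← hs, List.append_assoc]
      congr 1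
      rw [slice_cons ht.1]
      rcases Nat.eq_or_lt_of_le c4 with h3 | h3
      · rw [slice_of_le h3.ge, List.merge_right, List.merge_right]; rfl
      · rw [slice_cons (a := τ.nvar 7) h3, List.cons_merge_cons,
          if_pos (ht.2.resolve_left h3.ne)]
        rfl
    · have e : mergeBody.eff τ = ⟨Function.update (Function.update τ.nvar 7 (τ.nvar 7 + 1)) 5 (k + 1),
          τ.rvar, Function.update τ.narr 17 (Function.update (τ.narr 17) k (σ.narr 0 (τ.nvar 7))),
          τ.rarr⟩ := by
        simp [mergeBody, Prog.eff, NExpr.eval, ht, hk, a0]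
      rw [htest] at ht
      rw [e]
      have h3 : τ.nvar 7 < hi := by
        refine lt_of_le_of_ne c4 fun h3 => ?_
        exact ht ⟨by omega, .inl h3⟩
      refine ⟨by simp, τ.nvar 6, τ.nvar 7 + 1, by simp, by simp, by omega, by omega, by omega, by omega,
        by omega, by simpa using keep _, ?_⟩
      simp only [Function.update_self]
      rw [write, ← hs, List.append_assoc]
      congr 1
      rw [slice_cons (a := τ.nvar 7) h3]
      rcases Nat.eq_or_lt_of_le c2 with h4 | h4
      · rw [slice_of_le h4.ge, List.nil_merge, List.nil_merge]; rfl
      · rw [slice_cons h4, List.cons_merge_cons, if_neg fun h5 => ht ⟨h4, .inr h5⟩]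
        rfl
  · obtain ⟨-, p, q, -, -, c1, c2, c3, c4, c5, hold, hs⟩ := hτ
    refine ⟨hold, ?_⟩
    rwa [slice_of_le (a := p) (by omega), slice_of_le (a := q) (by omega), List.nil_merge,
      List.append_nil] at hs

theorem mergeBlock_spec {lo w m : ℕ} (hlo : lo ≤ m) (e1 : σ.nvar 1 = m) (e21 : σ.nvar 21 = w)
    (e22 : σ.nvar 22 = lo) :
    Runs mergeBlock σ (60 * (min (lo + w + w) m - lo) + 40) fun τ =>
      τ.nvar 22 = min (lo + w + w) m ∧ (∀ i < lo, τ.narr 17 i = σ.narr 17 i) ∧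
      slice (τ.narr 17) lo (min (lo + w + w) m) = (slice (σ.narr 0) lo (min (lo + w) m)).merge
        (slice (σ.narr 0) (min (lo + w) m) (min (lo + w + w) m))
        (keyLe (σ.rarr 19) (σ.rarr 20)) := by
  refine (Runs.seq (c := 28) (c' := 60 * (min (lo + w + w) m - lo) + 12) (Q' := fun τ =>
    τ.nvar 22 = lo ∧ τ.nvar 6 = lo ∧ τ.nvar 7 = min (lo + w) m ∧ τ.nvar 23 = min (lo + w) m ∧
    τ.nvar 24 = min (lo + w + w) m) (Runs.eff rfl (Nat.le_of_ble_eq_true rfl) ?_)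
    fun τ hτ hF => ?_).mono (by omega) fun τ h _ => h
  · simp [mergeInit, Prog.eff, NExpr.eval, e1, e21, e22]
    omega
  obtain ⟨f22, f6, f7, f23, f24⟩ := hτ
  rw [← hF.narr 0 (by decide), ← hF.rarr 19 (by decide), ← hF.rarr 20 (by decide),
    ← hF.narr 17 (by decide)]
  clear hF
  refine (Runs.seq (mergeLoop_spec (by omega) (by omega) f22 f6 f7 f23 f24) (c' := 2)
    fun ρ hρ hF => ?_).mono (by omega) fun τ h _ => h
  refine Runs.eff rfl le_rfl ⟨?_, hρ⟩
  simp only [Prog.eff, Function.update_self, NExpr.eval]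
  exact (hF.nvar 24 (by decide)).trans f24

/-- The blocks of length `w` are sorted. -/
def BlockSorted (X S : ℕ → ℝ) (f : ℕ → ℕ) (w m : ℕ) : Prop :=
  ∀ c, (slice f (c * w) (min (c * w + w) m)).Pairwise fun a b => keyLe X S a b = true

theorem mergeAll_spec {w m : ℕ} (hw : 1 ≤ w) (e1 : σ.nvar 1 = m) (e21 : σ.nvar 21 = w)
    (h : BlockSorted (σ.rarr 19) (σ.rarr 20) (σ.narr 0) w m) :
    Runs mergeAll σ (110 * m + 10) fun τ =>
      BlockSorted (σ.rarr 19) (σ.rarr 20) (τ.narr 17) (w + w) m ∧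
      (slice (τ.narr 17) 0 m).Perm (slice (σ.narr 0) 0 m) := by
  refine (Runs.seq (c := 2) (c' := 110 * m + 3) (Q' := fun τ => τ = Prog.eff (.nset 22 (.const 0)) σ)
    (Runs.eff rfl le_rfl rfl) ?_).mono (by omega) fun τ h _ => h
  rintro σ' rfl hF0
  -- Merging a block costs `60` per entry and a constant. The block is not empty, so `110` per entry
  -- covers both, also when blocks are short.
  refine (Runs.while (φ := 110 * m) (fun φ τ => ∃ c, τ.nvar 22 = min (c * (w + w)) m ∧
    φ = 110 * (m - min (c * (w + w)) m) ∧
    (∀ c' < c, (slice (τ.narr 17) (c' * (w + w)) (min (c' * (w + w) + (w + w)) m)).Pairwise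
      fun a b => keyLe (σ.rarr 19) (σ.rarr 20) a b = true) ∧
    (slice (τ.narr 17) 0 (min (c * (w + w)) m)).Perm (slice (σ.narr 0) 0 (min (c * (w + w)) m)))
    ⟨0, by simp [Prog.eff, NExpr.eval], by simp, fun c' hc => by omega, by simp [slice]⟩ ?_).mono
    (by simp [BExpr.cost, NExpr.cost]) ?_
  · rintro φ τ ⟨c, hc, rfl, hp, hperm⟩ hF hb
    have t1 : τ.nvar 1 = m := ((hF.nvar 1 (by decide)).trans (hF0.nvar 1 (by decide))).trans e1
    have t21 : τ.nvar 21 = w := ((hF.nvar 21 (by decide)).trans (hF0.nvar 21 (by decide))).trans e21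
    have t0 : τ.narr 0 = σ.narr 0 := (hF.narr 0 (by decide)).trans (hF0.narr 0 (by decide))
    have t19 : τ.rarr 19 = σ.rarr 19 := (hF.rarr 19 (by decide)).trans (hF0.rarr 19 (by decide))
    have t20 : τ.rarr 20 = σ.rarr 20 := (hF.rarr 20 (by decide)).trans (hF0.rarr 20 (by decide))
    simp only [BExpr.holds, NExpr.eval, hc, t1] at hb
    have hlt : c * (w + w) < m := by omega
    rw [min_eq_left hlt.le] at hc hperm ⊢
    have e2 : (c + 1) * (w + w) = c * (w + w) + w + w := by ring
    refine ⟨110 * (m - min ((c + 1) * (w + w)) m), 60 * (min (c * (w + w) + w + w) m - c * (w + w)) + 40,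
      ?_, (mergeBlock_spec hlt.le t1 t21 hc).mono le_rfl fun ρ hρ _ => ?_⟩
    · simp only [BExpr.cost, NExpr.cost, e2]; omega
    obtain ⟨r22, hold, hm⟩ := hρ
    rw [t0, t19, t20] at hm
    have s1 : (slice (σ.narr 0) (c * (w + w)) (min (c * (w + w) + w) m)).Pairwise
        fun a b => keyLe (σ.rarr 19) (σ.rarr 20) a b = true := by
      have := h (2 * c)
      rwa [show 2 * c * w = c * (w + w) by ring] at this
    have s2 : (slice (σ.narr 0) (min (c * (w + w) + w) m) (min (c * (w + w) + w + w) m)).Pairwise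
        fun a b => keyLe (σ.rarr 19) (σ.rarr 20) a b = true := by
      rcases le_total (c * (w + w) + w) m with h3 | h3
      · have := h (2 * c + 1)
        rw [min_eq_left h3]
        rwa [show (2 * c + 1) * w = c * (w + w) + w by ring] at this
      · rw [slice_of_le (by omega)]; exact List.Pairwise.nil
    have pre : ∀ b, b ≤ c * (w + w) → ∀ a, slice (ρ.narr 17) a b = slice (τ.narr 17) a b :=
      fun b hb a => slice_congr fun i _ hi => hold i (by omega)
    refine ⟨c + 1, by rw [r22, e2], rfl, fun c' hc' => ?_, ?_⟩
    · rcases Nat.lt_succ_iff_lt_or_eq.1 hc' with h3 | rfl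
      · have h4 : c' * (w + w) + (w + w) ≤ c * (w + w) := by
          have := Nat.mul_le_mul_right (w + w) h3
          rw [Nat.succ_mul] at this; exact this
        rw [pre _ (by omega)]
        exact hp c' h3
      · rw [← add_assoc, hm]
        exact List.pairwise_merge keyLe_trans keyLe_total _ _ s1 s2
    · rw [e2, ← slice_append (f := ρ.narr 17) (Nat.zero_le (c * (w + w))) (by omega), pre _ le_rfl, hm,
        ← slice_append (f := σ.narr 0) (Nat.zero_le (c * (w + w))) (by omega)]
      refine hperm.append ((List.merge_perm_append _).trans ?_)
      rw [slice_append (by omega) (by omega)]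
  · rintro τ ⟨⟨φ, c, hc, -, hp, hperm⟩, hb, hF⟩ -
    have t1 : τ.nvar 1 = m := ((hF.nvar 1 (by decide)).trans (hF0.nvar 1 (by decide))).trans e1
    simp only [BExpr.holds, NExpr.eval, hc, t1] at hb
    have h3 : m ≤ c * (w + w) := by omega
    rw [min_eq_right h3] at hperm
    refine ⟨fun c' => ?_, hperm⟩
    rcases Nat.lt_or_ge c' c with h4 | h4
    · exact hp c' h4
    · have := Nat.mul_le_mul_right (w + w) h4
      rw [slice_of_le (by omega)]; exact List.Pairwise.nil

theorem copyBack_spec {m : ℕ} (e1 : σ.nvar 1 = m) :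
    Runs copyBack σ (20 * m + 10) fun τ => ∀ i < m, τ.narr 0 i = σ.narr 17 i := by
  refine (Runs.for (bd := .var 1) (fun k τ => ∀ i < k, τ.narr 0 i = σ.narr 17 i) 10 0 m rfl
    (Nat.zero_le _) (fun i hi => by omega) (fun τ hF => (hF.nvar 1 (by decide)).trans e1)
    fun k τ hk _ hkm hJ hF => ?_).mono (by simp only [NExpr.cost]; omega) fun τ hτ _ => hτ.2
  refine Runs.eff rfl (Nat.le_of_ble_eq_true rfl) ⟨by simp [Prog.eff, NExpr.eval, hk],
    fun i hi => ?_⟩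
  have t17 : τ.narr 17 = σ.narr 17 := hF.narr 17 (by decide)
  rcases Nat.lt_succ_iff_lt_or_eq.1 hi with h1 | rfl
  · simp [Prog.eff, NExpr.eval, hk, h1.ne, hJ i h1]
  · simp [Prog.eff, NExpr.eval, hk, t17]

theorem mergeSort_spec {m : ℕ} (e1 : σ.nvar 1 = m) :
    Runs mergeSort σ (150 * (m + 1) * (Nat.clog 2 m + 1)) fun τ =>
      (slice (τ.narr 0) 0 m).Pairwise (fun a b => keyLe (σ.rarr 19) (σ.rarr 20) a b = true) ∧
      (slice (τ.narr 0) 0 m).Perm (slice (σ.narr 0) 0 m) := by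
  refine (Runs.seq (c := 2) (c' := 150 * (m + 1) * Nat.clog 2 m + 3)
    (Q' := fun τ => τ = Prog.eff (.nset 21 (.const 1)) σ)
    (Runs.eff rfl le_rfl rfl) ?_).mono
    (by rw [mul_add (150 * (m + 1)) (Nat.clog 2 m) 1]; omega) fun τ h _ => h
  rintro σ' rfl hF0
  -- After `t` rounds the blocks have length `2 ^ t`, so `clog 2 m` rounds of linear cost suffice.
  refine (Runs.while (σ := Prog.eff (.nset 21 (.const 1)) σ) (φ := 150 * (m + 1) * Nat.clog 2 m)
    (fun φ τ => ∃ t, τ.nvar 21 = 2 ^ t ∧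
    φ = 150 * (m + 1) * (Nat.clog 2 m - t) ∧
    BlockSorted (σ.rarr 19) (σ.rarr 20) (τ.narr 0) (2 ^ t) m ∧
    (slice (τ.narr 0) 0 m).Perm (slice (σ.narr 0) 0 m))
    ⟨0, by simp [Prog.eff, NExpr.eval], by simp, fun c => ?_, List.Perm.refl _⟩ ?_).mono
    (by simp only [BExpr.cost, NExpr.cost]; omega) ?_
  · rw [pow_zero, mul_one]
    rcases Nat.lt_or_ge c m with h | h
    · rw [min_eq_left h, slice_cons (by omega), slice_of_le le_rfl]
      exact List.pairwise_singleton _ _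
    · rw [slice_of_le (by omega)]; exact List.Pairwise.nil
  · rintro φ τ ⟨t, ht, rfl, hbs, hperm⟩ hF hb
    have t1 : τ.nvar 1 = m := ((hF.nvar 1 (by decide)).trans (hF0.nvar 1 (by decide))).trans e1
    have t19 : τ.rarr 19 = σ.rarr 19 := (hF.rarr 19 (by decide)).trans (hF0.rarr 19 (by decide))
    have t20 : τ.rarr 20 = σ.rarr 20 := (hF.rarr 20 (by decide)).trans (hF0.rarr 20 (by decide))
    simp only [BExpr.holds, NExpr.eval, ht, t1] at hb
    have hlt : t < Nat.clog 2 m := (Nat.lt_clog_iff_pow_lt one_lt_two).2 hb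
    refine ⟨150 * (m + 1) * (Nat.clog 2 m - (t + 1)), 130 * m + 24, ?_, ?_⟩
    · obtain ⟨d, hd⟩ := Nat.exists_eq_add_of_lt hlt
      rw [hd, show t + d + 1 - (t + 1) = d by omega, show t + d + 1 - t = d + 1 by omega,
        mul_add (150 * (m + 1)) d 1]
      simp only [BExpr.cost, NExpr.cost]; omega
    rw [← t19, ← t20] at hbs ⊢
    refine (Runs.seq (mergeAll_spec (Nat.one_le_two_pow) t1 ht hbs) (c' := 20 * m + 14)
      fun ρ hρ hF1 => ?_).mono (by omega) fun τ h _ => h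
    refine (Runs.seq (copyBack_spec ((hF1.nvar 1 (by decide)).trans t1)) (c' := 4)
      fun ω hω hF2 => ?_).mono (by omega) fun τ h _ => h
    have w21 : ω.nvar 21 = 2 ^ t := ((hF2.nvar 21 (by decide)).trans (hF1.nvar 21 (by decide))).trans ht
    have key : ∀ a b, b ≤ m → slice (ω.narr 0) a b = slice (ρ.narr 17) a b := fun a b hb =>
      slice_congr fun i _ hi => hω i (by omega)
    refine Runs.eff rfl le_rfl ⟨t + 1, ?_, rfl, fun c => ?_, ?_⟩
    · simp only [Prog.eff, Function.update_self, NExpr.eval, w21]; ring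
    · have := hρ.1 c
      rw [← key _ _ (min_le_right _ _)] at this
      rwa [pow_succ, mul_two]
    · refine List.Perm.trans ?_ (hρ.2.trans hperm)
      rw [← key _ _ le_rfl]
      exact List.Perm.refl _
  · rintro τ ⟨⟨φ, t, ht, -, hbs, hperm⟩, hb, hF⟩ -
    have t1 : τ.nvar 1 = m := ((hF.nvar 1 (by decide)).trans (hF0.nvar 1 (by decide))).trans e1
    simp only [BExpr.holds, NExpr.eval, ht, t1] at hb
    refine ⟨?_, hperm⟩
    have := hbs 0
    rwa [zero_mul, zero_add, min_eq_right (by omega)] at this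

end


/-! ## The zone of a line from the unsorted lines -/

/-- Keys are written for all lines. Those of the parallels come from a division by zero and are
never compared, since parallels are not put on the list. -/
def crossersBody : Prog :=
  .rput 19 (.var 5) (.div (gaE (.var 5)) (alE (.var 5)))
  ;; .rput 20 (.var 5) (.div (.sub (.const 0) (beE (.var 5))) (alE (.var 5)))
  ;; .ite (.req (alE (.var 5)) (.const 0)) .skip
    (.nput 0 (.var 1) (.var 5) ;; .nset 1 (.add (.var 1) (.const 1)))
  ;; .nset 5 (.add (.var 5) (.const 1))

def crossers : Prog :=
  (.rset 9 (.var 2) ;; .nset 1 (.const 0))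
    ;; .nset 5 (.const 0) ;; .loop (.nlt (.var 5) (.var 0)) crossersBody

def zoneUnsorted : Prog := crossers ;; mergeSort ;; zoneSorted

/-- The list of the lines with index below `k` that cross `l`, and their keys, are stored. -/
structure CrossersBelow {n : ℕ} (L : Fin n → LineEq) (l : LineEq) (k : ℕ) (s : List (Fin n))
    (σ : State) : Prop where
  length_eq : σ.nvar 1 = s.length
  stored : Stored 0 0 s σ
  nodup : s.Nodup
  mem : ∀ i, i ∈ s ↔ (i : ℕ) < k ∧ l.al (L i) ≠ 0
  X_eq : ∀ i : Fin n, (i : ℕ) < k → σ.rarr 19 i = l.Xof (L i)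
  S_eq : ∀ i : Fin n, (i : ℕ) < k → σ.rarr 20 i = l.Sof (L i)

section

variable {n : ℕ} {L : Fin n → LineEq} {l : LineEq} {s : List (Fin n)} {σ : State}

theorem crossersBody_eff {k : ℕ} (hL : Coeffs L σ) (hl : Current l σ) (hk : σ.nvar 5 = k)
    (hkn : k < n) :
    (crossersBody.eff σ).rarr 19 = Function.update (σ.rarr 19) k (l.Xof (L ⟨k, hkn⟩)) ∧
    (crossersBody.eff σ).rarr 20 = Function.update (σ.rarr 20) k (l.Sof (L ⟨k, hkn⟩)) ∧
    (crossersBody.eff σ).nvar 5 = k + 1 ∧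
    (crossersBody.eff σ).nvar 1 = (if l.al (L ⟨k, hkn⟩) = 0 then σ.nvar 1 else σ.nvar 1 + 1) ∧
    (crossersBody.eff σ).narr 0 = (if l.al (L ⟨k, hkn⟩) = 0 then σ.narr 0 else
      Function.update (σ.narr 0) (σ.nvar 1) k) := by
  have ha : σ.rarr 0 k = _ := hL.a_eq ⟨k, hkn⟩
  have hb : σ.rarr 1 k = _ := hL.b_eq ⟨k, hkn⟩
  have hc : σ.rarr 2 k = _ := hL.c_eq ⟨k, hkn⟩
  by_cases h : l.al (L ⟨k, hkn⟩) = 0 <;>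
  · have h' := h
    rw [LineEq.al] at h'
    simp [crossersBody, Prog.eff, BExpr.holds, RExpr.eval, NExpr.eval, alE, beE, gaE, hk, ha, hb, hc,
      hl.a_eq, hl.b_eq, hl.c_eq, h, h', LineEq.Xof, LineEq.Sof, LineEq.ga, LineEq.be, LineEq.nsq]
    try simp [LineEq.al]

theorem crossers_spec (hL : Coeffs L σ) (ha : σ.rvar 0 = l.a) (hb : σ.rvar 1 = l.b)
    (hc : σ.rvar 2 = l.c) :
    Runs crossers σ (200 * n + 20) fun τ => ∃ s, CrossersBelow L l n s τ := by
  refine (Runs.seq (c := 4) (c' := 200 * n + 10) (Q' := fun τ => Current l τ ∧ τ.nvar 1 = 0)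
    (Runs.eff rfl (Nat.le_of_ble_eq_true rfl) ⟨⟨?_, ?_, ?_⟩, ?_⟩) ?_).mono (by omega) fun τ h _ => h
  · simpa [Prog.eff] using ha
  · simpa [Prog.eff] using hb
  · simpa [Prog.eff, RExpr.eval] using hc
  · simp [Prog.eff, NExpr.eval]
  rintro τ ⟨hl, h1⟩ hF
  replace hL := hL.frame hF (by decide) (by decide) (by decide) (by decide)
  clear hF ha hb hc
  refine (Runs.for (bd := .var 0) (fun k τ => ∃ s, CrossersBelow L l k s τ) 180 0 n rfl
    (Nat.zero_le _) ⟨[], by simpa [Prog.eff] using h1, by simp [Stored], List.nodup_nil, by simp,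
      by simp, by simp⟩
    (fun τ hF => (hF.nvar 0 (by decide)).trans hL.n_eq) fun k τ hk _ hkn hJ hF => ?_).mono
    (by simp only [NExpr.cost]; omega) fun τ h _ => h.2
  obtain ⟨s, hJ⟩ := hJ
  obtain ⟨e19, e20, e5, e1, e0⟩ := crossersBody_eff
    (hL.frame hF (by decide) (by decide) (by decide) (by decide))
    (hl.frame hF (by decide) (by decide) (by decide)) hk hkn
  refine Runs.eff rfl (Nat.le_of_ble_eq_true rfl) ⟨e5, ?_⟩
  have hX : ∀ i : Fin n, (i : ℕ) < k + 1 →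
      (crossersBody.eff τ).rarr 19 i = l.Xof (L i) := fun i hi => by
    rw [e19]
    rcases Nat.lt_succ_iff_lt_or_eq.1 hi with h | rfl
    · rw [Function.update_of_ne h.ne, hJ.X_eq i h]
    · rw [Function.update_self]
  have hS : ∀ i : Fin n, (i : ℕ) < k + 1 →
      (crossersBody.eff τ).rarr 20 i = l.Sof (L i) := fun i hi => by
    rw [e20]
    rcases Nat.lt_succ_iff_lt_or_eq.1 hi with h | rfl
    · rw [Function.update_of_ne h.ne, hJ.S_eq i h]
    · rw [Function.update_self]
  by_cases h : l.al (L ⟨k, hkn⟩) = 0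
  · rw [if_pos h] at e0 e1
    refine ⟨s, e1.trans hJ.length_eq, ?_, hJ.nodup, fun i => ?_, hX, hS⟩
    · rw [Stored, e0]; exact hJ.stored
    · rw [hJ.mem, and_congr_left_iff]
      refine fun h1 => ⟨Nat.lt_succ_of_lt, fun h2 => lt_of_le_of_ne (Nat.le_of_lt_succ h2) ?_⟩
      rintro rfl
      exact h1 h
  · rw [if_neg h, hJ.length_eq] at e1
    rw [if_neg h, hJ.length_eq] at e0
    refine ⟨s ++ [⟨k, hkn⟩], by simp [e1], fun i hi => ?_, ?_, fun i => ?_, hX, hS⟩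
    · rw [e0, add_zero]
      rw [List.length_append, List.length_singleton] at hi
      rcases Nat.lt_succ_iff_lt_or_eq.1 hi with h | rfl
      · rw [Function.update_of_ne h.ne, List.getElem_append_left h]
        exact hJ.stored i h
      · rw [Function.update_self, List.getElem_concat_length]
        rfl
    · rw [List.nodup_append]
      refine ⟨hJ.nodup, List.nodup_singleton _, fun a ha b hb hab => ?_⟩
      rw [List.mem_singleton] at hb
      rw [hab, hb, hJ.mem] at ha
      exact lt_irrefl _ ha.1
    · rw [List.mem_append, List.mem_singleton, hJ.mem]
      refine ⟨?_, fun h1 => ?_⟩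
      · rintro (h1 | rfl)
        · exact ⟨Nat.lt_succ_of_lt h1.1, h1.2⟩
        · exact ⟨Nat.lt_succ_self _, h⟩
      · rcases Nat.lt_succ_iff_lt_or_eq.1 h1.1 with h2 | h2
        · exact .inl ⟨h2, h1.2⟩
        · exact .inr (Fin.ext h2)

theorem Stored.slice_eq (h : Stored 0 0 s σ) : slice (σ.narr 0) 0 s.length = s.map Fin.val := by
  refine List.ext_getElem (by simp [slice]) fun i h1 h2 => ?_
  rw [List.length_map] at h2
  simpa [slice] using h i h2

theorem stored_of_slice (h : slice (σ.narr 0) 0 s.length = s.map Fin.val) : Stored 0 0 s σ := by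
  intro i hi
  have := congrArg (fun t : List ℕ => t[i]?) h
  simpa [slice, hi] using this

/-- The sort gives a weak order. It is strict because crossing lines with equal `X` and `S`
coincide, while the lines of `L` are distinct. -/
theorem CrossersBelow.lexSorted (h : CrossersBelow L l n s σ)
    (hL : Function.Injective fun i => (L i).pts) {t : List (Fin n)} (hp : t.Perm s)
    (ht : (t.map Fin.val).Pairwise fun a b => keyLe (σ.rarr 19) (σ.rarr 20) a b = true) :
    LexSorted L l t := by
  have hm : ∀ i, i ∈ t ↔ l.al (L i) ≠ 0 := fun i => by
    rw [hp.mem_iff, h.mem, and_iff_right i.2]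
  refine ⟨hm, ?_⟩
  rw [List.pairwise_map] at ht
  refine (ht.and (hp.nodup_iff.2 h.nodup)).imp_of_mem fun {a b} ha hb hab => ?_
  have h1 := hab.1
  rw [keyLe_iff, h.X_eq a a.2, h.X_eq b b.2, h.S_eq a a.2, h.S_eq b b.2, not_or, not_lt, not_and,
    not_lt] at h1
  rcases h1.1.lt_or_eq with h2 | h2
  · exact .inl h2
  refine .inr ⟨h2, lt_of_le_of_ne (h1.2 h2.symm) fun h3 => hab.2 (hL ?_)⟩
  exact LineEq.pts_eq_of_cross ((hm a).1 ha) ((hm b).1 hb) h2 h3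

theorem CrossersBelow.length_le {k : ℕ} (h : CrossersBelow L l k s σ) : s.length ≤ n := by
  simpa using h.nodup.length_le_card

theorem zone_of_input (hL : Function.Injective fun i => (L i).pts) (hl : ∀ i, (L i).pts ≠ l.pts) :
    Runs zoneUnsorted (inputState L l) (14000 * (n + 1) * (Nat.clog 2 n + 1)) fun τ =>
      DescribesZone L l (outputOf τ) := by
  have hco : Coeffs L (inputState L l) := by
    refine ⟨rfl, fun i => ?_, fun i => ?_, fun i => ?_⟩ <;> simp [inputState]
  have hn : NegArrays (inputState L l) := by constructor <;> simp [inputState]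
  have hT : (200 * n + 20) + (150 * (n + 1) * (Nat.clog 2 n + 1) + 13000 * (n + 1)) ≤
      14000 * (n + 1) * (Nat.clog 2 n + 1) := by
    have : n + 1 ≤ (n + 1) * (Nat.clog 2 n + 1) := Nat.le_mul_of_pos_right _ (Nat.succ_pos _)
    rw [mul_assoc, mul_assoc]; omega
  refine (Runs.seq (crossers_spec (l := l) hco (by simp [inputState]) (by simp [inputState])
    (by simp [inputState])) ?_).mono hT fun τ h _ => h
  rintro τ ⟨s, hs⟩ hF
  replace hco := hco.frame hF (by decide) (by decide) (by decide) (by decide)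
  replace hn := hn.frame hF (by decide)
  have ha : τ.rvar 0 = l.a := (hF.rvar 0 (by decide)).trans (by simp [inputState])
  have hb : τ.rvar 1 = l.b := (hF.rvar 1 (by decide)).trans (by simp [inputState])
  have hc : τ.rvar 2 = l.c := (hF.rvar 2 (by decide)).trans (by simp [inputState])
  have hlog : 150 * (s.length + 1) * (Nat.clog 2 s.length + 1) ≤
      150 * (n + 1) * (Nat.clog 2 n + 1) := by
    have := Nat.clog_mono_right 2 hs.length_le
    have := hs.length_le
    gcongr
  refine Runs.seq ((mergeSort_spec hs.length_eq).mono hlog fun τ h _ => h) ?_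
  rintro ρ ⟨hsort, hperm⟩ hF
  replace hco := hco.frame hF (by decide) (by decide) (by decide) (by decide)
  replace hn := hn.frame hF (by decide)
  rw [hs.stored.slice_eq] at hperm
  obtain ⟨t, ht⟩ : slice (ρ.narr 0) 0 s.length ∈ Set.range (List.map (Fin.val (n := n))) := by
    rw [Set.range_list_map]
    intro x hx
    obtain ⟨i, -, rfl⟩ := List.mem_map.1 (hperm.mem_iff.1 hx)
    exact ⟨i, rfl⟩
  rw [← ht] at hsort hperm
  have hp : t.Perm s := (List.map_perm_map_iff Fin.val_injective).1 hperm
  rw [← hp.length_eq] at ht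
  exact zoneSorted_spec hco ((hF.rvar 0 (by decide)).trans ha) ((hF.rvar 1 (by decide)).trans hb)
    ((hF.rvar 2 (by decide)).trans hc)
    ((hF.nvar 1 (by decide)).trans (hs.length_eq.trans hp.length_eq.symm)) (stored_of_slice ht.symm) hn
    (hs.lexSorted hL hp hsort) hl hL

/-! ## The main theorem -/

theorem isBigO_linear (K : ℕ) :
    (fun n : ℕ => ((K * (n + 1) : ℕ) : ℝ)) =O[atTop] fun n : ℕ => (n : ℝ) := by
  refine IsBigO.of_bound (2 * K) ?_
  filter_upwards [eventually_ge_atTop 1] with n hn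
  have hn' : (1 : ℝ) ≤ n := by exact_mod_cast hn
  rw [Real.norm_natCast, Real.norm_natCast]
  push_cast
  nlinarith [Nat.cast_nonneg (α := ℝ) K]

theorem isBigO_clog (K : ℕ) :
    (fun n : ℕ => ((K * (n + 1) * (Nat.clog 2 n + 1) : ℕ) : ℝ)) =O[atTop]
      fun n : ℕ => (n : ℝ) * Real.log n := by
  have h : (fun n : ℕ => ((Nat.clog 2 n + 1 : ℕ) : ℝ)) =O[atTop] fun n : ℕ => Real.log n := by
    -- `clog 2 n + 1` exceeds `log n / log 2` by at most `2`, and `log 2 ≤ log n` absorbs this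
    -- excess into the constant `3`.
    refine IsBigO.of_bound (3 / Real.log 2) ?_
    filter_upwards [eventually_ge_atTop 2] with n hn
    have h2 : 0 < Real.log 2 := Real.log_pos one_lt_two
    have hn' : (2 : ℝ) ≤ n := by exact_mod_cast hn
    have h3 : Real.log 2 ≤ Real.log n := Real.log_le_log two_pos hn'
    have h4 : (Nat.clog 2 n : ℝ) * Real.log 2 ≤ Real.log n + Real.log 2 := by
      have h5 : 2 ^ (Nat.clog 2 n - 1) < n := Nat.pow_pred_clog_lt_self one_lt_two hn
      have h6 : 1 ≤ Nat.clog 2 n := Nat.clog_pos one_lt_two hn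
      have h7 : ((2 : ℝ) ^ (Nat.clog 2 n - 1)) ≤ n := by exact_mod_cast h5.le
      have h8 := Real.log_le_log (by positivity) h7
      rw [Real.log_pow, Nat.cast_sub h6, Nat.cast_one] at h8
      linarith
    rw [Real.norm_natCast, Real.norm_of_nonneg (h2.le.trans h3), div_mul_eq_mul_div, le_div_iff₀ h2]
    push_cast
    linarith
  refine ((isBigO_linear K).mul h).congr_left fun n => ?_
  push_cast; ring

end

end ZoneRAM

theorem mainTheorem1 :
    (∃ (P : ZoneRAM.Prog) (T : ℕ → ℕ),
      ((fun n : ℕ => (T n : ℝ)) =O[atTop] fun n : ℕ => (n : ℝ) * Real.log (n : ℝ)) ∧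
      ∀ (n : ℕ) (L : Fin n → ZoneRAM.LineEq) (l : ZoneRAM.LineEq),
        Function.Injective (fun i => (L i).pts) → (∀ i, (L i).pts ≠ l.pts) →
        ∃ (t : ℕ) (τ : ZoneRAM.State), t ≤ T n ∧
          ZoneRAM.Exec P (ZoneRAM.inputState L l) t τ ∧
          ZoneRAM.DescribesZone L l (ZoneRAM.outputOf τ)) ∧
    (∃ (P : ZoneRAM.Prog) (T : ℕ → ℕ),
      ((fun n : ℕ => (T n : ℝ)) =O[atTop] fun n : ℕ => (n : ℝ)) ∧
      ∀ (n : ℕ) (L : Fin n → ZoneRAM.LineEq) (l : ZoneRAM.LineEq),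
        Function.Injective (fun i => (L i).pts) → (∀ i, (L i).pts ≠ l.pts) →
        ∀ s : List (Fin n), ZoneRAM.IsSortedAlong L l s →
        ∃ (t : ℕ) (τ : ZoneRAM.State), t ≤ T n ∧
          ZoneRAM.Exec P (ZoneRAM.sortedInputState L l s) t τ ∧
          ZoneRAM.DescribesZone L l (ZoneRAM.outputOf τ)) :=
  ⟨⟨ZoneRAM.zoneUnsorted, fun n => 14000 * (n + 1) * (Nat.clog 2 n + 1), ZoneRAM.isBigO_clog 14000,
    fun _ _ _ hL hl => (ZoneRAM.zone_of_input hL hl).exists⟩,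
  ⟨ZoneRAM.zoneSorted, fun n => 13000 * (n + 1), ZoneRAM.isBigO_linear 13000,
    fun _ _ _ hL hl _ hs => (ZoneRAM.zone_of_sortedInput hL hl hs).exists⟩⟩
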